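/- Let $X$ be a topological space and $\mathcal{O}$ a sheaf of commutative rings on $X$. An $\mathcal{O}$-stack is a stack of categories $\mathcal{S}$ on $X$ such that, for every open $V\subset X$, the morphism sets of $\mathcal{S}(V)$ are $\mathcal{O}(V)$-modules, composition is bilinear, and restrictions are compatible with these structures; an $\mathcal{O}$-functor is a functor of stacks which is linear on morphisms, and an $\mathcal{O}$-equivalence ($\approx$) is an $\mathcal{O}$-functor having a quasi-inverse functor of stacks. By an $\mathcal{O}$-algebra we mean a sheaf $\mathcal{A}$ of unital, not necessarily commutative rings with a morphism $\mathcal{O}\to\mathcal{A}$ with central image; $\mathcal{A}^{\mathrm{op}}$ is the opposite algebra and $\mathrm{Mod}(\mathcal{A})$ is the $\mathcal{O}$-stack $V\mapsto\{\text{sheaves of left }\mathcal{A}|_V\text{-modules}\}$. For an $\mathcal{O}$-stack $\mathcal{S}$, $\mathrm{Mod}(\mathcal{A};\mathcal{S})$ is the $\mathcal{O}$-stack whose objects over $V$ are pairs of an object $F\in\mathcal{S}(V)$ and a morphism of sheaves of $\mathcal{O}|_V$-algebras $\mathcal{A}|_V\to\mathcal{E}nd_{\mathcal{S}|_V}(F)$,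 and whose morphisms are the morphisms of $\mathcal{S}(V)$ commuting with these actions. For $\mathcal{O}$-stacks $\mathcal{S},\mathcal{S}'$ let $\mathcal{H}om^{r}_{\mathcal{O}}(\mathcal{S},\mathcal{S}')$ be given by $V\mapsto\{\mathcal{O}|_V\text{-functors }\mathcal{S}|_V\to\mathcal{S}'|_V\text{ admitting a right adjoint functor of stacks}\}$, with all transformations as morphisms, and set $$\mathcal{S}^{\circledast-1}=\mathcal{H}om^{r}_{\mathcal{O}}(\mathcal{S},\mathrm{Mod}(\mathcal{O})),\qquad \mathcal{S}\circledast\mathcal{S}'=\mathcal{H}om^{r}_{\mathcal{O}}(\mathcal{S}^{\circledast-1},\mathcal{S}').$$ A stack of $\mathcal{O}$-twisted modules is an $\mathcal{O}$-stack $\mathcal{M}$ for which there are an open covering $X=\bigcup_i U_i$, $\mathcal{O}|_{U_i}$-algebras $\mathcal{A}_i$ on $U_i$, and $\mathcal{O}|_{U_i}$-equivalences $\mathcal{M}|_{U_i}\approx\mathrm{Mod}(\mathcal{A}_i)$. Proposition. If $\mathcal{A}$ and $\mathcal{A}'$ are $\mathcal{O}$-algebras, then $\mathrm{Mod}(\mathcal{A})$,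 $\mathrm{Mod}(\mathcal{A})^{\circledast-1}$, $\mathrm{Mod}(\mathcal{A})\circledast\mathrm{Mod}(\mathcal{A}')$ and $\mathrm{Mod}(\mathcal{A};\mathrm{Mod}(\mathcal{A}'))$ are $\mathcal{O}$-stacks, and there are $\mathcal{O}$-equivalences $$\mathrm{Mod}(\mathcal{A})^{\circledast-1}\approx\mathrm{Mod}(\mathcal{A}^{\mathrm{op}}),\qquad \mathrm{Mod}(\mathcal{A})\circledast\mathrm{Mod}(\mathcal{A}')\approx\mathrm{Mod}(\mathcal{A}\otimes_{\mathcal{O}}\mathcal{A}')\approx\mathrm{Mod}(\mathcal{A};\mathrm{Mod}(\mathcal{A}')).$$ Moreover, if $\mathcal{M}$ and $\mathcal{M}'$ are stacks of $\mathcal{O}$-twisted modules on $X$, then $\mathcal{M}^{\circledast-1}$ and $\mathcal{M}\circledast\mathcal{M}'$ are stacks of $\mathcal{O}$-twisted modules on $X$. -/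

import Mathlib

open CategoryTheory TopologicalSpace Opposite

universe w₁ v₁ w₂ v₂ w₃ v₃ w v u

namespace TwistedStack

/-- Sections of the structure sheaf over an open subset. -/
abbrev Sec {X : TopCat.{u}} (𝒪 : Sheaf (Opens.grothendieckTopology X) CommRingCat.{u}) (V : Opens X) : Type u :=
  𝒪.obj.obj (op V)

/-- Restriction of sections of the structure sheaf. -/
abbrev rho {X : TopCat.{u}} (𝒪 : Sheaf (Opens.grothendieckTopology X) CommRingCat.{u}) {V W : Opens X} (h : W ≤ V) :
    Sec 𝒪 V →+* Sec 𝒪 W :=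
  (𝒪.obj.map (homOfLE h).op).hom

/-! ### Conventions

`X` is a topological space and `𝒪` a sheaf of commutative rings on `X`. All notions are defined
"on an open subset `U` of `X`", in terms of the open subsets of `X` contained in `U`; sheaves on
`U` are sheaves on the site `Over U` of these. The notions on `X` itself are the case `U = ⊤`.
-/

/-! ### Linear prestacks and stacks on an open subset -/

/-- An `𝒪`-linear prestack on the open subset `U` of `X` (take `U = ⊤` for prestacks on `X`
itself): a category `Obj V` for every open `V ⊆ U`, enriched in `𝒪(V)`-modules, restriction
functors, and coherent isomorphisms `F|_W|_Y ≅ F|_Y`, restrictions being compatible with the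
linear structures. (The unit constraint `F|_V ≅ F` is not required to be an equality.) A linear stack is a prestack
satisfying `IsStack`. -/
structure Prestack {X : TopCat.{u}} (𝒪 : Sheaf (Opens.grothendieckTopology X) CommRingCat.{u}) (U : Opens X) where
  Obj (V : Opens X) (hV : V ≤ U) : Type w
  cat (V : Opens X) (hV : V ≤ U) : Category.{v} (Obj V hV)
  preadditive (V : Opens X) (hV : V ≤ U) : Preadditive (Obj V hV)
  linear (V : Opens X) (hV : V ≤ U) : Linear (Sec 𝒪 V) (Obj V hV)
  res {V W : Opens X} (hV : V ≤ U) (hW : W ≤ V) : Obj V hV ⥤ Obj W (hW.trans hV)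
  res_add {V W : Opens X} (hV : V ≤ U) (hW : W ≤ V) {F G : Obj V hV} (f g : F ⟶ G) :
    (res hV hW).map (f + g) = (res hV hW).map f + (res hV hW).map g
  res_smul {V W : Opens X} (hV : V ≤ U) (hW : W ≤ V) {F G : Obj V hV} (r : Sec 𝒪 V)
    (f : F ⟶ G) : (res hV hW).map (r • f) = rho 𝒪 hW r • (res hV hW).map f
  resId {V : Opens X} (hV : V ≤ U) : res hV le_rfl ≅ 𝟭 (Obj V hV)
  resComp {V W Y : Opens X} (hV : V ≤ U) (hW : W ≤ V) (hY : Y ≤ W) :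
    res hV hW ⋙ res (hW.trans hV) hY ≅ res hV (hY.trans hW)
  resComp_id {V W : Opens X} (hV : V ≤ U) (hW : W ≤ V) (F : Obj V hV) :
    (resComp hV hW le_rfl).hom.app F = (resId (hW.trans hV)).hom.app ((res hV hW).obj F)
  id_resComp {V W : Opens X} (hV : V ≤ U) (hW : W ≤ V) (F : Obj V hV) :
    (resComp hV le_rfl hW).hom.app F = (res hV hW).map ((resId hV).hom.app F)
  resComp_assoc {V W Y Z : Opens X} (hV : V ≤ U) (hW : W ≤ V) (hY : Y ≤ W) (hZ : Z ≤ Y)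
    (F : Obj V hV) :
    (res (hY.trans (hW.trans hV)) hZ).map ((resComp hV hW hY).hom.app F) ≫
        (resComp hV (hY.trans hW) hZ).hom.app F =
      (resComp (hW.trans hV) hY hZ).hom.app ((res hV hW).obj F) ≫
        (resComp hV hW (hZ.trans hY)).hom.app F

attribute [instance] Prestack.cat Prestack.preadditive Prestack.linear

namespace Prestack

section Basic

variable {X : TopCat.{u}} {𝒪 : Sheaf (Opens.grothendieckTopology X) CommRingCat.{u}} {U : Opens X}

/-- The restriction `S|_V` of a prestack to an open subset `V ⊆ U`. -/
@[reducible] def restrict (S : Prestack.{w, v} 𝒪 U) {V : Opens X} (hV : V ≤ U) :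
    Prestack.{w, v} 𝒪 V where
  Obj W hW := S.Obj W (hW.trans hV)
  cat W hW := S.cat W (hW.trans hV)
  preadditive W hW := S.preadditive W (hW.trans hV)
  linear W hW := S.linear W (hW.trans hV)
  res hW hY := S.res (hW.trans hV) hY
  res_add hW hY := S.res_add (hW.trans hV) hY
  res_smul hW hY := S.res_smul (hW.trans hV) hY
  resId hW := S.resId (hW.trans hV)
  resComp hW hY hZ := S.resComp (hW.trans hV) hY hZ
  resComp_id hW hY := S.resComp_id (hW.trans hV) hY
  id_resComp hW hY := S.id_resComp (hW.trans hV) hY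
  resComp_assoc hW hY hZ hT := S.resComp_assoc (hW.trans hV) hY hZ hT

/-- For objects `F` over `V₁` and `G` over `V₂`, the restriction map
`Hom(F|_W, G|_W) → Hom(F|_Y, G|_Y)` for `Y ⊆ W ⊆ V₁ ∩ V₂`. -/
def resHom (S : Prestack.{w, v} 𝒪 U) {V₁ V₂ W Y : Opens X} {h₁ : V₁ ≤ U} {h₂ : V₂ ≤ U}
    (F : S.Obj V₁ h₁) (G : S.Obj V₂ h₂) (w₁ : W ≤ V₁) (w₂ : W ≤ V₂) (hY : Y ≤ W)
    (f : (S.res h₁ w₁).obj F ⟶ (S.res h₂ w₂).obj G) :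
    (S.res h₁ (hY.trans w₁)).obj F ⟶ (S.res h₂ (hY.trans w₂)).obj G :=
  (S.resComp h₁ w₁ hY).inv.app F ≫ (S.res (w₁.trans h₁) hY).map f ≫
    (S.resComp h₂ w₂ hY).hom.app G

/-- A prestack is separated if the presheaves `W ↦ Hom(F|_W, G|_W)` are sheaves: for every open
covering `W = ⋃ i, c i`, compatible morphisms over the `c i` glue in a unique way. -/
def IsSeparated (S : Prestack.{w, v} 𝒪 U) : Prop :=
  ∀ (V : Opens X) (hV : V ≤ U) (F G : S.Obj V hV) (W : Opens X) (hW : W ≤ V)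
    (ι : Type u) (c : ι → Opens X) (hc : ∀ i, c i ≤ W), (⨆ i, c i) = W →
    ∀ s : ∀ i, (S.res hV ((hc i).trans hW)).obj F ⟶ (S.res hV ((hc i).trans hW)).obj G,
      (∀ i j, S.resHom F G ((hc i).trans hW) ((hc i).trans hW)
            (inf_le_left : c i ⊓ c j ≤ c i) (s i) =
          S.resHom F G ((hc j).trans hW) ((hc j).trans hW)
            (inf_le_right : c i ⊓ c j ≤ c j) (s j)) →
      ∃! t : (S.res hV hW).obj F ⟶ (S.res hV hW).obj G,
        ∀ i, S.resHom F G hW hW (hc i) t = s i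

/-- Every descent datum `(F i, θ i j : F j|_{ij} ≅ F i|_{ij})` satisfying the cocycle condition
`θ i j ∘ θ j k = θ i k` on triple intersections is effective. -/
def HasEffectiveDescent (S : Prestack.{w, v} 𝒪 U) : Prop :=
  ∀ (V : Opens X) (hV : V ≤ U) (ι : Type u) (c : ι → Opens X) (hc : ∀ i, c i ≤ V),
    (⨆ i, c i) = V →
    ∀ (F : ∀ i, S.Obj (c i) ((hc i).trans hV))
      (θ : ∀ i j, (S.res ((hc j).trans hV) (inf_le_right : c i ⊓ c j ≤ c j)).obj (F j) ≅
        (S.res ((hc i).trans hV) (inf_le_left : c i ⊓ c j ≤ c i)).obj (F i)),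
      (∀ i j k,
        S.resHom (F k) (F j) inf_le_right inf_le_left
            (le_inf (inf_le_left.trans inf_le_right) inf_le_right :
              c i ⊓ c j ⊓ c k ≤ c j ⊓ c k) (θ j k).hom ≫
          S.resHom (F j) (F i) inf_le_right inf_le_left
            (inf_le_left : c i ⊓ c j ⊓ c k ≤ c i ⊓ c j) (θ i j).hom =
        S.resHom (F k) (F i) inf_le_right inf_le_left
            (le_inf (inf_le_left.trans inf_le_left) inf_le_right :
              c i ⊓ c j ⊓ c k ≤ c i ⊓ c k) (θ i k).hom) →
      ∃ (G : S.Obj V hV) (η : ∀ i, (S.res hV (hc i)).obj G ≅ F i),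
        ∀ i j,
          (S.resComp hV (hc j) (inf_le_right : c i ⊓ c j ≤ c j)).inv.app G ≫
              (S.res ((hc j).trans hV) (inf_le_right : c i ⊓ c j ≤ c j)).map (η j).hom ≫
              (θ i j).hom =
            (S.resComp hV (hc i) (inf_le_left : c i ⊓ c j ≤ c i)).inv.app G ≫
              (S.res ((hc i).trans hV) (inf_le_left : c i ⊓ c j ≤ c i)).map (η i).hom

/-- A stack is a separated prestack in which every descent datum is effective. -/
structure IsStack (S : Prestack.{w, v} 𝒪 U) : Prop where
  isSeparated : S.IsSeparated
  hasEffectiveDescent : S.HasEffectiveDescent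

end Basic

end Prestack

/-! ### Functors of prestacks -/

/-- A functor of prestacks: functors `app V` for all opens `V ⊆ U`, and isomorphisms
`app W (F|_W) ≅ (app V F)|_W` compatible with iterated restrictions. -/
structure PFunctor {X : TopCat.{u}} {𝒪 : Sheaf (Opens.grothendieckTopology X) CommRingCat.{u}} {U : Opens X}
    (S : Prestack.{w₁, v₁} 𝒪 U) (T : Prestack.{w₂, v₂} 𝒪 U) where
  app (V : Opens X) (hV : V ≤ U) : S.Obj V hV ⥤ T.Obj V hV
  iso {V W : Opens X} (hV : V ≤ U) (hW : W ≤ V) :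
    S.res hV hW ⋙ app W (hW.trans hV) ≅ app V hV ⋙ T.res hV hW
  iso_comp {V W Y : Opens X} (hV : V ≤ U) (hW : W ≤ V) (hY : Y ≤ W) (F : S.Obj V hV) :
    (app Y (hY.trans (hW.trans hV))).map ((S.resComp hV hW hY).hom.app F) ≫
        (iso hV (hY.trans hW)).hom.app F =
      (iso (hW.trans hV) hY).hom.app ((S.res hV hW).obj F) ≫
        (T.res (hW.trans hV) hY).map ((iso hV hW).hom.app F) ≫
          (T.resComp hV hW hY).hom.app ((app V hV).obj F)

namespace PFunctor

section

variable {X : TopCat.{u}} {𝒪 : Sheaf (Opens.grothendieckTopology X) CommRingCat.{u}} {U : Opens X}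
  {S : Prestack.{w₁, v₁} 𝒪 U} {T : Prestack.{w₂, v₂} 𝒪 U} {R : Prestack.{w₃, v₃} 𝒪 U}

/-- A transformation of functors of prestacks. -/
@[ext]
structure Hom (φ ψ : PFunctor S T) where
  app (V : Opens X) (hV : V ≤ U) : φ.app V hV ⟶ ψ.app V hV
  naturality {V W : Opens X} (hV : V ≤ U) (hW : W ≤ V) (F : S.Obj V hV) :
    (app W (hW.trans hV)).app ((S.res hV hW).obj F) ≫ (ψ.iso hV hW).hom.app F =
      (φ.iso hV hW).hom.app F ≫ (T.res hV hW).map ((app V hV).app F)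

instance : Category (PFunctor S T) where
  Hom := Hom
  id φ := { app := fun V hV => 𝟙 (φ.app V hV), naturality := by intros; simp }
  comp α β :=
    { app := fun V hV => α.app V hV ≫ β.app V hV
      naturality := by
        intro V W hV hW F
        simp [β.naturality, reassoc_of% (α.naturality hV hW F)] }

@[ext]
lemma hom_ext {φ ψ : PFunctor S T} {α β : φ ⟶ ψ} (h : ∀ V hV, α.app V hV = β.app V hV) :
    α = β :=
  Hom.ext (funext fun V => funext fun hV => h V hV)

@[simp] lemma id_app (φ : PFunctor S T) (V : Opens X) (hV : V ≤ U) :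
    Hom.app (𝟙 φ) V hV = 𝟙 _ := rfl

@[simp] lemma comp_app {φ ψ χ : PFunctor S T} (α : φ ⟶ ψ) (β : ψ ⟶ χ) (V : Opens X)
    (hV : V ≤ U) : (α ≫ β).app V hV = α.app V hV ≫ β.app V hV := rfl

/-- The identity functor of a prestack. -/
def id (S : Prestack.{w₁, v₁} 𝒪 U) : PFunctor S S where
  app V hV := 𝟭 _
  iso hV hW := Iso.refl _
  iso_comp := by intros; simp

/-- Composition of functors of prestacks: `φ.comp ψ` is `ψ ∘ φ`. -/
def comp (φ : PFunctor S T) (ψ : PFunctor T R) : PFunctor S R where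
  app V hV := φ.app V hV ⋙ ψ.app V hV
  iso hV hW := NatIso.ofComponents
    (fun F => (ψ.app _ _).mapIso ((φ.iso hV hW).app F) ≪≫ (ψ.iso hV hW).app _) (by
      intro F G f
      have h₁ := (φ.iso hV hW).hom.naturality f
      have h₂ := (ψ.iso hV hW).hom.naturality ((φ.app _ hV).map f)
      dsimp at h₁ h₂ ⊢
      rw [Category.assoc, ← h₂, ← Functor.map_comp_assoc, h₁, Functor.map_comp_assoc])
  iso_comp hV hW hY F := by
    have h₁ := φ.iso_comp hV hW hY F
    have h₂ := ψ.iso_comp hV hW hY ((φ.app _ hV).obj F)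
    have h₃ := (ψ.iso (hW.trans hV) hY).hom.naturality ((φ.iso hV hW).hom.app F)
    dsimp at h₁ h₂ h₃ ⊢
    simp only [Functor.map_comp, Category.assoc]
    rw [← Functor.map_comp_assoc, h₁]
    simp only [Functor.map_comp, Category.assoc]
    rw [h₂, reassoc_of% h₃]

/-- A functor of prestacks is an `𝒪`-functor if it is linear at the level of morphisms. -/
structure IsLinear (φ : PFunctor S T) : Prop where
  map_add {V : Opens X} (hV : V ≤ U) {F G : S.Obj V hV} (f g : F ⟶ G) :
    (φ.app V hV).map (f + g) = (φ.app V hV).map f + (φ.app V hV).map g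
  map_smul {V : Opens X} (hV : V ≤ U) {F G : S.Obj V hV} (r : Sec 𝒪 V) (f : F ⟶ G) :
    (φ.app V hV).map (r • f) = r • (φ.app V hV).map f

/-- An adjunction between functors of prestacks: isomorphisms
`Hom(φ F, G) ≅ Hom(F, ψ G)`, natural in `F` and `G` and compatible with restrictions. -/
structure Adj (φ : PFunctor S T) (ψ : PFunctor T S) where
  adj (V : Opens X) (hV : V ≤ U) : φ.app V hV ⊣ ψ.app V hV
  homEquiv_res {V W : Opens X} (hV : V ≤ U) (hW : W ≤ V) (F : S.Obj V hV) (G : T.Obj V hV)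
    (f : (φ.app V hV).obj F ⟶ G) :
    (adj W (hW.trans hV)).homEquiv ((S.res hV hW).obj F) ((T.res hV hW).obj G)
          ((φ.iso hV hW).hom.app F ≫ (T.res hV hW).map f) ≫ (ψ.iso hV hW).hom.app G =
      (S.res hV hW).map ((adj V hV).homEquiv F G f)

/-- The functor `φ` admits a right adjoint functor of prestacks. -/
def HasRightAdjoint (φ : PFunctor S T) : Prop :=
  ∃ ψ : PFunctor T S, Nonempty (Adj φ ψ)

/-- The functor `φ` is an equivalence: it has a quasi-inverse functor of prestacks. -/
def IsEquiv (φ : PFunctor S T) : Prop :=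
  ∃ ψ : PFunctor T S, Nonempty (ψ.comp φ ≅ id T) ∧ Nonempty (φ.comp ψ ≅ id S)

/-- Restriction of a functor of prestacks to an open subset. -/
@[reducible] def restrict (φ : PFunctor S T) {V : Opens X} (hV : V ≤ U) :
    PFunctor (S.restrict hV) (T.restrict hV) where
  app W hW := φ.app W (hW.trans hV)
  iso hW hY := φ.iso (hW.trans hV) hY
  iso_comp hW hY hZ := φ.iso_comp (hW.trans hV) hY hZ

lemma IsLinear.restrict {φ : PFunctor S T} (h : φ.IsLinear) {V : Opens X} (hV : V ≤ U) :
    (φ.restrict hV).IsLinear where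
  map_add hW := h.map_add (hW.trans hV)
  map_smul hW := h.map_smul (hW.trans hV)

lemma HasRightAdjoint.restrict {φ : PFunctor S T} (h : φ.HasRightAdjoint) {V : Opens X}
    (hV : V ≤ U) : (φ.restrict hV).HasRightAdjoint := by
  obtain ⟨ψ, ⟨e⟩⟩ := h
  exact ⟨ψ.restrict hV, ⟨{
    adj := fun W hW => e.adj W (hW.trans hV)
    homEquiv_res := fun hW hY => e.homEquiv_res (hW.trans hV) hY }⟩⟩

end

end PFunctor

/-! ### Prestacks of functors -/

section Linear

variable {X : TopCat.{u}} {𝒪 : Sheaf (Opens.grothendieckTopology X) CommRingCat.{u}} {U : Opens X}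

instance Prestack.res_additive (S : Prestack.{w, v} 𝒪 U) {V W : Opens X} (hV : V ≤ U)
    (hW : W ≤ V) : (S.res hV hW).Additive where
  map_add := S.res_add hV hW _ _

lemma rho_rho (𝒪 : Sheaf (Opens.grothendieckTopology X) CommRingCat.{u}) {V W Y : Opens X} (h : W ≤ V) (k : Y ≤ W)
    (r : Sec 𝒪 V) : rho 𝒪 k (rho 𝒪 h r) = rho 𝒪 (k.trans h) r := by
  have : (homOfLE (k.trans h)).op = (homOfLE h).op ≫ (homOfLE k).op := rfl
  simp [rho, this]

end Linear

namespace PFunctor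

section

variable {X : TopCat.{u}} {𝒪 : Sheaf (Opens.grothendieckTopology X) CommRingCat.{u}} {U : Opens X}
  {S : Prestack.{w₁, v₁} 𝒪 U} {T : Prestack.{w₂, v₂} 𝒪 U}

instance (φ ψ : PFunctor S T) : Add (φ ⟶ ψ) where
  add α β :=
    { app := fun V hV => α.app V hV + β.app V hV
      naturality := by
        intro V W hV hW F
        simp [α.naturality, β.naturality, Functor.map_add] }

instance (φ ψ : PFunctor S T) : Zero (φ ⟶ ψ) where
  zero :=
    { app := fun V hV => 0
      naturality := by
        intro V W hV hW F
        simp }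

instance (φ ψ : PFunctor S T) : Neg (φ ⟶ ψ) where
  neg α :=
    { app := fun V hV => -α.app V hV
      naturality := by
        intro V W hV hW F
        simp [α.naturality, Functor.map_neg] }

/-- A section `r` of `𝒪` acts on transformations objectwise, through its restrictions. -/
instance (φ ψ : PFunctor S T) : SMul (Sec 𝒪 U) (φ ⟶ ψ) where
  smul r α :=
    { app := fun V hV => rho 𝒪 hV r • α.app V hV
      naturality := by
        intro V W hV hW F
        simp [α.naturality, T.res_smul, rho_rho] }

@[simp] lemma add_app {φ ψ : PFunctor S T} (α β : φ ⟶ ψ) (V : Opens X) (hV : V ≤ U) :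
    (α + β).app V hV = α.app V hV + β.app V hV := rfl

@[simp] lemma zero_app {φ ψ : PFunctor S T} (V : Opens X) (hV : V ≤ U) :
    (0 : φ ⟶ ψ).app V hV = 0 := rfl

@[simp] lemma neg_app {φ ψ : PFunctor S T} (α : φ ⟶ ψ) (V : Opens X) (hV : V ≤ U) :
    (-α).app V hV = -α.app V hV := rfl

@[simp] lemma smul_app {φ ψ : PFunctor S T} (r : Sec 𝒪 U) (α : φ ⟶ ψ) (V : Opens X)
    (hV : V ≤ U) : (r • α).app V hV = rho 𝒪 hV r • α.app V hV := rfl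

instance (φ ψ : PFunctor S T) : AddCommGroup (φ ⟶ ψ) where
  add_assoc α β γ := by ext1 V hV; simp [add_assoc]
  zero_add α := by ext1 V hV; simp
  add_zero α := by ext1 V hV; simp
  nsmul := nsmulRec
  zsmul := zsmulRec
  neg_add_cancel α := by ext1 V hV; simp
  add_comm α β := by ext1 V hV; simp [add_comm]

instance : Preadditive (PFunctor S T) where
  add_comp := by intros; ext1 V hV; simp
  comp_add := by intros; ext1 V hV; simp

instance : Linear (Sec 𝒪 U) (PFunctor S T) where
  homModule φ ψ :=
    { one_smul := fun α => by ext1 V hV; simp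
      mul_smul := fun r s α => by ext1 V hV; simp [mul_smul]
      smul_zero := fun r => by ext1 V hV; simp
      smul_add := fun r α β => by ext1 V hV; simp
      add_smul := fun r s α => by ext1 V hV; simp [add_smul]
      zero_smul := fun α => by ext1 V hV; simp }
  smul_comp := by intros; ext1 V hV; simp
  comp_smul := by intros; ext1 V hV; simp

/-- The property of being an `𝒪`-functor that admits a right adjoint. -/
def isRightAdj (S : Prestack.{w₁, v₁} 𝒪 U) (T : Prestack.{w₂, v₂} 𝒪 U) :
    ObjectProperty (PFunctor S T) :=
  fun φ => φ.IsLinear ∧ φ.HasRightAdjoint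

/-- Restriction of functors and transformations to an open subset. -/
@[simps]
def resFunctor {V W : Opens X} (hV : V ≤ U) (hW : W ≤ V) :
    PFunctor (S.restrict hV) (T.restrict hV) ⥤
      PFunctor (S.restrict (hW.trans hV)) (T.restrict (hW.trans hV)) where
  obj φ := φ.restrict hW
  map α :=
    { app := fun Y hY => α.app Y (hY.trans hW)
      naturality := fun hY hZ F => α.naturality (hY.trans hW) hZ F }
  map_id _ := rfl
  map_comp _ _ := rfl

end

end PFunctor

section Hom

variable {X : TopCat.{u}} {𝒪 : Sheaf (Opens.grothendieckTopology X) CommRingCat.{u}} {U : Opens X}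

/-- The prestack `V ↦ {𝒪|_V-functors S|_V → T|_V that admit a right adjoint}` and their
transformations, with the obvious restrictions. -/
def HomR (S : Prestack.{w₁, v₁} 𝒪 U) (T : Prestack.{w₂, v₂} 𝒪 U) :
    Prestack.{max u w₁ v₁ w₂ v₂, max u w₁ v₂} 𝒪 U where
  Obj V hV := (PFunctor.isRightAdj (S.restrict hV) (T.restrict hV)).FullSubcategory
  cat V hV := inferInstance
  preadditive V hV := inferInstance
  linear V hV := inferInstance
  res hV hW := ObjectProperty.lift _
    (ObjectProperty.ι _ ⋙ PFunctor.resFunctor (S := S) (T := T) hV hW)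
    (fun φ => ⟨φ.property.1.restrict hW, φ.property.2.restrict hW⟩)
  res_add _ _ _ _ _ _ := rfl
  res_smul {V W} hV hW φ ψ r α := by
    apply ObjectProperty.hom_ext
    refine PFunctor.hom_ext fun Y hY => ?_
    change rho 𝒪 (hY.trans hW) r • α.hom.app Y (hY.trans hW) =
      rho 𝒪 hY (rho 𝒪 hW r) • α.hom.app Y (hY.trans hW)
    rw [rho_rho]
  resId hV := Iso.refl _
  resComp hV hW hY := Iso.refl _
  resComp_id _ _ _ := rfl
  id_resComp _ _ _ := rfl
  resComp_assoc _ _ _ _ _ := rfl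

end Hom

/-! ### Sheaves of algebras and their modules -/

section Algebras

/-- A sheaf of (not necessarily commutative) `𝒪|_U`-algebras on the open subset `U` of `X`,
i.e. on the site of open subsets of `X` contained in `U`: a sheaf of rings with a morphism from
`𝒪|_U` whose image is central. -/
structure Alg {X : TopCat.{u}} (𝒪 : Sheaf (Opens.grothendieckTopology X) CommRingCat.{u}) (U : Opens X) where
  ring : Sheaf ((Opens.grothendieckTopology X).over U) RingCat.{u}
  unit : (𝒪.over U).obj ⋙ forget₂ CommRingCat.{u} RingCat.{u} ⟶ ring.obj
  central (T : (Over U)ᵒᵖ) (r : 𝒪.obj.obj (op T.unop.left)) (a : ring.obj.obj T) :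
    Commute ((unit.app T).hom r) a

variable {X : TopCat.{u}} {𝒪 : Sheaf (Opens.grothendieckTopology X) CommRingCat.{u}} {U : Opens X}

namespace Alg

/-- The restriction of a sheaf of algebras to an open subset. -/
def restrict (A : Alg 𝒪 U) {V : Opens X} (hV : V ≤ U) : Alg 𝒪 V where
  ring := ((Opens.grothendieckTopology X).overMapPullback RingCat.{u} (homOfLE hV)).obj A.ring
  unit := { app := fun T => A.unit.app (op ((Over.map (homOfLE hV)).obj T.unop))
            naturality := fun _ _ f => A.unit.naturality ((Over.map (homOfLE hV)).map f.unop).op }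
  central T r a := A.central (op ((Over.map (homOfLE hV)).obj T.unop)) r a

/-- Sections of `A` over `V ⊆ U`. -/
abbrev Sec (A : Alg 𝒪 U) (V : Opens X) (hV : V ≤ U) : Type u :=
  A.ring.obj.obj (op (Over.mk (homOfLE hV)))

/-- Restriction of sections of `A`. -/
abbrev rho (A : Alg 𝒪 U) {V W : Opens X} (hV : V ≤ U) (hW : W ≤ V) :
    A.Sec V hV →+* A.Sec W (hW.trans hV) :=
  (A.ring.obj.map (Over.homMk (homOfLE hW) :
    Over.mk (homOfLE (hW.trans hV)) ⟶ Over.mk (homOfLE hV)).op).hom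

/-- The structural morphism `𝒪(V) → A(V)`. -/
abbrev algMap (A : Alg 𝒪 U) (V : Opens X) (hV : V ≤ U) : TwistedStack.Sec 𝒪 V →+* A.Sec V hV :=
  (A.unit.app (op (Over.mk (homOfLE hV)))).hom

/-- `𝒪|_U` as a sheaf of `𝒪|_U`-algebras. -/
def base (𝒪 : Sheaf (Opens.grothendieckTopology X) CommRingCat.{u}) (U : Opens X) : Alg 𝒪 U where
  ring := (sheafCompose _ (forget₂ CommRingCat.{u} RingCat.{u})).obj (𝒪.over U)
  unit := 𝟙 _
  central T r a := mul_comm (G := 𝒪.obj.obj (op T.unop.left)) r a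

end Alg

/-- The opposite ring. -/
def opRing : RingCat.{u} ⥤ RingCat.{u} where
  obj R := RingCat.of Rᵐᵒᵖ
  map f := RingCat.ofHom f.hom.op

namespace Alg

/-- The opposite of a sheaf of algebras, given by the opposite rings of sections. -/
def opp (A : Alg 𝒪 U) : Alg 𝒪 U where
  ring := ⟨A.ring.obj ⋙ opRing, by
    rw [Presheaf.isSheaf_iff_isSheaf_forget _ _ (forget RingCat.{u})]
    have h := A.ring.property
    rw [Presheaf.isSheaf_iff_isSheaf_forget _ _ (forget RingCat.{u})] at h
    refine (Presheaf.isSheaf_of_iso_iff (NatIso.ofComponents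
      (fun T => Equiv.toIso MulOpposite.opEquiv) ?_)).1 h
    intros
    rfl⟩
  unit :=
    { app := fun T => RingCat.ofHom
        ((A.unit.app T).hom.toOpposite fun r s => A.central T r ((A.unit.app T).hom s))
      naturality := fun T T' f => by
        ext r
        exact congrArg MulOpposite.op (ConcreteCategory.congr_hom (A.unit.naturality f) r) }
  central T r a := (A.central T r a.unop).op

end Alg

end Algebras

/-! ### Tensor product of sheaves of algebras -/

section Tensor

open scoped TensorProduct

/-- The ring homomorphism `A ⊗[R] B → A' ⊗[R'] B'` induced by compatible ring homomorphisms. -/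
def tensorMap {R A B R' A' B' : Type u} [CommRing R] [Ring A] [Ring B] [Algebra R A] [Algebra R B]
    [CommRing R'] [Ring A'] [Ring B'] [Algebra R' A'] [Algebra R' B']
    (f : R →+* R') (g : A →+* A') (h : B →+* B')
    (hg : ∀ r, g (algebraMap R A r) = algebraMap R' A' (f r))
    (hh : ∀ r, h (algebraMap R B r) = algebraMap R' B' (f r)) :
    A ⊗[R] B →+* A' ⊗[R'] B' :=
  letI : Algebra R (A' ⊗[R'] B') := ((algebraMap R' (A' ⊗[R'] B')).comp f).toAlgebra'
    fun r x => Algebra.commutes (f r) x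
  (Algebra.TensorProduct.lift (R := R) (S := R)
    { (Algebra.TensorProduct.includeLeftRingHom : A' →+* A' ⊗[R'] B').comp g with
      commutes' := fun r => by
        change (g (algebraMap R A r)) ⊗ₜ[R'] (1 : B') = algebraMap R' (A' ⊗[R'] B') (f r)
        rw [hg, Algebra.TensorProduct.algebraMap_apply] }
    { (Algebra.TensorProduct.includeRight : B' →ₐ[R'] A' ⊗[R'] B').toRingHom.comp h with
      commutes' := fun r => by
        change (1 : A') ⊗ₜ[R'] (h (algebraMap R B r)) = algebraMap R' (A' ⊗[R'] B') (f r)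
        rw [hh, Algebra.TensorProduct.algebraMap_apply'] }
    (fun a b => by
      change (g a ⊗ₜ[R'] (1 : B')) * ((1 : A') ⊗ₜ[R'] h b) =
        ((1 : A') ⊗ₜ[R'] h b) * (g a ⊗ₜ[R'] (1 : B'))
      simp)).toRingHom

lemma tensorMap_tmul {R A B R' A' B' : Type u} [CommRing R] [Ring A] [Ring B] [Algebra R A]
    [Algebra R B] [CommRing R'] [Ring A'] [Ring B'] [Algebra R' A'] [Algebra R' B']
    (f : R →+* R') (g : A →+* A') (h : B →+* B')
    (hg : ∀ r, g (algebraMap R A r) = algebraMap R' A' (f r))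
    (hh : ∀ r, h (algebraMap R B r) = algebraMap R' B' (f r)) (a : A) (b : B) :
    tensorMap f g h hg hh (a ⊗ₜ b) = g a ⊗ₜ h b := by
  change (g a ⊗ₜ[R'] (1 : B')) * ((1 : A') ⊗ₜ[R'] h b) = _
  simp

variable {X : TopCat.{u}} {𝒪 : Sheaf (Opens.grothendieckTopology X) CommRingCat.{u}} {U : Opens X}

namespace Alg

/-- The sections of `A` over an open set form an algebra over the sections of `𝒪`. -/
instance algebra (A : Alg 𝒪 U) (T : (Over U)ᵒᵖ) :
    Algebra (𝒪.obj.obj (Opposite.op T.unop.left)) (A.ring.obj.obj T) :=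
  (A.unit.app T).hom.toAlgebra' (A.central T)

/-- The restriction homomorphism `A(V) ⊗[𝒪(V)] B(V) → A(W) ⊗[𝒪(W)] B(W)`. -/
noncomputable def tensorRes (A B : Alg 𝒪 U) {T T' : (Over U)ᵒᵖ} (f : T ⟶ T') :
    (A.ring.obj.obj T) ⊗[(𝒪.obj.obj (Opposite.op T.unop.left) : Type u)] (B.ring.obj.obj T) →+*
      (A.ring.obj.obj T') ⊗[(𝒪.obj.obj (Opposite.op T'.unop.left) : Type u)]
        (B.ring.obj.obj T') :=
  tensorMap ((𝒪.over U).obj.map f).hom (A.ring.obj.map f).hom (B.ring.obj.map f).hom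
    (fun r => (ConcreteCategory.congr_hom (A.unit.naturality f) r).symm)
    (fun r => (ConcreteCategory.congr_hom (B.unit.naturality f) r).symm)

lemma tensorRes_tmul (A B : Alg 𝒪 U) {T T' : (Over U)ᵒᵖ} (f : T ⟶ T') (a : A.ring.obj.obj T)
    (b : B.ring.obj.obj T) :
    A.tensorRes B f (a ⊗ₜ b) = (A.ring.obj.map f).hom a ⊗ₜ (B.ring.obj.map f).hom b :=
  tensorMap_tmul _ _ _ _ _ a b

/-- The presheaf of rings `V ↦ A(V) ⊗[𝒪(V)] B(V)`. -/
noncomputable def tensorPresheaf (A B : Alg 𝒪 U) : (Over U)ᵒᵖ ⥤ RingCat.{u} where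
  obj T := RingCat.of
    ((A.ring.obj.obj T) ⊗[(𝒪.obj.obj (Opposite.op T.unop.left) : Type u)] (B.ring.obj.obj T))
  map f := RingCat.ofHom (A.tensorRes B f)
  map_id T := by
    refine RingCat.hom_ext (Algebra.TensorProduct.ringHom_ext ?_ ?_)
    · ext a
      change A.tensorRes B (𝟙 T) (a ⊗ₜ 1) = a ⊗ₜ 1
      simp [tensorRes_tmul]
    · ext b
      change A.tensorRes B (𝟙 T) (1 ⊗ₜ b) = 1 ⊗ₜ b
      simp [tensorRes_tmul]
  map_comp f g := by
    refine RingCat.hom_ext (Algebra.TensorProduct.ringHom_ext ?_ ?_)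
    · ext a
      change A.tensorRes B (f ≫ g) (a ⊗ₜ 1) = A.tensorRes B g (A.tensorRes B f (a ⊗ₜ 1))
      simp [tensorRes_tmul]
    · ext b
      change A.tensorRes B (f ≫ g) (1 ⊗ₜ b) = A.tensorRes B g (A.tensorRes B f (1 ⊗ₜ b))
      simp [tensorRes_tmul]

/-- The structural morphism from `𝒪` to the presheaf tensor product. -/
noncomputable def tensorPresheafUnit (A B : Alg 𝒪 U) :
    (𝒪.over U).obj ⋙ forget₂ CommRingCat.{u} RingCat.{u} ⟶ A.tensorPresheaf B where
  app T := RingCat.ofHom (algebraMap (𝒪.obj.obj (Opposite.op T.unop.left) : Type u)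
    ((A.ring.obj.obj T) ⊗[(𝒪.obj.obj (Opposite.op T.unop.left) : Type u)] (B.ring.obj.obj T)))
  naturality T T' f := by
    ext r
    change algebraMap (𝒪.obj.obj (Opposite.op T'.unop.left) : Type u)
      ((A.ring.obj.obj T') ⊗[(𝒪.obj.obj (Opposite.op T'.unop.left) : Type u)] (B.ring.obj.obj T'))
        (((𝒪.over U).obj.map f).hom r) = A.tensorRes B f
          (algebraMap (𝒪.obj.obj (Opposite.op T.unop.left) : Type u)
            ((A.ring.obj.obj T) ⊗[(𝒪.obj.obj (Opposite.op T.unop.left) : Type u)]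
              (B.ring.obj.obj T)) r)
    refine Eq.trans ?_ (A.tensorRes_tmul B f ((A.unit.app T).hom r) 1).symm
    rw [map_one]
    exact congrArg (· ⊗ₜ 1) (ConcreteCategory.congr_hom (A.unit.naturality f) r)

lemma tensorPresheafUnit_central (A B : Alg 𝒪 U) (T : (Over U)ᵒᵖ)
    (r : 𝒪.obj.obj (Opposite.op T.unop.left)) (y : (A.tensorPresheaf B).obj T) :
    ((A.tensorPresheafUnit B).app T).hom r * y = y * ((A.tensorPresheafUnit B).app T).hom r :=
  Algebra.commutes (A := (A.ring.obj.obj T)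
    ⊗[(𝒪.obj.obj (Opposite.op T.unop.left) : Type u)] (B.ring.obj.obj T)) r y

/-- Two sections of a sheaf of rings that agree on a covering are equal. -/
lemma sheaf_ext {C : Type u} [Category.{u} C] {J : GrothendieckTopology C}
    (F : Sheaf J RingCat.{u}) {T : C} (R : Sieve T) (hR : R ∈ J T)
    (s t : F.obj.obj (Opposite.op T))
    (h : ∀ ⦃T' : C⦄ (f : T' ⟶ T), R f → (F.obj.map f.op).hom s = (F.obj.map f.op).hom t) :
    s = t := by
  have hF := F.property
  rw [Presheaf.isSheaf_iff_isSheaf_forget _ _ (forget RingCat.{u}),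
    isSheaf_iff_isSheaf_of_type] at hF
  exact (hF R hR).isSeparatedFor.ext h

/-- The tensor product `A ⊗_𝒪 B`: the sheaf associated with `V ↦ A(V) ⊗[𝒪(V)] B(V)`. -/
noncomputable def tensor (A B : Alg 𝒪 U) : Alg 𝒪 U where
  ring := (presheafToSheaf ((Opens.grothendieckTopology X).over U) RingCat.{u}).obj
    (A.tensorPresheaf B)
  unit := A.tensorPresheafUnit B ≫
    toSheafify ((Opens.grothendieckTopology X).over U) (A.tensorPresheaf B)
  central T r x := by
    let J := (Opens.grothendieckTopology X).over U
    let F := (presheafToSheaf J RingCat.{u}).obj (A.tensorPresheaf B)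
    let η : A.tensorPresheaf B ⟶ F.obj := toSheafify J (A.tensorPresheaf B)
    refine sheaf_ext F (Presheaf.imageSieve η x) (Presheaf.imageSieve_mem J η x) _ _ ?_
    rintro T' f ⟨y, hy⟩
    have h : (F.obj.map f.op).hom (((A.tensorPresheafUnit B ≫ η).app T).hom r) =
        (η.app (Opposite.op T')).hom (((A.tensorPresheafUnit B).app (Opposite.op T')).hom
          (((𝒪.over U).obj.map f.op).hom r)) :=
      (ConcreteCategory.congr_hom ((A.tensorPresheafUnit B ≫ η).naturality f.op) r).symm
    have hy' : (η.app (Opposite.op T')).hom y = (F.obj.map f.op).hom x := hy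
    change (F.obj.map f.op).hom (((A.tensorPresheafUnit B ≫ η).app T).hom r * x) =
      (F.obj.map f.op).hom (x * ((A.tensorPresheafUnit B ≫ η).app T).hom r)
    rw [map_mul, map_mul, h, ← hy', ← map_mul, ← map_mul]
    congr 1
    exact A.tensorPresheafUnit_central B (Opposite.op T') (((𝒪.over U).obj.map f.op).hom r) y

end Alg

end Tensor

/-! ### The stack of modules over a sheaf of algebras -/

section Modules

variable {X : TopCat.{u}} {𝒪 : Sheaf (Opens.grothendieckTopology X) CommRingCat.{u}} {U : Opens X}

namespace Alg

/-- The ring homomorphism from the sections of `𝒪` over `U` to the sections of `A` over `T`. -/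
def scalar (A : Alg 𝒪 U) (T : (Over U)ᵒᵖ) : TwistedStack.Sec 𝒪 U →+* A.ring.obj.obj T :=
  RingHom.comp (β := 𝒪.obj.obj (Opposite.op T.unop.left)) (A.unit.app T).hom
    (𝒪.obj.map T.unop.hom.op).hom

lemma map_scalar (A : Alg 𝒪 U) (r : TwistedStack.Sec 𝒪 U) {T T' : (Over U)ᵒᵖ} (f : T ⟶ T') :
    (A.ring.obj.map f).hom (A.scalar T r) = A.scalar T' r := by
  have h₁ := ConcreteCategory.congr_hom (A.unit.naturality f) ((𝒪.obj.map T.unop.hom.op).hom r)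
  have h₂ : (𝒪.obj.map f.unop.left.op).hom ((𝒪.obj.map T.unop.hom.op).hom r) =
      (𝒪.obj.map T'.unop.hom.op).hom r := by
    rw [← Over.w f.unop, op_comp, Functor.map_comp]
    rfl
  exact h₁.symm.trans (congrArg (A.unit.app T').hom h₂)

lemma scalar_restrict (A : Alg 𝒪 U) {V : Opens X} (hV : V ≤ U) (r : TwistedStack.Sec 𝒪 U)
    (T : (Over V)ᵒᵖ) :
    A.scalar (Opposite.op ((Over.map (homOfLE hV)).obj T.unop)) r =
      (A.restrict hV).scalar T (TwistedStack.rho 𝒪 hV r) := by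
  refine congrArg (A.unit.app (Opposite.op ((Over.map (homOfLE hV)).obj T.unop))).hom ?_
  exact ConcreteCategory.congr_hom (𝒪.obj.map_comp (homOfLE hV).op T.unop.hom.op) r

/-- Multiplication by a section of `𝒪`, as an endomorphism of a sheaf of `A`-modules. -/
noncomputable def scalarHom (A : Alg 𝒪 U) (r : TwistedStack.Sec 𝒪 U)
    (M : SheafOfModules.{u} A.ring) : M ⟶ M where
  val :=
    { app := fun T => ModuleCat.ofHom
        { toFun := fun m => A.scalar T r • m
          map_add' := fun m n => smul_add _ m n
          map_smul' := fun a m => by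
            rw [RingHom.id_apply, ← mul_smul, ← mul_smul]
            exact congrArg (· • m) (A.central T _ a).eq }
      naturality := fun {T T'} f => by
        ext m
        change A.scalar T' r • (M.val.map f).hom m = (M.val.map f).hom (A.scalar T r • m)
        rw [PresheafOfModules.map_smul]
        exact congrArg (· • (M.val.map f).hom m) (A.map_scalar r f).symm }

/-- The action of `𝒪(U)` on the category of sheaves of `A`-modules. -/
noncomputable def toCenter (A : Alg 𝒪 U) :
    TwistedStack.Sec 𝒪 U →+* CatCenter (SheafOfModules.{u} A.ring) where
  toFun r :=
    { app := fun M => A.scalarHom r M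
      naturality := fun M N f => by
        ext T m
        exact ((f.val.app T).hom.map_smul (A.scalar T r) m).symm }
  map_one' := by
    ext M T m
    change A.scalar T 1 • m = m
    rw [map_one, one_smul]
  map_mul' r s := by
    ext M T m
    change A.scalar T (r * s) • m = A.scalar T r • A.scalar T s • m
    rw [← mul_smul, map_mul]
  map_zero' := by
    ext M T m
    change A.scalar T 0 • m = 0
    rw [map_zero, zero_smul]
  map_add' r s := by
    ext M T m
    change A.scalar T (r + s) • m = A.scalar T r • m + A.scalar T s • m
    rw [← add_smul, map_add]

/-- Sheaves of `A`-modules form an `𝒪(U)`-linear category: sections of `𝒪` act on morphisms by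
multiplication. -/
noncomputable instance linearModules (A : Alg 𝒪 U) :
    Linear (TwistedStack.Sec 𝒪 U) (SheafOfModules.{u} A.ring) :=
  Linear.ofRingMorphism A.toCenter

lemma smul_val_app (A : Alg 𝒪 U) {M N : SheafOfModules.{u} A.ring} (r : TwistedStack.Sec 𝒪 U)
    (f : M ⟶ N) (T : (Over U)ᵒᵖ) (m : M.val.obj T) :
    ((r • f).val.app T).hom m = A.scalar T r • (f.val.app T).hom m :=
  (f.val.app T).hom.map_smul (A.scalar T r) m

/-- Restriction of sheaves of modules to an open subset. -/
noncomputable def resModules (A : Alg 𝒪 U) {V : Opens X} (hV : V ≤ U) :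
    SheafOfModules.{u} A.ring ⥤ SheafOfModules.{u} (A.restrict hV).ring :=
  SheafOfModules.pushforward (F := Over.map (homOfLE hV)) (𝟙 _)

lemma resModules_smul (A : Alg 𝒪 U) {V : Opens X} (hV : V ≤ U)
    {M N : SheafOfModules.{u} A.ring} (r : TwistedStack.Sec 𝒪 U) (f : M ⟶ N) :
    (A.resModules hV).map (r • f) = TwistedStack.rho 𝒪 hV r • (A.resModules hV).map f := by
  ext T m
  refine (A.smul_val_app r f (Opposite.op ((Over.map (homOfLE hV)).obj T.unop)) m).trans ?_
  rw [A.scalar_restrict hV r T]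
  exact ((A.restrict hV).smul_val_app (TwistedStack.rho 𝒪 hV r) ((A.resModules hV).map f) T m).symm

/-- Restriction of sheaves of `A`-modules on `U` to `U` itself. -/
noncomputable def resModulesSelf (A : Alg 𝒪 U) :
    SheafOfModules.{u} A.ring ⥤ SheafOfModules.{u} A.ring :=
  A.resModules le_rfl

/-- Restricting a sheaf of `A`-modules on `U` to `U` does not change it. -/
noncomputable def resModulesObjId (A : Alg 𝒪 U) (M : SheafOfModules.{u} A.ring) :
    A.resModulesSelf.obj M ≅ M := Iso.refl M

/-- Restricting sheaves of `A`-modules on `U` to `U` does not change them. -/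
noncomputable def resModulesId (A : Alg 𝒪 U) : A.resModulesSelf ≅ 𝟭 _ :=
  NatIso.ofComponents (fun M => A.resModulesObjId M) (fun _ => rfl)

/-- Restriction of sheaves of modules is transitive. -/
noncomputable def resModulesObjComp (A : Alg 𝒪 U) {V W : Opens X} (hV : V ≤ U) (hW : W ≤ V)
    (M : SheafOfModules.{u} A.ring) :
    (((A.restrict hV).resModules hW).obj ((A.resModules hV).obj M) :
      SheafOfModules.{u} (A.restrict (hW.trans hV)).ring) ≅ (A.resModules (hW.trans hV)).obj M :=
  Iso.refl ((A.resModules (hW.trans hV)).obj M)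

/-- Restriction of sheaves of modules is transitive. -/
noncomputable def resModulesComp (A : Alg 𝒪 U) {V W : Opens X} (hV : V ≤ U) (hW : W ≤ V) :
    (A.resModules hV ⋙ (A.restrict hV).resModules hW :
      SheafOfModules.{u} A.ring ⥤ SheafOfModules.{u} (A.restrict (hW.trans hV)).ring) ≅
      A.resModules (hW.trans hV) :=
  NatIso.ofComponents (fun M => A.resModulesObjComp hV hW M) (fun _ => rfl)

lemma resModulesId_app (A : Alg 𝒪 U) (M : SheafOfModules.{u} A.ring) (T : (Over U)ᵒᵖ)
    (m : M.val.obj T) : ((A.resModulesId.hom.app M).val.app T).hom m = m := rfl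

lemma resModulesComp_app (A : Alg 𝒪 U) {V W : Opens X} (hV : V ≤ U) (hW : W ≤ V)
    (M : SheafOfModules.{u} A.ring) (T : (Over W)ᵒᵖ)
    (m : ((A.resModules (hW.trans hV)).obj M).val.obj T) :
    (((A.resModulesComp hV hW).hom.app M).val.app T).hom m = m := rfl

end Alg

/-- The prestack `V ↦ {sheaves of left A|_V-modules}`. -/
noncomputable def Mod (A : Alg 𝒪 U) : Prestack.{u + 1, u} 𝒪 U where
  Obj V hV := SheafOfModules.{u} (A.restrict hV).ring
  cat V hV := inferInstance
  preadditive V hV := inferInstance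
  linear V hV := (A.restrict hV).linearModules
  res hV hW := (A.restrict hV).resModules hW
  res_add _ _ _ _ _ _ := rfl
  res_smul hV hW _ _ r f := (A.restrict hV).resModules_smul hW r f
  resId hV := (A.restrict hV).resModulesId
  resComp hV hW hY := (A.restrict hV).resModulesComp hW hY
  resComp_id _ _ _ := SheafOfModules.hom_ext rfl
  id_resComp _ _ _ := SheafOfModules.hom_ext rfl
  resComp_assoc _ _ _ _ _ := SheafOfModules.hom_ext rfl

end Modules

/-! ### Modules in a linear prestack -/

section ModIn

variable {X : TopCat.{u}} {𝒪 : Sheaf (Opens.grothendieckTopology X) CommRingCat.{u}} {U : Opens X}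

/-- A (left) `A`-module in `S` over `V`: an object `F` of `S(V)` with a morphism of sheaves of
`𝒪|_V`-algebras from `A|_V` to the sheaf of endomorphisms of `F`. In `End`, the product `f * g`
is `f` after `g`. -/
structure ModObj (A : Alg 𝒪 U) (S : Prestack.{w, v} 𝒪 U) (V : Opens X) (hV : V ≤ U) where
  obj : S.Obj V hV
  act (W : Opens X) (hW : W ≤ V) : A.Sec W (hW.trans hV) →+* End ((S.res hV hW).obj obj)
  act_algMap (W : Opens X) (hW : W ≤ V) (r : Sec 𝒪 W) :
    act W hW (A.algMap W (hW.trans hV) r) = r • 𝟙 ((S.res hV hW).obj obj)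
  act_res {W Y : Opens X} (hW : W ≤ V) (hY : Y ≤ W) (a : A.Sec W (hW.trans hV)) :
    act Y (hY.trans hW) (A.rho (hW.trans hV) hY a) = S.resHom obj obj hW hW hY (act W hW a)

namespace ModObj

variable {A : Alg 𝒪 U} {S : Prestack.{w, v} 𝒪 U} {V : Opens X} {hV : V ≤ U}

/-- Morphisms of `A`-modules in `S`: the morphisms of `S(V)` commuting with the actions. -/
@[ext]
structure Hom (M N : ModObj A S V hV) where
  hom : M.obj ⟶ N.obj
  comm (W : Opens X) (hW : W ≤ V) (a : A.Sec W (hW.trans hV)) :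
    (M.act W hW a : (S.res hV hW).obj M.obj ⟶ (S.res hV hW).obj M.obj) ≫ (S.res hV hW).map hom =
      (S.res hV hW).map hom ≫ N.act W hW a

instance : Category (ModObj A S V hV) where
  Hom := Hom
  id M := { hom := 𝟙 M.obj, comm := by intros; simp }
  comp f g :=
    { hom := f.hom ≫ g.hom
      comm := fun W hW a => by
        rw [Functor.map_comp, ← Category.assoc, f.comm, Category.assoc, g.comm, Category.assoc] }

@[ext]
lemma hom_ext {M N : ModObj A S V hV} {f g : M ⟶ N} (h : f.hom = g.hom) : f = g := Hom.ext h

@[simp] lemma id_hom (M : ModObj A S V hV) : Hom.hom (𝟙 M) = 𝟙 M.obj := rfl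

@[simp] lemma comp_hom {M N P : ModObj A S V hV} (f : M ⟶ N) (g : N ⟶ P) :
    (f ≫ g).hom = f.hom ≫ g.hom := rfl

instance (M N : ModObj A S V hV) : Add (M ⟶ N) where
  add f g :=
    { hom := f.hom + g.hom
      comm := fun W hW a => by
        rw [S.res_add, Preadditive.comp_add, Preadditive.add_comp, f.comm, g.comm] }

instance (M N : ModObj A S V hV) : Zero (M ⟶ N) where
  zero := { hom := 0, comm := fun W hW a => by simp }

instance (M N : ModObj A S V hV) : Neg (M ⟶ N) where
  neg f :=
    { hom := -f.hom
      comm := fun W hW a => by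
        rw [Functor.map_neg, Preadditive.comp_neg, Preadditive.neg_comp, f.comm] }

instance (M N : ModObj A S V hV) : SMul (Sec 𝒪 V) (M ⟶ N) where
  smul r f :=
    { hom := r • f.hom
      comm := fun W hW a => by
        rw [S.res_smul, Linear.comp_smul, Linear.smul_comp, f.comm] }

@[simp] lemma add_hom {M N : ModObj A S V hV} (f g : M ⟶ N) : (f + g).hom = f.hom + g.hom := rfl

@[simp] lemma zero_hom {M N : ModObj A S V hV} : (0 : M ⟶ N).hom = 0 := rfl

@[simp] lemma neg_hom {M N : ModObj A S V hV} (f : M ⟶ N) : (-f).hom = -f.hom := rfl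

@[simp] lemma smul_hom {M N : ModObj A S V hV} (r : Sec 𝒪 V) (f : M ⟶ N) :
    (r • f).hom = r • f.hom := rfl

instance (M N : ModObj A S V hV) : AddCommGroup (M ⟶ N) where
  add_assoc f g h := by ext1; simp [add_assoc]
  zero_add f := by ext1; simp
  add_zero f := by ext1; simp
  nsmul := nsmulRec
  zsmul := zsmulRec
  neg_add_cancel f := by ext1; simp
  add_comm f g := by ext1; simp [add_comm]

instance : Preadditive (ModObj A S V hV) where
  add_comp := by intros; ext1; simp
  comp_add := by intros; ext1; simp

instance : Linear (Sec 𝒪 V) (ModObj A S V hV) where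
  homModule M N :=
    { one_smul := fun f => by ext1; simp
      mul_smul := fun r s f => by ext1; simp [mul_smul]
      smul_zero := fun r => by ext1; simp
      smul_add := fun r f g => by ext1; simp
      add_smul := fun r s f => by ext1; simp [add_smul]
      zero_smul := fun f => by ext1; simp }
  smul_comp := by intros; ext1; simp
  comp_smul := by intros; ext1; simp

/-- An isomorphism of the underlying objects commuting with the actions. -/
@[simps]
def isoMk {M N : ModObj A S V hV} (e : M.obj ≅ N.obj)
    (comm : ∀ (W : Opens X) (hW : W ≤ V) (a : A.Sec W (hW.trans hV)),
      (M.act W hW a : (S.res hV hW).obj M.obj ⟶ (S.res hV hW).obj M.obj) ≫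
        (S.res hV hW).map e.hom = (S.res hV hW).map e.hom ≫ N.act W hW a) : M ≅ N where
  hom := { hom := e.hom, comm := comm }
  inv :=
    { hom := e.inv
      comm := fun W hW a => by
        rw [← cancel_epi ((S.res hV hW).map e.hom), ← reassoc_of% comm W hW a,
          ← Functor.map_comp, e.hom_inv_id, CategoryTheory.Functor.map_id, ← Functor.map_comp_assoc, e.hom_inv_id,
          CategoryTheory.Functor.map_id, Category.id_comp]
        exact Category.comp_id _ }
  hom_inv_id := hom_ext e.hom_inv_id
  inv_hom_id := hom_ext e.inv_hom_id

lemma conj_aux {C : Type w} [Category.{v} C] {P Q R T : C} (x : P ≅ Q) (y : Q ≅ R) (z : P ≅ T)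
    (t : T ≅ R) (h : x.hom ≫ y.hom = z.hom ≫ t.hom) (m : Q ⟶ Q) :
    t.hom ≫ (y.inv ≫ m ≫ y.hom) ≫ t.inv = z.inv ≫ (x.hom ≫ m ≫ x.inv) ≫ z.hom := by
  have h₁ : t.hom ≫ y.inv = z.inv ≫ x.hom := by
    rw [Iso.eq_inv_comp, ← reassoc_of% h, Iso.hom_inv_id, Category.comp_id]
  have h₂ : y.hom ≫ t.inv = x.inv ≫ z.hom := by
    rw [Iso.comp_inv_eq, Category.assoc, ← h, Iso.inv_hom_id_assoc]
  simp only [Category.assoc, h₂, reassoc_of% h₁]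

lemma conj_aux' {C : Type w} [Category.{v} C] {P Q R T : C} (x : P ≅ Q) (y : Q ≅ R) (z : P ≅ T)
    (t : T ≅ R) (h : x.hom ≫ y.hom = z.hom ≫ t.hom) (m : R ⟶ R) :
    (z.hom ≫ (t.hom ≫ m ≫ t.inv) ≫ z.inv) ≫ x.hom = x.hom ≫ y.hom ≫ m ≫ y.inv := by
  have h₂ : t.inv ≫ z.inv ≫ x.hom = y.inv := by
    rw [Iso.inv_comp_eq, Iso.inv_comp_eq, ← reassoc_of% h, Iso.hom_inv_id, Category.comp_id]
  simp only [Category.assoc, h₂, reassoc_of% h]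

lemma conj_comm_aux {C : Type w} [Category.{v} C] {P P' Q Q' : C} (p : P ⟶ P') (m : P' ⟶ P')
    (p' : P' ⟶ P) (q : Q ⟶ Q') (n : Q' ⟶ Q') (q' : Q' ⟶ Q) (f : P ⟶ Q) (f' : P' ⟶ Q')
    (h : m ≫ f' = f' ≫ n) (h₁ : f ≫ q = p ≫ f') (h₂ : f' ≫ q' = p' ≫ f) :
    (p ≫ m ≫ p') ≫ f = f ≫ q ≫ n ≫ q' := by
  rw [reassoc_of% h₁, Category.assoc, Category.assoc, ← h₂, reassoc_of% h]

/-- The restriction of an `A`-module in `S` to an open subset. -/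
def restrict (M : ModObj A S V hV) {W : Opens X} (hW : W ≤ V) : ModObj A S W (hW.trans hV) where
  obj := (S.res hV hW).obj M.obj
  act Y hY :=
    { toFun := fun a => ((S.resComp hV hW hY).hom.app M.obj ≫
        M.act Y (hY.trans hW) a ≫ (S.resComp hV hW hY).inv.app M.obj :
          (S.res (hW.trans hV) hY).obj ((S.res hV hW).obj M.obj) ⟶
            (S.res (hW.trans hV) hY).obj ((S.res hV hW).obj M.obj))
      map_one' := by
        rw [map_one, End.one_def, Category.id_comp, Iso.hom_inv_id_app]
        rfl
      map_mul' := fun a b => by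
        rw [map_mul, End.mul_def, End.mul_def]
        simp
      map_zero' := by
        rw [map_zero]
        exact (congrArg _ Limits.zero_comp).trans Limits.comp_zero
      map_add' := fun a b => by
        rw [map_add]
        exact (congrArg _ (Preadditive.add_comp _ _ _ _ _ _)).trans (Preadditive.comp_add _ _ _ _ _ _) }
  act_algMap Y hY r := by
    change (S.resComp hV hW hY).hom.app M.obj ≫ M.act Y (hY.trans hW) _ ≫
      (S.resComp hV hW hY).inv.app M.obj = _
    rw [M.act_algMap]
    simp
  act_res {Y Z} hY hZ a := by
    have h := M.act_res (hY.trans hW) hZ a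
    have h₁ := S.resComp_assoc hV hW hY hZ M.obj
    change (S.resComp hV hW (hZ.trans hY)).hom.app M.obj ≫ M.act Z (hZ.trans (hY.trans hW)) _ ≫
      (S.resComp hV hW (hZ.trans hY)).inv.app M.obj = _
    rw [h]
    refine (conj_aux ((S.res _ hZ).mapIso ((S.resComp hV hW hY).app M.obj))
      ((S.resComp hV (hY.trans hW) hZ).app M.obj)
      ((S.resComp (hW.trans hV) hY hZ).app ((S.res hV hW).obj M.obj))
      ((S.resComp hV hW (hZ.trans hY)).app M.obj) h₁
      ((S.res (hY.trans (hW.trans hV)) hZ).map (M.act Y (hY.trans hW) a))).trans ?_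
    refine congrArg (fun t => (S.resComp (hW.trans hV) hY hZ).inv.app _ ≫ t ≫
      (S.resComp (hW.trans hV) hY hZ).hom.app _) ?_
    exact (((S.res _ hZ).map_comp _ _).trans
      (congrArg (fun t => _ ≫ t) ((S.res _ hZ).map_comp _ _))).symm

end ModObj

/-- The prestack of `A`-modules in `S`. -/
def ModIn (A : Alg 𝒪 U) (S : Prestack.{w, v} 𝒪 U) : Prestack.{max u w v, v} 𝒪 U where
  Obj V hV := ModObj A S V hV
  cat V hV := inferInstance
  preadditive V hV := inferInstance
  linear V hV := inferInstance
  res hV hW :=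
    { obj := fun M => M.restrict hW
      map := fun f =>
        { hom := (S.res hV hW).map f.hom
          comm := fun Y hY a => 
            ModObj.conj_comm_aux _ _ _ _ _ _ _ _ (f.comm Y (hY.trans hW) a)
              ((S.resComp hV hW hY).hom.naturality f.hom)
              ((S.resComp hV hW hY).inv.naturality f.hom) }
      map_id := fun M => ModObj.hom_ext ((S.res hV hW).map_id _)
      map_comp := fun f g => ModObj.hom_ext ((S.res hV hW).map_comp _ _) }
  res_add hV hW _ _ f g := ModObj.hom_ext (S.res_add hV hW _ _)
  res_smul hV hW _ _ r f := ModObj.hom_ext (S.res_smul hV hW _ _)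
  resId hV := NatIso.ofComponents
    (fun M => ModObj.isoMk (M := M.restrict le_rfl) (N := M) ((S.resId hV).app M.obj)
      (fun W hW a => by
        have h := S.id_resComp hV hW M.obj
        change ((S.resComp hV le_rfl hW).hom.app M.obj ≫ M.act W hW a ≫
          (S.resComp hV le_rfl hW).inv.app M.obj) ≫ (S.res hV hW).map ((S.resId hV).hom.app M.obj) =
            (S.res hV hW).map ((S.resId hV).hom.app M.obj) ≫ M.act W hW a
        rw [← h]
        simp))
    (fun f => ModObj.hom_ext ((S.resId hV).hom.naturality f.hom))
  resComp hV hW hY := NatIso.ofComponents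
    (fun M => ModObj.isoMk (M := (M.restrict hW).restrict hY) (N := M.restrict (hY.trans hW))
      ((S.resComp hV hW hY).app M.obj)
      (fun Z hZ a => ModObj.conj_aux'
        ((S.res _ hZ).mapIso ((S.resComp hV hW hY).app M.obj))
        ((S.resComp hV (hY.trans hW) hZ).app M.obj)
        ((S.resComp (hW.trans hV) hY hZ).app ((S.res hV hW).obj M.obj))
        ((S.resComp hV hW (hZ.trans hY)).app M.obj) (S.resComp_assoc hV hW hY hZ M.obj)
        (M.act Z (hZ.trans (hY.trans hW)) a)))
    (fun f => ModObj.hom_ext ((S.resComp hV hW hY).hom.naturality f.hom))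
  resComp_id hV hW M := ModObj.hom_ext (S.resComp_id hV hW M.obj)
  id_resComp hV hW M := ModObj.hom_ext (S.id_resComp hV hW M.obj)
  resComp_assoc hV hW hY hZ M := ModObj.hom_ext (S.resComp_assoc hV hW hY hZ M.obj)

end ModIn

/-! ### Duality, product, twisted modules -/

section Twisted

variable {X : TopCat.{u}} {𝒪 : Sheaf (Opens.grothendieckTopology X) CommRingCat.{u}} {U : Opens X}

/-- The dual `S⁻¹ = Hom^r(S, Mod(𝒪))`. -/
noncomputable def dual (S : Prestack.{w, v} 𝒪 U) :
    Prestack.{max (u + 1) w v, max u w} 𝒪 U :=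
  HomR S (Mod (Alg.base 𝒪 U))

/-- The product `S ⊛ S' = Hom^r(S⁻¹, S')`. -/
noncomputable def product (S : Prestack.{w₁, v₁} 𝒪 U) (S' : Prestack.{w₂, v₂} 𝒪 U) :
    Prestack.{max (u + 1) w₁ v₁ w₂ v₂, max (u + 1) w₁ v₁ v₂} 𝒪 U :=
  HomR (dual S) S'

/-- `S` and `T` are `𝒪`-equivalent: there is an `𝒪`-functor `S → T` which is an equivalence. -/
def Equivalent (S : Prestack.{w₁, v₁} 𝒪 U) (T : Prestack.{w₂, v₂} 𝒪 U) : Prop :=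
  ∃ φ : PFunctor S T, φ.IsLinear ∧ φ.IsEquiv

/-- A stack of `𝒪`-twisted modules on `U`: an `𝒪`-stack which is locally `𝒪`-equivalent to
stacks of modules over sheaves of `𝒪`-algebras. -/
def IsTwisted (S : Prestack.{w, v} 𝒪 U) : Prop :=
  S.IsStack ∧ ∃ (ι : Type u) (c : ι → Opens X) (hc : ∀ i, c i ≤ U), (⨆ i, c i) = U ∧
    ∀ i, ∃ A : Alg 𝒪 (c i), Equivalent (S.restrict (hc i)) (Mod A)

end Twisted

end TwistedStack

/-!
Every statement reduces to a Morita theorem for stacks of modules,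
`Hom^r(Mod A, Mod B) ≈ Mod(A^op; Mod B)`, together with the identification of `Mod(A; Mod B)` with
the modules over `A ⊗ B`.

*Functors with a right adjoint.* An `𝒪`-functor `φ` from `Mod A` with a right adjoint is evaluated
at the module `A`; right multiplications make `φ(A)` a module over `A^op`. A section `m` of a
module `M` over `W` is a morphism `A|_W → M|_W` (`Mod.ev`), so that `φ` gives a pairing
`φ(A) × M → φ(M)`, where a `Pairing` of an `A^op`-module `P` with `M` is a family of morphisms
`P|_W → Q|_W` indexed by the sections of `M`, balanced over `A`. The right adjoint of `φ` shows
that this pairing is universal (`PFunctor.IsLinear.isUniversal_pairing`): thus `φ(M)` is the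
tensor product `φ(A) ⊗_A M`. In particular a transformation between two such functors is
determined by its value at `A`, which may be prescribed
(`PFunctor.IsLinear.mapModHom_unitMod_bijective`). Conversely each module `P` over `A^op` in
`Mod B` defines the functor `P ⊗_A -`, built with the sheaf associated with the presheaf of tensor
products of sections (`Mod.exists_universal_pairing`); its right adjoint is the internal `Hom`
from `P` (`Pairing.exists_pfunctor`). So evaluation at `A` is an equivalence
(`equivalent_homR_mod`).

*Tensor products.* If `C` is locally presented by `A` and `B` as a tensor product
(`Alg.TensorPresentation`), restriction of scalars identifies `Mod C` with `Mod(A; Mod B)`: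
morphisms that are linear over both factors are linear over `C`, which is locally generated by
them, and commuting actions of `A` and `B` extend uniquely to `C` by gluing
(`Alg.TensorPresentation.equivalent`). This applies to `A ⊗ B`, and to `A` itself as its tensor
product with `𝒪`.

Hence `Mod(A)⁻¹ = Hom^r(Mod A, Mod 𝒪) ≈ Mod(A^op; Mod 𝒪) ≈ Mod(A^op)`, and
`Mod(A) ⊛ Mod(A') ≈ Hom^r(Mod A^op, Mod A') ≈ Mod(A; Mod A') ≈ Mod(A ⊗ A')`, as `Hom^r` respects
equivalences in both arguments.

*Stacks.* Sheaves of modules glue (`Mod.isStack`). The prestack `Hom^r(S, T)` is a stack if `S`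
and `T` are (`HomR.isStack`): functors and transformations are glued from their values over small
open subsets, and having a right adjoint is a local property, because it amounts to the
representability of the sheaves `F ↦ Hom(φ(F), G)`. Local equivalences with stacks of modules on
open sets `U i` and `V j` then give the local structure of the dual on the `U i`, and of the
product on the intersections `U i ⊓ V j`.

Working with the categories of objects over the various open subsets, coherence isomorphisms are
kept under control by considering morphisms over `W` between objects over larger open subsets: a
functor of prestacks is the same as a map on objects together with a functorial,
restriction-compatible action on these (`PFunctor.Core`), and a functor that is an equivalence
over every open subset is an equivalence (`PFunctor.isEquiv_of_isEquivalence`).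
-/

namespace TwistedStack
/-! ### Morphisms over smaller open subsets -/

namespace Prestack

section

variable {X : TopCat.{u}} {𝒪 : Sheaf (Opens.grothendieckTopology X) CommRingCat.{u}} {U : Opens X}
  (S : Prestack.{w, v} 𝒪 U)

/-- The canonical isomorphism `(F|_W)|_Y ≅ F|_Y`. It is used as a morphism over `Y` from `F|_W`
to `F`. -/
abbrev can {V W Y : Opens X} {hV : V ≤ U} (F : S.Obj V hV) (hW : W ≤ V) (hY : Y ≤ W) :
    (S.res (hW.trans hV) hY).obj ((S.res hV hW).obj F) ≅ (S.res hV (hY.trans hW)).obj F :=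
  (S.resComp hV hW hY).app F

variable {V V₁ V₂ V₃ W Y Z : Opens X} {hV : V ≤ U} {h₁ : V₁ ≤ U} {h₂ : V₂ ≤ U} {h₃ : V₃ ≤ U}
  {S}

lemma resHom_id (F : S.Obj V hV) (w : W ≤ V) (hY : Y ≤ W) :
    S.resHom F F w w hY (𝟙 _) = 𝟙 _ := by
  simp [resHom]

lemma resHom_comp (F : S.Obj V₁ h₁) (G : S.Obj V₂ h₂) (K : S.Obj V₃ h₃) (w₁ : W ≤ V₁)
    (w₂ : W ≤ V₂) (w₃ : W ≤ V₃) (hY : Y ≤ W) (f : (S.res h₁ w₁).obj F ⟶ (S.res h₂ w₂).obj G)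
    (g : (S.res h₂ w₂).obj G ⟶ (S.res h₃ w₃).obj K) :
    S.resHom F K w₁ w₃ hY (f ≫ g) = S.resHom F G w₁ w₂ hY f ≫ S.resHom G K w₂ w₃ hY g := by
  simp [resHom]

/-- Over `Y`, the restriction of `f : F|_W ⟶ G|_W` as a morphism of `S(W)` and as a morphism over
`W` from `F` to `G` differ by the canonical isomorphisms. -/
lemma map_can (F : S.Obj V₁ h₁) (G : S.Obj V₂ h₂) (w₁ : W ≤ V₁) (w₂ : W ≤ V₂) (hY : Y ≤ W)
    (f : (S.res h₁ w₁).obj F ⟶ (S.res h₂ w₂).obj G) :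
    (S.res (w₁.trans h₁) hY).map f ≫ (S.can G w₂ hY).hom =
      (S.can F w₁ hY).hom ≫ S.resHom F G w₁ w₂ hY f := by
  simp [resHom]

lemma resHom_resHom (F : S.Obj V₁ h₁) (G : S.Obj V₂ h₂) (w₁ : W ≤ V₁) (w₂ : W ≤ V₂) (hY : Y ≤ W)
    (hZ : Z ≤ Y) (f : (S.res h₁ w₁).obj F ⟶ (S.res h₂ w₂).obj G) :
    S.resHom F G (hY.trans w₁) (hY.trans w₂) hZ (S.resHom F G w₁ w₂ hY f) =
      S.resHom F G w₁ w₂ (hZ.trans hY) f := by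
  have a₁ := S.resComp_assoc h₁ w₁ hY hZ F
  have a₂ := S.resComp_assoc h₂ w₂ hY hZ G
  rw [← cancel_epi ((S.resComp h₁ (hY.trans w₁) hZ).hom.app F),
    ← cancel_epi ((S.res _ hZ).map ((S.resComp h₁ w₁ hY).hom.app F))]
  have n := (S.resComp (w₁.trans h₁) hY hZ).hom.naturality f
  have i : (S.res (hY.trans (w₁.trans h₁)) hZ).map ((S.resComp h₁ w₁ hY).hom.app F) ≫
      (S.res _ hZ).map ((S.resComp h₁ w₁ hY).inv.app F) = 𝟙 _ := by
    rw [← Functor.map_comp, Iso.hom_inv_id_app, CategoryTheory.Functor.map_id]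
  dsimp at n
  simp only [resHom, Functor.map_comp, Category.assoc]
  rw [reassoc_of% (S.resComp h₁ (hY.trans w₁) hZ).hom_inv_id_app F, reassoc_of% i, a₂,
    reassoc_of% n, reassoc_of% a₁, reassoc_of% (S.resComp h₁ w₁ (hZ.trans hY)).hom_inv_id_app F]

lemma resHom_self (F : S.Obj V₁ h₁) (G : S.Obj V₂ h₂) (w₁ : W ≤ V₁) (w₂ : W ≤ V₂)
    (f : (S.res h₁ w₁).obj F ⟶ (S.res h₂ w₂).obj G) :
    S.resHom F G w₁ w₂ le_rfl f = f := by
  rw [← cancel_epi (S.can F w₁ le_rfl).hom, ← map_can]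
  have n := (S.resId (w₁.trans h₁)).hom.naturality f
  simp only [can, Iso.app_hom, S.resComp_id]
  exact n

lemma resHom_map (F G : S.Obj V hV) (hW : W ≤ V) (hY : Y ≤ W) (f : F ⟶ G) :
    S.resHom F G hW hW hY ((S.res hV hW).map f) = (S.res hV (hY.trans hW)).map f := by
  have n := (S.resComp hV hW hY).hom.naturality f
  dsimp at n
  simp [resHom, n]

lemma resHom_can (F : S.Obj V hV) (hW : W ≤ V) (hY : Y ≤ W) (hZ : Z ≤ Y) :
    S.resHom ((S.res hV hW).obj F) F hY (hY.trans hW) hZ (S.can F hW hY).hom =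
      (S.can F hW (hZ.trans hY)).hom := by
  have a₁ := S.resComp_assoc hV hW hY hZ F
  simp only [resHom, can, Iso.app_hom]
  rw [a₁]
  simp

lemma resHom_can_inv (F : S.Obj V hV) (hW : W ≤ V) (hY : Y ≤ W) (hZ : Z ≤ Y) :
    S.resHom F ((S.res hV hW).obj F) (hY.trans hW) hY hZ (S.can F hW hY).inv =
      (S.can F hW (hZ.trans hY)).inv := by
  rw [← cancel_epi (S.can F hW (hZ.trans hY)).hom, Iso.hom_inv_id, ← resHom_can F hW hY hZ, ← resHom_comp,
    Iso.hom_inv_id, resHom_id]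

/-- Restriction over `Y` of an isomorphism over `W`. -/
def resIso (F : S.Obj V₁ h₁) (G : S.Obj V₂ h₂) (w₁ : W ≤ V₁) (w₂ : W ≤ V₂) (hY : Y ≤ W)
    (f : (S.res h₁ w₁).obj F ≅ (S.res h₂ w₂).obj G) :
    (S.res h₁ (hY.trans w₁)).obj F ≅ (S.res h₂ (hY.trans w₂)).obj G where
  hom := S.resHom F G w₁ w₂ hY f.hom
  inv := S.resHom G F w₂ w₁ hY f.inv
  hom_inv_id := by rw [← resHom_comp, f.hom_inv_id, resHom_id]
  inv_hom_id := by rw [← resHom_comp, f.inv_hom_id, resHom_id]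

/-- The morphism `F ⟶ G` of `S(V)` given by a morphism over `V`. -/
def down {F G : S.Obj V hV} (f : (S.res hV le_rfl).obj F ⟶ (S.res hV le_rfl).obj G) : F ⟶ G :=
  (S.resId hV).inv.app F ≫ f ≫ (S.resId hV).hom.app G

lemma map_down {F G : S.Obj V hV} (f : (S.res hV le_rfl).obj F ⟶ (S.res hV le_rfl).obj G)
    (hW : W ≤ V) : (S.res hV hW).map (down f) = S.resHom F G le_rfl le_rfl hW f := by
  have i₁ : (S.res hV hW).map ((S.resId hV).inv.app F) = (S.resComp hV le_rfl hW).inv.app F := by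
    rw [← cancel_mono ((S.resComp hV le_rfl hW).hom.app F)]
    rw [S.id_resComp, ← Functor.map_comp, Iso.inv_hom_id_app, ← S.id_resComp, Iso.inv_hom_id_app,
      CategoryTheory.Functor.map_id]
    rfl
  rw [down, Functor.map_comp, Functor.map_comp, i₁, ← S.id_resComp]
  rfl

lemma map_down_self {F G : S.Obj V hV}
    (f : (S.res hV le_rfl).obj F ⟶ (S.res hV le_rfl).obj G) :
    (S.res hV le_rfl).map (down f) = f := by
  rw [map_down, resHom_self]

lemma down_map {F G : S.Obj V hV} (f : F ⟶ G) : down ((S.res hV le_rfl).map f) = f := by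
  have n := (S.resId hV).hom.naturality f
  dsimp at n
  simp [down, n]

lemma map_injective {F G : S.Obj V hV} {f g : F ⟶ G}
    (h : (S.res hV le_rfl).map f = (S.res hV le_rfl).map g) : f = g := by
  rw [← down_map f, h, down_map]

lemma down_comp {F G K : S.Obj V hV} (f : (S.res hV le_rfl).obj F ⟶ (S.res hV le_rfl).obj G)
    (g : (S.res hV le_rfl).obj G ⟶ (S.res hV le_rfl).obj K) :
    down (f ≫ g) = down f ≫ down g :=
  map_injective (by rw [Functor.map_comp, map_down_self, map_down_self, map_down_self])

lemma down_id (F : S.Obj V hV) : down (𝟙 ((S.res hV le_rfl).obj F)) = 𝟙 F :=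
  map_injective (by rw [map_down_self, CategoryTheory.Functor.map_id])

/-- The isomorphism `F ≅ G` of `S(V)` given by an isomorphism over `V`. -/
@[simps]
def downIso {F G : S.Obj V hV} (f : (S.res hV le_rfl).obj F ≅ (S.res hV le_rfl).obj G) :
    F ≅ G where
  hom := down f.hom
  inv := down f.inv
  hom_inv_id := by rw [← down_comp, f.hom_inv_id, down_id]
  inv_hom_id := by rw [← down_comp, f.inv_hom_id, down_id]

lemma resHom_add (F : S.Obj V₁ h₁) (G : S.Obj V₂ h₂) (w₁ : W ≤ V₁) (w₂ : W ≤ V₂) (hY : Y ≤ W)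
    (f g : (S.res h₁ w₁).obj F ⟶ (S.res h₂ w₂).obj G) :
    S.resHom F G w₁ w₂ hY (f + g) = S.resHom F G w₁ w₂ hY f + S.resHom F G w₁ w₂ hY g := by
  simp [resHom, Functor.map_add]

lemma resHom_smul (F : S.Obj V₁ h₁) (G : S.Obj V₂ h₂) (w₁ : W ≤ V₁) (w₂ : W ≤ V₂) (hY : Y ≤ W)
    (r : Sec 𝒪 W) (f : (S.res h₁ w₁).obj F ⟶ (S.res h₂ w₂).obj G) :
    S.resHom F G w₁ w₂ hY (r • f) = rho 𝒪 hY r • S.resHom F G w₁ w₂ hY f := by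
  simp [resHom, S.res_smul]

end

end Prestack

/-! ### Functors of prestacks acting on morphisms over smaller open subsets -/

namespace PFunctor

section

variable {X : TopCat.{u}} {𝒪 : Sheaf (Opens.grothendieckTopology X) CommRingCat.{u}} {U : Opens X}
  {S : Prestack.{w₁, v₁} 𝒪 U} {T : Prestack.{w₂, v₂} 𝒪 U} {R : Prestack.{w₃, v₃} 𝒪 U}

variable {V V₁ V₂ V₃ W Y Z : Opens X} {hV : V ≤ U} {h₁ : V₁ ≤ U} {h₂ : V₂ ≤ U} {h₃ : V₃ ≤ U}

open Prestack

/-- The action of a functor of prestacks on the morphisms over `W` between objects over larger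
open subsets. -/
def mapOn (φ : PFunctor S T) (F : S.Obj V₁ h₁) (G : S.Obj V₂ h₂) (w₁ : W ≤ V₁) (w₂ : W ≤ V₂)
    (f : (S.res h₁ w₁).obj F ⟶ (S.res h₂ w₂).obj G) :
    (T.res h₁ w₁).obj ((φ.app V₁ h₁).obj F) ⟶ (T.res h₂ w₂).obj ((φ.app V₂ h₂).obj G) :=
  (φ.iso h₁ w₁).inv.app F ≫ (φ.app W (w₁.trans h₁)).map f ≫ (φ.iso h₂ w₂).hom.app G

variable (φ : PFunctor S T)

lemma mapOn_id (F : S.Obj V hV) (w : W ≤ V) : φ.mapOn F F w w (𝟙 _) = 𝟙 _ := by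
  simp [mapOn]

lemma mapOn_comp (F : S.Obj V₁ h₁) (G : S.Obj V₂ h₂) (K : S.Obj V₃ h₃) (w₁ : W ≤ V₁)
    (w₂ : W ≤ V₂) (w₃ : W ≤ V₃) (f : (S.res h₁ w₁).obj F ⟶ (S.res h₂ w₂).obj G)
    (g : (S.res h₂ w₂).obj G ⟶ (S.res h₃ w₃).obj K) :
    φ.mapOn F K w₁ w₃ (f ≫ g) = φ.mapOn F G w₁ w₂ f ≫ φ.mapOn G K w₂ w₃ g := by
  simp [mapOn]

lemma mapOn_comp_assoc (F : S.Obj V₁ h₁) (G : S.Obj V₂ h₂) (K : S.Obj V₃ h₃) (w₁ : W ≤ V₁)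
    (w₂ : W ≤ V₂) (w₃ : W ≤ V₃) (f : (S.res h₁ w₁).obj F ⟶ (S.res h₂ w₂).obj G)
    (g : (S.res h₂ w₂).obj G ⟶ (S.res h₃ w₃).obj K) {L : T.Obj W (w₃.trans h₃)}
    (l : (T.res h₃ w₃).obj ((φ.app V₃ h₃).obj K) ⟶ L) :
    φ.mapOn F K w₁ w₃ (f ≫ g) ≫ l = φ.mapOn F G w₁ w₂ f ≫ φ.mapOn G K w₂ w₃ g ≫ l := by
  rw [mapOn_comp, Category.assoc]

/-- The action of a functor of prestacks on isomorphisms over `W`. -/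
@[simps]
def mapOnIso (F : S.Obj V₁ h₁) (G : S.Obj V₂ h₂) (w₁ : W ≤ V₁) (w₂ : W ≤ V₂)
    (f : (S.res h₁ w₁).obj F ≅ (S.res h₂ w₂).obj G) :
    (T.res h₁ w₁).obj ((φ.app V₁ h₁).obj F) ≅ (T.res h₂ w₂).obj ((φ.app V₂ h₂).obj G) where
  hom := φ.mapOn F G w₁ w₂ f.hom
  inv := φ.mapOn G F w₂ w₁ f.inv
  hom_inv_id := by rw [← mapOn_comp, f.hom_inv_id, mapOn_id]
  inv_hom_id := by rw [← mapOn_comp, f.inv_hom_id, mapOn_id]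

lemma mapOn_map (F G : S.Obj V hV) (hW : W ≤ V) (f : F ⟶ G) :
    φ.mapOn F G hW hW ((S.res hV hW).map f) = (T.res hV hW).map ((φ.app V hV).map f) := by
  have n := (φ.iso hV hW).hom.naturality f
  dsimp at n
  simp [mapOn, n]

lemma mapOn_can (F : S.Obj V hV) (hW : W ≤ V) (hY : Y ≤ W) :
    φ.mapOn ((S.res hV hW).obj F) F hY (hY.trans hW) (S.can F hW hY).hom =
      (T.res (hW.trans hV) hY).map ((φ.iso hV hW).hom.app F) ≫
        (T.can ((φ.app V hV).obj F) hW hY).hom := by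
  simp only [mapOn, can, Iso.app_hom, φ.iso_comp, Iso.inv_hom_id_app_assoc]

lemma resHom_mapOn (F : S.Obj V₁ h₁) (G : S.Obj V₂ h₂) (w₁ : W ≤ V₁) (w₂ : W ≤ V₂) (hY : Y ≤ W)
    (f : (S.res h₁ w₁).obj F ⟶ (S.res h₂ w₂).obj G) :
    T.resHom ((φ.app V₁ h₁).obj F) ((φ.app V₂ h₂).obj G) w₁ w₂ hY (φ.mapOn F G w₁ w₂ f) =
      φ.mapOn F G (hY.trans w₁) (hY.trans w₂) (S.resHom F G w₁ w₂ hY f) := by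
  have c₁ := φ.mapOn_can F w₁ hY
  have c₂ := φ.mapOn_can G w₂ hY
  rw [← cancel_epi (φ.mapOnIso ((S.res h₁ w₁).obj F) F hY (hY.trans w₁) (S.can F w₁ hY)).hom,
    mapOnIso_hom, ← mapOn_comp, ← map_can, mapOn_comp, c₁, c₂, mapOn_map, Category.assoc, ← map_can,
    ← Functor.map_comp_assoc, ← Functor.map_comp_assoc]
  simp [mapOn]

lemma map_down (F G : S.Obj V hV) (f : (S.res hV le_rfl).obj F ⟶ (S.res hV le_rfl).obj G) :
    (φ.app V hV).map (down f) = down (φ.mapOn F G le_rfl le_rfl f) :=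
  map_injective (by rw [map_down_self, ← mapOn_map, map_down_self])

lemma IsLinear.mapOn_add {φ : PFunctor S T} (hφ : φ.IsLinear) (F : S.Obj V₁ h₁) (G : S.Obj V₂ h₂)
    (w₁ : W ≤ V₁) (w₂ : W ≤ V₂) (f g : (S.res h₁ w₁).obj F ⟶ (S.res h₂ w₂).obj G) :
    φ.mapOn F G w₁ w₂ (f + g) = φ.mapOn F G w₁ w₂ f + φ.mapOn F G w₁ w₂ g := by
  simp [mapOn, hφ.map_add]

lemma IsLinear.mapOn_smul {φ : PFunctor S T} (hφ : φ.IsLinear) (F : S.Obj V₁ h₁)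
    (G : S.Obj V₂ h₂) (w₁ : W ≤ V₁) (w₂ : W ≤ V₂) (r : Sec 𝒪 W)
    (f : (S.res h₁ w₁).obj F ⟶ (S.res h₂ w₂).obj G) :
    φ.mapOn F G w₁ w₂ (r • f) = r • φ.mapOn F G w₁ w₂ f := by
  simp [mapOn, hφ.map_smul]

/-- Transformations are natural with respect to all morphisms over smaller open subsets. -/
lemma Hom.naturalityOn {φ ψ : PFunctor S T} (α : φ ⟶ ψ) (F : S.Obj V₁ h₁) (G : S.Obj V₂ h₂)
    (w₁ : W ≤ V₁) (w₂ : W ≤ V₂) (f : (S.res h₁ w₁).obj F ⟶ (S.res h₂ w₂).obj G) :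
    φ.mapOn F G w₁ w₂ f ≫ (T.res h₂ w₂).map ((α.app V₂ h₂).app G) =
      (T.res h₁ w₁).map ((α.app V₁ h₁).app F) ≫ ψ.mapOn F G w₁ w₂ f := by
  have n₁ := α.naturality h₁ w₁ F
  have n₂ := α.naturality h₂ w₂ G
  simp only [mapOn, Category.assoc]
  rw [← n₂, NatTrans.naturality_assoc, ← cancel_epi ((φ.iso h₁ w₁).hom.app F),
    ← reassoc_of% n₁]
  simp

/-- A transformation is determined by a family of morphisms which is natural with respect to the
morphisms over smaller open subsets. -/
@[simps]
def homMk {φ ψ : PFunctor S T} (a : ∀ (V : Opens X) (hV : V ≤ U) (F : S.Obj V hV),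
      (φ.app V hV).obj F ⟶ (ψ.app V hV).obj F)
    (ha : ∀ {V₁ V₂ W : Opens X} (h₁ : V₁ ≤ U) (h₂ : V₂ ≤ U) (F : S.Obj V₁ h₁) (G : S.Obj V₂ h₂)
      (w₁ : W ≤ V₁) (w₂ : W ≤ V₂) (f : (S.res h₁ w₁).obj F ⟶ (S.res h₂ w₂).obj G),
      φ.mapOn F G w₁ w₂ f ≫ (T.res h₂ w₂).map (a V₂ h₂ G) =
        (T.res h₁ w₁).map (a V₁ h₁ F) ≫ ψ.mapOn F G w₁ w₂ f) : φ ⟶ ψ where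
  app V hV :=
    { app := a V hV
      naturality := fun F G f => map_injective (by
        have h := ha hV hV F G le_rfl le_rfl ((S.res hV le_rfl).map f)
        rw [mapOn_map, mapOn_map] at h
        rw [Functor.map_comp, h, Functor.map_comp]) }
  naturality {V W} hV hW F := map_injective (by
    have h := ha (hW.trans hV) hV ((S.res hV hW).obj F) F le_rfl hW (S.can F hW le_rfl).hom
    rw [mapOn_can, mapOn_can, Category.assoc, ← resHom_map _ _ hW le_rfl, ← map_can] at h
    rw [← cancel_mono (T.can ((ψ.app V hV).obj F) hW le_rfl).hom]
    simpa only [Functor.map_comp, Category.assoc] using h.symm)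

/-- A transformation whose components are isomorphisms is an isomorphism. -/
noncomputable def isoOfHom {φ ψ : PFunctor S T} (α : φ ⟶ ψ)
    (h : ∀ (V : Opens X) (hV : V ≤ U) (F : S.Obj V hV), IsIso ((α.app V hV).app F)) : φ ≅ ψ :=
  haveI : ∀ V hV, IsIso (α.app V hV) := fun V hV =>
    haveI := h V hV
    NatIso.isIso_of_isIso_app _
  { hom := α
    inv :=
      { app := fun V hV => inv (α.app V hV)
        naturality := fun {V W} hV hW F => by
          have n := α.naturality hV hW F
          rw [← cancel_epi ((α.app W (hW.trans hV)).app ((S.res hV hW).obj F)), reassoc_of% n,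
            ← Functor.map_comp]
          simp }
    hom_inv_id := by ext1 V hV; simp
    inv_hom_id := by ext1 V hV; simp }

end

/-- Data determining a functor of prestacks: its values on objects, and its action on the
morphisms over `W` between objects over larger open subsets. In this form there are no coherence
isomorphisms. -/
structure Core {X : TopCat.{u}} {𝒪 : Sheaf (Opens.grothendieckTopology X) CommRingCat.{u}}
    {U : Opens X} (S : Prestack.{w₁, v₁} 𝒪 U) (T : Prestack.{w₂, v₂} 𝒪 U) where
  obj (V : Opens X) (hV : V ≤ U) (F : S.Obj V hV) : T.Obj V hV
  mapOn {V₁ V₂ W : Opens X} {h₁ : V₁ ≤ U} {h₂ : V₂ ≤ U} (F : S.Obj V₁ h₁) (G : S.Obj V₂ h₂)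
    (w₁ : W ≤ V₁) (w₂ : W ≤ V₂) (f : (S.res h₁ w₁).obj F ⟶ (S.res h₂ w₂).obj G) :
    (T.res h₁ w₁).obj (obj V₁ h₁ F) ⟶ (T.res h₂ w₂).obj (obj V₂ h₂ G)
  mapOn_id {V W : Opens X} {hV : V ≤ U} (F : S.Obj V hV) (w : W ≤ V) :
    mapOn F F w w (𝟙 _) = 𝟙 _
  mapOn_comp {V₁ V₂ V₃ W : Opens X} {h₁ : V₁ ≤ U} {h₂ : V₂ ≤ U} {h₃ : V₃ ≤ U} (F : S.Obj V₁ h₁)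
    (G : S.Obj V₂ h₂) (K : S.Obj V₃ h₃) (w₁ : W ≤ V₁) (w₂ : W ≤ V₂) (w₃ : W ≤ V₃)
    (f : (S.res h₁ w₁).obj F ⟶ (S.res h₂ w₂).obj G)
    (g : (S.res h₂ w₂).obj G ⟶ (S.res h₃ w₃).obj K) :
    mapOn F K w₁ w₃ (f ≫ g) = mapOn F G w₁ w₂ f ≫ mapOn G K w₂ w₃ g
  resHom_mapOn {V₁ V₂ W Y : Opens X} {h₁ : V₁ ≤ U} {h₂ : V₂ ≤ U} (F : S.Obj V₁ h₁)
    (G : S.Obj V₂ h₂) (w₁ : W ≤ V₁) (w₂ : W ≤ V₂) (hY : Y ≤ W)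
    (f : (S.res h₁ w₁).obj F ⟶ (S.res h₂ w₂).obj G) :
    T.resHom (obj V₁ h₁ F) (obj V₂ h₂ G) w₁ w₂ hY (mapOn F G w₁ w₂ f) =
      mapOn F G (hY.trans w₁) (hY.trans w₂) (S.resHom F G w₁ w₂ hY f)

namespace Core

variable {X : TopCat.{u}} {𝒪 : Sheaf (Opens.grothendieckTopology X) CommRingCat.{u}} {U : Opens X}
  {S : Prestack.{w₁, v₁} 𝒪 U} {T : Prestack.{w₂, v₂} 𝒪 U} (c : Core S T)
  {V V₁ V₂ W : Opens X} {hV : V ≤ U} {h₁ : V₁ ≤ U} {h₂ : V₂ ≤ U}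

open Prestack

/-- The action of a `Core` on isomorphisms. -/
@[simps]
def mapOnIso (F : S.Obj V₁ h₁) (G : S.Obj V₂ h₂) (w₁ : W ≤ V₁) (w₂ : W ≤ V₂)
    (f : (S.res h₁ w₁).obj F ≅ (S.res h₂ w₂).obj G) :
    (T.res h₁ w₁).obj (c.obj V₁ h₁ F) ≅ (T.res h₂ w₂).obj (c.obj V₂ h₂ G) where
  hom := c.mapOn F G w₁ w₂ f.hom
  inv := c.mapOn G F w₂ w₁ f.inv
  hom_inv_id := by rw [← c.mapOn_comp, f.hom_inv_id, c.mapOn_id]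
  inv_hom_id := by rw [← c.mapOn_comp, f.inv_hom_id, c.mapOn_id]

/-- The comparison of the value at `F|_W` with the restriction of the value at `F`: the image of
the canonical isomorphism over `W` from `F|_W` to `F`. -/
def isoApp (F : S.Obj V hV) (hW : W ≤ V) :
    c.obj W (hW.trans hV) ((S.res hV hW).obj F) ≅ (T.res hV hW).obj (c.obj V hV F) :=
  downIso (c.mapOnIso ((S.res hV hW).obj F) F le_rfl hW (S.can F hW le_rfl) ≪≫
    (T.can (c.obj V hV F) hW le_rfl).symm)

lemma map_isoApp {Y : Opens X} (F : S.Obj V hV) (hW : W ≤ V) (hY : Y ≤ W) :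
    (T.res (hW.trans hV) hY).map (c.isoApp F hW).hom ≫ (T.can (c.obj V hV F) hW hY).hom =
      c.mapOn ((S.res hV hW).obj F) F hY (hY.trans hW) (S.can F hW hY).hom := by
  simp only [isoApp, downIso_hom, Iso.trans_hom, Iso.symm_hom, mapOnIso_hom]
  rw [Prestack.map_down, resHom_comp (w₂ := hW), resHom_can_inv, c.resHom_mapOn, resHom_can,
    Category.assoc, Iso.inv_hom_id, Category.comp_id]

/-- The functor of prestacks determined by a `Core`. -/
def toPFunctor : PFunctor S T where
  app V hV :=
    { obj := c.obj V hV
      map := fun {F G} f => down (c.mapOn F G le_rfl le_rfl ((S.res hV le_rfl).map f))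
      map_id := fun F => by rw [CategoryTheory.Functor.map_id, c.mapOn_id, down_id]
      map_comp := fun f g => by rw [Functor.map_comp, c.mapOn_comp, Prestack.down_comp] }
  iso hV hW := NatIso.ofComponents (fun F => c.isoApp F hW) (fun {F G} f => map_injective (by
    dsimp only [Functor.comp_obj, Functor.comp_map]
    rw [Functor.map_comp, map_down_self, Functor.map_comp,
      ← cancel_mono (T.can (c.obj _ hV G) hW le_rfl).hom, Category.assoc, Category.assoc,
      map_isoApp, map_can, resHom_map, Prestack.map_down, ← Category.assoc, map_isoApp,
      ← c.mapOn_comp, map_can, c.mapOn_comp, c.resHom_mapOn, resHom_map, resHom_map]))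
  iso_comp hV hW hY F := map_injective (by
    dsimp only [NatIso.ofComponents_hom_app, Functor.comp_obj]
    rw [← cancel_mono (T.can (c.obj _ hV F) (hY.trans hW) le_rfl).hom]
    have a := T.resComp_assoc hV hW hY le_rfl (c.obj _ hV F)
    have a' := S.resComp_assoc hV hW hY le_rfl F
    have n := (T.resComp (hW.trans hV) hY le_rfl).hom.naturality (c.isoApp F hW).hom
    have e₁ := c.map_isoApp F hW hY
    have e₂ := c.map_isoApp ((S.res hV hW).obj F) hY le_rfl
    dsimp at a a' n e₁ e₂ ⊢
    simp only [Functor.map_comp, Category.assoc]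
    rw [a, reassoc_of% n, reassoc_of% e₂, e₁]
    rw [← c.mapOn_comp, ← a', c.mapOn_comp, map_down_self]
    exact congrArg _ (c.map_isoApp F (hY.trans hW) le_rfl))

lemma toPFunctor_mapOn (F : S.Obj V₁ h₁) (G : S.Obj V₂ h₂) (w₁ : W ≤ V₁) (w₂ : W ≤ V₂)
    (f : (S.res h₁ w₁).obj F ⟶ (S.res h₂ w₂).obj G) :
    c.toPFunctor.mapOn F G w₁ w₂ f = c.mapOn F G w₁ w₂ f := by
  change (c.isoApp F w₁).inv ≫ down (c.mapOn _ _ le_rfl le_rfl ((S.res _ le_rfl).map f)) ≫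
    (c.isoApp G w₂).hom = _
  rw [Iso.inv_comp_eq]
  apply map_injective
  rw [← cancel_mono (T.can (c.obj _ h₂ G) w₂ le_rfl).hom, Functor.map_comp, Functor.map_comp,
    Category.assoc, Category.assoc, map_isoApp, map_can, resHom_self, ← Category.assoc, map_isoApp,
    map_down_self, ← c.mapOn_comp, map_can, c.mapOn_comp, resHom_self]

end Core

end PFunctor

/-! ### Equivalences of prestacks -/

namespace PFunctor

section

variable {X : TopCat.{u}} {𝒪 : Sheaf (Opens.grothendieckTopology X) CommRingCat.{u}} {U : Opens X}
  {S : Prestack.{w₁, v₁} 𝒪 U} {T : Prestack.{w₂, v₂} 𝒪 U} {R : Prestack.{w₃, v₃} 𝒪 U}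

variable {V V₁ V₂ V₃ W Y Z : Opens X} {hV : V ≤ U} {h₁ : V₁ ≤ U} {h₂ : V₂ ≤ U} {h₃ : V₃ ≤ U}

open Prestack

lemma comp_mapOn (φ : PFunctor S T) (ψ : PFunctor T R) (F : S.Obj V₁ h₁) (G : S.Obj V₂ h₂)
    (w₁ : W ≤ V₁) (w₂ : W ≤ V₂) (f : (S.res h₁ w₁).obj F ⟶ (S.res h₂ w₂).obj G) :
    (φ.comp ψ).mapOn F G w₁ w₂ f = ψ.mapOn _ _ w₁ w₂ (φ.mapOn F G w₁ w₂ f) := by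
  simp [mapOn, comp]

lemma id_mapOn (F : S.Obj V₁ h₁) (G : S.Obj V₂ h₂) (w₁ : W ≤ V₁) (w₂ : W ≤ V₂)
    (f : (S.res h₁ w₁).obj F ⟶ (S.res h₂ w₂).obj G) :
    (PFunctor.id S).mapOn F G w₁ w₂ f = f := by
  simp [mapOn, PFunctor.id]

/-- A functor of prestacks is fully faithful if all its components are. -/
structure IsFullyFaithful (φ : PFunctor S T) : Prop where
  full (V : Opens X) (hV : V ≤ U) : (φ.app V hV).Full
  faithful (V : Opens X) (hV : V ≤ U) : (φ.app V hV).Faithful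

lemma IsFullyFaithful.mapOn_bijective {φ : PFunctor S T} (h : φ.IsFullyFaithful) (F : S.Obj V₁ h₁)
    (G : S.Obj V₂ h₂) (w₁ : W ≤ V₁) (w₂ : W ≤ V₂) :
    Function.Bijective (φ.mapOn F G w₁ w₂) := by
  have := h.full W (w₁.trans h₁)
  have := h.faithful W (w₁.trans h₁)
  constructor
  · intro f g hfg
    apply (φ.app W _).map_injective
    rwa [mapOn, mapOn, cancel_epi, cancel_mono] at hfg
  · intro g
    refine ⟨(φ.app W _).preimage ((φ.iso h₁ w₁).hom.app F ≫ g ≫ (φ.iso h₂ w₂).inv.app G), ?_⟩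
    simp [mapOn]

/-- The components of an equivalence of prestacks are equivalences of categories. -/
lemma IsEquiv.isEquivalence {φ : PFunctor S T} (h : φ.IsEquiv) (V : Opens X) (hV : V ≤ U) :
    (φ.app V hV).IsEquivalence := by
  obtain ⟨ψ, ⟨e₁⟩, ⟨e₂⟩⟩ := h
  let i₁ : ψ.app V hV ⋙ φ.app V hV ≅ 𝟭 _ :=
    { hom := e₁.hom.app V hV
      inv := e₁.inv.app V hV
      hom_inv_id := congrArg (fun α => Hom.app α V hV) e₁.hom_inv_id
      inv_hom_id := congrArg (fun α => Hom.app α V hV) e₁.inv_hom_id }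
  let i₂ : φ.app V hV ⋙ ψ.app V hV ≅ 𝟭 _ :=
    { hom := e₂.hom.app V hV
      inv := e₂.inv.app V hV
      hom_inv_id := congrArg (fun α => Hom.app α V hV) e₂.hom_inv_id
      inv_hom_id := congrArg (fun α => Hom.app α V hV) e₂.inv_hom_id }
  exact (CategoryTheory.Equivalence.mk (φ.app V hV) (ψ.app V hV) i₂.symm i₁).isEquivalence_functor

lemma IsEquiv.isFullyFaithful {φ : PFunctor S T} (h : φ.IsEquiv) : φ.IsFullyFaithful where
  full V hV := have := h.isEquivalence V hV; inferInstance
  faithful V hV := have := h.isEquivalence V hV; inferInstance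

/-- A functor of prestacks whose components are equivalences of categories is an equivalence: the
chosen quasi-inverses of the components are compatible with restrictions, because the functor is
fully faithful on morphisms over smaller open subsets. -/
theorem isEquiv_of_isEquivalence (φ : PFunctor S T)
    (h : ∀ (V : Opens X) (hV : V ≤ U), (φ.app V hV).IsEquivalence) : φ.IsEquiv := by
  have ff : φ.IsFullyFaithful := ⟨fun V hV => (h V hV).full, fun V hV => (h V hV).faithful⟩
  let o : ∀ (V : Opens X) (hV : V ≤ U), T.Obj V hV → S.Obj V hV :=
    fun V hV G => have := h V hV; (φ.app V hV).objPreimage G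
  let ε : ∀ (V : Opens X) (hV : V ≤ U) (G : T.Obj V hV), (φ.app V hV).obj (o V hV G) ≅ G :=
    fun V hV G => have := h V hV; (φ.app V hV).objObjPreimageIso G
  let m : ∀ {V₁ V₂ W : Opens X} {h₁ : V₁ ≤ U} {h₂ : V₂ ≤ U} (F : T.Obj V₁ h₁) (G : T.Obj V₂ h₂)
      (w₁ : W ≤ V₁) (w₂ : W ≤ V₂) (f : (T.res h₁ w₁).obj F ⟶ (T.res h₂ w₂).obj G),
      ∃ g : (S.res h₁ w₁).obj (o V₁ h₁ F) ⟶ (S.res h₂ w₂).obj (o V₂ h₂ G),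
        φ.mapOn _ _ w₁ w₂ g =
          (T.res h₁ w₁).map (ε V₁ h₁ F).hom ≫ f ≫ (T.res h₂ w₂).map (ε V₂ h₂ G).inv :=
    fun F G w₁ w₂ f => (ff.mapOn_bijective _ _ w₁ w₂).2 _
  choose m hm using @m
  let c : Core T S :=
    { obj := o
      mapOn := m
      mapOn_id := fun F w => (ff.mapOn_bijective _ _ w w).1 (by
        rw [hm, mapOn_id, Category.id_comp, ← Functor.map_comp, Iso.hom_inv_id,
          CategoryTheory.Functor.map_id])
      mapOn_comp := fun {_ V₂ _ _ _ h₂ _} F G K w₁ w₂ w₃ f g => (ff.mapOn_bijective _ _ w₁ w₃).1 (by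
        rw [hm, mapOn_comp, hm, hm]
        have : (T.res h₂ w₂).map (ε V₂ h₂ G).inv ≫ (T.res h₂ w₂).map (ε V₂ h₂ G).hom = 𝟙 _ := by
          rw [← Functor.map_comp, Iso.inv_hom_id, CategoryTheory.Functor.map_id]
        simp only [Category.assoc, reassoc_of% this])
      resHom_mapOn := fun {V₁ V₂ _ _ h₁ h₂} F G w₁ w₂ hY f => (ff.mapOn_bijective _ _ _ _).1 (by
        rw [hm, ← resHom_mapOn, hm, resHom_comp (w₂ := w₁) (G := F),
          resHom_comp (w₂ := w₂) (G := G), resHom_map, resHom_map]) }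
  let ψ := c.toPFunctor
  refine ⟨ψ, ⟨isoOfHom (homMk (φ := ψ.comp φ) (ψ := PFunctor.id T)
    (fun V hV G => (ε V hV G).hom) ?_) ?_⟩, ⟨isoOfHom (homMk (φ := φ.comp ψ) (ψ := PFunctor.id S)
    (fun V hV F => have := h V hV; (φ.app V hV).preimage (ε V hV _).hom) ?_) ?_⟩⟩
  · intro V₁ V₂ W h₁ h₂ F G w₁ w₂ f
    rw [id_mapOn, comp_mapOn, c.toPFunctor_mapOn]
    change φ.mapOn (o V₁ h₁ F) (o V₂ h₂ G) w₁ w₂ (m F G w₁ w₂ f) ≫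
      (T.res h₂ w₂).map (ε V₂ h₂ G).hom = (T.res h₁ w₁).map (ε V₁ h₁ F).hom ≫ f
    rw [hm, Category.assoc, Category.assoc, ← Functor.map_comp, Iso.inv_hom_id,
      CategoryTheory.Functor.map_id, Category.comp_id]
  · intro V hV F
    exact inferInstanceAs (IsIso (ε V hV F).hom)
  · intro V₁ V₂ W h₁ h₂ F G w₁ w₂ f
    have := h V₁ h₁
    have := h V₂ h₂
    apply (ff.mapOn_bijective _ _ _ _).1
    rw [id_mapOn, comp_mapOn, c.toPFunctor_mapOn]
    change φ.mapOn (o V₁ h₁ _) G w₁ w₂ (m _ _ w₁ w₂ (φ.mapOn F G w₁ w₂ f) ≫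
      (S.res h₂ w₂).map ((φ.app V₂ h₂).preimage (ε V₂ h₂ _).hom)) =
      φ.mapOn (o V₁ h₁ _) G w₁ w₂
        ((S.res h₁ w₁).map ((φ.app V₁ h₁).preimage (ε V₁ h₁ _).hom) ≫ f)
    rw [mapOn_comp (w₂ := w₂) (G := o V₂ h₂ _), mapOn_comp (w₂ := w₁) (G := F), mapOn_map,
      mapOn_map, hm, Functor.map_preimage, Functor.map_preimage, Category.assoc, Category.assoc,
      ← Functor.map_comp, Iso.inv_hom_id, CategoryTheory.Functor.map_id, Category.comp_id]
  · intro V hV F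
    have := h V hV
    have : IsIso ((φ.app V hV).map ((φ.app V hV).preimage (Y := F)
        (ε V hV ((φ.app V hV).obj F)).hom)) := by
      rw [Functor.map_preimage]
      infer_instance
    exact isIso_of_fully_faithful (φ.app V hV)
      ((φ.app V hV).preimage (Y := F) (ε V hV ((φ.app V hV).obj F)).hom)

lemma IsLinear.comp {φ : PFunctor S T} {ψ : PFunctor T R} (hφ : φ.IsLinear) (hψ : ψ.IsLinear) :
    (φ.comp ψ).IsLinear where
  map_add hV F G f g := by
    change (ψ.app _ hV).map ((φ.app _ hV).map (f + g)) = _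
    rw [hφ.map_add, hψ.map_add]
    rfl
  map_smul hV F G r f := by
    change (ψ.app _ hV).map ((φ.app _ hV).map (r • f)) = _
    rw [hφ.map_smul, hψ.map_smul]
    rfl

/-- A quasi-inverse of an `𝒪`-linear equivalence is `𝒪`-linear. -/
lemma IsLinear.of_comp_iso_id {φ : PFunctor S T} {ψ : PFunctor T S} (hφ : φ.IsLinear)
    (h : φ.IsFullyFaithful) (e : ψ.comp φ ≅ PFunctor.id T) : ψ.IsLinear := by
  have key : ∀ {V : Opens X} (hV : V ≤ U) {F G : T.Obj V hV},
      ∃ (a : (φ.app V hV).obj ((ψ.app V hV).obj F) ⟶ F)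
        (b : G ⟶ (φ.app V hV).obj ((ψ.app V hV).obj G)),
      ∀ f : F ⟶ G, (φ.app V hV).map ((ψ.app V hV).map f) = a ≫ f ≫ b := by
    intro V hV F G
    let a : ∀ F, (φ.app V hV).obj ((ψ.app V hV).obj F) ⟶ F := (e.hom.app V hV).app
    let b : G ⟶ (φ.app V hV).obj ((ψ.app V hV).obj G) := (e.inv.app V hV).app G
    refine ⟨a F, b, fun f => ?_⟩
    have n : (φ.app V hV).map ((ψ.app V hV).map f) ≫ a G = a F ≫ f :=
      (e.hom.app V hV).naturality f
    have i : a G ≫ b = 𝟙 _ :=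
      congrArg (fun α : ψ.comp φ ⟶ ψ.comp φ => (Hom.app α V hV).app G) e.hom_inv_id
    rw [← reassoc_of% n, i, Category.comp_id]
  constructor
  · intro V hV F G f g
    have := h.faithful V hV
    obtain ⟨a, b, key⟩ := key hV (F := F) (G := G)
    apply (φ.app V hV).map_injective
    rw [hφ.map_add, key, key, key, Preadditive.add_comp, Preadditive.comp_add]
  · intro V hV F G r f
    have := h.faithful V hV
    obtain ⟨a, b, key⟩ := key hV (F := F) (G := G)
    apply (φ.app V hV).map_injective
    rw [hφ.map_smul, key, key, Linear.smul_comp, Linear.comp_smul]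

lemma IsEquiv.comp {φ : PFunctor S T} {ψ : PFunctor T R} (hφ : φ.IsEquiv) (hψ : ψ.IsEquiv) :
    (φ.comp ψ).IsEquiv :=
  isEquiv_of_isEquivalence _ fun V hV =>
    have := hφ.isEquivalence V hV
    have := hψ.isEquivalence V hV
    inferInstanceAs (φ.app V hV ⋙ ψ.app V hV).IsEquivalence

lemma IsEquiv.restrict {φ : PFunctor S T} (hφ : φ.IsEquiv) (hV : V ≤ U) :
    (φ.restrict hV).IsEquiv :=
  isEquiv_of_isEquivalence _ fun W hW => hφ.isEquivalence W (hW.trans hV)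

end

end PFunctor

section Equivalent

variable {X : TopCat.{u}} {𝒪 : Sheaf (Opens.grothendieckTopology X) CommRingCat.{u}} {U : Opens X}
  {S : Prestack.{w₁, v₁} 𝒪 U} {T : Prestack.{w₂, v₂} 𝒪 U} {R : Prestack.{w₃, v₃} 𝒪 U}

lemma Equivalent.symm (h : Equivalent S T) : Equivalent T S := by
  obtain ⟨φ, hl, he⟩ := h
  have hf := he.isFullyFaithful
  obtain ⟨ψ, ⟨e₁⟩, ⟨e₂⟩⟩ := he
  exact ⟨ψ, hl.of_comp_iso_id hf e₁, φ, ⟨e₂⟩, ⟨e₁⟩⟩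

lemma Equivalent.trans (h : Equivalent S T) (k : Equivalent T R) : Equivalent S R := by
  obtain ⟨φ, hl, he⟩ := h
  obtain ⟨ψ, kl, ke⟩ := k
  exact ⟨φ.comp ψ, hl.comp kl, he.comp ke⟩

lemma Equivalent.restrict (h : Equivalent S T) {V : Opens X} (hV : V ≤ U) :
    Equivalent (S.restrict hV) (T.restrict hV) := by
  obtain ⟨φ, hl, he⟩ := h
  exact ⟨φ.restrict hV, hl.restrict hV, he.restrict hV⟩

end Equivalent

/-! ### Gluing in a stack -/

namespace Prestack

section

variable {X : TopCat.{u}} {𝒪 : Sheaf (Opens.grothendieckTopology X) CommRingCat.{u}} {U : Opens X}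
  {S : Prestack.{w, v} 𝒪 U}

lemma iSup_inf_of_iSup_eq {ι : Type u} {V W : Opens X} {c : ι → Opens X} (h : (⨆ i, c i) = V)
    (hW : W ≤ V) : (⨆ i, W ⊓ c i) = W := by
  rw [← inf_iSup_eq, h, inf_eq_left.2 hW]

/-- In a separated prestack, morphisms over `W` between objects over larger open subsets glue. -/
lemma IsSeparated.existsUnique (hS : S.IsSeparated) {V₁ V₂ W : Opens X} {h₁ : V₁ ≤ U}
    {h₂ : V₂ ≤ U} (F : S.Obj V₁ h₁) (G : S.Obj V₂ h₂) (w₁ : W ≤ V₁) (w₂ : W ≤ V₂)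
    {ι : Type u} (c : ι → Opens X) (hc : ∀ i, c i ≤ W) (h : (⨆ i, c i) = W)
    (s : ∀ i, (S.res h₁ ((hc i).trans w₁)).obj F ⟶ (S.res h₂ ((hc i).trans w₂)).obj G)
    (hs : ∀ i j, S.resHom F G _ _ (inf_le_left : c i ⊓ c j ≤ c i) (s i) =
      S.resHom F G _ _ (inf_le_right : c i ⊓ c j ≤ c j) (s j)) :
    ∃! t : (S.res h₁ w₁).obj F ⟶ (S.res h₂ w₂).obj G,
      ∀ i, S.resHom F G w₁ w₂ (hc i) t = s i := by
  let s' : ∀ i, (S.res (w₁.trans h₁) (hc i)).obj ((S.res h₁ w₁).obj F) ⟶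
      (S.res (w₂.trans h₂) (hc i)).obj ((S.res h₂ w₂).obj G) := fun i =>
    (S.can F w₁ (hc i)).hom ≫ s i ≫ (S.can G w₂ (hc i)).inv
  have hr : ∀ {Y : Opens X} (i) (hY : Y ≤ c i), S.resHom ((S.res h₁ w₁).obj F)
      ((S.res h₂ w₂).obj G) (hc i) (hc i) hY (s' i) = (S.can F w₁ (hY.trans (hc i))).hom ≫
        S.resHom F G _ _ hY (s i) ≫ (S.can G w₂ (hY.trans (hc i))).inv := by
    intro Y i hY
    rw [resHom_comp (w₂ := (hc i).trans w₁) (G := F), resHom_comp (w₂ := (hc i).trans w₂) (G := G),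
      resHom_can, resHom_can_inv]
  have ht : ∀ t : (S.res (w₁.trans h₁) (le_refl W)).obj ((S.res h₁ w₁).obj F) ⟶
      (S.res (w₂.trans h₂) (le_refl W)).obj ((S.res h₂ w₂).obj G), ∀ i,
      (S.resHom _ _ le_rfl le_rfl (hc i) t = s' i ↔ S.resHom F G w₁ w₂ (hc i) (down t) = s i) := by
    intro t i
    rw [← map_down, ← cancel_mono (S.can G w₂ (hc i)).hom, map_can]
    simp only [s', Category.assoc, Iso.inv_hom_id, Category.comp_id, Iso.cancel_iso_hom_left]
  obtain ⟨t, h₁t, h₂t⟩ := hS W (w₁.trans h₁) ((S.res h₁ w₁).obj F) ((S.res h₂ w₂).obj G) W le_rfl ι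
    c hc h s' (fun i j => by rw [hr, hr, hs])
  refine ⟨down t, fun i => (ht t i).1 (h₁t i), fun r hr => ?_⟩
  rw [← h₂t ((S.res _ le_rfl).map r) fun i => (ht _ i).2 (by rw [down_map]; exact hr i), down_map]

/-- Two morphisms over `W` agreeing on an open covering of `W` are equal. -/
lemma IsSeparated.ext (hS : S.IsSeparated) {V₁ V₂ W : Opens X} {h₁ : V₁ ≤ U}
    {h₂ : V₂ ≤ U} {F : S.Obj V₁ h₁} {G : S.Obj V₂ h₂} {w₁ : W ≤ V₁} {w₂ : W ≤ V₂}
    {ι : Type u} (c : ι → Opens X) (hc : ∀ i, c i ≤ W) (h : (⨆ i, c i) = W)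
    {s t : (S.res h₁ w₁).obj F ⟶ (S.res h₂ w₂).obj G}
    (hst : ∀ i, S.resHom F G w₁ w₂ (hc i) s = S.resHom F G w₁ w₂ (hc i) t) : s = t :=
  (hS.existsUnique F G w₁ w₂ c hc h (fun i => S.resHom F G w₁ w₂ (hc i) t)
    (fun i j => by rw [resHom_resHom, resHom_resHom])).unique hst fun _ => rfl

/-- Descent data given by transition morphisms over all open subsets of the intersections. -/
structure DescentDatum (S : Prestack.{w, v} 𝒪 U) {V : Opens X} (hV : V ≤ U) {ι : Type u}
    (c : ι → Opens X) (hc : ∀ i, c i ≤ V) where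
  obj (i : ι) : S.Obj (c i) ((hc i).trans hV)
  θ (i j : ι) (Y : Opens X) (hi : Y ≤ c i) (hj : Y ≤ c j) :
    (S.res ((hc j).trans hV) hj).obj (obj j) ⟶ (S.res ((hc i).trans hV) hi).obj (obj i)
  res_θ (i j : ι) (Y : Opens X) (hi : Y ≤ c i) (hj : Y ≤ c j) (Z : Opens X) (hZ : Z ≤ Y) :
    S.resHom (obj j) (obj i) hj hi hZ (θ i j Y hi hj) = θ i j Z (hZ.trans hi) (hZ.trans hj)
  θ_self (i : ι) (Y : Opens X) (hi : Y ≤ c i) : θ i i Y hi hi = 𝟙 _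
  θ_comp (i j k : ι) (Y : Opens X) (hi : Y ≤ c i) (hj : Y ≤ c j) (hk : Y ≤ c k) :
    θ j k Y hj hk ≫ θ i j Y hi hj = θ i k Y hi hk

/-- A descent datum is effective if it is isomorphic to that of an object. -/
def DescentDatum.IsEffective {V : Opens X} {hV : V ≤ U} {ι : Type u} {c : ι → Opens X}
    {hc : ∀ i, c i ≤ V} (D : DescentDatum S hV c hc) : Prop :=
  ∃ (G : S.Obj V hV) (η : ∀ i, (S.res hV (hc i)).obj G ≅ (S.res _ (le_refl (c i))).obj (D.obj i)),
    ∀ (i j : ι) (Y : Opens X) (hi : Y ≤ c i) (hj : Y ≤ c j),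
      S.resHom G (D.obj j) (hc j) le_rfl hj (η j).hom ≫ D.θ i j Y hi hj =
        S.resHom G (D.obj i) (hc i) le_rfl hi (η i).hom

lemma resHom_comp_resId_inv {V W Y : Opens X} {hV : V ≤ U} (hW : W ≤ V) (hY : Y ≤ W)
    (G : S.Obj V hV) (F : S.Obj W (hW.trans hV)) (f : (S.res hV hW).obj G ⟶ F) :
    S.resHom G F hW le_rfl hY (f ≫ (S.resId (hW.trans hV)).inv.app F) =
      (S.resComp hV hW hY).inv.app G ≫ (S.res (hW.trans hV) hY).map f := by
  simp only [resHom]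
  rw [S.id_resComp, ← Functor.map_comp, Category.assoc, Iso.inv_hom_id_app]
  exact congrArg (fun t => _ ≫ (S.res _ hY).map t) (Category.comp_id _)

theorem HasEffectiveDescent.isEffective (hS : S.HasEffectiveDescent) {V : Opens X} {hV : V ≤ U}
    {ι : Type u} {c : ι → Opens X} {hc : ∀ i, c i ≤ V} (h : (⨆ i, c i) = V)
    (D : DescentDatum S hV c hc) : D.IsEffective := by
  obtain ⟨G, η, hη⟩ := hS V hV ι c hc h D.obj
    (fun i j =>
      { hom := D.θ i j _ inf_le_left inf_le_right
        inv := D.θ j i _ inf_le_right inf_le_left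
        hom_inv_id := by rw [D.θ_comp, D.θ_self]
        inv_hom_id := by rw [D.θ_comp, D.θ_self] })
    (fun i j k => by
      dsimp only
      rw [D.res_θ, D.res_θ, D.res_θ, D.θ_comp])
  refine ⟨G, fun i => η i ≪≫ ((S.resId _).app (D.obj i)).symm, fun i j Y hi hj => ?_⟩
  have e := hη i j
  dsimp at e ⊢
  rw [← Category.assoc, ← resHom_comp_resId_inv, ← resHom_comp_resId_inv] at e
  have e' := congrArg
    (S.resHom G (D.obj i) ((inf_le_left.trans (hc i))) inf_le_left (le_inf hi hj)) e
  rwa [resHom_comp (G := D.obj j) (w₂ := inf_le_right), resHom_resHom, resHom_resHom,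
    D.res_θ] at e'

theorem hasEffectiveDescent_of_isEffective
    (hS : ∀ (V : Opens X) (hV : V ≤ U) (ι : Type u) (c : ι → Opens X) (hc : ∀ i, c i ≤ V),
      (⨆ i, c i) = V → ∀ D : DescentDatum S hV c hc, D.IsEffective) :
    S.HasEffectiveDescent := by
  intro V hV ι c hc h F θ hθ
  let Θ : ∀ (i j : ι) (Y : Opens X) (hi : Y ≤ c i) (hj : Y ≤ c j),
      (S.res ((hc j).trans hV) hj).obj (F j) ≅ (S.res ((hc i).trans hV) hi).obj (F i) :=
    fun i j Y hi hj => resIso (F j) (F i) inf_le_right inf_le_left (le_inf hi hj) (θ i j)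
  have hcomp : ∀ (i j k : ι) (Y : Opens X) (hi : Y ≤ c i) (hj : Y ≤ c j) (hk : Y ≤ c k),
      (Θ j k Y hj hk).hom ≫ (Θ i j Y hi hj).hom = (Θ i k Y hi hk).hom := by
    intro i j k Y hi hj hk
    have e := congrArg (S.resHom (F k) (F i) inf_le_right (inf_le_left.trans inf_le_left)
      (le_inf (le_inf hi hj) hk)) (hθ i j k)
    rw [resHom_comp (G := F j) (w₂ := inf_le_left.trans inf_le_right), resHom_resHom,
      resHom_resHom, resHom_resHom] at e
    exact e
  let D : DescentDatum S hV c hc :=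
    { obj := F
      θ := fun i j Y hi hj => (Θ i j Y hi hj).hom
      res_θ := fun i j Y hi hj Z hZ => resHom_resHom _ _ _ _ _ _ _
      θ_self := fun i Y hi => by
        rw [← cancel_mono (Θ i i Y hi hi).hom, hcomp, Category.id_comp]
      θ_comp := hcomp }
  obtain ⟨G, η, hη⟩ := hS V hV ι c hc h D
  refine ⟨G, fun i => η i ≪≫ (S.resId ((hc i).trans hV)).app (F i), fun i j => ?_⟩
  have e := hη i j (c i ⊓ c j) inf_le_left inf_le_right
  have k : ∀ i, (η i).hom = ((η i).hom ≫ (S.resId ((hc i).trans hV)).hom.app (F i)) ≫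
      (S.resId ((hc i).trans hV)).inv.app (F i) := fun i => by
    rw [Category.assoc, Iso.hom_inv_id_app]
    exact (Category.comp_id _).symm
  rw [k i, k j] at e
  erw [resHom_comp_resId_inv (hc i) inf_le_left G (F i), resHom_comp_resId_inv (hc j) inf_le_right G (F j)] at e
  have t : D.θ i j (c i ⊓ c j) inf_le_left inf_le_right = (θ i j).hom := resHom_self _ _ _ _ _
  rw [t, Category.assoc] at e
  exact e

/-- The image of a descent datum under a functor of prestacks. -/
def DescentDatum.map {T : Prestack.{w₁, v₁} 𝒪 U} (φ : PFunctor S T) {V : Opens X} {hV : V ≤ U}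
    {ι : Type u} {c : ι → Opens X} {hc : ∀ i, c i ≤ V} (D : DescentDatum S hV c hc) :
    DescentDatum T hV c hc where
  obj i := (φ.app _ _).obj (D.obj i)
  θ i j Y hi hj := φ.mapOn _ _ hj hi (D.θ i j Y hi hj)
  res_θ i j Y hi hj Z hZ := by rw [φ.resHom_mapOn, D.res_θ]
  θ_self i Y hi := by rw [D.θ_self, φ.mapOn_id]
  θ_comp i j k Y hi hj hk := by rw [← φ.mapOn_comp, D.θ_comp]

/-- A prestack equivalent to a stack is a stack. -/
theorem IsStack.of_isEquiv {T : Prestack.{w₁, v₁} 𝒪 U} (hT : T.IsStack) (φ : PFunctor S T)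
    (hφ : φ.IsEquiv) : S.IsStack where
  isSeparated V hV F G W hW ι c hc h s hs := by
    have b := fun {Y : Opens X} (y : Y ≤ V) => hφ.isFullyFaithful.mapOn_bijective F G y y
    obtain ⟨t, ht, ht'⟩ := hT.isSeparated.existsUnique ((φ.app V hV).obj F) ((φ.app V hV).obj G)
      hW hW c hc h (fun i => φ.mapOn F G _ _ (s i))
      (fun i j => by rw [φ.resHom_mapOn, φ.resHom_mapOn, hs])
    obtain ⟨t, rfl⟩ := (b hW).2 t
    refine ⟨t, fun i => (b _).1 ?_, fun r hr => (b _).1 (ht' _ fun i => ?_)⟩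
    · rw [← φ.resHom_mapOn, ht]
    · rw [φ.resHom_mapOn, hr]
  hasEffectiveDescent := hasEffectiveDescent_of_isEffective fun V hV ι c hc h D => by
    have b := hφ.isFullyFaithful
    obtain ⟨G', η', hη'⟩ := hT.hasEffectiveDescent.isEffective h (D.map φ)
    have := hφ.isEquivalence V hV
    let G := (φ.app V hV).objPreimage G'
    let e : (φ.app V hV).obj G ≅ G' := (φ.app V hV).objObjPreimageIso G'
    let η₁ : ∀ i, (T.res hV (hc i)).obj ((φ.app V hV).obj G) ≅
        (T.res _ le_rfl).obj ((φ.app _ _).obj (D.obj i)) :=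
      fun i => (T.res hV (hc i)).mapIso e ≪≫ η' i
    choose a ha using fun i => (b.mapOn_bijective G (D.obj i) (hc i) le_rfl).2 (η₁ i).hom
    choose a' ha' using fun i => (b.mapOn_bijective (D.obj i) G le_rfl (hc i)).2 (η₁ i).inv
    refine ⟨G, fun i =>
      { hom := a i
        inv := a' i
        hom_inv_id := (b.mapOn_bijective _ _ _ _).1 (by
          rw [φ.mapOn_comp, ha, ha', Iso.hom_inv_id, φ.mapOn_id])
        inv_hom_id := (b.mapOn_bijective _ _ _ _).1 (by
          rw [φ.mapOn_comp, ha, ha', Iso.inv_hom_id, φ.mapOn_id]) },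
      fun i j Y hi hj => (b.mapOn_bijective _ _ _ _).1 ?_⟩
    have k : ∀ (i) (hi : Y ≤ c i), φ.mapOn G (D.obj i) (hi.trans (hc i)) hi
        (S.resHom G (D.obj i) (hc i) le_rfl hi (a i)) = (T.res hV (hi.trans (hc i))).map e.hom ≫
          T.resHom G' ((φ.app _ _).obj (D.obj i)) (hc i) le_rfl hi (η' i).hom := by
      intro i hi
      rw [← φ.resHom_mapOn, ha]
      refine (resHom_comp (S := T) ((φ.app V hV).obj G) G' ((φ.app _ _).obj (D.obj i)) (hc i)
        (hc i) le_rfl hi ((T.res hV (hc i)).map e.hom) (η' i).hom).trans ?_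
      rw [resHom_map]
    rw [φ.mapOn_comp, k, k, Category.assoc]
    exact congrArg _ (hη' i j Y hi hj)

end

end Prestack

/-! ### Right adjoints and representing objects -/

namespace PFunctor

section

variable {X : TopCat.{u}} {𝒪 : Sheaf (Opens.grothendieckTopology X) CommRingCat.{u}} {U : Opens X}
  {S : Prestack.{w₁, v₁} 𝒪 U} {T : Prestack.{w₂, v₂} 𝒪 U} {R : Prestack.{w₃, v₃} 𝒪 U}

variable {V V₁ V₂ V₃ W Y Z : Opens X} {hV : V ≤ U} {h₁ : V₁ ≤ U} {h₂ : V₂ ≤ U} {h₃ : V₃ ≤ U}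

open Prestack

/-- For an object `G` of `T(V)` and an object `P` of `S(W)`, `W ⊆ V`, a morphism
`ε : φ P ⟶ G` over `W` is representing if for all objects `F` and all `Y ⊆ W`, composition with
`ε` identifies the morphisms `F ⟶ P` over `Y` with the morphisms `φ F ⟶ G` over `Y`. -/
def IsRep (φ : PFunctor S T) (G : T.Obj V hV) (w : W ≤ V) (P : S.Obj W (w.trans hV))
    (ε : (T.res (w.trans hV) le_rfl).obj ((φ.app W (w.trans hV)).obj P) ⟶ (T.res hV w).obj G) :
    Prop :=
  ∀ ⦃V₁ : Opens X⦄ ⦃h₁ : V₁ ≤ U⦄ (F : S.Obj V₁ h₁) (Y : Opens X) (y₁ : Y ≤ V₁) (y : Y ≤ W),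
    Function.Bijective fun f : (S.res h₁ y₁).obj F ⟶ (S.res (w.trans hV) y).obj P =>
      φ.mapOn F P y₁ y f ≫ T.resHom ((φ.app W (w.trans hV)).obj P) G le_rfl w y ε

/-- A right adjoint provides representing objects. -/
lemma HasRightAdjoint.exists_isRep {φ : PFunctor S T} (h : φ.HasRightAdjoint) (G : T.Obj V hV) :
    ∃ (P : S.Obj V hV) (ε : _), φ.IsRep G le_rfl P ε := by
  obtain ⟨ψ, ⟨e⟩⟩ := h
  let P := (ψ.app V hV).obj G
  let ε₀ : (φ.app V hV).obj P ⟶ G := (e.adj V hV).counit.app G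
  refine ⟨P, (T.res hV le_rfl).map ε₀, fun V₁ h₁ F Y y₁ y => ?_⟩
  let a := (e.adj Y (y.trans hV)).homEquiv
  let i : (S.res hV y).obj P ≅ (ψ.app Y (y.trans hV)).obj ((T.res hV y).obj G) :=
    ((ψ.iso hV y).app G).symm
  have key : (φ.iso hV y).hom.app P ≫ (T.res hV y).map ε₀ = (a _ _).symm i.hom := by
    have h := e.homEquiv_res hV y P G ε₀
    have h' : (e.adj V hV).homEquiv P G ε₀ = 𝟙 P :=
      ((e.adj V hV).homEquiv_unit _ _ _).trans ((e.adj V hV).right_triangle_components G)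
    rw [h', CategoryTheory.Functor.map_id] at h
    rw [Equiv.eq_symm_apply, ← cancel_mono i.inv, i.hom_inv_id]
    exact h
  have hf : ∀ f : (S.res h₁ y₁).obj F ⟶ (S.res hV y).obj P,
      φ.mapOn F P y₁ y f ≫ T.resHom ((φ.app V hV).obj P) G le_rfl le_rfl y
        ((T.res hV le_rfl).map ε₀) = ((φ.iso h₁ y₁).app F).inv ≫ (a _ _).symm (f ≫ i.hom) := by
    intro f
    rw [resHom_map, mapOn, Category.assoc, Category.assoc, key,
      Adjunction.homEquiv_naturality_left_symm]
    rfl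
  constructor
  · intro f g hfg
    dsimp only at hfg
    rwa [hf, hf, cancel_epi, (a _ _).symm.injective.eq_iff, cancel_mono] at hfg
  · intro g
    refine ⟨a _ _ (((φ.iso h₁ y₁).app F).hom ≫ g) ≫ i.inv, ?_⟩
    dsimp only
    rw [hf, Category.assoc, i.inv_hom_id, Category.comp_id, Equiv.symm_apply_apply,
      Iso.inv_hom_id_assoc]

/-- Representing objects for all `G` assemble to a right adjoint. -/
theorem hasRightAdjoint_of_exists_isRep (φ : PFunctor S T)
    (h : ∀ (V : Opens X) (hV : V ≤ U) (G : T.Obj V hV),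
      ∃ (P : S.Obj V hV) (ε : _), φ.IsRep G le_rfl P ε) : φ.HasRightAdjoint := by
  choose P ε₀ hε₀ using h
  let ε : ∀ (V : Opens X) (hV : V ≤ U) (G : T.Obj V hV), (φ.app V hV).obj (P V hV G) ⟶ G :=
    fun V hV G => down (ε₀ V hV G)
  have b : ∀ {V₁ V₂ W : Opens X} {h₁ : V₁ ≤ U} {h₂ : V₂ ≤ U} (F : S.Obj V₁ h₁) (G : T.Obj V₂ h₂)
      (w₁ : W ≤ V₁) (w₂ : W ≤ V₂), Function.Bijective
        fun f : (S.res h₁ w₁).obj F ⟶ (S.res h₂ w₂).obj (P V₂ h₂ G) =>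
          φ.mapOn F (P V₂ h₂ G) w₁ w₂ f ≫ (T.res h₂ w₂).map (ε V₂ h₂ G) := by
    intro V₁ V₂ W h₁ h₂ F G w₁ w₂
    simp only [ε, Prestack.map_down]
    exact hε₀ V₂ h₂ G F W w₁ w₂
  have m : ∀ {V₁ V₂ W : Opens X} {h₁ : V₁ ≤ U} {h₂ : V₂ ≤ U} (F : T.Obj V₁ h₁) (G : T.Obj V₂ h₂)
      (w₁ : W ≤ V₁) (w₂ : W ≤ V₂) (g : (T.res h₁ w₁).obj F ⟶ (T.res h₂ w₂).obj G),
      ∃ f : (S.res h₁ w₁).obj (P V₁ h₁ F) ⟶ (S.res h₂ w₂).obj (P V₂ h₂ G),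
        φ.mapOn _ _ w₁ w₂ f ≫ (T.res h₂ w₂).map (ε V₂ h₂ G) =
          (T.res h₁ w₁).map (ε V₁ h₁ F) ≫ g :=
    fun F G w₁ w₂ g => (b _ G w₁ w₂).2 _
  choose m hm using @m
  let c : Core T S :=
    { obj := P
      mapOn := m
      mapOn_id := fun F w => (b _ F w w).1 (by
        dsimp only
        rw [hm, mapOn_id, Category.id_comp, Category.comp_id])
      mapOn_comp := fun F G K w₁ w₂ w₃ f g => (b _ K w₁ w₃).1 (by
        dsimp only
        rw [hm, mapOn_comp, Category.assoc, hm, reassoc_of% hm F G w₁ w₂ f])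
      resHom_mapOn := fun F G w₁ w₂ hY f => (b _ G _ _).1 (by
        dsimp only
        rw [hm, ← resHom_mapOn, ← resHom_map _ _ w₂ hY, ← resHom_comp, hm, resHom_comp (w₂ := w₁)
          (G := F), resHom_map]) }
  let ψ := c.toPFunctor
  have b' : ∀ {V : Opens X} (hV : V ≤ U) (F : S.Obj V hV) (G : T.Obj V hV), Function.Bijective
      fun f : F ⟶ P V hV G => (φ.app V hV).map f ≫ ε V hV G := by
    intro V hV F G
    constructor
    · intro f g hfg
      apply map_injective
      apply (b F G le_rfl le_rfl).1
      dsimp only at hfg ⊢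
      rw [mapOn_map, mapOn_map, ← Functor.map_comp, ← Functor.map_comp, hfg]
    · intro g
      obtain ⟨f, hf⟩ := (b F G le_rfl le_rfl).2 ((T.res hV le_rfl).map g)
      refine ⟨down f, map_injective ?_⟩
      dsimp only at hf ⊢
      rw [φ.map_down, Functor.map_comp, map_down_self, hf]
  have hψ : ∀ {V : Opens X} (hV : V ≤ U) {F G : T.Obj V hV} (g : F ⟶ G),
      (φ.app V hV).map (X := P V hV F) (Y := P V hV G) ((ψ.app V hV).map g) ≫ ε V hV G =
        ε V hV F ≫ g := by
    intro V hV F G g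
    change (φ.app V hV).map (down (m F G le_rfl le_rfl ((T.res hV le_rfl).map g))) ≫ _ = _
    apply map_injective
    rw [φ.map_down, Functor.map_comp, map_down_self, hm, Functor.map_comp]
  have hiso : ∀ {V W : Opens X} (hV : V ≤ U) (hW : W ≤ V) (G : T.Obj V hV),
      (φ.app W (hW.trans hV)).map (c.isoApp G hW).hom ≫ (φ.iso hV hW).hom.app (P V hV G) ≫
        (T.res hV hW).map (ε V hV G) = ε W (hW.trans hV) ((T.res hV hW).obj G) := by
    intro V W hV hW G
    apply map_injective
    rw [← cancel_mono (T.can G hW le_rfl).hom, Functor.map_comp, Functor.map_comp, Category.assoc,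
      Category.assoc, map_can, resHom_map, ← Category.assoc ((T.res _ _).map ((φ.iso hV hW).hom.app _))]
    have e₁ := φ.mapOn_can (P V hV G) hW le_rfl
    dsimp only [Functor.comp_obj] at e₁ ⊢
    rw [← e₁, ← mapOn_map, ← mapOn_comp_assoc, c.map_isoApp]
    exact hm _ _ _ _ _
  refine ⟨ψ, ⟨⟨fun V hV => Adjunction.mkOfHomEquiv
    { homEquiv := fun F G => (Equiv.ofBijective _ (b' hV F G)).symm
      homEquiv_naturality_left_symm := fun f g => ?_
      homEquiv_naturality_right := fun {F G G'} f g => ?_ }, ?_⟩⟩⟩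
  · exact ((φ.app V hV).map_comp_assoc f g _)
  · refine (Equiv.ofBijective _ (b' hV F G')).symm_apply_eq.2 ?_
    have e := (Equiv.ofBijective _ (b' hV F G)).apply_symm_apply f
    generalize (Equiv.ofBijective _ (b' hV F G)).symm f = k at e ⊢
    change (φ.app V hV).map k ≫ ε V hV G = f at e
    change f ≫ g = (φ.app V hV).map (X := F) (Y := P V hV G') (k ≫ (ψ.app V hV).map g) ≫ ε V hV G'
    rw [← e, Category.assoc, ← hψ hV g]
    exact (((φ.app V hV).map_comp_assoc k ((ψ.app V hV).map g) _)).symm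
  · intro V W hV hW F G f
    simp only [Adjunction.mkOfHomEquiv_homEquiv]
    have e := (Equiv.ofBijective _ (b' hV F G)).apply_symm_apply f
    generalize (Equiv.ofBijective _ (b' hV F G)).symm f = k at e ⊢
    change (φ.app V hV).map k ≫ ε V hV G = f at e
    have n := (φ.iso hV hW).hom.naturality k
    have e' : ((Equiv.ofBijective _ (b' (hW.trans hV) ((S.res hV hW).obj F)
        ((T.res hV hW).obj G))).symm ((φ.iso hV hW).hom.app F ≫ (T.res hV hW).map f)) =
        (S.res hV hW).map k ≫ (c.isoApp G hW).inv := by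
      rw [Equiv.symm_apply_eq]
      change _ = (φ.app W (hW.trans hV)).map ((S.res hV hW).map k ≫ (c.isoApp G hW).inv) ≫ ε W _ _
      rw [← hiso hV hW G, ← Functor.map_comp_assoc, Category.assoc, Iso.inv_hom_id,
        Category.comp_id, ← e, Functor.map_comp]
      dsimp at n
      rw [reassoc_of% n]
    exact (congrArg (fun t => t ≫ (c.isoApp G hW).hom) e').trans <| (Category.assoc _ _ _).trans
      ((congrArg (fun t => _ ≫ t) (c.isoApp G hW).inv_hom_id).trans (Category.comp_id _))

lemma IsRep.comp {φ : PFunctor S T} {ψ : PFunctor T R} {G : R.Obj V hV} {P : T.Obj V hV}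
    {Q : S.Obj V hV} {ε : _} {δ : _} (hP : ψ.IsRep G le_rfl P ε) (hQ : φ.IsRep P le_rfl Q δ) :
    (φ.comp ψ).IsRep G le_rfl Q (ψ.mapOn _ _ le_rfl le_rfl δ ≫ ε) := by
  intro V₁ h₁ F Y y₁ y
  refine Eq.mp (congrArg Function.Bijective (funext fun f => ?_))
    ((hP ((φ.app V₁ h₁).obj F) Y y₁ y).comp (hQ F Y y₁ y))
  dsimp only [Function.comp_apply]
  symm
  rw [comp_mapOn, mapOn_comp, Category.assoc, ← ψ.resHom_mapOn]
  exact congrArg (fun t => ψ.mapOn _ _ y₁ y (φ.mapOn F Q y₁ y f) ≫ t)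
    (resHom_comp (S := R) ((ψ.app V hV).obj ((φ.app V hV).obj Q)) ((ψ.app V hV).obj P) G le_rfl
      le_rfl le_rfl y _ _)

lemma HasRightAdjoint.comp {φ : PFunctor S T} {ψ : PFunctor T R} (hφ : φ.HasRightAdjoint)
    (hψ : ψ.HasRightAdjoint) : (φ.comp ψ).HasRightAdjoint :=
  hasRightAdjoint_of_exists_isRep _ fun V hV G => by
    obtain ⟨P, ε, hP⟩ := hψ.exists_isRep G
    obtain ⟨Q, δ, hQ⟩ := hφ.exists_isRep P
    exact ⟨Q, _, hP.comp hQ⟩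

lemma IsEquiv.hasRightAdjoint {φ : PFunctor S T} (hφ : φ.IsEquiv) : φ.HasRightAdjoint :=
  hasRightAdjoint_of_exists_isRep _ fun V hV G => by
    have := hφ.isEquivalence V hV
    let e := (φ.app V hV).objObjPreimageIso G
    refine ⟨(φ.app V hV).objPreimage G, (T.res hV le_rfl).map e.hom, fun V₁ h₁ F Y y₁ y => ?_⟩
    simp only [resHom_map]
    exact (((T.res hV y).mapIso e).homToEquiv.bijective).comp
      (hφ.isFullyFaithful.mapOn_bijective F _ y₁ y)

end

end PFunctor

/-! ### Functoriality of the prestack of functors -/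

/-- Functors inverse to each other which preserve given properties of objects restrict to
equivalences of the full subcategories. -/
lemma isEquivalence_lift {C : Type w₁} [Category.{v₁} C] {D : Type w₂} [Category.{v₂} D]
    (P : ObjectProperty C) (Q : ObjectProperty D) (F : C ⥤ D) (G : D ⥤ C)
    (hF : ∀ x, P x → Q (F.obj x)) (hG : ∀ x, Q x → P (G.obj x)) (α : F ⋙ G ≅ 𝟭 C)
    (β : G ⋙ F ≅ 𝟭 D) : (Q.lift (P.ι ⋙ F) fun x => hF _ x.property).IsEquivalence := by
  let L := Q.lift (P.ι ⋙ F) fun x => hF _ x.property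
  let L' := P.lift (Q.ι ⋙ G) fun x => hG _ x.property
  have a : L ⋙ L' ≅ 𝟭 _ := NatIso.ofComponents
    (fun x => P.fullyFaithfulι.preimageIso (X := (L ⋙ L').obj x) (Y := x) (α.app x.obj))
    (fun f => ObjectProperty.hom_ext _ (α.hom.naturality f.hom))
  have b : L' ⋙ L ≅ 𝟭 _ := NatIso.ofComponents
    (fun x => Q.fullyFaithfulι.preimageIso (X := (L' ⋙ L).obj x) (Y := x) (β.app x.obj))
    (fun f => ObjectProperty.hom_ext _ (β.hom.naturality f.hom))
  exact (CategoryTheory.Equivalence.mk L L' a.symm b).isEquivalence_functor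

namespace PFunctor

section

variable {X : TopCat.{u}} {𝒪 : Sheaf (Opens.grothendieckTopology X) CommRingCat.{u}} {U : Opens X}
  {S : Prestack.{w₁, v₁} 𝒪 U} {S' : Prestack.{w₂, v₂} 𝒪 U} {T : Prestack.{w₃, v₃} 𝒪 U}
  {T' : Prestack.{w, v} 𝒪 U}

open Prestack

variable (T) in
/-- Composition with a functor `S → S'` on the source. -/
def precomp (e : PFunctor S S') : PFunctor S' T ⥤ PFunctor S T where
  obj φ := e.comp φ
  map {φ ψ} α :=
    { app := fun V hV => (e.app V hV).whiskerLeft (α.app V hV)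
      naturality := fun {V W} hV hW F => by
        have n₁ := α.naturality hV hW ((e.app V hV).obj F)
        have n₂ := (α.app W (hW.trans hV)).naturality ((e.iso hV hW).hom.app F)
        dsimp [PFunctor.comp] at n₁ n₂ ⊢
        rw [Category.assoc, ← n₁, reassoc_of% n₂] }

variable (S) in
/-- Composition with a functor `T → T'` on the target. -/
def postcomp (t : PFunctor T T') : PFunctor S T ⥤ PFunctor S T' where
  obj φ := φ.comp t
  map {φ ψ} α :=
    { app := fun V hV => Functor.whiskerRight (α.app V hV) (t.app V hV)
      naturality := fun {V W} hV hW F => by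
        have n₁ := α.naturality hV hW F
        have n₂ := (t.iso hV hW).hom.naturality ((α.app V hV).app F)
        dsimp [PFunctor.comp] at n₁ n₂ ⊢
        rw [Category.assoc, ← n₂, ← Functor.map_comp_assoc, n₁, Functor.map_comp_assoc] }

/-- The components of an isomorphism of a composite with the identity. -/
def counitApp {e : PFunctor S S'} {e' : PFunctor S' S} (i : e'.comp e ≅ PFunctor.id S')
    {V : Opens X} {hV : V ≤ U} (F : S'.Obj V hV) :
    (e.app V hV).obj ((e'.app V hV).obj F) ≅ F where
  hom := (i.hom.app V hV).app F
  inv := (i.inv.app V hV).app F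
  hom_inv_id := congrArg (fun α : e'.comp e ⟶ e'.comp e => (Hom.app α V hV).app F) i.hom_inv_id
  inv_hom_id := congrArg (fun α : PFunctor.id S' ⟶ PFunctor.id S' => (Hom.app α V hV).app F)
    i.inv_hom_id

lemma counitApp_naturality {e : PFunctor S S'} {e' : PFunctor S' S}
    (i : e'.comp e ≅ PFunctor.id S') {V₁ V₂ W : Opens X} {h₁ : V₁ ≤ U} {h₂ : V₂ ≤ U}
    (F : S'.Obj V₁ h₁) (G : S'.Obj V₂ h₂) (w₁ : W ≤ V₁) (w₂ : W ≤ V₂)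
    (f : (S'.res h₁ w₁).obj F ⟶ (S'.res h₂ w₂).obj G) :
    e.mapOn _ _ w₁ w₂ (e'.mapOn F G w₁ w₂ f) ≫ (S'.res h₂ w₂).map (counitApp i G).hom =
      (S'.res h₁ w₁).map (counitApp i F).hom ≫ f := by
  have n := i.hom.naturalityOn F G w₁ w₂ f
  rw [id_mapOn, comp_mapOn] at n
  exact n

/-- Composition with mutually inverse functors on the source is isomorphic to the identity. -/
noncomputable def precompIso {e : PFunctor S S'} {e' : PFunctor S' S}
    (i : e'.comp e ≅ PFunctor.id S') : precomp T e ⋙ precomp T e' ≅ 𝟭 (PFunctor S' T) :=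
  NatIso.ofComponents
    (fun φ => isoOfHom (φ := e'.comp (e.comp φ)) (ψ := φ) (homMk (φ := e'.comp (e.comp φ)) (ψ := φ)
      (fun V hV F => (φ.app V hV).map (counitApp i F).hom) (by
        intro V₁ V₂ W h₁ h₂ F G w₁ w₂ f
        rw [comp_mapOn, comp_mapOn]
        change φ.mapOn _ _ w₁ w₂ (e.mapOn _ _ w₁ w₂ (e'.mapOn F G w₁ w₂ f)) ≫
          (T.res h₂ w₂).map ((φ.app V₂ h₂).map (counitApp i G).hom) =
          (T.res h₁ w₁).map ((φ.app V₁ h₁).map (counitApp i F).hom) ≫ φ.mapOn F G w₁ w₂ f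
        rw [← φ.mapOn_map, ← φ.mapOn_map, ← φ.mapOn_comp, ← φ.mapOn_comp,
          counitApp_naturality i]))
      (fun V hV F => (inferInstance : IsIso ((φ.app V hV).map (counitApp i F).hom))))
    (fun {φ ψ} α => hom_ext fun V hV => NatTrans.ext (funext fun F =>
      ((α.app V hV).naturality (counitApp i F).hom).symm))

/-- Composition with mutually inverse functors on the target is isomorphic to the identity. -/
noncomputable def postcompIso {t : PFunctor T T'} {t' : PFunctor T' T}
    (i : t.comp t' ≅ PFunctor.id T) : postcomp S t ⋙ postcomp S t' ≅ 𝟭 (PFunctor S T) :=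
  NatIso.ofComponents
    (fun φ => isoOfHom (φ := (φ.comp t).comp t') (ψ := φ)
      (homMk (φ := (φ.comp t).comp t') (ψ := φ)
      (fun V hV F => (counitApp i ((φ.app V hV).obj F)).hom) (by
        intro V₁ V₂ W h₁ h₂ F G w₁ w₂ f
        rw [comp_mapOn, comp_mapOn]
        exact counitApp_naturality i _ _ w₁ w₂ (φ.mapOn F G w₁ w₂ f)))
      (fun V hV F => (inferInstance : IsIso (counitApp i ((φ.app V hV).obj F)).hom)))
    (fun {φ ψ} α => hom_ext fun V hV => NatTrans.ext (funext fun F =>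
      (i.hom.app V hV).naturality ((α.app V hV).app F)))

/-- Restriction to an open subset of the isomorphism making a composite the identity. -/
def restrictIso {e : PFunctor S S'} {e' : PFunctor S' S} (i : e'.comp e ≅ PFunctor.id S')
    {V : Opens X} (hV : V ≤ U) :
    (e'.restrict hV).comp (e.restrict hV) ≅ PFunctor.id (S'.restrict hV) where
  hom := { app := fun W hW => i.hom.app W (hW.trans hV)
           naturality := fun hW hY F => i.hom.naturality (hW.trans hV) hY F }
  inv := { app := fun W hW => i.inv.app W (hW.trans hV)
           naturality := fun hW hY F => i.inv.naturality (hW.trans hV) hY F }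
  hom_inv_id := hom_ext fun W hW =>
    congrArg (fun α : e'.comp e ⟶ e'.comp e => Hom.app α W (hW.trans hV)) i.hom_inv_id
  inv_hom_id := hom_ext fun W hW =>
    congrArg (fun α : PFunctor.id S' ⟶ PFunctor.id S' => Hom.app α W (hW.trans hV)) i.inv_hom_id

lemma isRightAdj.comp {φ : PFunctor S S'} {ψ : PFunctor S' T} (hφ : isRightAdj S S' φ)
    (hψ : isRightAdj S' T ψ) : isRightAdj S T (φ.comp ψ) :=
  ⟨hφ.1.comp hψ.1, hφ.2.comp hψ.2⟩

lemma isRightAdj.restrict {φ : PFunctor S T} (hφ : isRightAdj S T φ) {V : Opens X} (hV : V ≤ U) :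
    isRightAdj (S.restrict hV) (T.restrict hV) (φ.restrict hV) :=
  ⟨hφ.1.restrict hV, hφ.2.restrict hV⟩

end

end PFunctor

section HomREquiv

variable {X : TopCat.{u}} {𝒪 : Sheaf (Opens.grothendieckTopology X) CommRingCat.{u}} {U : Opens X}
  {S : Prestack.{w₁, v₁} 𝒪 U} {S' : Prestack.{w₂, v₂} 𝒪 U} {T : Prestack.{w₃, v₃} 𝒪 U}
  {T' : Prestack.{w, v} 𝒪 U}

open TwistedStack.PFunctor

/-- Composition on the source, as a functor of prestacks. -/
def HomR.precomp (T : Prestack.{w₃, v₃} 𝒪 U) (e : PFunctor S S') (he : isRightAdj S S' e) :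
    PFunctor (HomR S' T) (HomR S T) where
  app V hV := ObjectProperty.lift _
    (ObjectProperty.ι _ ⋙ PFunctor.precomp (T.restrict hV) (e.restrict hV))
    (fun φ => isRightAdj.comp (he.restrict hV) φ.property)
  iso hV hW := NatIso.ofComponents (fun φ => Iso.refl _) (fun f =>
    (Category.comp_id _).trans (Category.id_comp _).symm)
  iso_comp hV hW hY F := by
    apply ObjectProperty.hom_ext
    refine hom_ext fun Z hZ => NatTrans.ext (funext fun A => ?_)
    change 𝟙 _ ≫ 𝟙 _ = 𝟙 _ ≫ 𝟙 _ ≫ 𝟙 _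
    simp

/-- Composition on the target, as a functor of prestacks. -/
def HomR.postcomp (S : Prestack.{w₁, v₁} 𝒪 U) (t : PFunctor T T') (ht : isRightAdj T T' t) :
    PFunctor (HomR S T) (HomR S T') where
  app V hV := ObjectProperty.lift _
    (ObjectProperty.ι _ ⋙ PFunctor.postcomp (S.restrict hV) (t.restrict hV))
    (fun φ => isRightAdj.comp φ.property (ht.restrict hV))
  iso hV hW := NatIso.ofComponents (fun φ => Iso.refl _) (fun f =>
    (Category.comp_id _).trans (Category.id_comp _).symm)
  iso_comp hV hW hY F := by
    apply ObjectProperty.hom_ext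
    refine hom_ext fun Z hZ => NatTrans.ext (funext fun A => ?_)
    change (t.app Z _).map (𝟙 _) ≫ 𝟙 _ = 𝟙 _ ≫ 𝟙 _ ≫ 𝟙 _
    simp

/-- Equivalent prestacks have equivalent prestacks of functors to `T`. -/
theorem Equivalent.homR_left (h : Equivalent S S') (T : Prestack.{w₃, v₃} 𝒪 U) :
    Equivalent (HomR S' T) (HomR S T) := by
  obtain ⟨e, hl, he⟩ := h
  obtain ⟨e', ⟨i⟩, ⟨j⟩⟩ := id he
  have hr : isRightAdj S S' e := ⟨hl, he.hasRightAdjoint⟩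
  have he' : e'.IsEquiv := ⟨e, ⟨j⟩, ⟨i⟩⟩
  have hr' : isRightAdj S' S e' :=
    ⟨hl.of_comp_iso_id he.isFullyFaithful i, he'.hasRightAdjoint⟩
  refine ⟨HomR.precomp T e hr, ⟨?_, ?_⟩, isEquiv_of_isEquivalence _ fun V hV =>
    isEquivalence_lift _ _ (PFunctor.precomp (T.restrict hV) (e.restrict hV))
      (PFunctor.precomp (T.restrict hV) (e'.restrict hV)) (fun φ hφ => (hr.restrict hV).comp hφ)
      (fun φ hφ => (hr'.restrict hV).comp hφ) (precompIso (restrictIso i hV))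
      (precompIso (restrictIso j hV))⟩
  · intros
    rfl
  · intros
    rfl

/-- Equivalent prestacks have equivalent prestacks of functors from `S`. -/
theorem Equivalent.homR_right (h : Equivalent T T') (S : Prestack.{w₁, v₁} 𝒪 U) :
    Equivalent (HomR S T) (HomR S T') := by
  obtain ⟨e, hl, he⟩ := h
  obtain ⟨e', ⟨i⟩, ⟨j⟩⟩ := id he
  have hr : isRightAdj T T' e := ⟨hl, he.hasRightAdjoint⟩
  have he' : e'.IsEquiv := ⟨e, ⟨j⟩, ⟨i⟩⟩
  have hl' : e'.IsLinear := hl.of_comp_iso_id he.isFullyFaithful i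
  have hr' : isRightAdj T' T e' := ⟨hl', he'.hasRightAdjoint⟩
  refine ⟨HomR.postcomp S e hr, ⟨?_, ?_⟩, isEquiv_of_isEquivalence _ fun V hV =>
    isEquivalence_lift _ _ (PFunctor.postcomp (S.restrict hV) (e.restrict hV))
      (PFunctor.postcomp (S.restrict hV) (e'.restrict hV)) (fun φ hφ => hφ.comp (hr.restrict hV))
      (fun φ hφ => hφ.comp (hr'.restrict hV)) (postcompIso (restrictIso j hV))
      (postcompIso (restrictIso i hV))⟩
  · intro V hV F G α β
    apply ObjectProperty.hom_ext
    refine hom_ext fun W hW => NatTrans.ext (funext fun A => ?_)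
    exact hl.map_add (hW.trans hV) _ _
  · intro V hV F G r α
    apply ObjectProperty.hom_ext
    refine hom_ext fun W hW => NatTrans.ext (funext fun A => ?_)
    exact hl.map_smul (hW.trans hV) _ _

end HomREquiv

/-! ### The prestack of functors between stacks is a stack -/

namespace PFunctor

section

variable {X : TopCat.{u}} {𝒪 : Sheaf (Opens.grothendieckTopology X) CommRingCat.{u}} {U : Opens X}
  {S : Prestack.{w₁, v₁} 𝒪 U} {T : Prestack.{w₂, v₂} 𝒪 U}

open Prestack

/-- Transformations naturally extend to objects over larger open subsets: given `α` over `C`, this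
is the morphism `φ F ⟶ ψ F` over `Y ⊆ C` induced by the component of `α` at `F|_Y`. -/
def extendHom {φ ψ : PFunctor S T} {C : Opens X} (hC : C ≤ U)
    (α : φ.restrict hC ⟶ ψ.restrict hC) {V Y : Opens X} {hV : V ≤ U} (F : S.Obj V hV) (y : Y ≤ V)
    (hY : Y ≤ C) :
    (T.res hV y).obj ((φ.app V hV).obj F) ⟶ (T.res hV y).obj ((ψ.app V hV).obj F) :=
  φ.mapOn F ((S.res hV y).obj F) y le_rfl (S.can F y le_rfl).inv ≫
    (T.res (y.trans hV) le_rfl).map ((α.app Y hY).app ((S.res hV y).obj F)) ≫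
    ψ.mapOn ((S.res hV y).obj F) F le_rfl y (S.can F y le_rfl).hom

section extendHom

variable {φ ψ : PFunctor S T} {C : Opens X} (hC : C ≤ U) (α : φ.restrict hC ⟶ ψ.restrict hC)
  {V V₁ V₂ W Y Z : Opens X} {hV : V ≤ U}

lemma naturalityOn_restrict (c₁ : V₁ ≤ C) (c₂ : V₂ ≤ C) (F : S.Obj V₁ (c₁.trans hC))
    (G : S.Obj V₂ (c₂.trans hC)) (w₁ : W ≤ V₁) (w₂ : W ≤ V₂)
    (f : (S.res _ w₁).obj F ⟶ (S.res _ w₂).obj G) :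
    φ.mapOn F G w₁ w₂ f ≫ (T.res (c₂.trans hC) w₂).map ((α.app V₂ c₂).app G) =
      (T.res (c₁.trans hC) w₁).map ((α.app V₁ c₁).app F) ≫ ψ.mapOn F G w₁ w₂ f :=
  Hom.naturalityOn α F G w₁ w₂ f

/-- `extendHom` may be computed with any object isomorphic to `F` over `Z`. -/
lemma extendHom_eq (F : S.Obj V hV) (y : Z ≤ V) (hZ : Z ≤ C) (c₁ : W ≤ C)
    (A : S.Obj W (c₁.trans hC)) (w : Z ≤ W)
    (p : (S.res (c₁.trans hC) w).obj A ≅ (S.res hV y).obj F) :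
    extendHom hC α F y hZ = φ.mapOn F A y w p.inv ≫
      (T.res _ w).map ((α.app W c₁).app A) ≫ ψ.mapOn A F w y p.hom := by
  have n := naturalityOn_restrict hC α hZ c₁ ((S.res hV y).obj F) A le_rfl w
    ((S.can F y le_rfl).hom ≫ p.inv)
  rw [φ.mapOn_comp (w₂ := y) (G := F), ψ.mapOn_comp (w₂ := y) (G := F)] at n
  rw [extendHom]
  have i : φ.mapOn F ((S.res hV y).obj F) y le_rfl (S.can F y le_rfl).inv ≫
      φ.mapOn ((S.res hV y).obj F) F le_rfl y (S.can F y le_rfl).hom = 𝟙 _ := by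
    rw [← φ.mapOn_comp, Iso.inv_hom_id, φ.mapOn_id]
  have j : ψ.mapOn F A y w p.inv ≫ ψ.mapOn A F w y p.hom = 𝟙 _ := by
    rw [← ψ.mapOn_comp, Iso.inv_hom_id, ψ.mapOn_id]
  have n' := congrArg (fun t => φ.mapOn F ((S.res hV y).obj F) y le_rfl (S.can F y le_rfl).inv ≫
    t ≫ ψ.mapOn A F w y p.hom) n
  simp only [Category.assoc, reassoc_of% i, j, Category.comp_id] at n'
  exact n'.symm

lemma resHom_extendHom (F : S.Obj V hV) (y : Y ≤ V) (hY : Y ≤ C) (hZ : Z ≤ Y) :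
    T.resHom _ _ y y hZ (extendHom hC α F y hY) = extendHom hC α F (hZ.trans y) (hZ.trans hY) := by
  rw [extendHom_eq hC α F (hZ.trans y) (hZ.trans hY) hY ((S.res hV y).obj F) hZ (S.can F y hZ),
    extendHom, resHom_comp (w₂ := le_rfl) (G := (φ.app _ _).obj ((S.res hV y).obj F)),
    resHom_comp (w₂ := le_rfl) (G := (ψ.app _ _).obj ((S.res hV y).obj F)), φ.resHom_mapOn,
    ψ.resHom_mapOn, resHom_map, resHom_can, resHom_can_inv]

lemma extendHom_of_le (c₁ : V ≤ C) (F : S.Obj V (c₁.trans hC)) (y : Y ≤ V) :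
    extendHom hC α F y (y.trans c₁) = (T.res _ y).map ((α.app V c₁).app F) := by
  rw [extendHom_eq hC α F y (y.trans c₁) c₁ F y (Iso.refl _)]
  simp [mapOn_id]

lemma mapOn_extendHom {h₁ : V₁ ≤ U} {h₂ : V₂ ≤ U} (F : S.Obj V₁ h₁) (G : S.Obj V₂ h₂)
    (y₁ : Y ≤ V₁) (y₂ : Y ≤ V₂) (hY : Y ≤ C) (f : (S.res h₁ y₁).obj F ⟶ (S.res h₂ y₂).obj G) :
    φ.mapOn F G y₁ y₂ f ≫ extendHom hC α G y₂ hY = extendHom hC α F y₁ hY ≫ ψ.mapOn F G y₁ y₂ f := by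
  have n := naturalityOn_restrict hC α hY hY ((S.res h₁ y₁).obj F) ((S.res h₂ y₂).obj G) le_rfl
    le_rfl ((S.can F y₁ le_rfl).hom ≫ f ≫ (S.can G y₂ le_rfl).inv)
  rw [φ.mapOn_comp (w₂ := y₁) (G := F), φ.mapOn_comp (w₂ := y₂) (G := G),
    ψ.mapOn_comp (w₂ := y₁) (G := F), ψ.mapOn_comp (w₂ := y₂) (G := G)] at n
  have i : φ.mapOn F ((S.res h₁ y₁).obj F) y₁ le_rfl (S.can F y₁ le_rfl).inv ≫
      φ.mapOn ((S.res h₁ y₁).obj F) F le_rfl y₁ (S.can F y₁ le_rfl).hom = 𝟙 _ := by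
    rw [← φ.mapOn_comp, Iso.inv_hom_id, φ.mapOn_id]
  have j : ψ.mapOn G ((S.res h₂ y₂).obj G) y₂ le_rfl (S.can G y₂ le_rfl).inv ≫
      ψ.mapOn ((S.res h₂ y₂).obj G) G le_rfl y₂ (S.can G y₂ le_rfl).hom = 𝟙 _ := by
    rw [← ψ.mapOn_comp, Iso.inv_hom_id, ψ.mapOn_id]
  have n' := congrArg (fun t => φ.mapOn F ((S.res h₁ y₁).obj F) y₁ le_rfl (S.can F y₁ le_rfl).inv ≫
    t ≫ ψ.mapOn ((S.res h₂ y₂).obj G) G le_rfl y₂ (S.can G y₂ le_rfl).hom) n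
  simp only [Category.assoc, reassoc_of% i, j, Category.comp_id] at n'
  rw [extendHom, extendHom, n']
  simp only [Category.assoc]

end extendHom

/-- Transformations to a separated prestack glue. -/
lemma existsUnique_hom (hT : T.IsSeparated) (φ ψ : PFunctor S T) {ι : Type u} (c : ι → Opens X)
    (hc : ∀ i, c i ≤ U) (h : (⨆ i, c i) = U) (α : ∀ i, φ.restrict (hc i) ⟶ ψ.restrict (hc i))
    (hα : ∀ (i j : ι) (Z : Opens X) (hi : Z ≤ c i) (hj : Z ≤ c j),
      (α i).app Z hi = (α j).app Z hj) :
    ∃! β : φ ⟶ ψ, ∀ (i : ι) (Z : Opens X) (hi : Z ≤ c i),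
      β.app Z (hi.trans (hc i)) = (α i).app Z hi := by
  have e : ∀ {V Y : Opens X} {hV : V ≤ U} (F : S.Obj V hV) (y : Y ≤ V) (i j : ι) (hi : Y ≤ c i)
      (hj : Y ≤ c j), extendHom (hc i) (α i) F y hi = extendHom (hc j) (α j) F y hj := by
    intro V Y hV F y i j hi hj
    simp only [extendHom, hα i j Y hi hj]
  have g : ∀ (V : Opens X) (hV : V ≤ U) (F : S.Obj V hV),
      ∃ t : (φ.app V hV).obj F ⟶ (ψ.app V hV).obj F, ∀ (Y : Opens X) (y : Y ≤ V) (i : ι)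
        (hi : Y ≤ c i), (T.res hV y).map t = extendHom (hc i) (α i) F y hi := by
    intro V hV F
    obtain ⟨t, ht, -⟩ := hT.existsUnique ((φ.app V hV).obj F) ((ψ.app V hV).obj F) le_rfl le_rfl
      (fun i => V ⊓ c i) (fun i => inf_le_left) (iSup_inf_of_iSup_eq h hV)
      (fun i => extendHom (hc i) (α i) F inf_le_left inf_le_right)
      (fun i j => by
        rw [resHom_extendHom, resHom_extendHom]
        exact e F _ i j _ _)
    refine ⟨down t, fun Y y i hi => ?_⟩
    have := congrArg (T.resHom _ _ inf_le_left inf_le_left (le_inf y hi)) (ht i)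
    rwa [resHom_resHom, resHom_extendHom, ← Prestack.map_down] at this
  choose a ha using g
  refine ⟨homMk a ?_, fun i Z hi => NatTrans.ext (funext fun F => map_injective ?_),
    fun β hβ => hom_ext fun V hV => NatTrans.ext (funext fun F => map_injective ?_)⟩
  · intro V₁ V₂ W h₁ h₂ F G w₁ w₂ f
    refine hT.ext (fun i => W ⊓ c i) (fun i => inf_le_left)
      (iSup_inf_of_iSup_eq h (w₁.trans h₁)) fun i => ?_
    rw [resHom_comp (w₂ := w₂) (G := (φ.app V₂ h₂).obj G),
      resHom_comp (w₂ := w₁) (G := (ψ.app V₁ h₁).obj F), φ.resHom_mapOn, ψ.resHom_mapOn,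
      resHom_map, resHom_map, ha _ _ _ _ _ i inf_le_right, ha _ _ _ _ _ i inf_le_right,
      mapOn_extendHom]
  · rw [homMk_app_app, ha _ _ _ _ _ i hi]
    exact extendHom_of_le (hc i) (α i) hi F le_rfl
  · refine hT.ext (fun i => V ⊓ c i) (fun i => inf_le_left) (iSup_inf_of_iSup_eq h hV) fun i => ?_
    rw [resHom_map, resHom_map, homMk_app_app, ha _ _ _ _ _ i inf_le_right]
    have n := β.naturalityOn ((S.res hV inf_le_left).obj F) F le_rfl
      (inf_le_left : V ⊓ c i ≤ V) (S.can F inf_le_left le_rfl).hom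
    rw [extendHom, ← hβ i _ inf_le_right, ← n, ← Category.assoc, ← φ.mapOn_comp, Iso.inv_hom_id,
      φ.mapOn_id, Category.id_comp]

/-! ### Linearity and the existence of adjoints are local -/

lemma IsLinear.of_iso {φ ψ : PFunctor S T} (h : φ.IsLinear) (e : φ ≅ ψ) : ψ.IsLinear := by
  have key : ∀ {V : Opens X} (hV : V ≤ U) {F G : S.Obj V hV} (f : F ⟶ G),
      (ψ.app V hV).map f = (e.inv.app V hV).app F ≫ (φ.app V hV).map f ≫ (e.hom.app V hV).app G := by
    intro V hV F G f
    have i : (e.inv.app V hV).app F ≫ (e.hom.app V hV).app F = 𝟙 _ :=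
      congrArg (fun α : ψ ⟶ ψ => (Hom.app α V hV).app F) e.inv_hom_id
    rw [(e.hom.app V hV).naturality f, reassoc_of% i]
  constructor
  · intro V hV F G f g
    rw [key, key, key, h.map_add, Preadditive.add_comp, Preadditive.comp_add]
  · intro V hV F G r f
    rw [key, key, h.map_smul, Linear.smul_comp, Linear.comp_smul]

lemma HasRightAdjoint.of_iso {φ ψ : PFunctor S T} (h : φ.HasRightAdjoint) (e : φ ≅ ψ) :
    ψ.HasRightAdjoint :=
  hasRightAdjoint_of_exists_isRep _ fun V hV G => by
    have i : ∀ {V₁ : Opens X} {h₁ : V₁ ≤ U} (F : S.Obj V₁ h₁),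
        (e.hom.app V₁ h₁).app F ≫ (e.inv.app V₁ h₁).app F = 𝟙 _ := fun {V₁ h₁} F =>
      congrArg (fun α : φ ⟶ φ => (Hom.app α V₁ h₁).app F) e.hom_inv_id
    have i' : ∀ {V₁ : Opens X} {h₁ : V₁ ≤ U} (F : S.Obj V₁ h₁),
        (e.inv.app V₁ h₁).app F ≫ (e.hom.app V₁ h₁).app F = 𝟙 _ := fun {V₁ h₁} F =>
      congrArg (fun α : ψ ⟶ ψ => (Hom.app α V₁ h₁).app F) e.inv_hom_id
    let k : ∀ {V₁ : Opens X} {h₁ : V₁ ≤ U} (F : S.Obj V₁ h₁),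
        (ψ.app V₁ h₁).obj F ≅ (φ.app V₁ h₁).obj F := fun F => ⟨_, _, i' F, i F⟩
    obtain ⟨P, ε, hP⟩ := h.exists_isRep G
    refine ⟨P, (T.res hV le_rfl).map (k P).hom ≫ ε, fun V₁ h₁ F Y y₁ y => ?_⟩
    refine Eq.mp (congrArg Function.Bijective (funext fun f => ?_))
      ((((T.res h₁ y₁).mapIso (k F)).symm.homFromEquiv.bijective).comp (hP F Y y₁ y))
    dsimp only [Function.comp_apply]
    rw [resHom_comp (w₂ := le_rfl) (G := (φ.app V hV).obj P), resHom_map]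
    have n := e.inv.naturalityOn F P y₁ y f
    change (T.res h₁ y₁).map (k F).hom ≫ _ = _
    change _ ≫ (T.res hV y).map (k P).hom = (T.res h₁ y₁).map (k F).hom ≫ _ at n
    rw [← Category.assoc, ← n, Category.assoc]

lemma isLinear_of_cover (hT : T.IsSeparated) (φ : PFunctor S T) {ι : Type u} (c : ι → Opens X)
    (hc : ∀ i, c i ≤ U) (h : (⨆ i, c i) = U) (hφ : ∀ i, (φ.restrict (hc i)).IsLinear) :
    φ.IsLinear := by
  constructor
  · intro V hV F G f g
    refine map_injective (hT.ext (fun i => V ⊓ c i) (fun i => inf_le_left)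
      (iSup_inf_of_iSup_eq h hV) fun i => ?_)
    rw [resHom_map, resHom_map, T.res_add, ← mapOn_map, ← mapOn_map, ← mapOn_map, S.res_add]
    simp only [mapOn]
    rw [(hφ i).map_add inf_le_right, Preadditive.add_comp, Preadditive.comp_add]
  · intro V hV F G r f
    refine map_injective (hT.ext (fun i => V ⊓ c i) (fun i => inf_le_left)
      (iSup_inf_of_iSup_eq h hV) fun i => ?_)
    rw [resHom_map, resHom_map, T.res_smul, ← mapOn_map, ← mapOn_map, S.res_smul]
    simp only [mapOn]
    rw [(hφ i).map_smul inf_le_right, Linear.smul_comp, Linear.comp_smul]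

lemma IsRep.of_restrict {φ : PFunctor S T} {C : Opens X} (hC : C ≤ U) {V W : Opens X} {hV : V ≤ U}
    (G : T.Obj V hV) (w : W ≤ V) (hW : W ≤ C) (P : S.Obj W (w.trans hV))
    (ε : (T.res (w.trans hV) le_rfl).obj ((φ.app W (w.trans hV)).obj P) ⟶
      (T.res (w.trans hV) le_rfl).obj ((T.res hV w).obj G))
    (h : (φ.restrict hC).IsRep (hV := hW) ((T.res hV w).obj G) le_rfl P ε) :
    φ.IsRep G w P (ε ≫ (T.can G w le_rfl).hom) := by
  intro V₁ h₁ F Y y₁ y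
  have b := h ((S.res h₁ y₁).obj F) (h₁ := y.trans hW) Y le_rfl y
  refine Eq.mp (congrArg Function.Bijective (funext fun f => ?_))
    ((((φ.mapOnIso _ _ le_rfl y₁ (S.can F y₁ le_rfl)).homFromEquiv.bijective).comp
      ((T.can G w y).homToEquiv.bijective)).comp (b.comp
        ((S.can F y₁ le_rfl).symm.homFromEquiv.bijective)))
  change (φ.mapOnIso _ _ le_rfl y₁ (S.can F y₁ le_rfl)).inv ≫ (φ.mapOn _ P le_rfl y
    ((S.can F y₁ le_rfl).hom ≫ f) ≫ T.resHom ((φ.app W (w.trans hV)).obj P) ((T.res hV w).obj G)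
      le_rfl le_rfl y ε) ≫ (T.can G w y).hom = _
  rw [φ.mapOn_comp (w₂ := y₁) (G := F), resHom_comp (w₂ := le_rfl) (G := (T.res hV w).obj G),
    resHom_can, Category.assoc, Category.assoc]
  exact Iso.inv_hom_id_assoc (φ.mapOnIso _ _ le_rfl y₁ (S.can F y₁ le_rfl)) _

/-- The existence of a right adjoint of a functor of stacks is a local property: representing
objects are unique up to unique isomorphism, hence glue. -/
theorem hasRightAdjoint_of_cover (hS : S.IsStack) (hT : T.IsSeparated) (φ : PFunctor S T)
    {ι : Type u} (c : ι → Opens X) (hc : ∀ i, c i ≤ U) (h : (⨆ i, c i) = U)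
    (hφ : ∀ i, (φ.restrict (hc i)).HasRightAdjoint) : φ.HasRightAdjoint := by
  refine hasRightAdjoint_of_exists_isRep _ fun V hV G => ?_
  have g : ∀ i, ∃ (P : S.Obj (V ⊓ c i) (inf_le_left.trans hV)) (ε : _),
      φ.IsRep G inf_le_left P ε := fun i => by
    obtain ⟨P, ε, hP⟩ := (hφ i).exists_isRep (hV := inf_le_right)
      ((T.res hV (inf_le_left : V ⊓ c i ≤ V)).obj G)
    exact ⟨P, _, IsRep.of_restrict (hc i) G inf_le_left inf_le_right P ε hP⟩
  choose P ε b using g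
  have hm : ∀ (i j : ι) (Y : Opens X) (hi : Y ≤ V ⊓ c i) (hj : Y ≤ V ⊓ c j),
      ∃ θ : (S.res _ hj).obj (P j) ⟶ (S.res _ hi).obj (P i),
        φ.mapOn (P j) (P i) hj hi θ ≫ T.resHom _ G le_rfl inf_le_left hi (ε i) =
          T.resHom _ G le_rfl inf_le_left hj (ε j) :=
    fun i j Y hi hj => (b i (P j) Y hj hi).2 _
  choose θ hθ using hm
  let D : DescentDatum S hV (fun i => V ⊓ c i) (fun i => inf_le_left) :=
    { obj := P
      θ := θ
      res_θ := fun i j Y hi hj Z hZ => (b i (P j) Z _ _).1 (by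
        dsimp only
        rw [hθ, ← resHom_resHom _ _ _ _ hi hZ, ← φ.resHom_mapOn, ← resHom_comp, hθ, resHom_resHom])
      θ_self := fun i Y hi => (b i (P i) Y _ _).1 (by
        dsimp only
        rw [hθ, φ.mapOn_id, Category.id_comp])
      θ_comp := fun i j k Y hi hj hk => (b i (P k) Y _ _).1 (by
        dsimp only
        rw [φ.mapOn_comp, Category.assoc, hθ, hθ, hθ]) }
  have hcov : (⨆ i, V ⊓ c i) = V := iSup_inf_of_iSup_eq h hV
  obtain ⟨Q, η, hη⟩ := hS.hasEffectiveDescent.isEffective hcov D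
  let e : ∀ (i : ι) (Y : Opens X) (y : Y ≤ V ⊓ c i),
      (S.res hV (y.trans inf_le_left)).obj Q ≅ (S.res _ y).obj (P i) :=
    fun i Y y => resIso Q (P i) inf_le_left le_rfl y (η i)
  have he : ∀ (i j : ι) (Y : Opens X) (hi : Y ≤ V ⊓ c i) (hj : Y ≤ V ⊓ c j),
      (e j Y hj).hom ≫ θ i j Y hi hj = (e i Y hi).hom := hη
  have her : ∀ (i : ι) (Y : Opens X) (y : Y ≤ V ⊓ c i) (Z : Opens X) (hZ : Z ≤ Y),
      S.resHom Q (P i) (y.trans inf_le_left) y hZ (e i Y y).hom = (e i Z (hZ.trans y)).hom :=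
    fun i Y y Z hZ => resHom_resHom _ _ _ _ _ _ _
  let a : ∀ (i : ι) (Y : Opens X) (y : Y ≤ V ⊓ c i),
      (T.res hV (y.trans inf_le_left)).obj ((φ.app V hV).obj Q) ⟶
        (T.res hV (y.trans inf_le_left)).obj G :=
    fun i Y y => φ.mapOn Q (P i) _ y (e i Y y).hom ≫ T.resHom _ G le_rfl inf_le_left y (ε i)
  have har : ∀ (i : ι) (Y : Opens X) (y : Y ≤ V ⊓ c i) (Z : Opens X) (hZ : Z ≤ Y),
      T.resHom _ G (y.trans inf_le_left) (y.trans inf_le_left) hZ (a i Y y) = a i Z (hZ.trans y) := by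
    intro i Y y Z hZ
    rw [resHom_comp (w₂ := y) (G := (φ.app _ _).obj (P i)), φ.resHom_mapOn, her, resHom_resHom]
  have haij : ∀ (i j : ι) (Y : Opens X) (hi : Y ≤ V ⊓ c i) (hj : Y ≤ V ⊓ c j),
      a i Y hi = a j Y hj := by
    intro i j Y hi hj
    simp only [a]
    rw [← he i j Y hi hj, φ.mapOn_comp, Category.assoc, hθ]
  obtain ⟨δ, hδ, -⟩ := hT.existsUnique ((φ.app V hV).obj Q) G le_rfl le_rfl (fun i => V ⊓ c i)
    (fun i => inf_le_left) hcov (fun i => a i _ le_rfl)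
    (fun i j => by rw [har, har]; exact haij i j _ _ _)
  have hδ' : ∀ (i : ι) (Y : Opens X) (y : Y ≤ V ⊓ c i),
      T.resHom _ G le_rfl le_rfl (y.trans inf_le_left) δ = a i Y y := by
    intro i Y y
    have := congrArg (T.resHom _ G inf_le_left inf_le_left y) (hδ i)
    rwa [resHom_resHom, har] at this
  refine ⟨Q, δ, fun V₁ h₁ F Y y₁ y => ?_⟩
  have bloc : ∀ (i : ι) (Z : Opens X) (z₁ : Z ≤ V₁) (z : Z ≤ V ⊓ c i), Function.Bijective
      fun f : (S.res h₁ z₁).obj F ⟶ (S.res hV (z.trans inf_le_left)).obj Q =>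
        φ.mapOn F Q z₁ (z.trans inf_le_left) f ≫
          T.resHom ((φ.app V hV).obj Q) G le_rfl le_rfl (z.trans inf_le_left) δ := by
    intro i Z z₁ z
    refine Eq.mp (congrArg Function.Bijective (funext fun f => ?_))
      ((b i F Z z₁ z).comp ((e i Z z).homToEquiv.bijective))
    change φ.mapOn F (P i) z₁ z (f ≫ (e i Z z).hom) ≫ _ = _
    rw [hδ' i Z z, φ.mapOn_comp (w₂ := z.trans inf_le_left) (G := Q), Category.assoc]
  have hcovY : (⨆ i, Y ⊓ c i) = Y := iSup_inf_of_iSup_eq h (y.trans hV)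
  have hle : ∀ i, Y ⊓ c i ≤ V ⊓ c i := fun i => inf_le_inf_right _ y
  constructor
  · intro f g hfg
    refine hS.isSeparated.ext (fun i => Y ⊓ c i) (fun i => inf_le_left) hcovY fun i =>
      (bloc i _ _ (hle i)).1 ?_
    have := congrArg (T.resHom _ G y₁ y (inf_le_left : Y ⊓ c i ≤ Y)) hfg
    dsimp only at this ⊢
    rwa [resHom_comp (w₂ := y) (G := (φ.app V hV).obj Q), φ.resHom_mapOn, resHom_resHom,
      resHom_comp (w₂ := y) (G := (φ.app V hV).obj Q), φ.resHom_mapOn, resHom_resHom] at this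
  · intro g
    choose f hf using fun i => (bloc i (Y ⊓ c i) (inf_le_left.trans y₁) (hle i)).2
      (T.resHom _ G y₁ y inf_le_left g)
    dsimp only at hf
    have hfr : ∀ (i : ι) (Z : Opens X) (z : Z ≤ Y ⊓ c i),
        φ.mapOn F Q (z.trans (inf_le_left.trans y₁)) (z.trans (inf_le_left.trans y))
          (S.resHom F Q (inf_le_left.trans y₁) (inf_le_left.trans y) z (f i)) ≫
            T.resHom _ G le_rfl le_rfl (z.trans (inf_le_left.trans y)) δ =
          T.resHom _ G y₁ y (z.trans inf_le_left) g := by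
      intro i Z z
      have := congrArg (T.resHom _ G (inf_le_left.trans y₁) (inf_le_left.trans y) z) (hf i)
      rwa [resHom_comp (w₂ := inf_le_left.trans y) (G := (φ.app V hV).obj Q), φ.resHom_mapOn,
        resHom_resHom, resHom_resHom] at this
    obtain ⟨t, ht, -⟩ := hS.isSeparated.existsUnique F Q y₁ y (fun i => Y ⊓ c i)
      (fun i => inf_le_left) hcovY f (fun i j =>
        (bloc i _ _ (inf_le_left.trans (hle i))).1 ((hfr i _ _).trans (hfr j _ _).symm))
    refine ⟨t, hT.ext (fun i => Y ⊓ c i) (fun i => inf_le_left) hcovY fun i => ?_⟩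
    dsimp only
    rw [resHom_comp (w₂ := y) (G := (φ.app V hV).obj Q), φ.resHom_mapOn, resHom_resHom, ht, hf]

end

end PFunctor


/-! ### Gluing functors of stacks -/

namespace PFunctor

section

variable {X : TopCat.{u}} {𝒪 : Sheaf (Opens.grothendieckTopology X) CommRingCat.{u}} {U : Opens X}
  {S : Prestack.{w₁, v₁} 𝒪 U} {T : Prestack.{w₂, v₂} 𝒪 U}

open Prestack

section extend

variable {C C₁ C₂ : Opens X} {hC : C ≤ U} {k₁ : C₁ ≤ U} {k₂ : C₂ ≤ U}
  (φ : PFunctor (S.restrict hC) (T.restrict hC))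
  {V V₁ V₂ V₃ W W₁ W₂ Y Z : Opens X} {hV : V ≤ U} {h₁ : V₁ ≤ U} {h₂ : V₂ ≤ U} {h₃ : V₃ ≤ U}

/-- For a functor `φ` defined over `C` only, its value at `F|_{V ⊓ C}`, for `F` over `V`. -/
def extObj (F : S.Obj V hV) : T.Obj (V ⊓ C) (inf_le_right.trans hC) :=
  (φ.app (V ⊓ C) inf_le_right).obj ((S.res hV inf_le_left).obj F)

/-- The action of `φ` on a morphism `F ⟶ G` over `Y ⊆ C`. -/
def extMap (F : S.Obj V₁ h₁) (G : S.Obj V₂ h₂) (y₁ : Y ≤ V₁) (y₂ : Y ≤ V₂) (y : Y ≤ C)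
    (f : (S.res h₁ y₁).obj F ⟶ (S.res h₂ y₂).obj G) :
    (T.res _ (le_inf y₁ y)).obj (φ.extObj F) ⟶ (T.res _ (le_inf y₂ y)).obj (φ.extObj G) :=
  φ.mapOn (h₁ := inf_le_right) (h₂ := inf_le_right) ((S.res h₁ inf_le_left).obj F)
    ((S.res h₂ inf_le_left).obj G) (le_inf y₁ y) (le_inf y₂ y)
    ((S.can F inf_le_left (le_inf y₁ y)).hom ≫ f ≫ (S.can G inf_le_left (le_inf y₂ y)).inv)

/-- The action of `φ` on a morphism over `Y` whose source lives over `W ⊆ C`. -/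
def toExt (c : W ≤ C) (E : S.Obj W (c.trans hC)) (F : S.Obj V hV) (w : Y ≤ W) (v : Y ≤ V)
    (p : (S.res (c.trans hC) w).obj E ⟶ (S.res hV v).obj F) :
    (T.res (c.trans hC) w).obj ((φ.app W c).obj E) ⟶
      (T.res _ (le_inf v (w.trans c))).obj (φ.extObj F) :=
  φ.mapOn (h₁ := c) (h₂ := inf_le_right) E
    ((S.res hV inf_le_left).obj F) w (le_inf v (w.trans c))
    (p ≫ (S.can F inf_le_left (le_inf v (w.trans c))).inv)

/-- The action of `φ` on a morphism over `Y` whose target lives over `W ⊆ C`. -/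
def fromExt (c : W ≤ C) (E : S.Obj W (c.trans hC)) (F : S.Obj V hV) (w : Y ≤ W) (v : Y ≤ V)
    (p : (S.res hV v).obj F ⟶ (S.res (c.trans hC) w).obj E) :
    (T.res _ (le_inf v (w.trans c))).obj (φ.extObj F) ⟶
      (T.res (c.trans hC) w).obj ((φ.app W c).obj E) :=
  φ.mapOn (h₁ := inf_le_right) (h₂ := c)
    ((S.res hV inf_le_left).obj F) E (le_inf v (w.trans c)) w
    ((S.can F inf_le_left (le_inf v (w.trans c))).hom ≫ p)

lemma extMap_id (F : S.Obj V hV) (y : Y ≤ V) (y' : Y ≤ C) : φ.extMap F F y y y' (𝟙 _) = 𝟙 _ := by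
  rw [extMap, Category.id_comp, Iso.hom_inv_id]
  exact φ.mapOn_id _ _

lemma extMap_comp (F : S.Obj V₁ h₁) (G : S.Obj V₂ h₂) (K : S.Obj V₃ h₃) (y₁ : Y ≤ V₁)
    (y₂ : Y ≤ V₂) (y₃ : Y ≤ V₃) (y : Y ≤ C) (f : (S.res h₁ y₁).obj F ⟶ (S.res h₂ y₂).obj G)
    (g : (S.res h₂ y₂).obj G ⟶ (S.res h₃ y₃).obj K) :
    φ.extMap F K y₁ y₃ y (f ≫ g) = φ.extMap F G y₁ y₂ y f ≫ φ.extMap G K y₂ y₃ y g := by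
  refine Eq.trans ?_ (φ.mapOn_comp (h₁ := inf_le_right) (h₂ := inf_le_right)
    (h₃ := inf_le_right) _ _ _ _ _ _ _ _)
  simp only [extMap, Category.assoc, Iso.inv_hom_id_assoc]
  rfl

lemma toExt_extMap (c : W ≤ C) (E : S.Obj W (c.trans hC)) (F : S.Obj V₁ h₁) (G : S.Obj V₂ h₂)
    (w : Y ≤ W) (y₁ : Y ≤ V₁) (y₂ : Y ≤ V₂)
    (p : (S.res (c.trans hC) w).obj E ⟶ (S.res h₁ y₁).obj F)
    (f : (S.res h₁ y₁).obj F ⟶ (S.res h₂ y₂).obj G) :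
    φ.toExt c E F w y₁ p ≫ φ.extMap F G y₁ y₂ (w.trans c) f = φ.toExt c E G w y₂ (p ≫ f) := by
  refine (φ.mapOn_comp (h₁ := c) (h₂ := inf_le_right)
    (h₃ := inf_le_right) _ _ _ _ _ _ _ _).symm.trans ?_
  simp [toExt]

lemma extMap_fromExt (c : W ≤ C) (E : S.Obj W (c.trans hC)) (F : S.Obj V₁ h₁) (G : S.Obj V₂ h₂)
    (w : Y ≤ W) (y₁ : Y ≤ V₁) (y₂ : Y ≤ V₂)
    (p : (S.res h₂ y₂).obj G ⟶ (S.res (c.trans hC) w).obj E)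
    (f : (S.res h₁ y₁).obj F ⟶ (S.res h₂ y₂).obj G) :
    φ.extMap F G y₁ y₂ (w.trans c) f ≫ φ.fromExt c E G w y₂ p = φ.fromExt c E F w y₁ (f ≫ p) := by
  refine (φ.mapOn_comp (h₁ := inf_le_right) (h₂ := inf_le_right)
    (h₃ := c) _ _ _ _ _ _ _ _).symm.trans ?_
  simp [fromExt]

lemma toExt_fromExt (c₁ : W₁ ≤ C) (c₂ : W₂ ≤ C) (E₁ : S.Obj W₁ (c₁.trans hC))
    (E₂ : S.Obj W₂ (c₂.trans hC)) (F : S.Obj V hV) (w₁ : Y ≤ W₁) (w₂ : Y ≤ W₂) (y : Y ≤ V)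
    (p : (S.res _ w₁).obj E₁ ⟶ (S.res hV y).obj F) (q : (S.res hV y).obj F ⟶ (S.res _ w₂).obj E₂) :
    φ.toExt c₁ E₁ F w₁ y p ≫ φ.fromExt c₂ E₂ F w₂ y q =
      φ.mapOn (h₁ := c₁) (h₂ := c₂) E₁ E₂ w₁ w₂ (p ≫ q) := by
  refine (φ.mapOn_comp (h₁ := c₁) (h₂ := inf_le_right) (h₃ := c₂) _ _ _ _ _ _ _ _).symm.trans ?_
  simp

lemma fromExt_toExt (c : W ≤ C) (E : S.Obj W (c.trans hC)) (F : S.Obj V₁ h₁) (G : S.Obj V₂ h₂)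
    (w : Y ≤ W) (y₁ : Y ≤ V₁) (y₂ : Y ≤ V₂)
    (p : (S.res h₁ y₁).obj F ⟶ (S.res (c.trans hC) w).obj E)
    (q : (S.res (c.trans hC) w).obj E ⟶ (S.res h₂ y₂).obj G) :
    φ.fromExt c E F w y₁ p ≫ φ.toExt c E G w y₂ q = φ.extMap F G y₁ y₂ (w.trans c) (p ≫ q) := by
  refine (φ.mapOn_comp (h₁ := inf_le_right) (h₂ := c)
    (h₃ := inf_le_right) _ _ _ _ _ _ _ _).symm.trans ?_
  simp [extMap]

lemma fromExt_mapOn (c₁ : W₁ ≤ C) (c₂ : W₂ ≤ C) (E₁ : S.Obj W₁ (c₁.trans hC))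
    (E₂ : S.Obj W₂ (c₂.trans hC)) (F : S.Obj V hV) (w₁ : Y ≤ W₁) (w₂ : Y ≤ W₂) (y : Y ≤ V)
    (p : (S.res hV y).obj F ⟶ (S.res _ w₁).obj E₁) (q : (S.res _ w₁).obj E₁ ⟶ (S.res _ w₂).obj E₂) :
    φ.fromExt c₁ E₁ F w₁ y p ≫ φ.mapOn (h₁ := c₁) (h₂ := c₂) E₁ E₂ w₁ w₂ q =
      φ.fromExt c₂ E₂ F w₂ y (p ≫ q) := by
  refine (φ.mapOn_comp (h₁ := inf_le_right) (h₂ := c₁) (h₃ := c₂)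
    _ _ _ _ _ _ _ _).symm.trans ?_
  simp [fromExt]

lemma mapOn_toExt (c₁ : W₁ ≤ C) (c₂ : W₂ ≤ C) (E₁ : S.Obj W₁ (c₁.trans hC))
    (E₂ : S.Obj W₂ (c₂.trans hC)) (F : S.Obj V hV) (w₁ : Y ≤ W₁) (w₂ : Y ≤ W₂) (y : Y ≤ V)
    (p : (S.res _ w₁).obj E₁ ⟶ (S.res _ w₂).obj E₂) (q : (S.res _ w₂).obj E₂ ⟶ (S.res hV y).obj F) :
    φ.mapOn (h₁ := c₁) (h₂ := c₂) E₁ E₂ w₁ w₂ p ≫ φ.toExt c₂ E₂ F w₂ y q =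
      φ.toExt c₁ E₁ F w₁ y (p ≫ q) := by
  refine (φ.mapOn_comp (h₁ := c₁) (h₂ := c₂) (h₃ := inf_le_right) _ _ _ _ _ _ _ _).symm.trans ?_
  simp [toExt]

lemma resHom_extMap (F : S.Obj V₁ h₁) (G : S.Obj V₂ h₂) (y₁ : Y ≤ V₁) (y₂ : Y ≤ V₂) (y : Y ≤ C)
    (hZ : Z ≤ Y) (f : (S.res h₁ y₁).obj F ⟶ (S.res h₂ y₂).obj G) :
    T.resHom (φ.extObj F) (φ.extObj G) _ _ hZ (φ.extMap F G y₁ y₂ y f) =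
      φ.extMap F G (hZ.trans y₁) (hZ.trans y₂) (hZ.trans y) (S.resHom F G y₁ y₂ hZ f) := by
  refine (φ.resHom_mapOn (h₁ := inf_le_right) (h₂ := inf_le_right) _ _ _ _ hZ _).trans ?_
  refine congrArg (φ.mapOn (h₁ := inf_le_right) (h₂ := inf_le_right) _ _ _ _) ?_
  change S.resHom ((S.res h₁ inf_le_left).obj F) ((S.res h₂ inf_le_left).obj G) _ _ hZ _ = _
  rw [resHom_comp (w₂ := y₁) (G := F), resHom_comp (w₂ := y₂) (G := G), resHom_can,
    resHom_can_inv]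

lemma resHom_toExt (c : W ≤ C) (E : S.Obj W (c.trans hC)) (F : S.Obj V hV) (w : Y ≤ W) (v : Y ≤ V)
    (hZ : Z ≤ Y) (p : (S.res (c.trans hC) w).obj E ⟶ (S.res hV v).obj F) :
    T.resHom ((φ.app W c).obj E) (φ.extObj F) _ _ hZ (φ.toExt c E F w v p) =
      φ.toExt c E F (hZ.trans w) (hZ.trans v) (S.resHom E F w v hZ p) := by
  refine (φ.resHom_mapOn (h₁ := c) (h₂ := inf_le_right) _ _ _ _ hZ _).trans ?_
  refine congrArg (φ.mapOn (h₁ := c) (h₂ := inf_le_right) _ _ _ _) ?_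
  change S.resHom E ((S.res hV inf_le_left).obj F) _ _ hZ _ = _
  rw [resHom_comp (w₂ := v) (G := F), resHom_can_inv]

lemma resHom_fromExt (c : W ≤ C) (E : S.Obj W (c.trans hC)) (F : S.Obj V hV) (w : Y ≤ W)
    (v : Y ≤ V) (hZ : Z ≤ Y) (p : (S.res hV v).obj F ⟶ (S.res (c.trans hC) w).obj E) :
    T.resHom (φ.extObj F) ((φ.app W c).obj E) _ _ hZ (φ.fromExt c E F w v p) =
      φ.fromExt c E F (hZ.trans w) (hZ.trans v) (S.resHom F E v w hZ p) := by
  refine (φ.resHom_mapOn (h₁ := inf_le_right) (h₂ := c) _ _ _ _ hZ _).trans ?_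
  refine congrArg (φ.mapOn (h₁ := inf_le_right) (h₂ := c) _ _ _ _) ?_
  change S.resHom ((S.res hV inf_le_left).obj F) E _ _ hZ _ = _
  rw [resHom_comp (w₂ := v) (G := F), resHom_can]

variable {φ₁ : PFunctor (S.restrict k₁) (T.restrict k₁)}
  {φ₂ : PFunctor (S.restrict k₂) (T.restrict k₂)} {c₁ : C ≤ C₁} {c₂ : C ≤ C₂}

/-- Naturality of a transformation over `C`, for objects over open subsets of `C`. -/
lemma naturalityOn_restrict₂ (α : φ₁.restrict c₁ ⟶ φ₂.restrict c₂) (w₁ : W₁ ≤ C) (w₂ : W₂ ≤ C)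
    (E₁ : S.Obj W₁ (w₁.trans (c₁.trans k₁))) (E₂ : S.Obj W₂ (w₂.trans (c₁.trans k₁)))
    (y₁ : Y ≤ W₁) (y₂ : Y ≤ W₂) (f : (S.res _ y₁).obj E₁ ⟶ (S.res _ y₂).obj E₂) :
    φ₁.mapOn (h₁ := w₁.trans c₁) (h₂ := w₂.trans c₁) E₁ E₂ y₁ y₂ f ≫
        (T.res (w₂.trans (c₁.trans k₁)) y₂).map ((α.app W₂ w₂).app E₂) =
      (T.res (w₁.trans (c₁.trans k₁)) y₁).map ((α.app W₁ w₁).app E₁) ≫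
        φ₂.mapOn (h₁ := w₁.trans c₂) (h₂ := w₂.trans c₂) E₁ E₂ y₁ y₂ f :=
  Hom.naturalityOn α E₁ E₂ y₁ y₂ f

/-- The component of a transformation `α` defined over `C`, at an object `F` over a larger open
subset, as a morphism over `Y ⊆ C`. -/
def extHom (α : φ₁.restrict c₁ ⟶ φ₂.restrict c₂) (F : S.Obj V hV) (y : Y ≤ V) (c : Y ≤ C) :
    (T.res _ (le_inf y (c.trans c₁))).obj (φ₁.extObj F) ⟶
      (T.res _ (le_inf y (c.trans c₂))).obj (φ₂.extObj F) :=
  φ₁.fromExt (c.trans c₁) ((S.res hV y).obj F) F le_rfl y (S.can F y le_rfl).inv ≫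
    (T.res (y.trans hV) le_rfl).map ((α.app Y c).app ((S.res hV y).obj F)) ≫
    φ₂.toExt (c.trans c₂) ((S.res hV y).obj F) F le_rfl y (S.can F y le_rfl).hom

/-- `extHom` may be computed with any object isomorphic to `F` over `Y`. -/
lemma extHom_eq (α : φ₁.restrict c₁ ⟶ φ₂.restrict c₂) (F : S.Obj V hV) (y : Y ≤ V) (w : W ≤ C)
    (E : S.Obj W (w.trans (c₁.trans k₁))) (y' : Y ≤ W)
    (p : (S.res _ y').obj E ≅ (S.res hV y).obj F) :
    extHom α F y (y'.trans w) = φ₁.fromExt (w.trans c₁) E F y' y p.inv ≫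
      (T.res (w.trans (c₁.trans k₁)) y').map ((α.app W w).app E) ≫
        φ₂.toExt (w.trans c₂) E F y' y p.hom := by
  have n := naturalityOn_restrict₂ α (y'.trans w) w ((S.res hV y).obj F) E le_rfl y'
    ((S.can F y le_rfl).hom ≫ p.inv)
  have a : φ₁.fromExt ((y'.trans w).trans c₁) ((S.res hV y).obj F) F le_rfl y
      (S.can F y le_rfl).inv ≫ φ₁.mapOn (h₁ := (y'.trans w).trans c₁) (h₂ := w.trans c₁)
        ((S.res hV y).obj F) E le_rfl y' ((S.can F y le_rfl).hom ≫ p.inv) =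
      φ₁.fromExt (w.trans c₁) E F y' y p.inv := by
    rw [fromExt_mapOn, Iso.inv_hom_id_assoc]
  have b : φ₂.mapOn (h₁ := (y'.trans w).trans c₂) (h₂ := w.trans c₂)
        ((S.res hV y).obj F) E le_rfl y' ((S.can F y le_rfl).hom ≫ p.inv) ≫
        φ₂.toExt (w.trans c₂) E F y' y p.hom =
      φ₂.toExt ((y'.trans w).trans c₂) ((S.res hV y).obj F) F le_rfl y (S.can F y le_rfl).hom := by
    rw [mapOn_toExt, Category.assoc, Iso.inv_hom_id, Category.comp_id]
  rw [extHom, ← a, ← b, Category.assoc, reassoc_of% n]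

lemma resHom_extHom (α : φ₁.restrict c₁ ⟶ φ₂.restrict c₂) (F : S.Obj V hV) (y : Y ≤ V)
    (c : Y ≤ C) (hZ : Z ≤ Y) :
    T.resHom (φ₁.extObj F) (φ₂.extObj F) _ _ hZ (extHom α F y c) =
      extHom α F (hZ.trans y) (hZ.trans c) := by
  rw [extHom_eq α F (hZ.trans y) c ((S.res hV y).obj F) hZ (S.can F y hZ), extHom,
    resHom_comp (S := T) (w₂ := le_rfl) (G := (φ₁.app Y (c.trans c₁)).obj ((S.res hV y).obj F)),
    resHom_comp (S := T) (w₂ := le_rfl) (G := (φ₂.app Y (c.trans c₂)).obj ((S.res hV y).obj F)),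
    resHom_fromExt, resHom_toExt, resHom_map, resHom_can, resHom_can_inv]

lemma extMap_extHom (α : φ₁.restrict c₁ ⟶ φ₂.restrict c₂) (F : S.Obj V₁ h₁) (G : S.Obj V₂ h₂)
    (y₁ : Y ≤ V₁) (y₂ : Y ≤ V₂) (c : Y ≤ C) (f : (S.res h₁ y₁).obj F ⟶ (S.res h₂ y₂).obj G) :
    φ₁.extMap F G y₁ y₂ (c.trans c₁) f ≫ extHom α G y₂ c =
      extHom α F y₁ c ≫ φ₂.extMap F G y₁ y₂ (c.trans c₂) f := by
  have n := naturalityOn_restrict₂ α c c ((S.res h₁ y₁).obj F) ((S.res h₂ y₂).obj G) le_rfl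
    le_rfl ((S.can F y₁ le_rfl).hom ≫ f ≫ (S.can G y₂ le_rfl).inv)
  have a : φ₁.extMap F G y₁ y₂ (c.trans c₁) f ≫
      φ₁.fromExt (c.trans c₁) ((S.res h₂ y₂).obj G) G le_rfl y₂ (S.can G y₂ le_rfl).inv =
      φ₁.fromExt (c.trans c₁) ((S.res h₁ y₁).obj F) F le_rfl y₁ (S.can F y₁ le_rfl).inv ≫
        φ₁.mapOn (h₁ := c.trans c₁) (h₂ := c.trans c₁) ((S.res h₁ y₁).obj F)
          ((S.res h₂ y₂).obj G) le_rfl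
          le_rfl ((S.can F y₁ le_rfl).hom ≫ f ≫ (S.can G y₂ le_rfl).inv) := by
    rw [fromExt_mapOn, Iso.inv_hom_id_assoc]
    exact φ₁.extMap_fromExt (c.trans c₁) ((S.res h₂ y₂).obj G) F G le_rfl y₁ y₂ _ f
  have b : φ₂.toExt (c.trans c₂) ((S.res h₁ y₁).obj F) F le_rfl y₁ (S.can F y₁ le_rfl).hom ≫
        φ₂.extMap F G y₁ y₂ (c.trans c₂) f =
      φ₂.mapOn (h₁ := c.trans c₂) (h₂ := c.trans c₂) ((S.res h₁ y₁).obj F)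
          ((S.res h₂ y₂).obj G) le_rfl
          le_rfl ((S.can F y₁ le_rfl).hom ≫ f ≫ (S.can G y₂ le_rfl).inv) ≫
        φ₂.toExt (c.trans c₂) ((S.res h₂ y₂).obj G) G le_rfl y₂ (S.can G y₂ le_rfl).hom := by
    rw [mapOn_toExt]
    refine (φ₂.toExt_extMap (c.trans c₂) ((S.res h₁ y₁).obj F) F G le_rfl y₁ y₂ _ f).trans ?_
    rw [Category.assoc, Category.assoc, Iso.inv_hom_id, Category.comp_id]
  rw [extHom, extHom, ← Category.assoc, a, Category.assoc, reassoc_of% n, ← b]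
  simp only [Category.assoc]

end extend

/-- Functors to a stack, defined locally and related by a cocycle of transformations, glue: the
value at `F` of the glued functor is obtained by descent from the values at the restrictions of
`F`. -/
theorem exists_glue (hT : T.IsStack) {ι : Type u} (c : ι → Opens X) (hc : ∀ i, c i ≤ U)
    (h : (⨆ i, c i) = U) (φ : ∀ i, PFunctor (S.restrict (hc i)) (T.restrict (hc i)))
    (θ : ∀ i j, (φ j).restrict (inf_le_right : c i ⊓ c j ≤ c j) ⟶ (φ i).restrict inf_le_left)
    (hθ₁ : ∀ (i : ι) (Z : Opens X) (hi : Z ≤ c i) (F : S.Obj Z (hi.trans (hc i))),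
      ((θ i i).app Z (le_inf hi hi)).app F = 𝟙 _)
    (hθ : ∀ (i j k : ι) (Z : Opens X) (hi : Z ≤ c i) (hj : Z ≤ c j) (hk : Z ≤ c k)
      (F : S.Obj Z (hi.trans (hc i))),
      ((θ j k).app Z (le_inf hj hk)).app F ≫ ((θ i j).app Z (le_inf hi hj)).app F =
        ((θ i k).app Z (le_inf hi hk)).app F) :
    ∃ (ψ : PFunctor S T) (η : ∀ i, ψ.restrict (hc i) ≅ φ i), ∀ (i j : ι) (Z : Opens X)
      (hi : Z ≤ c i) (hj : Z ≤ c j) (F : S.Obj Z (hi.trans (hc i))),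
      ((η j).hom.app Z hj).app F ≫ ((θ i j).app Z (le_inf hi hj)).app F =
        ((η i).hom.app Z hi).app F := by
  let D : ∀ (V : Opens X) (hV : V ≤ U) (F : S.Obj V hV),
      DescentDatum T hV (fun i => V ⊓ c i) (fun i => inf_le_left) := fun V hV F =>
    { obj := fun i => (φ i).extObj F
      θ := fun i j Y hi hj => extHom (θ i j) F (hi.trans inf_le_left)
        (le_inf (hi.trans inf_le_right) (hj.trans inf_le_right))
      res_θ := fun i j Y hi hj Z hZ => resHom_extHom (θ i j) F _ _ hZ
      θ_self := fun i Y hi => by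
        rw [extHom, hθ₁ i Y (hi.trans inf_le_right)]
        refine (congrArg (fun t => _ ≫ t ≫ _) ((T.res _ le_rfl).map_id _)).trans ?_
        rw [Category.id_comp, fromExt_toExt, Iso.inv_hom_id, extMap_id]
      θ_comp := fun i j k Y hi hj hk => by
        rw [extHom, extHom, extHom, ← hθ i j k Y (hi.trans inf_le_right) (hj.trans inf_le_right)
          (hk.trans inf_le_right)]
        simp only [Category.assoc]
        rw [← Category.assoc (toExt _ _ _ _ _ _ _), toExt_fromExt, Iso.hom_inv_id, mapOn_id]
        erw [Category.id_comp]
        refine congrArg (fun t => _ ≫ t) ?_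
        rw [← Category.assoc]
        refine congrArg (fun t => t ≫ _) ?_
        exact ((T.res _ _).map_comp _ _).symm }
  choose G e he using fun V hV F => hT.hasEffectiveDescent.isEffective
    (iSup_inf_of_iSup_eq h hV) (D V hV F)
  let r : ∀ {V : Opens X} {hV : V ≤ U} (F : S.Obj V hV) (i : ι) (Y : Opens X) (y : Y ≤ V)
      (hi : Y ≤ c i), (T.res hV y).obj (G V hV F) ≅
        (T.res _ (le_inf y hi)).obj ((φ i).extObj F) := fun {V hV} F i Y y hi =>
    resIso (G V hV F) ((φ i).extObj F) inf_le_left le_rfl (le_inf y hi) (e V hV F i)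
  have hr : ∀ {V : Opens X} {hV : V ≤ U} (F : S.Obj V hV) (i : ι) (Y Z : Opens X) (y : Y ≤ V)
      (hi : Y ≤ c i) (hZ : Z ≤ Y),
      T.resHom (G V hV F) ((φ i).extObj F) y (le_inf y hi) hZ (r F i Y y hi).hom =
        (r F i Z (hZ.trans y) (hZ.trans hi)).hom :=
    fun F i Y Z y hi hZ => resHom_resHom _ _ _ _ _ _ _
  have hr' : ∀ {V : Opens X} {hV : V ≤ U} (F : S.Obj V hV) (i : ι) (Y Z : Opens X) (y : Y ≤ V)
      (hi : Y ≤ c i) (hZ : Z ≤ Y),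
      T.resHom ((φ i).extObj F) (G V hV F) (le_inf y hi) y hZ (r F i Y y hi).inv =
        (r F i Z (hZ.trans y) (hZ.trans hi)).inv :=
    fun F i Y Z y hi hZ => resHom_resHom _ _ _ _ _ _ _
  have rθ : ∀ {V : Opens X} {hV : V ≤ U} (F : S.Obj V hV) (i j : ι) (Y : Opens X) (y : Y ≤ V)
      (hi : Y ≤ c i) (hj : Y ≤ c j),
      (r F j Y y hj).hom ≫ extHom (θ i j) F y (le_inf hi hj) = (r F i Y y hi).hom :=
    fun {V hV} F i j Y y hi hj => he V hV F i j Y (le_inf y hi) (le_inf y hj)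
  let s : ∀ {V₁ V₂ : Opens X} {h₁ : V₁ ≤ U} {h₂ : V₂ ≤ U} (F : S.Obj V₁ h₁) (G' : S.Obj V₂ h₂)
      (i : ι) (Y : Opens X) (y₁ : Y ≤ V₁) (y₂ : Y ≤ V₂) (hi : Y ≤ c i)
      (f : (S.res h₁ y₁).obj F ⟶ (S.res h₂ y₂).obj G'),
      (T.res h₁ y₁).obj (G V₁ h₁ F) ⟶ (T.res h₂ y₂).obj (G V₂ h₂ G') :=
    fun F G' i Y y₁ y₂ hi f =>
      (r F i Y y₁ hi).hom ≫ (φ i).extMap F G' y₁ y₂ hi f ≫ (r G' i Y y₂ hi).inv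
  have hs : ∀ {V₁ V₂ : Opens X} {h₁ : V₁ ≤ U} {h₂ : V₂ ≤ U} (F : S.Obj V₁ h₁) (G' : S.Obj V₂ h₂)
      (i : ι) (Y Z : Opens X) (y₁ : Y ≤ V₁) (y₂ : Y ≤ V₂) (hi : Y ≤ c i) (hZ : Z ≤ Y)
      (f : (S.res h₁ y₁).obj F ⟶ (S.res h₂ y₂).obj G'),
      T.resHom (G V₁ h₁ F) (G V₂ h₂ G') y₁ y₂ hZ (s F G' i Y y₁ y₂ hi f) =
        s F G' i Z (hZ.trans y₁) (hZ.trans y₂) (hZ.trans hi) (S.resHom F G' y₁ y₂ hZ f) := by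
    intro V₁ V₂ h₁ h₂ F G' i Y Z y₁ y₂ hi hZ f
    rw [resHom_comp (w₂ := le_inf y₁ hi) (G := (φ i).extObj F),
      resHom_comp (w₂ := le_inf y₂ hi) (G := (φ i).extObj G'), hr F i Y Z y₁ hi hZ, hr' G' i Y Z y₂ hi hZ,
      resHom_extMap]
  have sij : ∀ {V₁ V₂ : Opens X} {h₁ : V₁ ≤ U} {h₂ : V₂ ≤ U} (F : S.Obj V₁ h₁)
      (G' : S.Obj V₂ h₂) (i j : ι) (Y : Opens X) (y₁ : Y ≤ V₁) (y₂ : Y ≤ V₂) (hi : Y ≤ c i)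
      (hj : Y ≤ c j) (f : (S.res h₁ y₁).obj F ⟶ (S.res h₂ y₂).obj G'),
      s F G' i Y y₁ y₂ hi f = s F G' j Y y₁ y₂ hj f := by
    intro V₁ V₂ h₁ h₂ F G' i j Y y₁ y₂ hi hj f
    have n := extMap_extHom (θ i j) F G' y₁ y₂ (le_inf hi hj) f
    rw [← cancel_mono (r G' i Y y₂ hi).hom]
    simp only [s, Category.assoc, Iso.inv_hom_id, Category.comp_id]
    rw [← rθ F i j Y y₁ hi hj, ← rθ G' i j Y y₂ hi hj, Iso.inv_hom_id_assoc, Category.assoc, n]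
  have g : ∀ {V₁ V₂ W : Opens X} {h₁ : V₁ ≤ U} {h₂ : V₂ ≤ U} (F : S.Obj V₁ h₁)
      (G' : S.Obj V₂ h₂) (w₁ : W ≤ V₁) (w₂ : W ≤ V₂)
      (f : (S.res h₁ w₁).obj F ⟶ (S.res h₂ w₂).obj G'),
      ∃ t : (T.res h₁ w₁).obj (G V₁ h₁ F) ⟶ (T.res h₂ w₂).obj (G V₂ h₂ G'),
        ∀ (i : ι) (Y : Opens X) (hY : Y ≤ W) (hi : Y ≤ c i),
          T.resHom (G V₁ h₁ F) (G V₂ h₂ G') w₁ w₂ hY t =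
            s F G' i Y (hY.trans w₁) (hY.trans w₂) hi (S.resHom F G' w₁ w₂ hY f) := by
    intro V₁ V₂ W h₁ h₂ F G' w₁ w₂ f
    obtain ⟨t, ht, -⟩ := hT.isSeparated.existsUnique (G V₁ h₁ F) (G V₂ h₂ G') w₁ w₂
      (fun i => W ⊓ c i) (fun i => inf_le_left) (iSup_inf_of_iSup_eq h (w₁.trans h₁))
      (fun i => s F G' i _ (inf_le_left.trans w₁) (inf_le_left.trans w₂) inf_le_right
        (S.resHom F G' w₁ w₂ inf_le_left f)) (fun i j => by
        rw [hs, hs, resHom_resHom, resHom_resHom]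
        exact sij _ _ _ _ _ _ _ _ _ _)
    refine ⟨t, fun i Y hY hi => ?_⟩
    have := congrArg (T.resHom _ _ (inf_le_left.trans w₁) (inf_le_left.trans w₂)
      (le_inf hY hi)) (ht i)
    rwa [resHom_resHom, hs, resHom_resHom] at this
  choose t ht using @g
  have tu : ∀ {V₁ V₂ W : Opens X} {h₁ : V₁ ≤ U} {h₂ : V₂ ≤ U} (F : S.Obj V₁ h₁)
      (G' : S.Obj V₂ h₂) (w₁ : W ≤ V₁) (w₂ : W ≤ V₂)
      (t₁ t₂ : (T.res h₁ w₁).obj (G V₁ h₁ F) ⟶ (T.res h₂ w₂).obj (G V₂ h₂ G')),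
      (∀ (i : ι) (Y : Opens X) (hY : Y ≤ W) (_ : Y ≤ c i),
          T.resHom (G V₁ h₁ F) (G V₂ h₂ G') w₁ w₂ hY t₁ =
            T.resHom (G V₁ h₁ F) (G V₂ h₂ G') w₁ w₂ hY t₂) → t₁ = t₂ :=
    fun {V₁ V₂ W h₁ h₂} F G' w₁ w₂ t₁ t₂ h' => hT.isSeparated.ext (fun i => W ⊓ c i)
      (fun i => inf_le_left)
      (iSup_inf_of_iSup_eq h (w₁.trans h₁)) fun i => h' i _ _ inf_le_right
  let K : Core S T :=
    { obj := G
      mapOn := t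
      mapOn_id := fun F w => tu _ _ _ _ _ _ fun i Y hY hi => by
        rw [ht _ _ _ _ _ i Y hY hi, resHom_id, resHom_id]
        simp only [s]
        rw [extMap_id, Category.id_comp, Iso.hom_inv_id]
      mapOn_comp := fun F G' H w₁ w₂ w₃ f g => tu _ _ _ _ _ _ fun i Y hY hi => by
        rw [ht _ _ _ _ _ i Y hY hi, resHom_comp (w₂ := w₂) (G := G'),
          resHom_comp (w₂ := w₂) (G := G _ _ G'),
          ht _ _ _ _ _ i Y hY hi, ht _ _ _ _ _ i Y hY hi]
        simp only [s]
        rw [extMap_comp (G := G') (y₂ := hY.trans w₂)]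
        simp
      resHom_mapOn := fun F G' w₁ w₂ hY f => tu _ _ _ _ _ _ fun i Z hZ hi => by
        rw [ht _ _ _ _ _ i Z hZ hi, resHom_resHom, ht _ _ _ _ _ i Z _ hi, resHom_resHom] }
  let q : ∀ {i : ι} {Z : Opens X} (hi : Z ≤ c i) (E : S.Obj Z (hi.trans (hc i))) (W : Opens X)
      (w : W ≤ Z), (T.res (hi.trans (hc i)) w).obj (G Z _ E) ≅
        (T.res (hi.trans (hc i)) w).obj (((φ i).app Z hi).obj E) := fun {i Z} hi E W w =>
    r E i W w (w.trans hi) ≪≫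
      { hom := (φ i).fromExt hi E E w w (𝟙 _)
        inv := (φ i).toExt hi E E w w (𝟙 _)
        hom_inv_id := by rw [fromExt_toExt, Category.id_comp, extMap_id]
        inv_hom_id := by rw [toExt_fromExt, Category.id_comp]; exact (φ i).mapOn_id _ _ }
  have hq : ∀ {i : ι} {Z : Opens X} (hi : Z ≤ c i) (E : S.Obj Z (hi.trans (hc i))) (W : Opens X)
      (w : W ≤ Z), (T.res (hi.trans (hc i)) w).map (down (q hi E Z le_rfl).hom) =
        (q hi E W w).hom := by
    intro i Z hi E W w
    rw [Prestack.map_down]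
    simp only [q, Iso.trans_hom]
    rw [resHom_comp (w₂ := le_inf le_rfl hi) (G := (φ i).extObj E), hr E i Z W le_rfl hi w,
      resHom_fromExt, resHom_id]
  refine ⟨K.toPFunctor, fun i => isoOfHom (homMk (fun Z hi E => down (q hi E Z le_rfl).hom) ?_)
    fun Z hi E => ⟨down (q hi E Z le_rfl).inv, ?_, ?_⟩, fun i j Z hi hj E => ?_⟩
  · intro V₁ V₂ W z₁ z₂ E E' w₁ w₂ f
    have a : K.toPFunctor.mapOn E E' w₁ w₂ f = s E E' i W w₁ w₂ (w₁.trans z₁) f := by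
      rw [K.toPFunctor_mapOn]
      have := ht E E' w₁ w₂ f i W le_rfl (w₁.trans z₁)
      rwa [resHom_self, resHom_self] at this
    refine (congrArg (fun t => t ≫ _) a).trans ?_
    refine (congrArg (fun t => _ ≫ t) (hq z₂ E' W w₂)).trans
      (Eq.trans ?_ (congrArg (fun t => t ≫ _) (hq z₁ E W w₁).symm))
    have b₁ := (φ i).extMap_fromExt z₂ E' E E' w₂ w₁ w₂ (𝟙 _) f
    have b₂ := (φ i).fromExt_mapOn z₁ z₂ E E' E w₁ w₂ w₁ (𝟙 _) f
    rw [Category.comp_id] at b₁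
    rw [Category.id_comp] at b₂
    change s E E' i W w₁ w₂ (w₁.trans z₁) f ≫ (q z₂ E' W w₂).hom = (q z₁ E W w₁).hom ≫
      (show (T.res (z₁.trans (hc i)) w₁).obj (((φ i).app _ z₁).obj E) ⟶
        (T.res (z₂.trans (hc i)) w₂).obj (((φ i).app _ z₂).obj E') from
          (φ i).mapOn (h₁ := z₁) (h₂ := z₂) E E' w₁ w₂ f)
    simp only [s, q, Iso.trans_hom, Category.assoc, Iso.inv_hom_id_assoc]
    exact congrArg (fun t => _ ≫ t) (b₁.trans b₂.symm)
  · exact (Prestack.down_comp _ _).symm.trans ((congrArg down (Iso.hom_inv_id _)).trans (down_id _))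
  · exact (Prestack.down_comp _ _).symm.trans ((congrArg down (Iso.inv_hom_id _)).trans (down_id _))
  · apply map_injective
    refine ((T.res _ le_rfl).map_comp _ _).trans ?_
    refine (congrArg (fun t => t ≫ _) (hq hj E Z le_rfl)).trans
      (Eq.trans ?_ (hq hi E Z le_rfl).symm)
    have a := extHom_eq (θ i j) E le_rfl (le_inf hi hj) E le_rfl (Iso.refl _)
    have b := rθ E i j Z le_rfl hi hj
    rw [a] at b
    have c' := (φ i).toExt_fromExt hi hi E E E le_rfl le_rfl le_rfl (𝟙 _) (𝟙 _)
    rw [Category.comp_id] at c'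
    replace c' := c'.trans ((φ i).mapOn_id (hV := hi) E le_rfl)
    change (q hj E Z le_rfl).hom ≫ (T.res (hj.trans (hc j)) le_rfl).map
      (((θ i j).app Z (le_inf hi hj)).app E) = (q hi E Z le_rfl).hom
    simp only [q, Iso.trans_hom]
    rw [← b]
    simp only [Category.assoc]
    exact congrArg (fun t => (r E j Z le_rfl hj).hom ≫
      (φ j).fromExt hj E E le_rfl le_rfl (𝟙 _) ≫ t) ((Category.comp_id _).symm.trans
        (congrArg (fun t => (T.res (hj.trans (hc j)) le_rfl).map
          (((θ i j).app Z (le_inf hi hj)).app E) ≫ t) c'.symm))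

end

end PFunctor

section

variable {X : TopCat.{u}} {𝒪 : Sheaf (Opens.grothendieckTopology X) CommRingCat.{u}} {U : Opens X}
  {S : Prestack.{w₁, v₁} 𝒪 U} {T : Prestack.{w₂, v₂} 𝒪 U}

open Prestack

lemma Prestack.IsStack.restrict (hT : T.IsStack) {V : Opens X} (hV : V ≤ U) :
    (T.restrict hV).IsStack where
  isSeparated W hW := hT.isSeparated W (hW.trans hV)
  hasEffectiveDescent W hW := hT.hasEffectiveDescent W (hW.trans hV)

lemma HomR.resHom_app {V₁ V₂ W Y Z : Opens X} {h₁ : V₁ ≤ U} {h₂ : V₂ ≤ U}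
    (F : (HomR S T).Obj V₁ h₁) (G : (HomR S T).Obj V₂ h₂) (w₁ : W ≤ V₁) (w₂ : W ≤ V₂) (hY : Y ≤ W)
    (f : ((HomR S T).res h₁ w₁).obj F ⟶ ((HomR S T).res h₂ w₂).obj G) (hZ : Z ≤ Y) :
    PFunctor.Hom.app ((HomR S T).resHom F G w₁ w₂ hY f).hom Z hZ =
      PFunctor.Hom.app f.hom Z (hZ.trans hY) :=
  (Category.id_comp _).trans (Category.comp_id _)

/-- The functors between two stacks admitting a right adjoint form a stack. -/
theorem HomR.isStack (hS : S.IsStack) (hT : T.IsStack) : (HomR S T).IsStack where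
  isSeparated V hV F G W hW ι c hc h s hs := by
    obtain ⟨β, hβ, hβ'⟩ := PFunctor.existsUnique_hom (hT.restrict (hW.trans hV)).isSeparated
      (F.obj.restrict hW) (G.obj.restrict hW) c hc h (fun i => (s i).hom) (fun i j Z hi hj => by
        have := congrArg (fun t => PFunctor.Hom.app t.hom Z (le_inf hi hj)) (hs i j)
        dsimp only at this
        rwa [HomR.resHom_app, HomR.resHom_app] at this)
    refine ⟨ObjectProperty.homMk β, fun i => ObjectProperty.hom_ext _ (PFunctor.hom_ext fun Z hZ => ?_),
      fun r hr => ObjectProperty.hom_ext _ (hβ' r.hom fun i Z hi => ?_)⟩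
    · exact (HomR.resHom_app F G hW hW (hc i) _ hZ).trans (hβ i Z hZ)
    · rw [← hr i]
      exact (HomR.resHom_app F G hW hW (hc i) _ hi).symm
  hasEffectiveDescent := hasEffectiveDescent_of_isEffective fun V hV ι c hc h D => by
    let φ : ∀ i, PFunctor ((S.restrict hV).restrict (hc i)) ((T.restrict hV).restrict (hc i)) :=
      fun i => (D.obj i).obj
    let θ : ∀ i j, (φ j).restrict (inf_le_right : c i ⊓ c j ≤ c j) ⟶ (φ i).restrict inf_le_left :=
      fun i j => (D.θ i j _ inf_le_left inf_le_right).hom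
    have hθ : ∀ (i j : ι) (Y Z : Opens X) (hi : Y ≤ c i) (hj : Y ≤ c j) (hZ : Z ≤ Y),
        (θ i j).app Z (le_inf (hZ.trans hi) (hZ.trans hj)) =
          PFunctor.Hom.app (D.θ i j Y hi hj).hom Z hZ := by
      intro i j Y Z hi hj hZ
      rw [← D.res_θ i j _ inf_le_left inf_le_right Y (le_inf hi hj), HomR.resHom_app]
    obtain ⟨ψ, η, hη⟩ := PFunctor.exists_glue (hT.restrict hV) c hc h φ θ
      (fun i Z hi F => by
        have := hθ i i Z Z hi hi le_rfl
        rw [D.θ_self] at this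
        exact congrArg (fun t => NatTrans.app t F) this)
      (fun i j k Z hi hj hk F => by
        have := congrArg (fun t => (PFunctor.Hom.app t.hom Z le_rfl).app F)
          (D.θ_comp i j k Z hi hj hk)
        have a₁ := congrArg (fun t => NatTrans.app t F) (hθ i j Z Z hi hj le_rfl)
        have a₂ := congrArg (fun t => NatTrans.app t F) (hθ j k Z Z hj hk le_rfl)
        have a₃ := congrArg (fun t => NatTrans.app t F) (hθ i k Z Z hi hk le_rfl)
        refine Eq.trans ?_ (this.trans a₃.symm)
        exact congrArg₂ (fun s t => s ≫ t) a₂ a₁)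
    have hl : ψ.IsLinear := PFunctor.isLinear_of_cover (hT.restrict hV).isSeparated ψ c hc h
      fun i => (D.obj i).property.1.of_iso (η i).symm
    have hr : ψ.HasRightAdjoint := PFunctor.hasRightAdjoint_of_cover (hS.restrict hV)
      (hT.restrict hV).isSeparated ψ c hc h
      fun i => (D.obj i).property.2.of_iso (η i).symm
    refine ⟨⟨ψ, hl, hr⟩, fun i => ObjectProperty.isoMk _ (η i), fun i j Y hi hj => ?_⟩
    refine ObjectProperty.hom_ext _ (PFunctor.hom_ext fun Z hZ => NatTrans.ext (funext fun F => ?_))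
    have a := congrArg (fun t => NatTrans.app t F) (hθ i j Y Z hi hj hZ)
    have b₁ := congrArg (fun t => NatTrans.app t F) (HomR.resHom_app (S := S) (T := T)
      (⟨ψ, hl, hr⟩ : (HomR S T).Obj V hV) (D.obj j) (hc j) le_rfl hj
      (ObjectProperty.homMk (η j).hom) hZ)
    have b₂ := congrArg (fun t => NatTrans.app t F) (HomR.resHom_app (S := S) (T := T)
      (⟨ψ, hl, hr⟩ : (HomR S T).Obj V hV) (D.obj i) (hc i) le_rfl hi
      (ObjectProperty.homMk (η i).hom) hZ)
    refine Eq.trans ?_ ((hη i j Z (hZ.trans hi) (hZ.trans hj) F).trans b₂.symm)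
    exact congrArg₂ (fun s t => s ≫ t) b₁ a.symm

end

/-! ### Sheaves on the site of open subsets of an open subset -/

section OverSite

variable {X : TopCat.{u}} {U : Opens X}

lemma mem_over_iff_exists {T : Over U} (R : Sieve T) :
    R ∈ (Opens.grothendieckTopology X).over U T ↔
      ∀ x ∈ T.left, ∃ (T' : Over U) (f : T' ⟶ T), R f ∧ x ∈ T'.left := by
  rw [GrothendieckTopology.mem_over_iff, Opens.mem_grothendieckTopology]
  refine forall₂_congr fun x _ => ⟨?_, ?_⟩
  · rintro ⟨V, f, hf, hx⟩
    rw [Sieve.overEquiv_iff] at hf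
    exact ⟨_, _, hf, hx⟩
  · rintro ⟨T', f, hf, hx⟩
    refine ⟨T'.left, f.left, ?_, hx⟩
    rw [Sieve.overEquiv_iff]
    exact hf

variable (P : (Over U)ᵒᵖ ⥤ Type u)

/-- Restriction of sections of a presheaf on `U`. -/
def overRes {V W : Opens X} (hV : V ≤ U) (hW : W ≤ V) (s : P.obj (op (Over.mk (homOfLE hV)))) :
    P.obj (op (Over.mk (homOfLE (hW.trans hV)))) :=
  P.map (Over.homMk (homOfLE hW) :
    Over.mk (homOfLE (hW.trans hV)) ⟶ Over.mk (homOfLE hV)).op s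

lemma overRes_self {V : Opens X} (hV : V ≤ U) (s : P.obj (op (Over.mk (homOfLE hV)))) :
    overRes P hV le_rfl s = s :=
  P.map_id_apply _ s

lemma overRes_overRes {V W Y : Opens X} (hV : V ≤ U) (hW : W ≤ V) (hY : Y ≤ W)
    (s : P.obj (op (Over.mk (homOfLE hV)))) :
    overRes P (hW.trans hV) hY (overRes P hV hW s) = overRes P hV (hY.trans hW) s :=
  (P.map_comp_apply _ _ s).symm

/-- A presheaf on `U` is a sheaf if and only if compatible sections over the members of an open
covering glue in a unique way. -/
lemma isSheaf_over_iff :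
    Presieve.IsSheaf ((Opens.grothendieckTopology X).over U) P ↔
      ∀ (W : Opens X) (hW : W ≤ U) (ι : Type u) (c : ι → Opens X) (hc : ∀ i, c i ≤ W),
        (⨆ i, c i) = W → ∀ s : ∀ i, P.obj (op (Over.mk (homOfLE ((hc i).trans hW)))),
          (∀ i j, overRes P ((hc i).trans hW) (inf_le_left : c i ⊓ c j ≤ c i) (s i) =
            overRes P ((hc j).trans hW) (inf_le_right : c i ⊓ c j ≤ c j) (s j)) →
          ∃! t, ∀ i, overRes P hW (hc i) t = s i := by
  constructor
  · intro hP W hW ι c hc h s hs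
    let T : Over U := Over.mk (homOfLE hW)
    let R : Sieve T :=
      { arrows := fun T' f => ∃ i, T'.left ≤ c i
        downward_closed := fun {T' T''} f ⟨i, hi⟩ g => ⟨i, (leOfHom g.left).trans hi⟩ }
    have hR : R ∈ (Opens.grothendieckTopology X).over U T := by
      rw [mem_over_iff_exists]
      intro x hx
      have hx' : x ∈ ⨆ i, c i := h.symm ▸ hx
      obtain ⟨i, hi⟩ := Opens.mem_iSup.1 hx'
      exact ⟨Over.mk (homOfLE ((hc i).trans hW)), Over.homMk (homOfLE (hc i)), ⟨i, le_rfl⟩, hi⟩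
    have key : ∀ (T' : Over U) (i j : ι) (hi : T'.left ≤ c i) (hj : T'.left ≤ c j),
        overRes P ((hc i).trans hW) hi (s i) = overRes P ((hc j).trans hW) hj (s j) := by
      intro T' i j hi hj
      have := congrArg (overRes P (inf_le_left.trans ((hc i).trans hW)) (le_inf hi hj)) (hs i j)
      rwa [overRes_overRes, overRes_overRes] at this
    let x : Presieve.FamilyOfElements P R.arrows := fun T' f hf =>
      overRes P ((hc _).trans hW) hf.choose_spec (s hf.choose)
    have hx : ∀ (T' : Over U) (f : T' ⟶ T) (hf : R f) (i : ι) (hi : T'.left ≤ c i),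
        x f hf = overRes P ((hc i).trans hW) hi (s i) := fun T' f hf i hi => key _ _ _ _ _
    have hxc : x.Compatible := by
      intro T₁ T₂ Z g₁ g₂ f₁ f₂ h₁ h₂ _
      obtain ⟨i, hi⟩ := id h₁
      obtain ⟨j, hj⟩ := id h₂
      rw [hx _ _ _ i hi, hx _ _ _ j hj]
      exact (overRes_overRes P _ hi (leOfHom g₁.left) (s i)).trans ((key Z i j _ _).trans
        (overRes_overRes P _ hj (leOfHom g₂.left) (s j)).symm)
    obtain ⟨t, ht, ht'⟩ := hP R hR x hxc
    refine ⟨t, fun i => ?_, fun r hr => ht' r fun T' f hf => ?_⟩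
    · let f : Over.mk (homOfLE ((hc i).trans hW)) ⟶ T := Over.homMk (homOfLE (hc i))
      refine (ht f ⟨i, le_rfl⟩).trans ?_
      rw [hx _ f _ i le_rfl]
      exact overRes_self P _ (s i)
    · obtain ⟨i, hi⟩ := id hf
      rw [hx _ _ _ i hi, ← hr i]
      exact (overRes_overRes P hW (hc i) hi r).symm
  · intro hP T R hR x hx
    let ι := Σ T' : Over U, { f : T' ⟶ T // R f }
    rw [mem_over_iff_exists] at hR
    have h : (⨆ i : ι, i.1.left) = T.left := le_antisymm
      (iSup_le fun i => leOfHom i.2.1.left) fun y hy => by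
        obtain ⟨T', f, hf, hy'⟩ := hR y hy
        exact Opens.mem_iSup.2 ⟨⟨T', f, hf⟩, hy'⟩
    obtain ⟨t, ht, ht'⟩ := hP T.left (leOfHom T.hom) ι (fun i => i.1.left)
      (fun i => leOfHom i.2.1.left) h (fun i => x i.2.1 i.2.2) (fun i j => by
        exact hx _ _ i.2.2 j.2.2 (by ext; rfl))
    exact ⟨t, fun T' f hf => ht ⟨T', f, hf⟩, fun r hr => ht' r fun i => hr i.2.1 i.2.2⟩

end OverSite

/-! ### Sections of sheaves of modules -/

namespace Alg

variable {X : TopCat.{u}} {𝒪 : Sheaf (Opens.grothendieckTopology X) CommRingCat.{u}} {U : Opens X}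
  (A : Alg 𝒪 U) {V W Y : Opens X}

lemma rho_self (hV : V ≤ U) (a : A.Sec V hV) : A.rho hV le_rfl a = a :=
  overRes_self (A.ring.obj ⋙ forget _) hV a

lemma rho_rho (hV : V ≤ U) (hW : W ≤ V) (hY : Y ≤ W) (a : A.Sec V hV) :
    A.rho (hW.trans hV) hY (A.rho hV hW a) = A.rho hV (hY.trans hW) a :=
  overRes_overRes (A.ring.obj ⋙ forget _) hV hW hY a

lemma rho_algMap (hV : V ≤ U) (hW : W ≤ V) (r : TwistedStack.Sec 𝒪 V) :
    A.rho hV hW (A.algMap V hV r) = A.algMap W (hW.trans hV) (TwistedStack.rho 𝒪 hW r) :=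
  (ConcreteCategory.congr_hom (A.unit.naturality (Over.homMk (homOfLE hW) :
    Over.mk (homOfLE (hW.trans hV)) ⟶ Over.mk (homOfLE hV)).op) r).symm

lemma algMap_commute (hV : V ≤ U) (r : TwistedStack.Sec 𝒪 V) (a : A.Sec V hV) :
    Commute (A.algMap V hV r) a :=
  A.central (op (Over.mk (homOfLE hV))) r a

end Alg

namespace Mod

variable {X : TopCat.{u}} {𝒪 : Sheaf (Opens.grothendieckTopology X) CommRingCat.{u}} {U : Opens X}
  {A : Alg 𝒪 U} {V V₁ V₂ V₃ W Y Z : Opens X} {hV : V ≤ U} {h₁ : V₁ ≤ U} {h₂ : V₂ ≤ U} {h₃ : V₃ ≤ U}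

/-- An object of `Mod A` over `V`, as a sheaf of modules. -/
abbrev toSheaf (F : (Mod A).Obj V hV) : SheafOfModules.{u} (A.restrict hV).ring := F

/-- Sections over `W` of a sheaf of `A`-modules `F` on `V`. -/
def sec (F : (Mod A).Obj V hV) (W : Opens X) (hW : W ≤ V) : Type u :=
  (toSheaf F).val.obj (op (Over.mk (homOfLE hW)))

noncomputable instance (F : (Mod A).Obj V hV) (W : Opens X) (hW : W ≤ V) :
    AddCommGroup (sec F W hW) :=
  inferInstanceAs (AddCommGroup ((toSheaf F).val.obj
    (op (Over.mk (homOfLE hW)))))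

noncomputable instance (F : (Mod A).Obj V hV) (W : Opens X) (hW : W ≤ V) :
    Module (A.Sec W (hW.trans hV)) (sec F W hW) :=
  inferInstanceAs (Module ((A.restrict hV).ring.obj.obj (op (Over.mk (homOfLE hW))))
    ((toSheaf F).val.obj (op (Over.mk (homOfLE hW)))))

/-- Restriction of sections. -/
noncomputable def secRes (F : (Mod A).Obj V hV) (hW : W ≤ V) (hY : Y ≤ W) :
    sec F W hW →+ sec F Y (hY.trans hW) :=
  (((toSheaf F).val.map
    (Over.homMk (homOfLE hY) :
      Over.mk (homOfLE (hY.trans hW)) ⟶ Over.mk (homOfLE hW)).op).hom).toAddMonoidHom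

lemma secRes_smul (F : (Mod A).Obj V hV) (hW : W ≤ V) (hY : Y ≤ W) (a : A.Sec W (hW.trans hV))
    (m : sec F W hW) : secRes F hW hY (a • m) = A.rho (hW.trans hV) hY a • secRes F hW hY m :=
  PresheafOfModules.map_smul (R := (A.restrict hV).ring.obj) (toSheaf F).val
    (Over.homMk (homOfLE hY) :
      Over.mk (homOfLE (hY.trans hW)) ⟶ Over.mk (homOfLE hW)).op a m

lemma secRes_self (F : (Mod A).Obj V hV) (hW : W ≤ V) (m : sec F W hW) :
    secRes F hW le_rfl m = m :=
  overRes_self ((toSheaf F).val.presheaf ⋙ forget _) hW m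

lemma secRes_secRes (F : (Mod A).Obj V hV) (hW : W ≤ V) (hY : Y ≤ W) (hZ : Z ≤ Y)
    (m : sec F W hW) : secRes F (hY.trans hW) hZ (secRes F hW hY m) = secRes F hW (hZ.trans hY) m :=
  overRes_overRes ((toSheaf F).val.presheaf ⋙ forget _)
    hW hY hZ m

/-- Sections of a sheaf of modules glue. -/
lemma existsUnique_sec (F : (Mod A).Obj V hV) (hW : W ≤ V) {ι : Type u} (c : ι → Opens X)
    (hc : ∀ i, c i ≤ W) (h : (⨆ i, c i) = W) (s : ∀ i, sec F (c i) ((hc i).trans hW))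
    (hs : ∀ i j, secRes F ((hc i).trans hW) (inf_le_left : c i ⊓ c j ≤ c i) (s i) =
      secRes F ((hc j).trans hW) (inf_le_right : c i ⊓ c j ≤ c j) (s j)) :
    ∃! t : sec F W hW, ∀ i, secRes F hW (hc i) t = s i := by
  have hF := (toSheaf F).isSheaf
  rw [Presheaf.isSheaf_iff_isSheaf_forget _ _ (forget AddCommGrpCat.{u}),
    isSheaf_iff_isSheaf_of_type, isSheaf_over_iff] at hF
  exact hF W hW ι c hc h s hs

lemma sec_ext (F : (Mod A).Obj V hV) (hW : W ≤ V) {ι : Type u} (c : ι → Opens X)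
    (hc : ∀ i, c i ≤ W) (h : (⨆ i, c i) = W) {s t : sec F W hW}
    (hst : ∀ i, secRes F hW (hc i) s = secRes F hW (hc i) t) : s = t :=
  (existsUnique_sec F hW c hc h (fun i => secRes F hW (hc i) t)
    (fun i j => by rw [secRes_secRes, secRes_secRes])).unique hst fun _ => rfl

/-- A morphism over `W`, as a morphism of sheaves of modules on `W`. -/
abbrev toSheafHom {F : (Mod A).Obj V₁ h₁} {G : (Mod A).Obj V₂ h₂} {w₁ : W ≤ V₁} {w₂ : W ≤ V₂}
    (f : ((Mod A).res h₁ w₁).obj F ⟶ ((Mod A).res h₂ w₂).obj G) :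
    ((A.restrict h₁).resModules w₁).obj (toSheaf F) ⟶
      ((A.restrict h₂).resModules w₂).obj (toSheaf G) := f

/-- The action of a morphism over `W` on sections. -/
noncomputable def secApp {F : (Mod A).Obj V₁ h₁} {G : (Mod A).Obj V₂ h₂} {w₁ : W ≤ V₁}
    {w₂ : W ≤ V₂} (f : ((Mod A).res h₁ w₁).obj F ⟶ ((Mod A).res h₂ w₂).obj G) (Y : Opens X)
    (hY : Y ≤ W) :
    sec F Y (hY.trans w₁) →ₗ[A.Sec Y (hY.trans (w₁.trans h₁))] sec G Y (hY.trans w₂) :=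
  ((toSheafHom f).val.app (op (Over.mk (homOfLE hY)))).hom

section

variable {F : (Mod A).Obj V₁ h₁} {G : (Mod A).Obj V₂ h₂} {K : (Mod A).Obj V₃ h₃} {w₁ : W ≤ V₁}
  {w₂ : W ≤ V₂} {w₃ : W ≤ V₃}

lemma secRes_secApp (f : ((Mod A).res h₁ w₁).obj F ⟶ ((Mod A).res h₂ w₂).obj G) (hY : Y ≤ W)
    (hZ : Z ≤ Y) (m : sec F Y (hY.trans w₁)) :
    secRes G (hY.trans w₂) hZ (secApp f Y hY m) =
      secApp f Z (hZ.trans hY) (secRes F (hY.trans w₁) hZ m) :=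
  (PresheafOfModules.naturality_apply (toSheafHom f).val (Over.homMk (homOfLE hZ) :
      Over.mk (homOfLE (hZ.trans hY)) ⟶ Over.mk (homOfLE hY)).op m).symm

lemma secApp_comp (f : ((Mod A).res h₁ w₁).obj F ⟶ ((Mod A).res h₂ w₂).obj G)
    (g : ((Mod A).res h₂ w₂).obj G ⟶ ((Mod A).res h₃ w₃).obj K) (hY : Y ≤ W)
    (m : sec F Y (hY.trans w₁)) :
    secApp (F := F) (G := K) (f ≫ g) Y hY m = secApp g Y hY (secApp f Y hY m) := rfl

lemma secApp_id (hY : Y ≤ W) (m : sec F Y (hY.trans w₁)) :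
    secApp (F := F) (G := F) (𝟙 (((Mod A).res h₁ w₁).obj F)) Y hY m = m := rfl

lemma secApp_resHom (f : ((Mod A).res h₁ w₁).obj F ⟶ ((Mod A).res h₂ w₂).obj G) (hY : Y ≤ W)
    (hZ : Z ≤ Y) (m : sec F Z (hZ.trans (hY.trans w₁))) :
    secApp (F := F) (G := G) ((Mod A).resHom F G w₁ w₂ hY f) Z hZ m =
      secApp f Z (hZ.trans hY) m := rfl

lemma secApp_add (f g : ((Mod A).res h₁ w₁).obj F ⟶ ((Mod A).res h₂ w₂).obj G) (hY : Y ≤ W)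
    (m : sec F Y (hY.trans w₁)) :
    secApp (F := F) (G := G) (f + g) Y hY m = secApp f Y hY m + secApp g Y hY m := rfl

lemma secApp_smul (r : Sec 𝒪 W) (f : ((Mod A).res h₁ w₁).obj F ⟶ ((Mod A).res h₂ w₂).obj G)
    (hY : Y ≤ W) (m : sec F Y (hY.trans w₁)) :
    secApp (F := F) (G := G) (r • f) Y hY m =
      A.algMap Y (hY.trans (w₁.trans h₁)) (rho 𝒪 hY r) • secApp f Y hY m :=
  (secApp f Y hY).map_smul (A.algMap Y (hY.trans (w₁.trans h₁)) (rho 𝒪 hY r)) m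

lemma secApp_ext {f g : ((Mod A).res h₁ w₁).obj F ⟶ ((Mod A).res h₂ w₂).obj G}
    (h : ∀ (Y : Opens X) (hY : Y ≤ W) (m : sec F Y (hY.trans w₁)),
      secApp f Y hY m = secApp g Y hY m) : f = g := by
  refine SheafOfModules.hom_ext (PresheafOfModules.hom_ext fun T => ModuleCat.hom_ext
    (LinearMap.ext fun m => ?_))
  exact h T.unop.left (leOfHom T.unop.hom) m

variable (F G) in
/-- A morphism over `W` is a compatible family of linear maps between the sections over the open
subsets of `W`. -/
noncomputable def secHom (w₁ : W ≤ V₁) (w₂ : W ≤ V₂) (g : ∀ (Y : Opens X) (hY : Y ≤ W),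
      sec F Y (hY.trans w₁) →ₗ[A.Sec Y (hY.trans (w₁.trans h₁))] sec G Y (hY.trans w₂))
    (hg : ∀ (Y Z : Opens X) (hY : Y ≤ W) (hZ : Z ≤ Y) (m : sec F Y (hY.trans w₁)),
      secRes G (hY.trans w₂) hZ (g Y hY m) =
        g Z (hZ.trans hY) (secRes F (hY.trans w₁) hZ m)) :
    ((Mod A).res h₁ w₁).obj F ⟶ ((Mod A).res h₂ w₂).obj G :=
  (⟨{ app := fun T => ModuleCat.ofHom
        (R := A.Sec T.unop.left ((leOfHom T.unop.hom).trans (w₁.trans h₁)))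
        (X := sec F T.unop.left ((leOfHom T.unop.hom).trans w₁))
        (Y := sec G T.unop.left ((leOfHom T.unop.hom).trans w₂))
        (g T.unop.left (leOfHom T.unop.hom))
      naturality := fun {T T'} f => ModuleCat.hom_ext (LinearMap.ext fun m =>
        (hg T.unop.left T'.unop.left (leOfHom T.unop.hom) (leOfHom f.unop.left) m).symm) }⟩ :
    ((A.restrict h₁).resModules w₁).obj (toSheaf F) ⟶
      ((A.restrict h₂).resModules w₂).obj (toSheaf G))

@[simp]
lemma secApp_secHom (w₁ : W ≤ V₁) (w₂ : W ≤ V₂) (g : ∀ (Y : Opens X) (hY : Y ≤ W),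
      sec F Y (hY.trans w₁) →ₗ[A.Sec Y (hY.trans (w₁.trans h₁))] sec G Y (hY.trans w₂))
    (hg) (hY : Y ≤ W) : secApp (secHom F G w₁ w₂ g hg) Y hY = g Y hY := rfl

end

variable (A) in
/-- A presheaf of `A`-modules on `V`, in terms of its sections. -/
structure PreMod {V : Opens X} (hV : V ≤ U) where
  carrier (W : Opens X) (hW : W ≤ V) : Type u
  [addCommGroup (W : Opens X) (hW : W ≤ V) : AddCommGroup (carrier W hW)]
  [module (W : Opens X) (hW : W ≤ V) : Module (A.Sec W (hW.trans hV)) (carrier W hW)]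
  res {W Y : Opens X} (hW : W ≤ V) (hY : Y ≤ W) : carrier W hW →+ carrier Y (hY.trans hW)
  res_smul {W Y : Opens X} (hW : W ≤ V) (hY : Y ≤ W) (a : A.Sec W (hW.trans hV))
    (m : carrier W hW) : res hW hY (a • m) = A.rho (hW.trans hV) hY a • res hW hY m
  res_self {W : Opens X} (hW : W ≤ V) (m : carrier W hW) : res hW le_rfl m = m
  res_res {W Y Z : Opens X} (hW : W ≤ V) (hY : Y ≤ W) (hZ : Z ≤ Y) (m : carrier W hW) :
    res (hY.trans hW) hZ (res hW hY m) = res hW (hZ.trans hY) m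

attribute [instance] PreMod.addCommGroup PreMod.module

namespace PreMod

/-- The presheaf condition on sections: unique gluing. -/
def IsSheaf (P : PreMod A hV) : Prop :=
  ∀ (W : Opens X) (hW : W ≤ V) (ι : Type u) (c : ι → Opens X) (hc : ∀ i, c i ≤ W),
    (⨆ i, c i) = W → ∀ s : ∀ i, P.carrier (c i) ((hc i).trans hW),
      (∀ i j, P.res ((hc i).trans hW) (inf_le_left : c i ⊓ c j ≤ c i) (s i) =
        P.res ((hc j).trans hW) (inf_le_right : c i ⊓ c j ≤ c j) (s j)) →
      ∃! t, ∀ i, P.res hW (hc i) t = s i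

variable (P : PreMod A hV)

/-- The underlying presheaf of abelian groups. -/
def presheaf : (Over V)ᵒᵖ ⥤ AddCommGrpCat.{u} where
  obj T := AddCommGrpCat.of (P.carrier T.unop.left (leOfHom T.unop.hom))
  map f := AddCommGrpCat.ofHom (P.res _ (leOfHom f.unop.left))
  map_id T := by
    ext m
    exact P.res_self _ m
  map_comp f g := by
    ext m
    exact (P.res_res _ (leOfHom f.unop.left) (leOfHom g.unop.left) m).symm

/-- The associated presheaf of modules. -/
noncomputable def toPresheafOfModules : PresheafOfModules.{u} (A.restrict hV).ring.obj :=
  letI : ∀ T, Module ((A.restrict hV).ring.obj.obj T) (P.presheaf.obj T) := fun T =>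
    P.module T.unop.left (leOfHom T.unop.hom)
  PresheafOfModules.ofPresheaf P.presheaf fun {T _} f a m =>
    P.res_smul (leOfHom T.unop.hom) (leOfHom f.unop.left) a m

variable {P} in
/-- The sheaf of modules with given sections. -/
noncomputable def toObj (hP : P.IsSheaf) : (Mod A).Obj V hV :=
  (⟨P.toPresheafOfModules, by
    change Presheaf.IsSheaf _ P.presheaf
    rw [Presheaf.isSheaf_iff_isSheaf_forget _ _ (forget AddCommGrpCat.{u}),
      isSheaf_iff_isSheaf_of_type, isSheaf_over_iff]
    exact hP⟩ : SheafOfModules.{u} (A.restrict hV).ring)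

end PreMod

end Mod

/-! ### Sheaves of modules form a stack -/

namespace Mod

variable {X : TopCat.{u}} {𝒪 : Sheaf (Opens.grothendieckTopology X) CommRingCat.{u}} {U : Opens X}
  {A : Alg 𝒪 U} {V V₁ V₂ V₃ W Y Z : Opens X} {hV : V ≤ U} {h₁ : V₁ ≤ U} {h₂ : V₂ ≤ U} {h₃ : V₃ ≤ U}

open Prestack

/-- Morphisms of sheaves of modules glue. -/
lemma exists_glueHom (F : (Mod A).Obj V₁ h₁) (G : (Mod A).Obj V₂ h₂) (w₁ : W ≤ V₁) (w₂ : W ≤ V₂)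
    {ι : Type u} (c : ι → Opens X) (hc : ∀ i, c i ≤ W) (h : (⨆ i, c i) = W)
    (s : ∀ i, ((Mod A).res h₁ ((hc i).trans w₁)).obj F ⟶
      ((Mod A).res h₂ ((hc i).trans w₂)).obj G)
    (hs : ∀ (i j : ι) (Z : Opens X) (hi : Z ≤ c i) (hj : Z ≤ c j)
      (m : sec F Z (hi.trans ((hc i).trans w₁))), secApp (s i) Z hi m = secApp (s j) Z hj m) :
    ∃ t : ((Mod A).res h₁ w₁).obj F ⟶ ((Mod A).res h₂ w₂).obj G,
      ∀ (i : ι) (Z : Opens X) (hi : Z ≤ c i) (m : sec F Z (hi.trans ((hc i).trans w₁))),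
        secApp t Z (hi.trans (hc i)) m = secApp (s i) Z hi m := by
  have g : ∀ (Y : Opens X) (hY : Y ≤ W) (m : sec F Y (hY.trans w₁)),
      ∃ n : sec G Y (hY.trans w₂), ∀ (i : ι) (Z : Opens X) (z : Z ≤ Y) (hi : Z ≤ c i),
        secRes G (hY.trans w₂) z n = secApp (s i) Z hi (secRes F (hY.trans w₁) z m) := by
    intro Y hY m
    obtain ⟨n, hn, -⟩ := existsUnique_sec G (hY.trans w₂) (fun i => Y ⊓ c i)
      (fun i => inf_le_left) (iSup_inf_of_iSup_eq h hY)
      (fun i => secApp (s i) (Y ⊓ c i) inf_le_right (secRes F (hY.trans w₁) inf_le_left m))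
      (fun i j => by
        rw [secRes_secApp (s i), secRes_secApp (s j), secRes_secRes, secRes_secRes]
        exact hs i j _ _ _ _)
    refine ⟨n, fun i Z z hi => ?_⟩
    rw [← secRes_secRes G (hY.trans w₂) inf_le_left (le_inf z hi), hn i,
      secRes_secApp (s i), secRes_secRes]
  choose n hn using g
  have ext : ∀ (Y : Opens X) (hY : Y ≤ W) (x y : sec G Y (hY.trans w₂)),
      (∀ (i : ι) (Z : Opens X) (z : Z ≤ Y) (_ : Z ≤ c i),
        secRes G (hY.trans w₂) z x = secRes G (hY.trans w₂) z y) → x = y :=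
    fun Y hY x y hxy => sec_ext G (hY.trans w₂) (fun i => Y ⊓ c i) (fun i => inf_le_left)
      (iSup_inf_of_iSup_eq h hY) fun i => hxy i _ _ inf_le_right
  refine ⟨secHom F G w₁ w₂ (fun Y hY =>
    { toFun := n Y hY
      map_add' := fun x y => ext Y hY _ _ fun i Z z hi => by
        rw [map_add, hn _ _ _ i Z z hi, hn _ _ _ i Z z hi, hn _ _ _ i Z z hi, map_add, map_add]
      map_smul' := fun a x => ext Y hY _ _ fun i Z z hi => by
        rw [RingHom.id_apply, secRes_smul, hn _ _ _ i Z z hi, hn _ _ _ i Z z hi, secRes_smul,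
          map_smul] })
    (fun Y Y' hY hY' m => ext Y' (hY'.trans hY) _ _ fun i Z z hi => ?_), fun i Z hi m => ?_⟩
  · change secRes G _ z (secRes G _ hY' (n Y hY m)) =
      secRes G _ z (n Y' (hY'.trans hY) (secRes F (hY.trans w₁) hY' m))
    rw [secRes_secRes, hn _ _ _ i Z _ hi, hn _ _ _ i Z _ hi, secRes_secRes]
  · have := hn Z (hi.trans (hc i)) m i Z le_rfl hi
    rwa [secRes_self, secRes_self] at this

variable (A) in
lemma isSeparated : (Mod A).IsSeparated := by
  intro V hV F G W hW ι c hc h s hs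
  obtain ⟨t, ht⟩ := exists_glueHom F G hW hW c hc h s (fun i j Z hi hj m => by
    have := congrArg (fun f => secApp (F := F) (G := G) f Z (le_inf hi hj) m) (hs i j)
    exact this)
  refine ⟨t, fun i => secApp_ext (ht i), fun r hr => secApp_ext fun Y hY m =>
    sec_ext G (hY.trans hW) (fun i => Y ⊓ c i) (fun i => inf_le_left)
      (iSup_inf_of_iSup_eq h hY) fun i => ?_⟩
  rw [secRes_secApp r, secRes_secApp t, ht i _ inf_le_right, ← hr i]
  rfl

section descent

variable {ι : Type u} {c : ι → Opens X} {hc : ∀ i, c i ≤ V}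

/-- The action of the transition morphisms of a descent datum on sections. -/
noncomputable def transition (D : DescentDatum (Mod A) hV c hc) (i j : ι) (Y : Opens X)
    (hi : Y ≤ c i) (hj : Y ≤ c j) : sec (D.obj j) Y hj →ₗ[A.Sec Y (hi.trans ((hc i).trans hV))]
      sec (D.obj i) Y hi :=
  secApp (D.θ i j Y hi hj) Y le_rfl

variable (D : DescentDatum (Mod A) hV c hc)

lemma secApp_θ (i j : ι) (Y Z : Opens X) (hi : Y ≤ c i) (hj : Y ≤ c j) (hZ : Z ≤ Y)
    (m : sec (D.obj j) Z (hZ.trans hj)) :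
    secApp (D.θ i j Y hi hj) Z hZ m = transition D i j Z (hZ.trans hi) (hZ.trans hj) m := by
  rw [transition, ← D.res_θ i j Y hi hj Z hZ]
  rfl

lemma secRes_transition (i j : ι) (Y Z : Opens X) (hi : Y ≤ c i) (hj : Y ≤ c j) (hZ : Z ≤ Y)
    (m : sec (D.obj j) Y hj) : secRes (D.obj i) hi hZ (transition D i j Y hi hj m) =
      transition D i j Z (hZ.trans hi) (hZ.trans hj) (secRes (D.obj j) hj hZ m) := by
  rw [← secApp_θ D i j Y Z hi hj hZ]
  exact secRes_secApp (D.θ i j Y hi hj) le_rfl hZ m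

lemma transition_self (i : ι) (Y : Opens X) (hi : Y ≤ c i) (m : sec (D.obj i) Y hi) :
    transition D i i Y hi hi m = m := by
  rw [transition, D.θ_self]
  rfl

lemma transition_transition (i j k : ι) (Y : Opens X) (hi : Y ≤ c i) (hj : Y ≤ c j)
    (hk : Y ≤ c k) (m : sec (D.obj k) Y hk) :
    transition D i j Y hi hj (transition D j k Y hj hk m) = transition D i k Y hi hk m := by
  rw [transition, transition, transition, ← D.θ_comp i j k Y hi hj hk]
  rfl

/-- The sections over `W` of the sheaf obtained by descent: the families of sections over the
`W ⊓ c i` that correspond to each other under the transition morphisms. -/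
def descentSec (W : Opens X) (_ : W ≤ V) : AddSubgroup (∀ i, sec (D.obj i) (W ⊓ c i) inf_le_right) where
  carrier := {x | ∀ (i j : ι) (Y : Opens X) (y : Y ≤ W) (hi : Y ≤ c i) (hj : Y ≤ c j),
    transition D i j Y hi hj (secRes (D.obj j) inf_le_right (le_inf y hj) (x j)) =
      secRes (D.obj i) inf_le_right (le_inf y hi) (x i)}
  add_mem' {x x'} hx hx' := fun i j Y y hi hj => by
    rw [Pi.add_apply, Pi.add_apply, map_add, map_add, map_add, hx i j Y y, hx' i j Y y]
  zero_mem' := fun i j Y y hi hj => by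
    rw [Pi.zero_apply, Pi.zero_apply, map_zero, map_zero, map_zero]
  neg_mem' {x} hx := fun i j Y y hi hj => by
    rw [Pi.neg_apply, Pi.neg_apply, map_neg, map_neg, map_neg, hx i j Y y]

noncomputable instance (W : Opens X) (hW : W ≤ V) :
    SMul (A.Sec W (hW.trans hV)) (descentSec D W hW) where
  smul a x := ⟨fun i => A.rho (hW.trans hV) inf_le_left a • x.1 i, fun i j Y y hi hj => by
    rw [secRes_smul, secRes_smul, map_smul, A.rho_rho, A.rho_rho, x.2 i j Y y]⟩

noncomputable instance (W : Opens X) (hW : W ≤ V) :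
    Module (A.Sec W (hW.trans hV)) (descentSec D W hW) where
  one_smul x := Subtype.ext (funext fun i => by
    change A.rho (hW.trans hV) inf_le_left 1 • x.1 i = x.1 i
    rw [map_one, one_smul])
  mul_smul a b x := Subtype.ext (funext fun i => by
    change A.rho (hW.trans hV) inf_le_left (a * b) • x.1 i =
      A.rho (hW.trans hV) (inf_le_left : W ⊓ c i ≤ W) a •
        A.rho (hW.trans hV) (inf_le_left : W ⊓ c i ≤ W) b • x.1 i
    rw [map_mul, mul_smul])
  smul_zero a := Subtype.ext (funext fun i => smul_zero _)
  smul_add a x y := Subtype.ext (funext fun i => smul_add _ _ _)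
  add_smul a b x := Subtype.ext (funext fun i => by
    change A.rho (hW.trans hV) inf_le_left (a + b) • x.1 i =
      A.rho (hW.trans hV) (inf_le_left : W ⊓ c i ≤ W) a • x.1 i +
        A.rho (hW.trans hV) (inf_le_left : W ⊓ c i ≤ W) b • x.1 i
    rw [map_add, add_smul])
  zero_smul x := Subtype.ext (funext fun i => by
    change A.rho (hW.trans hV) inf_le_left 0 • x.1 i = 0
    rw [map_zero, zero_smul])

/-- The presheaf of modules obtained by descent. -/
noncomputable def descentPreMod : PreMod A hV where
  carrier W hW := descentSec D W hW
  res {W Y} hW hY :=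
    { toFun := fun x => ⟨fun i => secRes (D.obj i) inf_le_right (inf_le_inf_right _ hY) (x.1 i),
        fun i j Z z hi hj => by rw [secRes_secRes, secRes_secRes, x.2 i j Z (z.trans hY)]⟩
      map_zero' := Subtype.ext (funext fun i => map_zero _)
      map_add' := fun x y => Subtype.ext (funext fun i => map_add _ _ _) }
  res_smul {W Y} hW hY a x := Subtype.ext (funext fun i => by
    change secRes (D.obj i) _ _ (A.rho (hW.trans hV) inf_le_left a • x.1 i) =
      A.rho (hY.trans (hW.trans hV)) inf_le_left (A.rho (hW.trans hV) hY a) •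
        secRes (D.obj i) _ _ (x.1 i)
    rw [secRes_smul, A.rho_rho, A.rho_rho])
  res_self hW x := Subtype.ext (funext fun i => secRes_self _ _ _)
  res_res hW hY hZ x := Subtype.ext (funext fun i => secRes_secRes _ _ _ _ _)

lemma descentPreMod_isSheaf : (descentPreMod D).IsSheaf := by
  intro W hW κ d hd h s hs
  have cov : ∀ i, (⨆ k, d k ⊓ c i) = W ⊓ c i := fun i => by rw [← iSup_inf_eq, h]
  have hs' : ∀ (k l : κ) (i : ι) (Z : Opens X) (zk : Z ≤ d k) (zl : Z ≤ d l) (hi : Z ≤ c i),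
      secRes (D.obj i) inf_le_right (le_inf zk hi) ((s k).1 i) =
        secRes (D.obj i) inf_le_right (le_inf zl hi) ((s l).1 i) := by
    intro k l i Z zk zl hi
    have := congrArg (fun t => secRes (D.obj i) inf_le_right
      (le_inf (le_inf zk zl) hi : Z ≤ d k ⊓ d l ⊓ c i) (t.1 i)) (hs k l)
    exact (secRes_secRes (D.obj i) _ _ _ _).symm.trans (this.trans (secRes_secRes (D.obj i) _ _ _ _))
  choose x hx using fun i => (existsUnique_sec (D.obj i) (inf_le_right : W ⊓ c i ≤ c i)
    (fun k => d k ⊓ c i) (fun k => inf_le_inf_right _ (hd k)) (cov i) (fun k => (s k).1 i)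
    (fun k l => hs' k l i _ (inf_le_left.trans inf_le_left)
      (inf_le_right.trans inf_le_left) (inf_le_left.trans inf_le_right))).exists
  have hx' : ∀ (i : ι) (k : κ) (Z : Opens X) (hW : Z ≤ W ⊓ c i) (hk : Z ≤ d k ⊓ c i),
      secRes (D.obj i) inf_le_right hW (x i) = secRes (D.obj i) inf_le_right hk ((s k).1 i) := by
    intro i k Z hW hk
    rw [← hx i k, secRes_secRes]
  refine ⟨⟨x, fun i j Y y hi hj => ?_⟩, fun k => Subtype.ext (funext fun i => hx i k), fun r hr =>
    Subtype.ext (funext fun i => ?_)⟩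
  · refine sec_ext (D.obj i) hi (fun k => Y ⊓ d k) (fun k => inf_le_left)
      (iSup_inf_of_iSup_eq h y) fun k => ?_
    rw [secRes_transition, secRes_secRes, secRes_secRes,
      hx' i k _ _ (le_inf inf_le_right (inf_le_left.trans hi)),
      hx' j k _ _ (le_inf inf_le_right (inf_le_left.trans hj))]
    exact (s k).2 i j _ inf_le_right _ _
  · refine sec_ext (D.obj i) inf_le_right (fun k => d k ⊓ c i) (fun k => inf_le_inf_right _ (hd k))
      (cov i) fun k => ?_
    rw [hx i k, ← hr k]
    rfl

/-- Descent data of sheaves of modules are effective. -/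
lemma isEffective_descentDatum : D.IsEffective := by
  let G : (Mod A).Obj V hV := PreMod.toObj (descentPreMod_isSheaf D)
  let v : ∀ {Y : Opens X} (hY : Y ≤ V), sec G Y hY → descentSec D Y hY := fun _ x => x
  let f : ∀ i, ((Mod A).res hV (hc i)).obj G ⟶ ((Mod A).res _ (le_refl (c i))).obj (D.obj i) :=
    fun i => secHom G (D.obj i) (hc i) le_rfl (fun Y hY =>
      { toFun := fun x => secRes (D.obj i) inf_le_right (le_inf le_rfl hY) ((v _ x).1 i)
        map_add' := fun x y => map_add _ _ _
        map_smul' := fun a x => by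
          change secRes (D.obj i) _ _ (A.rho (hY.trans ((hc i).trans hV)) inf_le_left a • (v _ x).1 i) = _
          rw [secRes_smul, A.rho_rho, A.rho_self]
          rfl })
      (fun Y Z hY hZ x => by
        change secRes (D.obj i) hY hZ (secRes (D.obj i) _ _ ((v _ x).1 i)) =
          secRes (D.obj i) _ _ (secRes (D.obj i) _ _ ((v _ x).1 i))
        rw [secRes_secRes, secRes_secRes])
  let g : ∀ i, ((Mod A).res _ (le_refl (c i))).obj (D.obj i) ⟶ ((Mod A).res hV (hc i)).obj G :=
    fun i => secHom (D.obj i) G le_rfl (hc i) (fun Y hY =>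
      { toFun := fun m => (⟨fun j => transition D j i (Y ⊓ c j) inf_le_right (inf_le_left.trans hY)
            (secRes (D.obj i) hY inf_le_left m), fun j k Z y hj hk => by
            rw [secRes_transition, secRes_transition, secRes_secRes, secRes_secRes,
              transition_transition]⟩ : descentSec D Y _)
        map_add' := fun x y => Subtype.ext (funext fun j => by
          change transition D j i _ _ _ (secRes _ _ _ (x + y)) =
            transition D j i _ _ _ (secRes _ _ _ x) + transition D j i _ _ _ (secRes _ _ _ y)
          rw [map_add, map_add])
        map_smul' := fun a x => Subtype.ext (funext fun j => by
          change transition D j i _ _ _ (secRes _ _ _ (a • x)) =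
            A.rho (hY.trans ((hc i).trans hV)) inf_le_left a •
              transition D j i (Y ⊓ c j) inf_le_right (inf_le_left.trans hY)
                (secRes (D.obj i) hY inf_le_left x)
          rw [secRes_smul, map_smul]) })
      (fun Y Z hY hZ m => Subtype.ext (funext fun j => by
        change secRes (D.obj j) _ _ (transition D j i _ _ _ (secRes (D.obj i) _ _ m)) =
          transition D j i _ _ _ (secRes (D.obj i) _ _ (secRes (D.obj i) _ _ m))
        rw [secRes_transition, secRes_secRes, secRes_secRes]))
  refine ⟨G, fun i => ⟨f i, g i, secApp_ext (F := G) (G := G) fun Y hY x => ?_,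
    secApp_ext (F := D.obj i) (G := D.obj i) fun Y hY m => ?_⟩,
    fun i j Y hi hj => secApp_ext (F := G) (G := D.obj i) fun Z hZ x => ?_⟩
  · refine Subtype.ext (funext fun j => ?_)
    change transition D j i (Y ⊓ c j) inf_le_right (inf_le_left.trans hY) (secRes (D.obj i) hY
      inf_le_left (secRes (D.obj i) inf_le_right (le_inf le_rfl hY) ((v _ x).1 i))) = (v _ x).1 j
    rw [secRes_secRes, (v _ x).2 j i _ inf_le_left, secRes_self]
  · change secRes (D.obj i) _ (le_inf le_rfl hY) (transition D i i (Y ⊓ c i) inf_le_right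
      (inf_le_left.trans hY) (secRes (D.obj i) hY inf_le_left m)) = m
    rw [transition_self, secRes_secRes, secRes_self]
  · change secApp (D.θ i j Y hi hj) Z hZ (secRes (D.obj j) inf_le_right
      (le_inf le_rfl (hZ.trans hj)) ((v _ x).1 j)) = secRes (D.obj i) inf_le_right
      (le_inf le_rfl (hZ.trans hi)) ((v _ x).1 i)
    rw [secApp_θ, (v _ x).2 i j Z le_rfl]

end descent

variable (A) in
/-- Sheaves of modules form a stack. -/
theorem isStack : (Mod A).IsStack where
  isSeparated := isSeparated A
  hasEffectiveDescent :=
    hasEffectiveDescent_of_isEffective fun _ _ _ _ _ _ D => isEffective_descentDatum D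

end Mod

/-! ### The sheaf associated with a presheaf of modules -/

section

variable {X : TopCat.{u}}

lemma exists_cover {W : Opens X} {p : ∀ Y : Opens X, Y ≤ W → Prop}
    (h : ∀ x ∈ W, ∃ (Y : Opens X) (hY : Y ≤ W), x ∈ Y ∧ p Y hY) :
    ∃ (ι : Type u) (c : ι → Opens X) (hc : ∀ i, c i ≤ W), (⨆ i, c i) = W ∧ ∀ i, p (c i) (hc i) := by
  choose c hc hx hp using h
  exact ⟨W, fun x => c x.1 x.2, fun x => hc _ _, le_antisymm (iSup_le fun x => hc _ _)
    fun x hxW => Opens.mem_iSup.2 ⟨⟨x, hxW⟩, hx x hxW⟩, fun x => hp _ _⟩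

end

namespace Mod

variable {X : TopCat.{u}} {𝒪 : Sheaf (Opens.grothendieckTopology X) CommRingCat.{u}} {U : Opens X}
  {A : Alg 𝒪 U} {V V₁ V₂ V₃ W Y Z : Opens X} {hV : V ≤ U} {h₁ : V₁ ≤ U} {h₂ : V₂ ≤ U} {h₃ : V₃ ≤ U}

open Prestack

/-- A morphism from a presheaf of modules to a sheaf which is locally bijective. -/
structure PreMod.Sheafification (P : PreMod A hV) (F : (Mod A).Obj V hV) where
  η (W : Opens X) (hW : W ≤ V) : P.carrier W hW →ₗ[A.Sec W (hW.trans hV)] sec F W hW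
  secRes_η (W Y : Opens X) (hW : W ≤ V) (hY : Y ≤ W) (p : P.carrier W hW) :
    secRes F hW hY (η W hW p) = η Y (hY.trans hW) (P.res hW hY p)
  locally_injective (W : Opens X) (hW : W ≤ V) (p : P.carrier W hW) (hp : η W hW p = 0) :
    ∀ x ∈ W, ∃ (Y : Opens X) (hY : Y ≤ W), x ∈ Y ∧ P.res hW hY p = 0
  locally_surjective (W : Opens X) (hW : W ≤ V) (q : sec F W hW) :
    ∀ x ∈ W, ∃ (Y : Opens X) (hY : Y ≤ W), x ∈ Y ∧
      ∃ p : P.carrier Y (hY.trans hW), η Y (hY.trans hW) p = secRes F hW hY q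

theorem PreMod.exists_sheafification (P : PreMod A hV) :
    ∃ F : (Mod A).Obj V hV, Nonempty (P.Sheafification F) := by
  let J := (Opens.grothendieckTopology X).over V
  let φ : P.toPresheafOfModules.presheaf ⟶
      ((presheafToSheaf J AddCommGrpCat.{u}).obj P.toPresheafOfModules.presheaf).obj :=
    toSheafify J P.toPresheafOfModules.presheaf
  let F : (Mod A).Obj V hV := PresheafOfModules.sheafify (J := J) (R := (A.restrict hV).ring)
    (𝟙 (A.restrict hV).ring.obj) φ
  refine ⟨F, ⟨{
    η := fun W hW =>
      { toFun := (φ.app (op (Over.mk (homOfLE hW)))).hom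
        map_add' := map_add _
        map_smul' := fun a p => by
          have := PresheafOfModules.Sheafify.map_smul_eq (J := J) (R := (A.restrict hV).ring)
            (𝟙 (A.restrict hV).ring.obj) φ (X := op (Over.mk (homOfLE hW))) a
            ((φ.app (op (Over.mk (homOfLE hW)))).hom p) (𝟙 _) a (by simp) p (by simp)
          refine this.symm.trans ?_
          rw [CategoryTheory.Functor.map_id]
          rfl }
    secRes_η := fun W Y hW hY p => ?_
    locally_injective := fun W hW p hp x hx => ?_
    locally_surjective := fun W hW q x hx => ?_ }⟩⟩
  · exact (ConcreteCategory.congr_hom (φ.naturality (Over.homMk (homOfLE hY) :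
      Over.mk (homOfLE (hY.trans hW)) ⟶ Over.mk (homOfLE hW)).op) p).symm
  · have h : φ.app (op (Over.mk (homOfLE hW))) p = φ.app (op (Over.mk (homOfLE hW))) 0 :=
      hp.trans (map_zero _).symm
    have := Presheaf.equalizerSieve_mem J φ _ _ h
    obtain ⟨T, f, hf, hxT⟩ := (mem_over_iff_exists _).1 this x hx
    exact ⟨T.left, leOfHom f.left, hxT, hf.trans (map_zero _)⟩
  · have := Presheaf.imageSieve_mem J φ (U := op (Over.mk (homOfLE hW))) q
    obtain ⟨T, f, hf, hxT⟩ := (mem_over_iff_exists _).1 this x hx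
    obtain ⟨p, hp⟩ := hf
    exact ⟨T.left, leOfHom f.left, hxT, p, hp⟩

namespace PreMod.Sheafification

variable {P : PreMod A hV} {F : (Mod A).Obj V hV} (e : P.Sheafification F)

/-- Compatible linear maps from a presheaf of modules to a sheaf extend to the associated sheaf. -/
theorem existsUnique_hom (G : (Mod A).Obj V₂ h₂) (w₁ : W ≤ V) (w₂ : W ≤ V₂)
    (g : ∀ (Y : Opens X) (hY : Y ≤ W),
      P.carrier Y (hY.trans w₁) →ₗ[A.Sec Y (hY.trans (w₁.trans hV))] sec G Y (hY.trans w₂))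
    (hg : ∀ (Y Z : Opens X) (hY : Y ≤ W) (hZ : Z ≤ Y) (p : P.carrier Y (hY.trans w₁)),
      secRes G (hY.trans w₂) hZ (g Y hY p) = g Z (hZ.trans hY) (P.res (hY.trans w₁) hZ p)) :
    ∃! f : ((Mod A).res hV w₁).obj F ⟶ ((Mod A).res h₂ w₂).obj G,
      ∀ (Y : Opens X) (hY : Y ≤ W) (p : P.carrier Y (hY.trans w₁)),
        secApp f Y hY (e.η Y (hY.trans w₁) p) = g Y hY p := by
  have inj : ∀ (Y : Opens X) (hY : Y ≤ W) (p p' : P.carrier Y (hY.trans w₁)),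
      e.η Y (hY.trans w₁) p = e.η Y (hY.trans w₁) p' → g Y hY p = g Y hY p' := by
    intro Y hY p p' hp
    rw [← sub_eq_zero, ← map_sub] at hp
    obtain ⟨ι, c, hc, h, h'⟩ := exists_cover (e.locally_injective Y _ _ hp)
    refine sec_ext G (hY.trans w₂) c hc h fun i => ?_
    rw [hg, hg, ← sub_eq_zero, ← map_sub, ← map_sub, h' i, map_zero]
  have ex : ∀ (Y : Opens X) (hY : Y ≤ W) (q : sec F Y (hY.trans w₁)), ∃ n : sec G Y (hY.trans w₂),
      ∀ (Z : Opens X) (hZ : Z ≤ Y) (p : P.carrier Z (hZ.trans (hY.trans w₁))),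
        e.η Z (hZ.trans (hY.trans w₁)) p = secRes F (hY.trans w₁) hZ q →
          secRes G (hY.trans w₂) hZ n = g Z (hZ.trans hY) p := by
    intro Y hY q
    obtain ⟨ι, c, hc, h, h'⟩ := exists_cover (e.locally_surjective Y _ q)
    choose p hp using h'
    have key : ∀ (i : ι) (Z : Opens X) (hZ : Z ≤ Y) (hi : Z ≤ c i)
        (p' : P.carrier Z (hZ.trans (hY.trans w₁))),
        e.η Z (hZ.trans (hY.trans w₁)) p' = secRes F (hY.trans w₁) hZ q →
        secRes G ((hc i).trans (hY.trans w₂)) hi (g (c i) ((hc i).trans hY) (p i)) =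
          g Z (hZ.trans hY) p' := by
      intro i Z hZ hi p' hp'
      rw [hg]
      exact inj _ _ _ _ (by rw [← e.secRes_η, hp i, secRes_secRes, hp'])
    obtain ⟨n, hn, -⟩ := existsUnique_sec G (hY.trans w₂) c hc h
      (fun i => g (c i) ((hc i).trans hY) (p i)) (fun i j => by
        rw [key i (c i ⊓ c j) (inf_le_left.trans (hc i)) inf_le_left
            (P.res ((hc i).trans (hY.trans w₁)) inf_le_left (p i))
            (by rw [← e.secRes_η, hp i, secRes_secRes]),
          key j (c i ⊓ c j) (inf_le_left.trans (hc i)) inf_le_right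
            (P.res ((hc i).trans (hY.trans w₁)) inf_le_left (p i))
            (by rw [← e.secRes_η, hp i, secRes_secRes])])
    refine ⟨n, fun Z hZ p' hp' => sec_ext G _ (fun i => Z ⊓ c i) (fun i => inf_le_left)
      (iSup_inf_of_iSup_eq h hZ) fun i => ?_⟩
    rw [secRes_secRes, hg, ← key i (Z ⊓ c i) (inf_le_left.trans hZ) inf_le_right
      (P.res _ inf_le_left p') (by rw [← e.secRes_η, hp', secRes_secRes]), ← hn i, secRes_secRes]
  choose n hn using ex
  have uniq : ∀ (Y : Opens X) (hY : Y ≤ W) (q : sec F Y (hY.trans w₁))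
      (n₁ n₂ : sec G Y (hY.trans w₂)), (∀ (Z : Opens X) (hZ : Z ≤ Y)
        (p : P.carrier Z (hZ.trans (hY.trans w₁))),
        e.η Z (hZ.trans (hY.trans w₁)) p = secRes F (hY.trans w₁) hZ q →
          secRes G (hY.trans w₂) hZ n₁ = secRes G (hY.trans w₂) hZ n₂) → n₁ = n₂ := by
    intro Y hY q n₁ n₂ h
    obtain ⟨ι, c, hc, hc', h'⟩ := exists_cover (e.locally_surjective Y _ q)
    exact sec_ext G _ c hc hc' fun i => h _ _ _ (h' i).choose_spec
  have sec_eq : ∀ (Y : Opens X) (hY : Y ≤ W) (p : P.carrier Y (hY.trans w₁)),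
      n Y hY (e.η Y (hY.trans w₁) p) = g Y hY p := by
    intro Y hY p
    have := hn Y hY (e.η Y (hY.trans w₁) p) Y le_rfl p (secRes_self _ _ _).symm
    rwa [secRes_self] at this
  have uniq₂ : ∀ (Y : Opens X) (hY : Y ≤ W) (q q' : sec F Y (hY.trans w₁))
      (n₁ n₂ : sec G Y (hY.trans w₂)), (∀ (Z : Opens X) (hZ : Z ≤ Y)
        (p p' : P.carrier Z (hZ.trans (hY.trans w₁))),
        e.η Z (hZ.trans (hY.trans w₁)) p = secRes F (hY.trans w₁) hZ q →
        e.η Z (hZ.trans (hY.trans w₁)) p' = secRes F (hY.trans w₁) hZ q' →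
          secRes G (hY.trans w₂) hZ n₁ = secRes G (hY.trans w₂) hZ n₂) → n₁ = n₂ := by
    intro Y hY q q' n₁ n₂ h
    refine uniq Y hY q _ _ fun Z hZ p hp => uniq Z (hZ.trans hY) (secRes F _ hZ q') _ _
      fun Z' hZ' p' hp' => ?_
    rw [secRes_secRes, secRes_secRes]
    exact h Z' _ (P.res _ hZ' p) p' (by rw [← e.secRes_η, hp, secRes_secRes])
      (by rw [hp', secRes_secRes])
  refine ⟨secHom F G w₁ w₂ (fun Y hY =>
    { toFun := n Y hY
      map_add' := fun q q' => uniq₂ Y hY q q' _ _ fun Z hZ p p' hp hp' => by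
        rw [hn Y hY (q + q') Z hZ (p + p') (by rw [map_add, map_add, hp, hp']), map_add, map_add,
          hn Y hY q Z hZ p hp, hn Y hY q' Z hZ p' hp']
      map_smul' := fun a q => uniq Y hY q _ _ fun Z hZ p hp => by
        rw [hn Y hY (a • q) Z hZ (A.rho _ hZ a • p) (by rw [map_smul, secRes_smul, hp]),
          RingHom.id_apply, secRes_smul, hn Y hY q Z hZ p hp, map_smul] })
    (fun Y Y' hY hY' q => uniq Y' (hY'.trans hY) (secRes F _ hY' q) _ _ fun Z hZ p hp => ?_),
    fun Y hY p => sec_eq Y hY p, fun f hf => secApp_ext fun Y hY q => uniq Y hY q _ _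
      fun Z hZ p hp => ?_⟩
  · change secRes G _ hZ (secRes G _ hY' (n Y hY q)) = secRes G _ hZ (n Y' _ (secRes F _ hY' q))
    rw [hn Y' (hY'.trans hY) _ Z hZ p hp, secRes_secRes,
      hn Y hY q Z (hZ.trans hY') p (by rw [hp, secRes_secRes])]
  · rw [secRes_secApp f, ← hp, hf]
    exact (hn Y hY q Z hZ p hp).symm

end PreMod.Sheafification

end Mod

/-! ### Morphisms from the free module of rank one -/

namespace Mod

variable {X : TopCat.{u}} {𝒪 : Sheaf (Opens.grothendieckTopology X) CommRingCat.{u}} {U : Opens X}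
  {A : Alg 𝒪 U} {V V₁ V₂ V₃ W Y Z : Opens X} {hV : V ≤ U} {h₁ : V₁ ≤ U} {h₂ : V₂ ≤ U} {h₃ : V₃ ≤ U}

open Prestack

variable (A) in
/-- The sheaf of algebras `A` as a left module over itself. -/
noncomputable def unit : (Mod A).Obj U le_rfl :=
  SheafOfModules.unit (A.restrict le_rfl).ring

variable (A) in
/-- The sections of `A`, as sections of the module `A`. -/
noncomputable def unitSec (W : Opens X) (hW : W ≤ U) :
    A.Sec W hW ≃ₗ[A.Sec W hW] sec (unit A) W hW where
  toFun a := a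
  map_add' _ _ := rfl
  map_smul' _ _ := rfl
  invFun a := a
  left_inv _ := rfl
  right_inv _ := rfl

lemma secRes_unitSec (hW : W ≤ U) (hY : Y ≤ W) (a : A.Sec W hW) :
    secRes (unit A) hW hY (unitSec A W hW a) = unitSec A Y (hY.trans hW) (A.rho hW hY a) := rfl

lemma unitSec_symm_secRes (hW : W ≤ U) (hY : Y ≤ W) (x : sec (unit A) W hW) :
    (unitSec A Y (hY.trans hW)).symm (secRes (unit A) hW hY x) =
      A.rho hW hY ((unitSec A W hW).symm x) := rfl

lemma unitSec_mul (hW : W ≤ U) (a b : A.Sec W hW) :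
    unitSec A W hW (a * b) = a • unitSec A W hW b := rfl

/-- The morphism `A|_W ⟶ M|_W`, `x ↦ x • m`, given by a section `m` of `M` over `W`. -/
noncomputable def ev (M : (Mod A).Obj V hV) (hW : W ≤ V) (m : sec M W hW) :
    ((Mod A).res le_rfl (hW.trans hV)).obj (unit A) ⟶ ((Mod A).res hV hW).obj M :=
  secHom (unit A) M (hW.trans hV) hW
    (fun Y hY => (LinearMap.toSpanSingleton _ _ (secRes M hW hY m)).comp
      (unitSec A Y (hY.trans (hW.trans hV))).symm.toLinearMap)
    (fun Y Z hY hZ x => by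
      rw [LinearMap.comp_apply, LinearMap.comp_apply, LinearMap.toSpanSingleton_apply,
        LinearMap.toSpanSingleton_apply, secRes_smul, secRes_secRes]
      rfl)

lemma secApp_ev (M : (Mod A).Obj V hV) (hW : W ≤ V) (m : sec M W hW) (hY : Y ≤ W)
    (a : A.Sec Y (hY.trans (hW.trans hV))) :
    secApp (ev M hW m) Y hY (unitSec A Y (hY.trans (hW.trans hV)) a) = a • secRes M hW hY m := rfl

lemma secApp_ev_one (M : (Mod A).Obj V hV) (hW : W ≤ V) (m : sec M W hW) :
    secApp (ev M hW m) W le_rfl (unitSec A W (hW.trans hV) 1) = m := by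
  rw [secApp_ev, one_smul, secRes_self]

/-- A morphism out of the module `A` is determined by the image of the section `1`. -/
lemma unit_hom_ext {M : (Mod A).Obj V hV} {w₁ : W ≤ U} {hW : W ≤ V}
    {f g : ((Mod A).res le_rfl w₁).obj (unit A) ⟶ ((Mod A).res hV hW).obj M}
    (h : secApp f W le_rfl (unitSec A W w₁ 1) = secApp g W le_rfl (unitSec A W w₁ 1)) :
    f = g := by
  refine secApp_ext fun Y hY x => ?_
  have hx : x = (unitSec A Y (hY.trans w₁)).symm x •
      secRes (unit A) w₁ hY (unitSec A W w₁ 1) := by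
    rw [secRes_unitSec, map_one, ← unitSec_mul, mul_one, LinearEquiv.apply_symm_apply]
  rw [hx, map_smul, map_smul, ← secRes_secApp f le_rfl, ← secRes_secApp g le_rfl, h]

lemma eq_ev {M : (Mod A).Obj V hV} {w₁ : W ≤ U} {hW : W ≤ V}
    (f : ((Mod A).res le_rfl w₁).obj (unit A) ⟶ ((Mod A).res hV hW).obj M) :
    f = ev M hW (secApp f W le_rfl (unitSec A W w₁ 1)) :=
  unit_hom_ext (secApp_ev_one M hW _).symm

lemma ev_injective (M : (Mod A).Obj V hV) (hW : W ≤ V) : Function.Injective (ev M hW) := by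
  intro m m' h
  rw [← secApp_ev_one M hW m, h, secApp_ev_one]

lemma ev_add (M : (Mod A).Obj V hV) (hW : W ≤ V) (m m' : sec M W hW) :
    ev M hW (m + m') = ev M hW m + ev M hW m' := by
  refine unit_hom_ext ?_
  rw [secApp_ev_one, secApp_add, secApp_ev_one, secApp_ev_one]

lemma ev_comp (M : (Mod A).Obj V₁ h₁) (N : (Mod A).Obj V₂ h₂) (w₁ : W ≤ V₁) (w₂ : W ≤ V₂)
    (m : sec M W w₁) (f : ((Mod A).res h₁ w₁).obj M ⟶ ((Mod A).res h₂ w₂).obj N) :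
    ev M w₁ m ≫ f = ev N w₂ (secApp f W le_rfl m) := by
  refine unit_hom_ext ?_
  rw [secApp_ev_one]
  exact congrArg (secApp f W le_rfl) (secApp_ev_one M w₁ m)

lemma ev_smul (M : (Mod A).Obj V hV) (hW : W ≤ V) (a : A.Sec W (hW.trans hV)) (m : sec M W hW) :
    ev M hW (a • m) = ev (unit A) (hW.trans hV) (unitSec A W (hW.trans hV) a) ≫ ev M hW m := by
  rw [ev_comp, secApp_ev, secRes_self]

lemma ev_one (hW : W ≤ U) : ev (unit A) hW (unitSec A W hW 1) = 𝟙 _ :=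
  unit_hom_ext (secApp_ev_one (unit A) hW _)

lemma ev_mul (hW : W ≤ U) (a b : A.Sec W hW) : ev (unit A) hW (unitSec A W hW (a * b)) =
    ev (unit A) hW (unitSec A W hW a) ≫ ev (unit A) hW (unitSec A W hW b) := by
  rw [unitSec_mul, ev_smul]

lemma ev_algMap (hW : W ≤ U) (r : Sec 𝒪 W) :
    ev (unit A) hW (unitSec A W hW (A.algMap W hW r)) = r • 𝟙 (((Mod A).res le_rfl hW).obj (unit A)) := by
  refine unit_hom_ext ?_
  rw [secApp_ev_one, secApp_smul, secApp_id, ← unitSec_mul, mul_one, ← A.rho_algMap, A.rho_self]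

lemma resHom_ev (M : (Mod A).Obj V hV) (hW : W ≤ V) (hY : Y ≤ W) (m : sec M W hW) :
    (Mod A).resHom (unit A) M (hW.trans hV) hW hY (ev M hW m) =
      ev M (hY.trans hW) (secRes M hW hY m) := by
  refine unit_hom_ext ?_
  rw [secApp_ev_one, secApp_resHom, secApp_ev, one_smul]

end Mod

/-! ### Modules over the opposite algebra, and bilinear pairings -/

section

variable {X : TopCat.{u}} {𝒪 : Sheaf (Opens.grothendieckTopology X) CommRingCat.{u}} {U : Opens X}
  {A : Alg 𝒪 U} {S : Prestack.{w, v} 𝒪 U}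
  {V V₁ V₂ V₃ W Y Z : Opens X} {hV : V ≤ U} {h₁ : V₁ ≤ U} {h₂ : V₂ ≤ U} {h₃ : V₃ ≤ U}

open Prestack _root_.TwistedStack.Mod

namespace ModObj

/-- The right action of the sections of `A` on a module over the opposite algebra. -/
def ract (P : ModObj A.opp S V hV) (hW : W ≤ V) (a : A.Sec W (hW.trans hV)) :
    (S.res hV hW).obj P.obj ⟶ (S.res hV hW).obj P.obj :=
  P.act W hW (MulOpposite.op a : (A.Sec W (hW.trans hV))ᵐᵒᵖ)

variable (P : ModObj A.opp S V hV)

lemma ract_one (hW : W ≤ V) : P.ract hW 1 = 𝟙 _ := (P.act W hW).map_one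

lemma ract_add (hW : W ≤ V) (a b : A.Sec W (hW.trans hV)) :
    P.ract hW (a + b) = P.ract hW a + P.ract hW b := (P.act W hW).map_add _ _

lemma ract_mul (hW : W ≤ V) (a b : A.Sec W (hW.trans hV)) :
    P.ract hW (a * b) = P.ract hW a ≫ P.ract hW b :=
  (P.act W hW).map_mul (MulOpposite.op b : (A.Sec W (hW.trans hV))ᵐᵒᵖ)
    (MulOpposite.op a : (A.Sec W (hW.trans hV))ᵐᵒᵖ)

lemma ract_algMap (hW : W ≤ V) (r : Sec 𝒪 W) :
    P.ract hW (A.algMap W (hW.trans hV) r) = r • 𝟙 _ := P.act_algMap W hW r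

lemma resHom_ract (hW : W ≤ V) (hY : Y ≤ W) (a : A.Sec W (hW.trans hV)) :
    S.resHom P.obj P.obj hW hW hY (P.ract hW a) = P.ract (hY.trans hW) (A.rho (hW.trans hV) hY a) :=
  (P.act_res hW hY (MulOpposite.op a : (A.Sec W (hW.trans hV))ᵐᵒᵖ)).symm

end ModObj

/-- An `A`-bilinear pairing over `W` of an `A.opp`-module `P` in `S` with a sheaf of `A`-modules
`M`, with values in an object `Q` of `S`: a family of morphisms `P ⟶ Q` over the open subsets
of `W`, depending on sections of `M` in an additive, `A`-balanced way. -/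
structure Pairing (P : ModObj A.opp S U le_rfl) (M : (Mod A).Obj V₁ h₁) (Q : S.Obj V₂ h₂)
    (w₁ : W ≤ V₁) (w₂ : W ≤ V₂) where
  hom (Y : Opens X) (hY : Y ≤ W) (m : sec M Y (hY.trans w₁)) :
    (S.res le_rfl (hY.trans (w₂.trans h₂))).obj P.obj ⟶ (S.res h₂ (hY.trans w₂)).obj Q
  hom_add (Y : Opens X) (hY : Y ≤ W) (m m' : sec M Y (hY.trans w₁)) :
    hom Y hY (m + m') = hom Y hY m + hom Y hY m'
  hom_smul (Y : Opens X) (hY : Y ≤ W) (a : A.Sec Y (hY.trans (w₁.trans h₁)))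
    (m : sec M Y (hY.trans w₁)) : hom Y hY (a • m) = P.ract (hY.trans (w₁.trans h₁)) a ≫ hom Y hY m
  resHom_hom (Y Z : Opens X) (hY : Y ≤ W) (hZ : Z ≤ Y) (m : sec M Y (hY.trans w₁)) :
    S.resHom P.obj Q (hY.trans (w₁.trans h₁)) (hY.trans w₂) hZ (hom Y hY m) =
      hom Z (hZ.trans hY) (secRes M (hY.trans w₁) hZ m)

namespace Pairing

variable {P : ModObj A.opp S U le_rfl} {M : (Mod A).Obj V₁ h₁} {Q : S.Obj V₂ h₂}
    {w₁ : W ≤ V₁} {w₂ : W ≤ V₂}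

/-- Composition of a pairing with values in `Q` and of a morphism `Q ⟶ N` over `W`. -/
noncomputable def comp (τ : Pairing P M Q w₁ w₂) {N : S.Obj V₃ h₃} {w₃ : W ≤ V₃}
    (β : (S.res h₂ w₂).obj Q ⟶ (S.res h₃ w₃).obj N) : Pairing P M N w₁ w₃ where
  hom Y hY m := τ.hom Y hY m ≫ S.resHom Q N w₂ w₃ hY β
  hom_add Y hY m m' := by rw [τ.hom_add, Preadditive.add_comp]
  hom_smul Y hY a m := by rw [τ.hom_smul, Category.assoc]
  resHom_hom Y Z hY hZ m := by
    rw [resHom_comp (w₂ := hY.trans w₂), τ.resHom_hom, resHom_resHom]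

/-- Composition of a morphism of sheaves of modules over `W` with a pairing. -/
noncomputable def precomp {V₀ : Opens X} {h₀ : V₀ ≤ U} {w₀ : W ≤ V₀} {L : (Mod A).Obj V₀ h₀}
    (f : ((Mod A).res h₀ w₀).obj L ⟶ ((Mod A).res h₁ w₁).obj M) (τ : Pairing P M Q w₁ w₂) :
    Pairing P L Q w₀ w₂ where
  hom Y hY m := τ.hom Y hY (secApp f Y hY m)
  hom_add Y hY m m' := by rw [map_add, τ.hom_add]
  hom_smul Y hY a m := by rw [map_smul, τ.hom_smul]
  resHom_hom Y Z hY hZ m := by rw [τ.resHom_hom, secRes_secApp f]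

/-- Restriction of a pairing to an open subset. -/
noncomputable def restrict (τ : Pairing P M Q w₁ w₂) (hY : Y ≤ W) :
    Pairing P M Q (hY.trans w₁) (hY.trans w₂) where
  hom Z hZ m := τ.hom Z (hZ.trans hY) m
  hom_add _ _ _ _ := τ.hom_add _ _ _ _
  hom_smul _ _ _ _ := τ.hom_smul _ _ _ _
  resHom_hom _ _ _ _ _ := τ.resHom_hom _ _ _ _ _

/-- A pairing is universal if all pairings, over all open subsets, factor through it in a unique
way: then `Q` is the tensor product `P ⊗_A M`. -/
def IsUniversal {Q : S.Obj V₁ h₁} (τ : Pairing P M Q (le_refl V₁) (le_refl V₁)) : Prop :=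
  ∀ ⦃V₂ : Opens X⦄ ⦃h₂ : V₂ ≤ U⦄ (N : S.Obj V₂ h₂) (W : Opens X) (w₁ : W ≤ V₁) (w₂ : W ≤ V₂)
    (g : Pairing P M N w₁ w₂), ∃! β : (S.res h₁ w₁).obj Q ⟶ (S.res h₂ w₂).obj N,
      ∀ (Y : Opens X) (hY : Y ≤ W) (m : sec M Y (hY.trans w₁)),
        τ.hom Y (hY.trans w₁) m ≫ S.resHom Q N w₁ w₂ hY β = g.hom Y hY m

lemma IsUniversal.hom_ext {Q : S.Obj V₁ h₁} {τ : Pairing P M Q (le_refl V₁) (le_refl V₁)}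
    (hτ : τ.IsUniversal) {N : S.Obj V₂ h₂} {w₁ : W ≤ V₁} {w₂ : W ≤ V₂}
    {β β' : (S.res h₁ w₁).obj Q ⟶ (S.res h₂ w₂).obj N}
    (h : ∀ (Y : Opens X) (hY : Y ≤ W) (m : sec M Y (hY.trans w₁)),
      τ.hom Y (hY.trans w₁) m ≫ S.resHom Q N w₁ w₂ hY β =
        τ.hom Y (hY.trans w₁) m ≫ S.resHom Q N w₁ w₂ hY β') : β = β' :=
  (hτ N W w₁ w₂ ((τ.restrict w₁).comp β')).unique h fun _ _ _ => rfl

end Pairing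

end

/-! ### The value of a functor on the free module of rank one -/

namespace PFunctor

section

variable {X : TopCat.{u}} {𝒪 : Sheaf (Opens.grothendieckTopology X) CommRingCat.{u}} {U : Opens X}
  {C : Alg 𝒪 U} {T : Prestack.{w₁, v₁} 𝒪 U} {S : Prestack.{w₂, v₂} 𝒪 U} {V : Opens X}
  {hV : V ≤ U} {φ ψ : PFunctor T S}

/-- The image of a module under an `𝒪`-functor. -/
@[reducible] def IsLinear.mapMod (hφ : φ.IsLinear) (E : ModObj C T V hV) : ModObj C S V hV where
  obj := (φ.app V hV).obj E.obj
  act W hW :=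
    { toFun := fun a => φ.mapOn E.obj E.obj hW hW (E.act W hW a)
      map_one' := (congrArg _ (map_one _)).trans (φ.mapOn_id _ hW)
      map_mul' := fun a b => (congrArg _ (map_mul _ a b)).trans
        (φ.mapOn_comp E.obj E.obj E.obj hW hW hW _ _)
      map_zero' := by
        have h := hφ.mapOn_add E.obj E.obj hW hW (E.act W hW 0) (E.act W hW 0)
        refine left_eq_add.1 (Eq.trans (congrArg _ ?_) h)
        exact (congrArg _ (add_zero 0).symm).trans (_root_.map_add _ _ _)
      map_add' := fun a b => (congrArg _ (_root_.map_add _ a b)).trans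
        (hφ.mapOn_add E.obj E.obj hW hW _ _) }
  act_algMap W hW r := (congrArg _ (E.act_algMap W hW r)).trans
    ((hφ.mapOn_smul E.obj E.obj hW hW r _).trans (congrArg (r • ·) (φ.mapOn_id E.obj hW)))
  act_res {W Y} hW hY a := (congrArg _ (E.act_res hW hY a)).trans
    (φ.resHom_mapOn E.obj E.obj hW hW hY _).symm

/-- The morphism between the images of a module under two `𝒪`-functors given by a
transformation. -/
def IsLinear.mapModHom (hφ : φ.IsLinear) (hψ : ψ.IsLinear) (E : ModObj C T V hV) (α : φ ⟶ ψ) :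
    hφ.mapMod E ⟶ hψ.mapMod E where
  hom := (α.app V hV).app E.obj
  comm _ hW _ := α.naturalityOn E.obj E.obj hW hW _

end

variable {X : TopCat.{u}} {𝒪 : Sheaf (Opens.grothendieckTopology X) CommRingCat.{u}} {U : Opens X}
  {A : Alg 𝒪 U} {S : Prestack.{w, v} 𝒪 U}
  {V V₁ V₂ V₃ W Y Z : Opens X} {hV : V ≤ U} {h₁ : V₁ ≤ U} {h₂ : V₂ ≤ U} {h₃ : V₃ ≤ U}

open Prestack _root_.TwistedStack.Mod

variable (A) in
/-- The left module `A`, on which the opposite algebra acts by right multiplications. -/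
@[reducible] noncomputable def _root_.TwistedStack.Mod.unitMod : ModObj A.opp (Mod A) U le_rfl where
  obj := unit A
  act W hW :=
    { toFun := fun a =>
        ev (unit A) hW (unitSec A W hW (MulOpposite.unop (α := A.Sec W hW) a))
      map_one' := ev_one hW
      map_mul' := fun a b => ev_mul hW _ _
      map_zero' := by
        refine left_eq_add.1 ((congrArg _ ?_).trans (ev_add (unit A) hW (unitSec A W hW 0) 0))
        exact (congrArg (unitSec A W hW) (add_zero 0).symm).trans (_root_.map_add _ _ _)
      map_add' := fun a b => (congrArg (ev (unit A) hW) (_root_.map_add (unitSec A W hW) _ _)).trans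
        (ev_add _ hW _ _) }
  act_algMap W hW r := ev_algMap hW r
  act_res {W Y} hW hY a :=
    (resHom_ev (unit A) hW hY (unitSec A W hW (MulOpposite.unop (α := A.Sec W hW) a))).symm

variable {φ ψ : PFunctor (Mod A) S}

/-- The image of the module `A` under an `𝒪`-functor is a module over the opposite algebra. -/
@[reducible] noncomputable def IsLinear.onUnit (hφ : φ.IsLinear) : ModObj A.opp S U le_rfl :=
  hφ.mapMod (unitMod A)

lemma IsLinear.onUnit_ract (hφ : φ.IsLinear) (hW : W ≤ U) (a : A.Sec W hW) :
    hφ.onUnit.ract hW a = φ.mapOn (unit A) (unit A) hW hW (ev (unit A) hW (unitSec A W hW a)) :=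
  rfl

/-- The image of `M` under an `𝒪`-functor receives a pairing of the image of `A` with `M`. -/
@[simps]
noncomputable def IsLinear.pairing (hφ : φ.IsLinear) (M : (Mod A).Obj V hV) :
    Pairing hφ.onUnit M ((φ.app V hV).obj M) (le_refl V) (le_refl V) where
  hom Y hY m := φ.mapOn (unit A) M (hY.trans hV) hY (ev M hY m)
  hom_add Y hY m m' := by rw [ev_add, hφ.mapOn_add]
  hom_smul Y hY a m := by rw [ev_smul, φ.mapOn_comp, hφ.onUnit_ract]
  resHom_hom Y Z hY hZ m := by
    rw [← resHom_ev]
    exact φ.resHom_mapOn (unit A) M (hY.trans hV) hY hZ _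

/-- An `𝒪`-functor with a right adjoint is the tensor product with its value at `A`. -/
theorem IsLinear.isUniversal_pairing (hφ : φ.IsLinear) (hr : φ.HasRightAdjoint)
    (M : (Mod A).Obj V hV) : (hφ.pairing M).IsUniversal := by
  intro V₂ h₂ N W w₁ w₂ g
  obtain ⟨R, ε, hR⟩ := hr.exists_isRep N
  have key : ∀ (b : ((Mod A).res hV w₁).obj M ⟶ ((Mod A).res h₂ w₂).obj R) (Y : Opens X)
      (hY : Y ≤ W) (m : sec M Y (hY.trans w₁)),
      (hφ.pairing M).hom Y (hY.trans w₁) m ≫ S.resHom _ N w₁ w₂ hY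
        (φ.mapOn M R w₁ w₂ b ≫ S.resHom _ N le_rfl le_rfl w₂ ε) =
      φ.mapOn (unit A) R (hY.trans (w₁.trans hV)) (hY.trans w₂)
        (ev R (hY.trans w₂) (secApp b Y hY m)) ≫ S.resHom _ N le_rfl le_rfl (hY.trans w₂) ε := by
    intro b Y hY m
    rw [resHom_comp (w₂ := w₂), resHom_resHom, φ.resHom_mapOn, IsLinear.pairing_hom,
      ← Category.assoc, ← φ.mapOn_comp, ev_comp, secApp_resHom]
  have hb : ∀ (Y : Opens X) (hY : Y ≤ W) (m : sec M Y (hY.trans w₁)),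
      ∃ r : sec R Y (hY.trans w₂), φ.mapOn (unit A) R (hY.trans (w₁.trans hV)) (hY.trans w₂)
        (ev R (hY.trans w₂) r) ≫ S.resHom _ N le_rfl le_rfl (hY.trans w₂) ε = g.hom Y hY m := by
    intro Y hY m
    obtain ⟨f, hf⟩ := (hR (unit A) Y (hY.trans (w₁.trans hV)) (hY.trans w₂)).2 (g.hom Y hY m)
    exact ⟨_, by rw [← eq_ev f]; exact hf⟩
  have inj : ∀ (Y : Opens X) (hY : Y ≤ W) (r r' : sec R Y (hY.trans w₂)),
      φ.mapOn (unit A) R (hY.trans (w₁.trans hV)) (hY.trans w₂) (ev R (hY.trans w₂) r) ≫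
        S.resHom _ N le_rfl le_rfl (hY.trans w₂) ε =
      φ.mapOn (unit A) R (hY.trans (w₁.trans hV)) (hY.trans w₂) (ev R (hY.trans w₂) r') ≫
        S.resHom _ N le_rfl le_rfl (hY.trans w₂) ε → r = r' := fun Y hY r r' h =>
    ev_injective R _ ((hR (unit A) Y (hY.trans (w₁.trans hV)) (hY.trans w₂)).1 h)
  choose b hb using hb
  let β : ((Mod A).res hV w₁).obj M ⟶ ((Mod A).res h₂ w₂).obj R := secHom M R w₁ w₂
    (fun Y hY =>
      { toFun := b Y hY
        map_add' := fun m m' => inj Y hY _ _ (by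
          rw [hb, g.hom_add, ev_add, hφ.mapOn_add, Preadditive.add_comp, hb, hb])
        map_smul' := fun a m => inj Y hY _ _ (by
          rw [hb, g.hom_smul, RingHom.id_apply, ev_smul, φ.mapOn_comp, Category.assoc, hb]
          rfl) })
    (fun Y Z hY hZ m => inj Z (hZ.trans hY) _ _ (by
      have h := congrArg (S.resHom _ N (hY.trans (w₁.trans hV)) (hY.trans w₂) hZ) (hb Y hY m)
      rw [resHom_comp (w₂ := hY.trans w₂), resHom_resHom, φ.resHom_mapOn, resHom_ev] at h
      exact h.trans ((g.resHom_hom Y Z hY hZ m).trans (hb Z (hZ.trans hY) _).symm)))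
  refine ⟨φ.mapOn M R w₁ w₂ β ≫ S.resHom _ N le_rfl le_rfl w₂ ε, fun Y hY m => ?_,
    fun β' hβ' => ?_⟩
  · rw [key]
    exact hb Y hY m
  · obtain ⟨f, rfl⟩ := (hR M W w₁ w₂).2 β'
    refine congrArg (fun t => φ.mapOn M R w₁ w₂ t ≫ S.resHom _ N le_rfl le_rfl w₂ ε)
      (secApp_ext fun Y hY m => inj Y hY _ _ ?_)
    rw [← key]
    exact (hβ' Y hY m).trans (hb Y hY m).symm

end PFunctor

/-! ### Functors with a right adjoint as tensor products -/

namespace PFunctor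

section

variable {X : TopCat.{u}} {𝒪 : Sheaf (Opens.grothendieckTopology X) CommRingCat.{u}} {U : Opens X}
  {A : Alg 𝒪 U} {S : Prestack.{w, v} 𝒪 U}
  {V V₁ V₂ V₃ W Y Z : Opens X} {hV : V ≤ U} {h₁ : V₁ ≤ U} {h₂ : V₂ ≤ U} {h₃ : V₃ ≤ U}

open Prestack _root_.TwistedStack.Mod

variable {φ ψ : PFunctor (Mod A) S}

/-- A transformation out of an `𝒪`-functor that admits a right adjoint is determined by its
component at `A`, which can be any morphism commuting with the right multiplications. -/
theorem IsLinear.mapModHom_unitMod_bijective (hφ : φ.IsLinear) (hr : φ.HasRightAdjoint)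
    (hψ : ψ.IsLinear) : Function.Bijective (hφ.mapModHom hψ (unitMod A)) := by
  have uni := fun {V : Opens X} {hV : V ≤ U} (M : (Mod A).Obj V hV) =>
    hφ.isUniversal_pairing hr M
  constructor
  · intro α α' h
    have h' : (α.app U le_rfl).app (unit A) = (α'.app U le_rfl).app (unit A) :=
      congrArg ModObj.Hom.hom h
    refine PFunctor.hom_ext fun V hV => NatTrans.ext (funext fun M => map_injective
      ((uni M).hom_ext fun Y hY m => ?_))
    rw [resHom_map, resHom_map, IsLinear.pairing_hom, α.naturalityOn, α'.naturalityOn, h']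
  · intro f
    have comm : ∀ (W : Opens X) (hW : W ≤ U) (a : A.Sec W hW),
        φ.mapOn (unit A) (unit A) hW hW (ev (unit A) hW (unitSec A W hW a)) ≫
            (S.res le_rfl hW).map f.hom =
          (S.res le_rfl hW).map f.hom ≫
            ψ.mapOn (unit A) (unit A) hW hW (ev (unit A) hW (unitSec A W hW a)) := fun W hW a =>
      f.comm W hW (MulOpposite.op a : (A.Sec W hW)ᵐᵒᵖ)
    let g : ∀ (V : Opens X) (hV : V ≤ U) (M : (Mod A).Obj V hV),
        Pairing hφ.onUnit M ((ψ.app V hV).obj M) (le_refl V) (le_refl V) := fun V hV M =>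
      { hom := fun Y hY m => (S.res le_rfl (hY.trans hV)).map f.hom ≫
          ψ.mapOn (unit A) M (hY.trans hV) hY (ev M hY m)
        hom_add := fun Y hY m m' => by rw [ev_add, hψ.mapOn_add, Preadditive.comp_add]
        hom_smul := fun Y hY a m => by
          rw [ev_smul, ψ.mapOn_comp, hφ.onUnit_ract, ← reassoc_of% comm Y (hY.trans hV) a]
        resHom_hom := fun Y Z hY hZ m => by
          rw [resHom_comp (w₂ := hY.trans hV), resHom_map, ψ.resHom_mapOn, resHom_ev] }
    have hβ := fun (V : Opens X) (hV : V ≤ U) (M : (Mod A).Obj V hV) =>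
      (uni M ((ψ.app V hV).obj M) V le_rfl le_rfl (g V hV M)).exists
    choose β hβ using hβ
    have hβ' : ∀ (V : Opens X) (hV : V ≤ U) (M : (Mod A).Obj V hV) (Y : Opens X) (hY : Y ≤ V)
        (m : sec M Y hY), φ.mapOn (unit A) M (hY.trans hV) hY (ev M hY m) ≫
          (S.res hV hY).map (down (β V hV M)) =
        (S.res le_rfl (hY.trans hV)).map f.hom ≫
          ψ.mapOn (unit A) M (hY.trans hV) hY (ev M hY m) := by
      intro V hV M Y hY m
      rw [Prestack.map_down]
      exact hβ V hV M Y hY m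
    refine ⟨homMk (fun V hV M => down (β V hV M)) ?_, ModObj.hom_ext ?_⟩
    · intro V₁ V₂ W h₁ h₂ M N w₁ w₂ b
      refine (uni M).hom_ext fun Y hY m => ?_
      rw [resHom_comp (w₂ := w₂), resHom_map, resHom_comp (w₂ := w₁), resHom_map,
        φ.resHom_mapOn, ψ.resHom_mapOn, IsLinear.pairing_hom, reassoc_of% hβ' V₁ h₁ M Y,
        ← φ.mapOn_comp_assoc, ev_comp, hβ', ← ψ.mapOn_comp, ev_comp]
    · change down (β U le_rfl (unit A)) = f.hom
      have h := hβ' U le_rfl (unit A) U le_rfl (unitSec A U le_rfl 1)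
      rw [ev_one, φ.mapOn_id, ψ.mapOn_id, Category.id_comp, Category.comp_id] at h
      exact map_injective h

end

section

variable {X : TopCat.{u}} {𝒪 : Sheaf (Opens.grothendieckTopology X) CommRingCat.{u}} {U : Opens X}
  {S : Prestack.{w₁, v₁} 𝒪 U} {T : Prestack.{w₂, v₂} 𝒪 U}

open Prestack

lemma Core.isLinear (c : Core S T)
    (hadd : ∀ (V : Opens X) (hV : V ≤ U) (F G : S.Obj V hV)
      (f g : (S.res hV le_rfl).obj F ⟶ (S.res hV le_rfl).obj G),
      c.mapOn F G le_rfl le_rfl (f + g) = c.mapOn F G le_rfl le_rfl f + c.mapOn F G le_rfl le_rfl g)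
    (hsmul : ∀ (V : Opens X) (hV : V ≤ U) (F G : S.Obj V hV) (r : Sec 𝒪 V)
      (f : (S.res hV le_rfl).obj F ⟶ (S.res hV le_rfl).obj G),
      c.mapOn F G le_rfl le_rfl (r • f) = r • c.mapOn F G le_rfl le_rfl f) :
    c.toPFunctor.IsLinear where
  map_add {V} hV F G f g := map_injective (by
    rw [T.res_add, ← mapOn_map, ← mapOn_map, ← mapOn_map, S.res_add]
    refine (c.toPFunctor_mapOn _ _ _ _ _).trans ((hadd V hV F G _ _).trans ?_)
    exact congrArg₂ (· + ·) (c.toPFunctor_mapOn _ _ _ _ _).symm (c.toPFunctor_mapOn _ _ _ _ _).symm)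
  map_smul {V} hV F G r f := map_injective (by
    rw [T.res_smul, ← mapOn_map, ← mapOn_map, S.res_smul]
    refine (c.toPFunctor_mapOn _ _ _ _ _).trans ((hsmul V hV F G _ _).trans ?_)
    exact congrArg (rho 𝒪 le_rfl r • ·) (c.toPFunctor_mapOn _ _ _ _ _).symm)

end

end PFunctor

namespace Pairing

variable {X : TopCat.{u}} {𝒪 : Sheaf (Opens.grothendieckTopology X) CommRingCat.{u}} {U : Opens X}
  {A : Alg 𝒪 U} {S : Prestack.{w, u} 𝒪 U}
  {V V₁ V₂ V₃ W Y Z : Opens X} {hV : V ≤ U} {h₁ : V₁ ≤ U} {h₂ : V₂ ≤ U} {h₃ : V₃ ≤ U}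

open Prestack _root_.TwistedStack.Mod

section Hom

variable (P : ModObj A.opp S U le_rfl) (N : S.Obj V hV)

/-- The morphisms from `P` to `N` over an open subset. -/
def HomSec (W : Opens X) (hW : W ≤ V) : Type u :=
  (S.res le_rfl (hW.trans hV)).obj P.obj ⟶ (S.res hV hW).obj N

noncomputable instance (W : Opens X) (hW : W ≤ V) : AddCommGroup (HomSec P N W hW) :=
  inferInstanceAs (AddCommGroup ((S.res le_rfl (hW.trans hV)).obj P.obj ⟶ (S.res hV hW).obj N))

noncomputable instance (W : Opens X) (hW : W ≤ V) :
    Module (A.Sec W (hW.trans hV)) (HomSec P N W hW) where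
  smul a f := P.ract (hW.trans hV) a ≫ f
  one_smul f := (congrArg (· ≫ f) (P.ract_one _)).trans (Category.id_comp f)
  mul_smul a b f := (congrArg (· ≫ f) (P.ract_mul _ a b)).trans (Category.assoc _ _ _)
  smul_zero _ := Limits.comp_zero
  smul_add _ _ _ := Preadditive.comp_add _ _ _ _ _ _
  add_smul a b f := (congrArg (· ≫ f) (P.ract_add _ a b)).trans (Preadditive.add_comp _ _ _ _ _ _)
  zero_smul f := (congrArg (· ≫ f) (map_zero (P.act W (hW.trans hV)))).trans Limits.zero_comp

/-- The presheaf of morphisms from an `A.opp`-module to an object, as a presheaf of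
`A`-modules. -/
noncomputable def homPreMod : PreMod A hV where
  carrier W hW := HomSec P N W hW
  res {W Y} hW hY :=
    { toFun := fun f => S.resHom P.obj N (hW.trans hV) hW hY f
      map_zero' := by
        have h := S.resHom_add P.obj N (hW.trans hV) hW hY 0 0
        rw [add_zero] at h
        exact left_eq_add.1 h
      map_add' := fun f g => resHom_add P.obj N (hW.trans hV) hW hY f g }
  res_smul {W Y} hW hY a f :=
    (resHom_comp P.obj P.obj N (hW.trans hV) (hW.trans hV) hW hY _ _).trans
      (congrArg (· ≫ S.resHom P.obj N (hW.trans hV) hW hY f) (P.resHom_ract _ _ _))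
  res_self hW f := resHom_self P.obj N _ _ f
  res_res hW hY hZ f := resHom_resHom P.obj N _ _ _ _ f

variable {N}

lemma isSheaf_homPreMod (hS : S.IsSeparated) : (homPreMod P N).IsSheaf := fun _ hW _ c hc h s hs =>
  hS.existsUnique P.obj N (hW.trans hV) hW c hc h s hs

end Hom

section Functor

variable {P : ModObj A.opp S U le_rfl}
  {Q : ∀ (V : Opens X) (hV : V ≤ U), (Mod A).Obj V hV → S.Obj V hV}
  {τ : ∀ (V : Opens X) (hV : V ≤ U) (M : (Mod A).Obj V hV),
    Pairing P M (Q V hV M) (le_refl V) (le_refl V)}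

/-- Universal pairings with all sheaves of `A`-modules are given by an `𝒪`-functor with a right
adjoint: the right adjoint takes `N` to the sheaf of morphisms from `P` to `N`. -/
theorem exists_pfunctor (hS : S.IsSeparated)
    (hτ : ∀ (V : Opens X) (hV : V ≤ U) (M : (Mod A).Obj V hV), (τ V hV M).IsUniversal) :
    ∃ (φ : PFunctor (Mod A) S) (hφ : φ.IsLinear), φ.HasRightAdjoint ∧
      Nonempty (hφ.onUnit ≅ P) := by
  have m : ∀ {V₁ V₂ W : Opens X} {h₁ : V₁ ≤ U} {h₂ : V₂ ≤ U} (M : (Mod A).Obj V₁ h₁)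
      (N : (Mod A).Obj V₂ h₂) (w₁ : W ≤ V₁) (w₂ : W ≤ V₂)
      (f : ((Mod A).res h₁ w₁).obj M ⟶ ((Mod A).res h₂ w₂).obj N),
      ∃ β : (S.res h₁ w₁).obj (Q V₁ h₁ M) ⟶ (S.res h₂ w₂).obj (Q V₂ h₂ N),
        ∀ (Y : Opens X) (hY : Y ≤ W) (m : sec M Y (hY.trans w₁)),
          (τ V₁ h₁ M).hom Y (hY.trans w₁) m ≫ S.resHom (Q V₁ h₁ M) (Q V₂ h₂ N) w₁ w₂ hY β =
            (τ V₂ h₂ N).hom Y (hY.trans w₂) (secApp f Y hY m) :=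
    fun {V₁ V₂ W h₁ h₂} M N w₁ w₂ f =>
      (hτ V₁ h₁ M (Q V₂ h₂ N) W w₁ w₂ (((τ V₂ h₂ N).restrict w₂).precomp f)).exists
  choose m hm using @m
  let c : PFunctor.Core (Mod A) S :=
    { obj := Q
      mapOn := fun {V₁ V₂ W h₁ h₂} F G w₁ w₂ f => m F G w₁ w₂ f
      mapOn_id := fun {V W hV} F w => (hτ V hV F).hom_ext fun Y hY x => by
        rw [hm, resHom_id, Category.comp_id, secApp_id]
      mapOn_comp := fun {V₁ V₂ V₃ W h₁ h₂ h₃} F G K w₁ w₂ w₃ f g =>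
        (hτ V₁ h₁ F).hom_ext fun Y hY x => by
          rw [hm, resHom_comp (w₂ := w₂), reassoc_of% hm F G, hm, secApp_comp]
      resHom_mapOn := fun {V₁ V₂ W Y h₁ h₂} F G w₁ w₂ hY f =>
        (hτ V₁ h₁ F).hom_ext fun Z hZ x => by
          rw [hm, resHom_resHom, hm, secApp_resHom] }
  let φ := c.toPFunctor
  have hc : ∀ {V₁ V₂ W : Opens X} {h₁ : V₁ ≤ U} {h₂ : V₂ ≤ U} (F : (Mod A).Obj V₁ h₁)
      (G : (Mod A).Obj V₂ h₂) (w₁ : W ≤ V₁) (w₂ : W ≤ V₂)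
      (f : ((Mod A).res h₁ w₁).obj F ⟶ ((Mod A).res h₂ w₂).obj G),
      φ.mapOn F G w₁ w₂ f = m F G w₁ w₂ f := fun F G w₁ w₂ f => c.toPFunctor_mapOn F G w₁ w₂ f
  have hφ : φ.IsLinear := c.isLinear
    (fun V hV F G f g => (hτ V hV F).hom_ext fun Y hY x => by
      change _ ≫ S.resHom _ _ _ _ hY (m F G _ _ (f + g)) =
        _ ≫ S.resHom _ _ _ _ hY (m F G _ _ f + m F G _ _ g)
      rw [hm, resHom_add, Preadditive.comp_add, hm, hm, secApp_add, Pairing.hom_add])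
    (fun V hV F G r f => (hτ V hV F).hom_ext fun Y hY x => by
      change _ ≫ S.resHom _ _ _ _ hY (m F G _ _ (r • f)) =
        _ ≫ S.resHom _ _ _ _ hY (r • m F G _ _ f)
      rw [hm, resHom_smul, Linear.comp_smul, hm, secApp_smul, Pairing.hom_smul, ModObj.ract_algMap,
        Linear.smul_comp, Category.id_comp])
  refine ⟨φ, hφ, PFunctor.hasRightAdjoint_of_exists_isRep φ fun V hV N => ?_, ?_⟩
  · let R : (Mod A).Obj V hV := PreMod.toObj (isSheaf_homPreMod P (N := N) hS)
    let ofSec : ∀ {W : Opens X} (hW : W ≤ V), sec R W hW →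
      ((S.res le_rfl (hW.trans hV)).obj P.obj ⟶ (S.res hV hW).obj N) := fun hW f => f
    let toSec : ∀ {W : Opens X} (hW : W ≤ V), ((S.res le_rfl (hW.trans hV)).obj P.obj ⟶
      (S.res hV hW).obj N) → sec R W hW := fun hW f => f
    let t : Pairing P R N (le_refl V) (le_refl V) :=
      { hom := fun Y hY f => ofSec hY f
        hom_add := fun _ _ _ _ => rfl
        hom_smul := fun _ _ _ _ => rfl
        resHom_hom := fun _ _ _ _ _ => rfl }
    obtain ⟨ε, hε, -⟩ := hτ V hV R N V le_rfl le_rfl t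
    refine ⟨R, ε, fun V₁ h₁ F Y y₁ y => ?_⟩
    have key : ∀ (f : ((Mod A).res h₁ y₁).obj F ⟶ ((Mod A).res hV y).obj R) (Z : Opens X)
        (hZ : Z ≤ Y) (x : sec F Z (hZ.trans y₁)),
        (τ V₁ h₁ F).hom Z (hZ.trans y₁) x ≫ S.resHom (Q V₁ h₁ F) N y₁ y hZ
          (m F R y₁ y f ≫ S.resHom (Q V hV R) N le_rfl le_rfl y ε) =
        ofSec (hZ.trans y) (secApp f Z hZ x) := by
      intro f Z hZ x
      rw [resHom_comp (w₂ := y), reassoc_of% hm F R, resHom_resHom]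
      exact hε Z (hZ.trans y) _
    refine Eq.mp (congrArg Function.Bijective (funext fun f =>
      congrArg (· ≫ S.resHom (Q V hV R) N le_rfl le_rfl y ε) (hc F R y₁ y f).symm)) ⟨?_, ?_⟩
    · intro f f' h
      refine secApp_ext fun Z hZ x => ?_
      refine (key f Z hZ x).symm.trans (Eq.trans ?_ (key f' Z hZ x))
      exact congrArg (fun t => (τ V₁ h₁ F).hom Z (hZ.trans y₁) x ≫ S.resHom _ N y₁ y hZ t) h
    · intro β
      let s := ((τ V₁ h₁ F).restrict y₁).comp β
      refine ⟨secHom F R y₁ y (fun Z hZ =>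
        { toFun := fun x => toSec (hZ.trans y) (s.hom Z hZ x)
          map_add' := fun x x' => s.hom_add Z hZ x x'
          map_smul' := fun a x => s.hom_smul Z hZ a x })
        (fun Z Z' hZ hZ' x => s.resHom_hom Z Z' hZ hZ' x), (hτ V₁ h₁ F).hom_ext fun Z hZ x => ?_⟩
      exact key _ Z hZ x
  · let τ₀ := τ U le_rfl (unit A)
    let t : Pairing P (unit A) P.obj (le_refl U) (le_refl U) :=
      { hom := fun Y hY a => P.ract hY ((unitSec A Y hY).symm a)
        hom_add := fun Y hY a b => by rw [map_add, P.ract_add]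
        hom_smul := fun Y hY a b => by rw [map_smul, smul_eq_mul, P.ract_mul]
        resHom_hom := fun Y Z hY hZ a => by rw [P.resHom_ract, unitSec_symm_secRes] }
    obtain ⟨β, hβ, -⟩ := hτ U le_rfl (unit A) P.obj U le_rfl le_rfl t
    let γ := τ₀.hom U le_rfl (unitSec A U le_rfl 1)
    have hγ : ∀ (Y : Opens X) (hY : Y ≤ U), S.resHom P.obj _ le_rfl le_rfl hY γ =
        τ₀.hom Y hY (unitSec A Y hY 1) := fun Y hY => by
      rw [τ₀.resHom_hom, secRes_unitSec, map_one]
    let i : (S.res le_rfl le_rfl).obj (Q U le_rfl (unit A)) ≅ (S.res le_rfl le_rfl).obj P.obj :=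
      { hom := β
        inv := γ
        hom_inv_id := (hτ U le_rfl (unit A)).hom_ext fun Y hY a => by
          rw [resHom_comp (w₂ := le_rfl), reassoc_of% hβ Y hY, hγ, resHom_id, Category.comp_id,
            ← τ₀.hom_smul, ← unitSec_mul, mul_one, LinearEquiv.apply_symm_apply]
        inv_hom_id := by
          have := hβ U le_rfl (unitSec A U le_rfl 1)
          rw [resHom_self] at this
          refine this.trans ?_
          change P.ract le_rfl ((unitSec A U le_rfl).symm (unitSec A U le_rfl 1)) = _
          rw [LinearEquiv.symm_apply_apply, P.ract_one] }
    refine ⟨ModObj.isoMk (M := hφ.onUnit) (N := P) (downIso i) fun W hW a => ?_⟩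
    have key : ∀ a : A.Sec W hW, m (unit A) (unit A) hW hW (ev (unit A) hW (unitSec A W hW a)) ≫
        (S.res le_rfl hW).map (down β) = (S.res le_rfl hW).map (down β) ≫ P.ract hW a := by
      intro a
      rw [Prestack.map_down]
      refine (hτ U le_rfl (unit A)).hom_ext fun Y hY x => ?_
      rw [resHom_comp (w₂ := hW), reassoc_of% hm (unit A) (unit A), resHom_resHom, hβ,
        resHom_comp (w₂ := hW), resHom_resHom, reassoc_of% hβ Y (hY.trans hW), P.resHom_ract]
      exact P.ract_mul (hY.trans hW) ((unitSec A Y (hY.trans hW)).symm x) (A.rho hW hY a)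
    exact (congrArg (· ≫ (S.res le_rfl hW).map (down β)) (hc _ _ _ _ _)).trans
      (key (MulOpposite.unop (α := A.Sec W hW) a))

end Functor

end Pairing

/-! ### Tensor products over a noncommutative ring -/

section

open scoped TensorProduct

/-- The relations `r a p ⊗ m = p ⊗ a m` imposed in a tensor product over a noncommutative ring. -/
def balancedRelations {A B P : Type u} (M : Type u) [Ring A] [Ring B] [AddCommGroup P] [Module B P]
    [AddCommGroup M] [Module A M] (r : A → P →ₗ[B] P) : Submodule B (P ⊗[ℤ] M) :=
  Submodule.span B {t | ∃ a p m, t = r a p ⊗ₜ[ℤ] m - p ⊗ₜ[ℤ] (a • m)}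

/-- The tensor product over a noncommutative ring `A` of a left `B`-module `P`, on which `A` acts
from the right through a family `r` of endomorphisms, with a left `A`-module `M`. -/
def BalancedTensor {A B P : Type u} (M : Type u) [Ring A] [Ring B] [AddCommGroup P] [Module B P]
    [AddCommGroup M] [Module A M] (r : A → P →ₗ[B] P) : Type u :=
  (P ⊗[ℤ] M) ⧸ balancedRelations M r

namespace BalancedTensor

variable {A B P M : Type u} [Ring A] [Ring B] [AddCommGroup P] [Module B P] [AddCommGroup M]
  [Module A M] (r : A → P →ₗ[B] P)

noncomputable instance : AddCommGroup (BalancedTensor M r) :=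
  inferInstanceAs (AddCommGroup ((P ⊗[ℤ] M) ⧸ balancedRelations M r))

noncomputable instance : Module B (BalancedTensor M r) :=
  inferInstanceAs (Module B ((P ⊗[ℤ] M) ⧸ balancedRelations M r))

/-- The class of an elementary tensor. -/
noncomputable def mk (m : M) : P →ₗ[B] BalancedTensor M r where
  toFun p := Submodule.Quotient.mk (p ⊗ₜ m)
  map_add' p p' := by rw [TensorProduct.add_tmul]; rfl
  map_smul' b p := by rw [← TensorProduct.smul_tmul']; rfl

lemma mk_add (m m' : M) (p : P) : mk r (m + m') p = mk r m p + mk r m' p :=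
  congrArg Submodule.Quotient.mk (TensorProduct.tmul_add p m m')

lemma mk_smul (a : A) (m : M) (p : P) : mk r (a • m) p = mk r m (r a p) :=
  ((Submodule.Quotient.eq (balancedRelations M r)).2 (Submodule.subset_span ⟨a, p, m, rfl⟩)).symm

variable {r} {B' N : Type u} [Ring B'] [AddCommGroup N] [Module B' N] {σ : B →+* B'}

@[elab_as_elim]
lemma induction_on {motive : BalancedTensor M r → Prop} (t : BalancedTensor M r)
    (mk : ∀ m p, motive (mk r m p)) (add : ∀ t t', motive t → motive t' → motive (t + t')) :
    motive t := by
  obtain ⟨t, rfl⟩ := Submodule.Quotient.mk_surjective _ t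
  induction t with
  | zero => 
    have := mk 0 0
    rwa [map_zero] at this
  | tmul p m => exact mk m p
  | add t t' h h' => exact add _ _ h h'

/-- The universal property of the tensor product. -/
noncomputable def lift (g : M → P →ₛₗ[σ] N) (hadd : ∀ m m', g (m + m') = g m + g m')
    (hsmul : ∀ (a : A) (m : M) (p : P), g (a • m) p = g m (r a p)) :
    BalancedTensor M r →ₛₗ[σ] N :=
  let f : P ⊗[ℤ] M →+ N := TensorProduct.liftAddHom
    { toFun := fun p => AddMonoidHom.mk' (fun m => g m p) fun m m' => by rw [hadd]; rfl
      map_zero' := AddMonoidHom.ext fun m => map_zero (g m)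
      map_add' := fun p p' => AddMonoidHom.ext fun m => map_add (g m) p p' }
    (fun n p m => by
      have h := map_zsmul (AddMonoidHom.mk' (fun m => g m p) fun m m' => by rw [hadd]; rfl) n m
      exact (map_zsmul (g m) n p).trans h.symm)
  Submodule.liftQ (balancedRelations M r)
    { toFun := f
      map_add' := map_add f
      map_smul' := fun b t => by
        induction t with
        | zero => rw [smul_zero, map_zero, smul_zero]
        | tmul p m => exact (g m).map_smulₛₗ b p
        | add t t' h h' => rw [smul_add, map_add, h, h', map_add, smul_add] }
    (Submodule.span_le.2 (by
      rintro _ ⟨a, p, m, rfl⟩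
      rw [SetLike.mem_coe, LinearMap.mem_ker, LinearMap.coe_mk, AddHom.coe_mk]
      refine (map_sub f _ _).trans (sub_eq_zero.2 ?_)
      exact (hsmul a m p).symm))

end BalancedTensor

end

/-! ### Existence of universal pairings in stacks of modules -/

namespace Mod

variable {X : TopCat.{u}} {𝒪 : Sheaf (Opens.grothendieckTopology X) CommRingCat.{u}} {U : Opens X}
  {A B : Alg 𝒪 U} {V V₁ V₂ V₃ W Y Z : Opens X} {hV : V ≤ U} {h₁ : V₁ ≤ U} {h₂ : V₂ ≤ U}
  {h₃ : V₃ ≤ U}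

open Prestack

variable (P : ModObj A.opp (Mod B) U le_rfl) (M : (Mod A).Obj V hV)

/-- The right action of the sections of `A` on the sections of an `A.opp`-module in `Mod B`. -/
noncomputable def secRact (W : Opens X) (hW : W ≤ U) (a : A.Sec W hW) :
    sec P.obj W hW →ₗ[B.Sec W hW] sec P.obj W hW :=
  secApp (P.ract hW a) W le_rfl

variable {P} in
lemma secApp_ract (hW : W ≤ U) (hY : Y ≤ W) (a : A.Sec W hW) (p : sec P.obj Y (hY.trans hW)) :
    secApp (P.ract hW a) Y hY p = secRact P Y (hY.trans hW) (A.rho hW hY a) p := by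
  rw [secRact, ← P.resHom_ract]
  exact (secApp_resHom (P.ract hW a) hY le_rfl p).symm

lemma secRes_secRact (hW : W ≤ U) (hY : Y ≤ W) (a : A.Sec W hW) (p : sec P.obj W hW) :
    secRes P.obj hW hY (secRact P W hW a p) =
      secRact P Y (hY.trans hW) (A.rho hW hY a) (secRes P.obj hW hY p) := by
  rw [← secApp_ract]
  exact secRes_secApp (P.ract hW a) le_rfl hY p

/-- The restriction map of the presheaf tensor product. -/
noncomputable def tensorSecRes (hW : W ≤ V) (hY : Y ≤ W) :
    BalancedTensor (sec M W hW) (secRact P W (hW.trans hV)) →ₛₗ[B.rho (hW.trans hV) hY]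
      BalancedTensor (sec M Y (hY.trans hW)) (secRact P Y (hY.trans (hW.trans hV))) :=
  BalancedTensor.lift
    (fun m =>
      { toFun := fun p => BalancedTensor.mk _ (secRes M hW hY m) (secRes P.obj (hW.trans hV) hY p)
        map_add' := fun p p' => by rw [map_add, map_add]
        map_smul' := fun b p => by rw [secRes_smul, map_smul] })
    (fun m m' => LinearMap.ext fun p => by
      change BalancedTensor.mk _ (secRes M hW hY (m + m')) _ = _
      rw [map_add, BalancedTensor.mk_add]
      rfl)
    (fun a m p => by
      change BalancedTensor.mk _ (secRes M hW hY (a • m)) _ =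
        BalancedTensor.mk _ (secRes M hW hY m) (secRes P.obj _ hY (secRact P W _ a p))
      rw [secRes_smul, BalancedTensor.mk_smul, secRes_secRact])

lemma tensorSecRes_mk (hW : W ≤ V) (hY : Y ≤ W) (m : sec M W hW) (p : sec P.obj W (hW.trans hV)) :
    tensorSecRes P M hW hY (BalancedTensor.mk _ m p) =
      BalancedTensor.mk _ (secRes M hW hY m) (secRes P.obj (hW.trans hV) hY p) := rfl

/-- The presheaf tensor product over `A`. -/
noncomputable def tensorPreMod : PreMod B hV where
  carrier W hW := BalancedTensor (sec M W hW) (secRact P W (hW.trans hV))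
  res hW hY := (tensorSecRes P M hW hY).toAddMonoidHom
  res_smul hW hY b t := (tensorSecRes P M hW hY).map_smulₛₗ b t
  res_self hW t := by
    induction t using BalancedTensor.induction_on with
    | mk m p =>
      refine (tensorSecRes_mk P M hW le_rfl m p).trans ?_
      rw [secRes_self, secRes_self]
    | add t t' h h' => rw [map_add, h, h']
  res_res {W Y Z} hW hY hZ t := by
    induction t using BalancedTensor.induction_on with
    | mk m p =>
      change BalancedTensor.mk _ (secRes M _ hZ (secRes M hW hY m))
        (secRes P.obj _ hZ (secRes P.obj _ hY p)) =
          BalancedTensor.mk _ (secRes M hW (hZ.trans hY) m) (secRes P.obj _ (hZ.trans hY) p)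
      rw [secRes_secRes, secRes_secRes]
    | add t t' h h' => rw [map_add, map_add, h, h', map_add]

section

variable {P M} {Q : (Mod B).Obj V hV} (e : (tensorPreMod P M).Sheafification Q)

/-- The sections of the tensor product given by a section `m` of `M` and the sections of `P`. -/
noncomputable def secTensor (Y : Opens X) (hY : Y ≤ V) (m : sec M Y hY) :
    sec P.obj Y (hY.trans hV) →ₗ[B.Sec Y (hY.trans hV)] sec Q Y hY :=
  (e.η Y hY).comp (BalancedTensor.mk (secRact P Y (hY.trans hV)) m)

lemma secRes_secTensor (hY : Y ≤ V) (hZ : Z ≤ Y) (m : sec M Y hY)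
    (p : sec P.obj Y (hY.trans hV)) : secRes Q hY hZ (secTensor e Y hY m p) =
      secTensor e Z (hZ.trans hY) (secRes M hY hZ m) (secRes P.obj (hY.trans hV) hZ p) :=
  e.secRes_η Y Z hY hZ _

lemma secTensor_add (Y : Opens X) (hY : Y ≤ V) (m m' : sec M Y hY)
    (p : sec P.obj Y (hY.trans hV)) :
    secTensor e Y hY (m + m') p = secTensor e Y hY m p + secTensor e Y hY m' p :=
  (congrArg (e.η Y hY) (BalancedTensor.mk_add _ m m' p)).trans (map_add (e.η Y hY) _ _)

lemma secTensor_smul (Y : Opens X) (hY : Y ≤ V) (a : A.Sec Y (hY.trans hV)) (m : sec M Y hY)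
    (p : sec P.obj Y (hY.trans hV)) :
    secTensor e Y hY (a • m) p = secTensor e Y hY m (secRact P Y (hY.trans hV) a p) :=
  congrArg (e.η Y hY) (BalancedTensor.mk_smul _ a m p)

/-- The morphism from `P` to the tensor product given by a section of `M`. -/
noncomputable def tensorHom (Y : Opens X) (hY : Y ≤ V) (m : sec M Y hY) :
    ((Mod B).res le_rfl (hY.trans hV)).obj P.obj ⟶ ((Mod B).res hV hY).obj Q :=
  secHom P.obj Q (hY.trans hV) hY (fun Z hZ => secTensor e Z (hZ.trans hY) (secRes M hY hZ m))
    (fun Z Z' hZ hZ' p => by rw [secRes_secTensor, secRes_secRes])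

lemma secApp_tensorHom (hY : Y ≤ V) (m : sec M Y hY) (hZ : Z ≤ Y)
    (p : sec P.obj Z (hZ.trans (hY.trans hV))) :
    secApp (tensorHom e Y hY m) Z hZ p = secTensor e Z (hZ.trans hY) (secRes M hY hZ m) p := by
  rw [tensorHom, secApp_secHom]

/-- The pairing with values in the tensor product. -/
@[simps]
noncomputable def tensorPairing : Pairing P M Q (le_refl V) (le_refl V) where
  hom Y hY m := tensorHom e Y hY m
  hom_add Y hY m m' := secApp_ext fun Z hZ p => by
    rw [secApp_add, secApp_tensorHom, secApp_tensorHom, secApp_tensorHom, map_add, secTensor_add]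
  hom_smul Y hY a m := secApp_ext fun Z hZ p => by
    rw [secApp_comp, secApp_tensorHom, secApp_tensorHom, secRes_smul, secApp_ract, secTensor_smul]
  resHom_hom Y Z hY hZ m := secApp_ext fun Z' hZ' p => by
    rw [secApp_resHom, secApp_tensorHom, secApp_tensorHom, secRes_secRes]

end

section

variable {P M} {N : (Mod B).Obj V₂ h₂} {w₁ : W ≤ V} {w₂ : W ≤ V₂} (g : Pairing P M N w₁ w₂)

/-- The linear map from the presheaf tensor product given by a pairing. -/
noncomputable def pairingLift (Y : Opens X) (hY : Y ≤ W) :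
    BalancedTensor (sec M Y (hY.trans w₁)) (secRact P Y (hY.trans (w₁.trans hV)))
      →ₗ[B.Sec Y (hY.trans (w₁.trans hV))] sec N Y (hY.trans w₂) :=
  BalancedTensor.lift (fun m => secApp (g.hom Y hY m) Y le_rfl)
    (fun m m' => LinearMap.ext fun p => by rw [g.hom_add]; exact secApp_add _ _ le_rfl p)
    (fun a m p => by rw [g.hom_smul]; exact secApp_comp _ _ le_rfl p)

lemma pairingLift_mk (Y : Opens X) (hY : Y ≤ W) (m : sec M Y (hY.trans w₁))
    (p : sec P.obj Y (hY.trans (w₁.trans hV))) :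
    pairingLift g Y hY (BalancedTensor.mk _ m p) = secApp (g.hom Y hY m) Y le_rfl p := rfl

lemma secApp_pairing_hom (hY : Y ≤ W) (hZ : Z ≤ Y) (m : sec M Y (hY.trans w₁))
    (p : sec P.obj Z (hZ.trans (hY.trans (w₁.trans hV)))) :
    secApp (g.hom Y hY m) Z hZ p =
      secApp (g.hom Z (hZ.trans hY) (secRes M (hY.trans w₁) hZ m)) Z le_rfl p := by
  rw [← g.resHom_hom]
  exact (secApp_resHom (g.hom Y hY m) hZ le_rfl p).symm

lemma secRes_pairingLift (hY : Y ≤ W) (hZ : Z ≤ Y)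
    (q : BalancedTensor (sec M Y (hY.trans w₁)) (secRact P Y (hY.trans (w₁.trans hV)))) :
    secRes N (hY.trans w₂) hZ (pairingLift g Y hY q) =
      pairingLift g Z (hZ.trans hY) (tensorSecRes P M (hY.trans w₁) hZ q) := by
  induction q using BalancedTensor.induction_on with
  | mk m p =>
    rw [tensorSecRes_mk, pairingLift_mk, pairingLift_mk, ← secApp_pairing_hom]
    exact secRes_secApp (g.hom Y hY m) le_rfl hZ p
  | add q q' h h' => rw [map_add, map_add, h, h', map_add, map_add]

end

/-- The sheaf associated with the presheaf tensor product is a tensor product. -/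
theorem exists_universal_pairing :
    ∃ (Q : (Mod B).Obj V hV) (τ : Pairing P M Q (le_refl V) (le_refl V)), τ.IsUniversal := by
  obtain ⟨Q, ⟨e⟩⟩ := (tensorPreMod P M).exists_sheafification
  refine ⟨Q, tensorPairing e, fun V₂ h₂ N W w₁ w₂ g => ?_⟩
  obtain ⟨f, hf, hf'⟩ := e.existsUnique_hom N w₁ w₂ (fun Y hY => pairingLift g Y hY)
    (fun Y Z hY hZ q => secRes_pairingLift g hY hZ q)
  refine ⟨f, fun Y hY m => secApp_ext fun Z hZ p => ?_, fun f' h => hf' f' fun Y hY q => ?_⟩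
  · rw [secApp_comp, secApp_resHom, tensorPairing_hom, secApp_tensorHom, secApp_pairing_hom]
    exact hf Z (hZ.trans hY) _
  · refine BalancedTensor.induction_on (motive := fun q =>
      secApp f' Y hY (e.η Y (hY.trans w₁) q) = pairingLift g Y hY q) q (fun m p => ?_)
      fun q q' h h' => ?_
    · rw [pairingLift_mk, ← h Y hY m, secApp_comp, secApp_resHom, tensorPairing_hom,
        secApp_tensorHom, secRes_self]
      rfl
    · rw [map_add, ← h, ← h', ← map_add]
      exact congrArg (secApp f' Y hY) (map_add (e.η Y _) q q')

end Mod

/-! ### The value of functors at a module -/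

section

variable {X : TopCat.{u}} {𝒪 : Sheaf (Opens.grothendieckTopology X) CommRingCat.{u}} {U : Opens X}
  {C : Alg 𝒪 U} {T : Prestack.{w₁, v₁} 𝒪 U} {S : Prestack.{w₂, v₂} 𝒪 U} {V W Y : Opens X}
  {hV : V ≤ U}

open Prestack _root_.TwistedStack.Mod

/-- The comparison of the restriction of the value at `F` with the value at the restriction of `F`
intertwines the images of the corresponding endomorphisms of `F` over smaller open subsets. -/
lemma PFunctor.mapOn_comp_map_iso (φ : PFunctor T S)
    (F : T.Obj V hV) (hW : W ≤ V) (hY : Y ≤ W)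
    (e : (T.res (hW.trans hV) hY).obj ((T.res hV hW).obj F) ⟶
      (T.res (hW.trans hV) hY).obj ((T.res hV hW).obj F))
    (e' : (T.res hV (hY.trans hW)).obj F ⟶ (T.res hV (hY.trans hW)).obj F)
    (h : (T.can F hW hY).inv ≫ e ≫ (T.can F hW hY).hom = e') :
    φ.mapOn ((T.res hV hW).obj F) ((T.res hV hW).obj F) hY hY e ≫
      (S.res (hW.trans hV) hY).map ((φ.iso hV hW).hom.app F) =
    (S.res (hW.trans hV) hY).map ((φ.iso hV hW).hom.app F) ≫
      (S.can ((φ.app V hV).obj F) hW hY).hom ≫ φ.mapOn F F (hY.trans hW) (hY.trans hW) e' ≫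
        (S.can ((φ.app V hV).obj F) hW hY).inv := by
  have c := φ.mapOn_can F hW hY
  have i : φ.mapOn _ _ _ _ (T.can F hW hY).hom ≫ φ.mapOn _ _ _ _ (T.can F hW hY).inv = 𝟙 _ := by
    rw [← φ.mapOn_comp, Iso.hom_inv_id, φ.mapOn_id]
  rw [← h, φ.mapOn_comp (G := (T.res hV hW).obj F) (w₂ := hY),
    φ.mapOn_comp (G := (T.res hV hW).obj F) (w₂ := hY), ← reassoc_of% c]
  simp only [Category.assoc]
  rw [reassoc_of% i, reassoc_of% c, Iso.hom_inv_id, Category.comp_id]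

/-- The comparison of the values of a functor at an object `F` and at an object `G` isomorphic to
`F|_W` intertwines the images of corresponding endomorphisms over smaller open subsets. -/
lemma PFunctor.mapOn_comp_map_iso' (φ : PFunctor T S) (F : T.Obj V hV) (hW : W ≤ V)
    (G : T.Obj W (hW.trans hV)) (c : G ⟶ (T.res hV hW).obj F) (hY : Y ≤ W)
    (e : (T.res (hW.trans hV) hY).obj G ⟶ (T.res (hW.trans hV) hY).obj G)
    (e' : (T.res hV (hY.trans hW)).obj F ⟶ (T.res hV (hY.trans hW)).obj F)
    (h : e ≫ (T.res (hW.trans hV) hY).map c =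
      (T.res (hW.trans hV) hY).map c ≫ (T.can F hW hY).hom ≫ e' ≫ (T.can F hW hY).inv) :
    φ.mapOn G G hY hY e ≫
      (S.res (hW.trans hV) hY).map ((φ.app W (hW.trans hV)).map c ≫ (φ.iso hV hW).hom.app F) =
    (S.res (hW.trans hV) hY).map ((φ.app W (hW.trans hV)).map c ≫ (φ.iso hV hW).hom.app F) ≫
      (S.can ((φ.app V hV).obj F) hW hY).hom ≫ φ.mapOn F F (hY.trans hW) (hY.trans hW) e' ≫
        (S.can ((φ.app V hV).obj F) hW hY).inv := by
  have k := φ.mapOn_comp_map_iso F hW hY ((T.can F hW hY).hom ≫ e' ≫ (T.can F hW hY).inv) e'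
    (by simp)
  rw [Functor.map_comp, Category.assoc, ← k, ← φ.mapOn_map, ← φ.mapOn_comp_assoc, h,
    φ.mapOn_comp_assoc]

/-- Compatibility of the comparison maps for three open subsets. -/
lemma PFunctor.iso_comp' (φ : PFunctor T S) (F : T.Obj V hV) (hW : W ≤ V) (hY : Y ≤ W)
    (G : T.Obj W (hW.trans hV)) (c : G ⟶ (T.res hV hW).obj F)
    (H : T.Obj Y (hY.trans (hW.trans hV))) (d : H ⟶ (T.res (hW.trans hV) hY).obj G)
    (b : H ⟶ (T.res hV (hY.trans hW)).obj F)
    (h : d ≫ (T.res (hW.trans hV) hY).map c ≫ (T.resComp hV hW hY).hom.app F = b) :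
    (φ.app _ _).map b ≫ (φ.iso hV (hY.trans hW)).hom.app F =
      ((φ.app _ _).map d ≫ (φ.iso (hW.trans hV) hY).hom.app G) ≫
        (S.res (hW.trans hV) hY).map ((φ.app _ _).map c ≫ (φ.iso hV hW).hom.app F) ≫
          (S.resComp hV hW hY).hom.app ((φ.app V hV).obj F) := by
  have n := (φ.iso (hW.trans hV) hY).hom.naturality c
  dsimp at n
  rw [← h, Functor.map_comp, Functor.map_comp, Category.assoc, Category.assoc, φ.iso_comp,
    Functor.map_comp, Category.assoc, Category.assoc, ← reassoc_of% n]

lemma Prestack.resComp_inv_assoc {V₀ : Opens X} (h₀ : V₀ ≤ U) (hV : V ≤ V₀) (hW : W ≤ V)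
    (hY : Y ≤ W) (F : T.Obj V₀ h₀) :
    (T.resComp h₀ (hW.trans hV) hY).inv.app F ≫
        (T.res (hW.trans (hV.trans h₀)) hY).map ((T.resComp h₀ hV hW).inv.app F) ≫
          (T.resComp (hV.trans h₀) hW hY).hom.app ((T.res h₀ hV).obj F) =
      (T.resComp h₀ hV (hY.trans hW)).inv.app F := by
  have a := T.resComp_assoc h₀ hV hW hY F
  rw [← cancel_mono ((T.resComp h₀ hV (hY.trans hW)).hom.app F), Category.assoc, Category.assoc,
    ← a, ← Functor.map_comp_assoc, Iso.inv_hom_id_app, Iso.inv_hom_id_app]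
  simp

namespace ModObj

/-- A module over `V` in the restriction to `V` of a prestack, as a module over `V` in the
prestack. -/
def ofRestrict (M : ModObj (C.restrict hV) (S.restrict hV) V le_rfl) : ModObj C S V hV where
  obj := M.obj
  act := M.act
  act_algMap := M.act_algMap
  act_res := M.act_res

/-- The morphisms between modules do not depend on the ambient open subset. -/
def ofRestrictHom (M N : ModObj (C.restrict hV) (S.restrict hV) V le_rfl) :
    (M ⟶ N) ≃ (M.ofRestrict ⟶ N.ofRestrict) where
  toFun f := { hom := f.hom, comm := f.comm }
  invFun f := { hom := f.hom, comm := f.comm }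
  left_inv _ := rfl
  right_inv _ := rfl

/-- A module over `V` in a prestack, as a module in the restriction of the prestack to `V`. -/
def toRestrict (M : ModObj C S V hV) : ModObj (C.restrict hV) (S.restrict hV) V le_rfl where
  obj := M.obj
  act := M.act
  act_algMap := M.act_algMap
  act_res := M.act_res

lemma nonempty_iso_of_restrict {M : ModObj (C.restrict hV) (S.restrict hV) V le_rfl}
    {N : ModObj C S V hV} (e : M ≅ N.toRestrict) : Nonempty (M.ofRestrict ≅ N) :=
  ⟨{ hom := ofRestrictHom M N.toRestrict e.hom
     inv := ofRestrictHom N.toRestrict M e.inv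
     hom_inv_id := congrArg (ofRestrictHom M M) e.hom_inv_id
     inv_hom_id := congrArg (ofRestrictHom N.toRestrict N.toRestrict) e.inv_hom_id }⟩

end ModObj

variable (E : ModObj C T U le_rfl)

/-- The image of a module under an `𝒪`-functor over `V`. -/
def evalObj (φ : (HomR T S).Obj V hV) : ModObj C S V hV :=
  ModObj.ofRestrict (PFunctor.IsLinear.mapMod φ.property.1 (E.restrict hV).toRestrict)

/-- The morphism between the images of a module given by a transformation. -/
def evalMap {φ ψ : (HomR T S).Obj V hV} (α : φ ⟶ ψ) : evalObj E φ ⟶ evalObj E ψ :=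
  ModObj.ofRestrictHom _ _
    (PFunctor.IsLinear.mapModHom φ.property.1 ψ.property.1 (E.restrict hV).toRestrict α.hom)

/-- Evaluation of functors at a module commutes with restriction. -/
def evalRes (φ : (HomR T S).Obj V hV) (hW : W ≤ V) :
    evalObj E (((HomR T S).res hV hW).obj φ) ≅ (evalObj E φ).restrict hW :=
  let ψ : PFunctor (T.restrict hV) (S.restrict hV) := φ.obj
  let c := (T.resComp le_rfl hV hW).app E.obj
  ModObj.isoMk (M := evalObj E (((HomR T S).res hV hW).obj φ)) (N := (evalObj E φ).restrict hW)
    ((ψ.app W hW).mapIso c.symm ≪≫ (ψ.iso le_rfl hW).app (E.restrict hV).obj)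
    (fun Y hY a => ψ.mapOn_comp_map_iso' (E.restrict hV).obj hW (E.restrict (hW.trans hV)).obj c.inv hY _ _
      ((((ModIn C T).resComp le_rfl hV hW).inv.app E).comm Y hY a))

variable (S) in
/-- Evaluation of functors at a module. -/
def evalFunctor : PFunctor (HomR T S) (ModIn C S) where
  app V hV :=
    { obj := fun φ => evalObj E φ
      map := fun α => evalMap E α
      map_id := fun _ => ModObj.hom_ext rfl
      map_comp := fun _ _ => ModObj.hom_ext rfl }
  iso {V W} hV hW := NatIso.ofComponents (fun φ => evalRes E φ hW)
    (fun {φ ψ} α => ModObj.hom_ext (by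
      let φ' : PFunctor (T.restrict hV) (S.restrict hV) := φ.obj
      let ψ' : PFunctor (T.restrict hV) (S.restrict hV) := ψ.obj
      let α' : φ' ⟶ ψ' := α.hom
      let c := (T.resComp le_rfl hV hW).app E.obj
      have n := α'.naturality le_rfl hW (E.restrict hV).obj
      have n' := (α'.app W hW).naturality c.inv
      change (α'.app W hW).app (E.restrict (hW.trans hV)).obj ≫ (ψ'.app W hW).map c.inv ≫
          (ψ'.iso le_rfl hW).hom.app (E.restrict hV).obj =
        ((φ'.app W hW).map c.inv ≫ (φ'.iso le_rfl hW).hom.app (E.restrict hV).obj) ≫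
          (S.res hV hW).map ((α'.app V le_rfl).app (E.restrict hV).obj)
      exact (Category.assoc _ _ _).symm.trans ((congrArg (· ≫ _) n'.symm).trans
        ((Category.assoc _ _ _).trans ((congrArg _ n).trans (Category.assoc _ _ _).symm)))))
  iso_comp {V W Y} hV hW hY φ := ModObj.hom_ext (by
    let ψ : PFunctor (T.restrict hV) (S.restrict hV) := φ.obj
    have h := ψ.iso_comp' (hV := le_rfl) (E.restrict hV).obj hW hY (E.restrict (hW.trans hV)).obj
      ((T.resComp le_rfl hV hW).inv.app E.obj) (E.restrict (hY.trans (hW.trans hV))).obj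
      ((T.resComp le_rfl (hW.trans hV) hY).inv.app E.obj)
      ((T.resComp le_rfl hV (hY.trans hW)).inv.app E.obj) (T.resComp_inv_assoc le_rfl hV hW hY E.obj)
    exact (Category.id_comp _).trans h)

lemma isLinear_evalFunctor : (evalFunctor S E).IsLinear where
  map_add _ _ _ _ _ := ModObj.hom_ext rfl
  map_smul {V} hV _ _ r α := ModObj.hom_ext (by
    have h : rho 𝒪 (le_refl V) r = r := ConcreteCategory.congr_hom (𝒪.obj.map_id (op V)) r
    exact congrArg (· • (α.hom.app V le_rfl).app (E.restrict hV).obj) h)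

end

/-! ### Functors with a right adjoint between stacks of modules -/

section

variable {X : TopCat.{u}} {𝒪 : Sheaf (Opens.grothendieckTopology X) CommRingCat.{u}} {U : Opens X}
  {A B : Alg 𝒪 U} {S : Prestack.{w, v} 𝒪 U} {V W Y : Opens X} {hV : V ≤ U}

open Prestack _root_.TwistedStack.Mod

lemma ModObj.eq_of_heq_act {C : Alg 𝒪 U} {M N : ModObj C S V hV} (h : M.obj = N.obj)
    (h' : ∀ W hW a, HEq (M.act W hW a) (N.act W hW a)) : M = N := by
  obtain ⟨o, a, _, _⟩ := M
  obtain ⟨o', a', _, _⟩ := N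
  obtain rfl : o = o' := h
  obtain rfl : a = a' :=
    funext fun W => funext fun hW => RingHom.ext fun x => eq_of_heq (h' W hW x)
  rfl

lemma Iso.hom_comp_comp_inv_eq {C : Type w} [Category.{v} C] {P Q : C} (i : P ≅ Q) {e : P ⟶ P}
    {f : Q ⟶ Q} (h : i.inv ≫ e ≫ i.hom = f) : i.hom ≫ f ≫ i.inv = e := by
  rw [← h]
  simp

namespace Mod

lemma can_inv_comp_ev_comp_can (hW : W ≤ U) (hY : Y ≤ W) (a : A.Sec Y (hY.trans hW)) :
    ((Mod A).can (unit A) hW hY).inv ≫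
        (ev (unit (A.restrict hW)) hY (unitSec (A.restrict hW) Y hY a) :
          ((Mod A).res hW hY).obj (((Mod A).res le_rfl hW).obj (unit A)) ⟶
            ((Mod A).res hW hY).obj (((Mod A).res le_rfl hW).obj (unit A))) ≫
          ((Mod A).can (unit A) hW hY).hom =
      ev (unit A) (hY.trans hW) (unitSec A Y (hY.trans hW) a) := by
  refine unit_hom_ext ?_
  rw [secApp_ev_one]
  exact secApp_ev_one (A := A.restrict hW) (unit (A.restrict hW)) hY
    (unitSec (A.restrict hW) Y hY a)

lemma can_comp_ev_comp_can_inv (hW : W ≤ U) (hY : Y ≤ W) (a : A.Sec Y (hY.trans hW)) :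
    ((Mod A).can (unit A) hW hY).hom ≫ ev (unit A) (hY.trans hW) (unitSec A Y (hY.trans hW) a) ≫
        ((Mod A).can (unit A) hW hY).inv =
      ev (unit (A.restrict hW)) hY (unitSec (A.restrict hW) Y hY a) :=
  Iso.hom_comp_comp_inv_eq _ (can_inv_comp_ev_comp_can hW hY a)

lemma act_toRestrict_restrict_unitMod (hV : V ≤ U) (hW : W ≤ V) (a : A.Sec W (hW.trans hV)) :
    (((unitMod A).restrict hV).toRestrict).act W hW
        (MulOpposite.op (α := A.Sec W (hW.trans hV)) a) =
      ((Mod A).can (unit A) hV hW).hom ≫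
        ev (unit A) (hW.trans hV) (unitSec A W (hW.trans hV) a) ≫
          ((Mod A).can (unit A) hV hW).inv := rfl

/-- The restriction to `V` of the module `A` over `U` is the module `A|_V` over `V`. -/
lemma unitMod_restrict (hV : V ≤ U) :
    ((unitMod A).restrict hV).toRestrict = unitMod (A.restrict hV) :=
  ModObj.eq_of_heq_act rfl fun W hW a => heq_of_eq
    ((act_toRestrict_restrict_unitMod hV hW
      (MulOpposite.unop (α := A.Sec W (hW.trans hV)) a)).trans (can_comp_ev_comp_can_inv hV hW _))

end Mod

/-- Transformations between `𝒪`-functors with right adjoints on modules over `A` are the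
morphisms between their values at the bimodule `A`. -/
lemma evalMap_unitMod_bijective (φ ψ : (HomR (Mod A) S).Obj V hV) :
    Function.Bijective (evalMap (unitMod A) : (φ ⟶ ψ) → _) := by
  have h : ∀ E : ModObj (A.restrict hV).opp (Mod (A.restrict hV)) V le_rfl,
      E = unitMod (A.restrict hV) →
        Function.Bijective (PFunctor.IsLinear.mapModHom φ.property.1 ψ.property.1 E) := by
    rintro E rfl
    exact PFunctor.IsLinear.mapModHom_unitMod_bijective (A := A.restrict hV)
      (S := S.restrict hV) φ.property.1 φ.property.2 ψ.property.1
  refine (ModObj.ofRestrictHom (C := A.opp) _ _).bijective.comp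
    ((h _ (Mod.unitMod_restrict hV)).comp ⟨?_, ?_⟩)
  · exact fun α α' e => ObjectProperty.hom_ext _ e
  · exact fun α => ⟨ObjectProperty.homMk α, rfl⟩

/-- The tensor product with a bimodule is an `𝒪`-functor with a right adjoint. -/
lemma exists_mapMod_unitMod_iso (P : ModObj A.opp (Mod B) U le_rfl) :
    ∃ (φ : PFunctor (Mod A) (Mod B)) (hφ : φ.IsLinear),
      φ.HasRightAdjoint ∧ Nonempty (hφ.mapMod (unitMod A) ≅ P) := by
  have ex := fun (W : Opens X) (hW : W ≤ U) (M : (Mod A).Obj W hW) =>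
    exists_universal_pairing P M
  choose Q τ hτ using ex
  exact Pairing.exists_pfunctor (Mod.isSeparated B) hτ

/-- The preceding statement for prestacks that are only propositionally stacks of modules. -/
lemma exists_mapMod_iso {S T : Prestack.{u + 1, u} 𝒪 U} (hS : S = Mod A) (hT : T = Mod B)
    (E : ModObj A.opp S U le_rfl) (hE : HEq E (unitMod A)) (P : ModObj A.opp T U le_rfl) :
    ∃ (φ : PFunctor S T) (hφ : φ.IsLinear),
      φ.HasRightAdjoint ∧ Nonempty (hφ.mapMod E ≅ P) := by
  subst hS hT
  obtain rfl := eq_of_heq hE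
  exact exists_mapMod_unitMod_iso P

/-- Every bimodule is the value at `A` of an `𝒪`-functor with a right adjoint. -/
lemma exists_evalObj_unitMod_iso (P : ModObj A.opp (Mod B) V hV) :
    ∃ φ : (HomR (Mod A) (Mod B)).Obj V hV, Nonempty (evalObj (unitMod A) φ ≅ P) := by
  obtain ⟨φ, hφ, hr, ⟨e⟩⟩ := exists_mapMod_iso (S := (Mod A).restrict hV)
    (T := (Mod B).restrict hV) (A := A.restrict hV) (B := B.restrict hV) rfl rfl
    ((unitMod A).restrict hV).toRestrict (heq_of_eq (Mod.unitMod_restrict hV)) P.toRestrict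
  exact ⟨⟨φ, hφ, hr⟩, ModObj.nonempty_iso_of_restrict (C := A.opp) e⟩

variable (A B) in
theorem isEquiv_evalFunctor_unitMod : (evalFunctor (Mod B) (unitMod A)).IsEquiv := by
  refine PFunctor.isEquiv_of_isEquivalence _ fun V hV => ?_
  have : ((evalFunctor (Mod B) (unitMod A)).app V hV).Full :=
    ⟨fun {φ ψ} f => (evalMap_unitMod_bijective φ ψ).2 f⟩
  have : ((evalFunctor (Mod B) (unitMod A)).app V hV).Faithful :=
    ⟨fun {φ ψ} _ _ h => (evalMap_unitMod_bijective φ ψ).1 h⟩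
  have : ((evalFunctor (Mod B) (unitMod A)).app V hV).EssSurj :=
    ⟨fun P => exists_evalObj_unitMod_iso P⟩
  exact { }

variable (A B) in
theorem equivalent_homR_mod : Equivalent (HomR (Mod A) (Mod B)) (ModIn A.opp (Mod B)) :=
  ⟨evalFunctor (Mod B) (unitMod A), isLinear_evalFunctor _, isEquiv_evalFunctor_unitMod A B⟩

end

/-! ### Presentations of sheaves of algebras as tensor products -/

section

open scoped TensorProduct

/-- The ring homomorphism from a tensor product of algebras given by two ring homomorphisms with
commuting images, which agree on scalars but need not send these to the center. -/
noncomputable def tensorLift {R A B E : Type*} [CommRing R] [Ring A] [Ring B] [Algebra R A]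
    [Algebra R B] [Ring E] (f : A →+* E) (g : B →+* E)
    (h : ∀ r : R, f (algebraMap R A r) = g (algebraMap R B r)) (hc : ∀ a b, Commute (f a) (g b)) :
    A ⊗[R] B →+* E :=
  let m : A ⊗[R] B →+ E := TensorProduct.liftAddHom
    ((AddMonoidHom.mul.comp f.toAddMonoidHom).compr₂ (AddMonoidHom.id E) |>.flip.comp
      g.toAddMonoidHom |>.flip) (fun r a b => by
        change f (r • a) * g b = f a * g (r • b)
        rw [Algebra.smul_def, Algebra.smul_def, map_mul, map_mul, ← h, ← mul_assoc, ← map_mul,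
          ← map_mul, Algebra.commutes])
  have hm : ∀ a b, m (a ⊗ₜ b) = f a * g b := fun _ _ => rfl
  { toFun := m
    map_zero' := map_zero m
    map_add' := map_add m
    map_one' := by
      rw [Algebra.TensorProduct.one_def, hm, map_one, map_one, one_mul]
    map_mul' := fun s t => by
      induction s with
      | zero => rw [zero_mul, map_zero, zero_mul]
      | add s s' hs hs' => rw [add_mul, map_add, map_add, hs, hs', add_mul]
      | tmul a b =>
        induction t with
        | zero => rw [mul_zero, map_zero, mul_zero]
        | add t t' ht ht' => rw [mul_add, map_add, map_add, ht, ht', mul_add]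
        | tmul a' b' =>
          rw [Algebra.TensorProduct.tmul_mul_tmul, hm, hm, hm, map_mul, map_mul, mul_assoc,
            mul_assoc, ← mul_assoc (g b), ← (hc a' b).eq, mul_assoc] }

@[simp]
lemma tensorLift_tmul {R A B E : Type*} [CommRing R] [Ring A] [Ring B] [Algebra R A]
    [Algebra R B] [Ring E] (f : A →+* E) (g : B →+* E)
    (h : ∀ r : R, f (algebraMap R A r) = g (algebraMap R B r)) (hc) (a : A) (b : B) :
    tensorLift f g h hc (a ⊗ₜ b) = f a * g b := rfl

lemma eq_tensorLift {R A B E : Type*} [CommRing R] [Ring A] [Ring B] [Algebra R A]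
    [Algebra R B] [Ring E] (f : A →+* E) (g : B →+* E)
    (h : ∀ r : R, f (algebraMap R A r) = g (algebraMap R B r)) (hc) (k : A ⊗[R] B →+* E)
    (hf : ∀ a, k (a ⊗ₜ 1) = f a) (hg : ∀ b, k (1 ⊗ₜ b) = g b) : k = tensorLift f g h hc := by
  refine RingHom.ext fun t => ?_
  induction t with
  | zero => rw [map_zero, map_zero]
  | add t t' ht ht' => rw [map_add, map_add, ht, ht']
  | tmul a b =>
    rw [tensorLift_tmul, ← hf, ← hg, ← map_mul, Algebra.TensorProduct.tmul_mul_tmul, mul_one,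
      one_mul]

namespace Alg

variable {X : TopCat.{u}} {𝒪 : Sheaf (Opens.grothendieckTopology X) CommRingCat.{u}} {U : Opens X}
  {V W Y Z : Opens X}

noncomputable instance algebraSec (A : Alg 𝒪 U) (W : Opens X) (hW : W ≤ U) :
    Algebra (TwistedStack.Sec 𝒪 W) (A.Sec W hW) :=
  A.algebra (op (Over.mk (homOfLE hW)))

/-- The tensor product over the sections of `𝒪` of the sections of two algebras. -/
abbrev TensorSec (A B : Alg 𝒪 U) (W : Opens X) (hW : W ≤ U) : Type u :=
  (A.Sec W hW) ⊗[TwistedStack.Sec 𝒪 W] (B.Sec W hW)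

/-- Restriction of sections of the presheaf tensor product. -/
noncomputable abbrev tensorRho (A B : Alg 𝒪 U) (hW : W ≤ U) (hY : Y ≤ W) :
    TensorSec A B W hW →+* TensorSec A B Y (hY.trans hW) :=
  A.tensorRes B (Over.homMk (homOfLE hY) :
    Over.mk (homOfLE (hY.trans hW)) ⟶ Over.mk (homOfLE hW)).op

lemma tensorRho_tmul (A B : Alg 𝒪 U) (hW : W ≤ U) (hY : Y ≤ W) (a : A.Sec W hW)
    (b : B.Sec W hW) : tensorRho A B hW hY (a ⊗ₜ b) = A.rho hW hY a ⊗ₜ B.rho hW hY b :=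
  A.tensorRes_tmul B _ a b

/-- A presentation of a sheaf of algebras `C` as the tensor product of `A` and `B`: commuting
morphisms from `A` and `B` to `C`, such that the morphism from the presheaf tensor product to `C`
which they define is locally bijective. -/
structure TensorPresentation (A B C : Alg 𝒪 U) where
  left (W : Opens X) (hW : W ≤ U) : A.Sec W hW →+* C.Sec W hW
  right (W : Opens X) (hW : W ≤ U) : B.Sec W hW →+* C.Sec W hW
  left_algMap (W : Opens X) (hW : W ≤ U) (r : TwistedStack.Sec 𝒪 W) :
    left W hW (A.algMap W hW r) = C.algMap W hW r
  right_algMap (W : Opens X) (hW : W ≤ U) (r : TwistedStack.Sec 𝒪 W) :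
    right W hW (B.algMap W hW r) = C.algMap W hW r
  rho_left {W Y : Opens X} (hW : W ≤ U) (hY : Y ≤ W) (a : A.Sec W hW) :
    C.rho hW hY (left W hW a) = left Y (hY.trans hW) (A.rho hW hY a)
  rho_right {W Y : Opens X} (hW : W ≤ U) (hY : Y ≤ W) (b : B.Sec W hW) :
    C.rho hW hY (right W hW b) = right Y (hY.trans hW) (B.rho hW hY b)
  commute (W : Opens X) (hW : W ≤ U) (a : A.Sec W hW) (b : B.Sec W hW) :
    Commute (left W hW a) (right W hW b)
  locally_injective (W : Opens X) (hW : W ≤ U) (t : TensorSec A B W hW)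
    (ht : tensorLift (left W hW) (right W hW)
      (fun r => (left_algMap W hW r).trans (right_algMap W hW r).symm) (commute W hW) t = 0) :
    ∀ x ∈ W, ∃ (Y : Opens X) (hY : Y ≤ W), x ∈ Y ∧ tensorRho A B hW hY t = 0
  locally_surjective (W : Opens X) (hW : W ≤ U) (c : C.Sec W hW) :
    ∀ x ∈ W, ∃ (Y : Opens X) (hY : Y ≤ W), x ∈ Y ∧ ∃ t : TensorSec A B Y (hY.trans hW),
      tensorLift (left Y (hY.trans hW)) (right Y (hY.trans hW))
        (fun r => (left_algMap Y (hY.trans hW) r).trans (right_algMap Y (hY.trans hW) r).symm)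
        (commute Y (hY.trans hW)) t = C.rho hW hY c

namespace TensorPresentation

/-- The morphism from the presheaf tensor product given by a presentation. -/
noncomputable def mul {A B C : Alg 𝒪 U} (p : TensorPresentation A B C) (W : Opens X)
    (hW : W ≤ U) : TensorSec A B W hW →+* C.Sec W hW :=
  tensorLift (p.left W hW) (p.right W hW)
    (fun r => (p.left_algMap W hW r).trans (p.right_algMap W hW r).symm) (p.commute W hW)

lemma mul_tmul {A B C : Alg 𝒪 U} (p : TensorPresentation A B C) (hW : W ≤ U) (a : A.Sec W hW)
    (b : B.Sec W hW) : p.mul W hW (a ⊗ₜ b) = p.left W hW a * p.right W hW b := rfl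

lemma rho_mul {A B C : Alg 𝒪 U} (p : TensorPresentation A B C) (hW : W ≤ U) (hY : Y ≤ W)
    (t : TensorSec A B W hW) :
    C.rho hW hY (p.mul W hW t) = p.mul Y (hY.trans hW) (tensorRho A B hW hY t) := by
  induction t using TensorProduct.induction_on with
  | zero => rw [map_zero, map_zero, map_zero, map_zero]
  | add t t' h h' => rw [map_add, map_add, map_add, map_add, h, h']
  | tmul a b => rw [tensorRho_tmul, mul_tmul, mul_tmul, map_mul, p.rho_left, p.rho_right]

variable (A B : Alg 𝒪 U)

/-- The defining presentation of the tensor product. -/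
noncomputable def tensor : TensorPresentation A B (A.tensor B) :=
  let J := (Opens.grothendieckTopology X).over U
  let F := (presheafToSheaf J RingCat.{u}).obj (A.tensorPresheaf B)
  let η : A.tensorPresheaf B ⟶ F.obj := toSheafify J (A.tensorPresheaf B)
  let k (W : Opens X) (hW : W ≤ U) : TensorSec A B W hW →+* (A.tensor B).Sec W hW :=
    (η.app (op (Over.mk (homOfLE hW)))).hom
  have rho_k {W Y : Opens X} (hW : W ≤ U) (hY : Y ≤ W) (t : TensorSec A B W hW) :
      (A.tensor B).rho hW hY (k W hW t) = k Y (hY.trans hW) (tensorRho A B hW hY t) :=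
    (ConcreteCategory.congr_hom (η.naturality (Over.homMk (homOfLE hY) :
      Over.mk (homOfLE (hY.trans hW)) ⟶ Over.mk (homOfLE hW)).op) t).symm
  let l (W : Opens X) (hW : W ≤ U) : A.Sec W hW →+* (A.tensor B).Sec W hW :=
    (k W hW).comp Algebra.TensorProduct.includeLeftRingHom
  let r (W : Opens X) (hW : W ≤ U) : B.Sec W hW →+* (A.tensor B).Sec W hW :=
    (k W hW).comp Algebra.TensorProduct.includeRight.toRingHom
  have hl (W : Opens X) (hW : W ≤ U) (s : TwistedStack.Sec 𝒪 W) :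
    l W hW (A.algMap W hW s) = (A.tensor B).algMap W hW s := rfl
  have hr (W : Opens X) (hW : W ≤ U) (s : TwistedStack.Sec 𝒪 W) :
    r W hW (B.algMap W hW s) = (A.tensor B).algMap W hW s :=
      congrArg (k W hW) (Algebra.TensorProduct.algebraMap_apply' s).symm
  have hc (W : Opens X) (hW : W ≤ U) (a : A.Sec W hW) (b : B.Sec W hW) :
    Commute (l W hW a) (r W hW b) := by
      have h : Commute (a ⊗ₜ 1 : TensorSec A B W hW) (1 ⊗ₜ b) := by
        rw [commute_iff_eq, Algebra.TensorProduct.tmul_mul_tmul,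
          Algebra.TensorProduct.tmul_mul_tmul, mul_one, one_mul, mul_one, one_mul]
      exact h.map (k W hW)
  have hk (W : Opens X) (hW : W ≤ U) : k W hW = tensorLift (l W hW) (r W hW)
      (fun s => (hl W hW s).trans (hr W hW s).symm) (hc W hW) :=
    eq_tensorLift _ _ _ _ _ (fun _ => rfl) fun _ => rfl
  { left := l
    right := r
    left_algMap := hl
    right_algMap := hr
    rho_left := fun {W Y} hW hY a => by
      refine (rho_k hW hY (a ⊗ₜ 1)).trans (congrArg (k Y (hY.trans hW)) ?_)
      rw [tensorRho_tmul, map_one]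
      rfl
    rho_right := fun {W Y} hW hY b => by
      refine (rho_k hW hY (1 ⊗ₜ b)).trans (congrArg (k Y (hY.trans hW)) ?_)
      rw [tensorRho_tmul, map_one]
      rfl
    commute := hc
    locally_injective := fun W hW t ht x hx => by
      rw [← hk] at ht
      have h : η.app (op (Over.mk (homOfLE hW))) t = η.app (op (Over.mk (homOfLE hW))) 0 :=
        ht.trans (map_zero (k W hW)).symm
      have := Presheaf.equalizerSieve_mem J η _ _ h
      obtain ⟨T, f, hf, hxT⟩ := (mem_over_iff_exists _).1 this x hx
      exact ⟨T.left, leOfHom f.left, hxT, hf.trans (map_zero _)⟩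
    locally_surjective := fun W hW c x hx => by
      have := Presheaf.imageSieve_mem J η (U := op (Over.mk (homOfLE hW))) c
      obtain ⟨T, f, ⟨t, ht⟩, hxT⟩ := (mem_over_iff_exists _).1 this x hx
      refine ⟨T.left, leOfHom f.left, hxT, t, ?_⟩
      rw [← hk]
      exact ht }

variable (𝒪 U) in
/-- The identification of the sections of `𝒪`, as an algebra over itself, with the sections of
`𝒪`. -/
def baseSec (W : Opens X) (hW : W ≤ U) : (base 𝒪 U).Sec W hW →+* TwistedStack.Sec 𝒪 W :=
  RingHom.id (TwistedStack.Sec 𝒪 W)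

/-- The presentation of an algebra as its tensor product with `𝒪`. -/
noncomputable def selfBase : TensorPresentation A (base 𝒪 U) A where
  left W hW := RingHom.id (A.Sec W hW)
  right W hW := (A.algMap W hW).comp (baseSec 𝒪 U W hW)
  left_algMap _ _ _ := rfl
  right_algMap _ _ _ := rfl
  rho_left _ _ _ := rfl
  rho_right hW hY r := A.rho_algMap hW hY (baseSec 𝒪 U _ hW r)
  commute W hW a r := (A.algMap_commute hW (baseSec 𝒪 U W hW r) a).symm
  locally_injective W hW t ht x hx := by
    refine ⟨W, le_rfl, hx, ?_⟩
    have ex : ∃ a : A.Sec W hW, t = a ⊗ₜ 1 := by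
      clear ht
      induction t using TensorProduct.induction_on with
      | zero => exact ⟨0, (TensorProduct.zero_tmul _ _).symm⟩
      | add t t' h h' =>
        obtain ⟨a, rfl⟩ := h
        obtain ⟨a', rfl⟩ := h'
        exact ⟨a + a', (TensorProduct.add_tmul _ _ _).symm⟩
      | tmul a r =>
        refine ⟨baseSec 𝒪 U W hW r • a, ?_⟩
        rw [TensorProduct.smul_tmul, Algebra.smul_def, mul_one]
        rfl
    obtain ⟨a, rfl⟩ := ex
    rw [tensorLift_tmul, map_one, mul_one, RingHom.id_apply] at ht
    rw [ht, TensorProduct.zero_tmul, map_zero]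
  locally_surjective W hW c x hx := by
    refine ⟨W, le_rfl, hx, c ⊗ₜ 1, ?_⟩
    rw [tensorLift_tmul, map_one, mul_one, RingHom.id_apply, A.rho_self]

end TensorPresentation

end Alg

end

/-! ### Modules over a tensor product of sheaves of algebras -/

namespace Mod

variable {X : TopCat.{u}} {𝒪 : Sheaf (Opens.grothendieckTopology X) CommRingCat.{u}} {U : Opens X}
  {A B C : Alg 𝒪 U} {V V₁ V₂ V₃ W Y Z : Opens X} {hV : V ≤ U} {h₁ : V₁ ≤ U} {h₂ : V₂ ≤ U}
  {h₃ : V₃ ≤ U}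

open Prestack
open scoped TensorProduct

section restrictScalars

variable (p : A.TensorPresentation B C) (M : (Mod C).Obj V hV)

/-- The sections of a module over a tensor product, as modules over the second factor. -/
@[reducible]
noncomputable def scalarsPreMod : PreMod B hV where
  carrier W hW := sec M W hW
  module W hW := Module.compHom _ (p.right W (hW.trans hV))
  res hW hY := secRes M hW hY
  res_smul hW hY b m := by
    change secRes M hW hY (p.right _ _ b • m) = p.right _ _ (B.rho _ hY b) • secRes M hW hY m
    rw [secRes_smul, p.rho_right]
  res_self hW m := secRes_self M hW m
  res_res hW hY hZ m := secRes_secRes M hW hY hZ m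

/-- Restriction of scalars along the second factor of a tensor product. -/
noncomputable def scalars : (Mod B).Obj V hV :=
  PreMod.toObj (P := scalarsPreMod p M) fun _ hW _ c hc h s hs => existsUnique_sec M hW c hc h s hs

/-- Restriction of scalars does not change the sections. -/
noncomputable def scalarsSec (W : Opens X) (hW : W ≤ V) :
    sec (scalars p M) W hW ≃+ sec M W hW :=
  AddEquiv.refl (sec M W hW)

lemma scalarsSec_smul (hW : W ≤ V) (b : B.Sec W (hW.trans hV)) (m : sec (scalars p M) W hW) :
    scalarsSec p M W hW (b • m) = p.right W (hW.trans hV) b • scalarsSec p M W hW m := rfl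

lemma scalarsSec_symm_smul (hW : W ≤ V) (b : B.Sec W (hW.trans hV)) (m : sec M W hW) :
    (scalarsSec p M W hW).symm (p.right W (hW.trans hV) b • m) =
      b • (scalarsSec p M W hW).symm m := rfl

lemma scalarsSec_secRes (hW : W ≤ V) (hY : Y ≤ W) (m : sec (scalars p M) W hW) :
    scalarsSec p M Y (hY.trans hW) (secRes (scalars p M) hW hY m) =
      secRes M hW hY (scalarsSec p M W hW m) := rfl

/-- The action of a section of the first factor, on the restriction of scalars. -/
noncomputable def scalarsAct (hW : W ≤ V) (a : A.Sec W (hW.trans hV)) :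
    ((Mod B).res hV hW).obj (scalars p M) ⟶ ((Mod B).res hV hW).obj (scalars p M) :=
  secHom (scalars p M) (scalars p M) hW hW (fun Y hY =>
    { toFun := fun m => (scalarsSec p M Y (hY.trans hW)).symm
        (p.left Y (hY.trans (hW.trans hV)) (A.rho (hW.trans hV) hY a) •
          scalarsSec p M Y (hY.trans hW) m)
      map_add' := fun m m' => by rw [map_add, smul_add, map_add]
      map_smul' := fun b m => by
        rw [scalarsSec_smul, ← mul_smul, (p.commute _ _ _ _).eq, mul_smul, scalarsSec_symm_smul,
          RingHom.id_apply] })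
    (fun Y Z hY hZ m => by
      apply (scalarsSec p M Z _).injective
      rw [scalarsSec_secRes]
      change secRes M _ hZ (p.left Y _ (A.rho _ hY a) • scalarsSec p M Y _ m) =
        p.left Z _ (A.rho _ (hZ.trans hY) a) • scalarsSec p M Z _ (secRes (scalars p M) _ hZ m)
      rw [secRes_smul, p.rho_left, A.rho_rho, scalarsSec_secRes])

lemma secApp_scalarsAct (hW : W ≤ V) (a : A.Sec W (hW.trans hV)) (hY : Y ≤ W)
    (m : sec (scalars p M) Y (hY.trans hW)) :
    scalarsSec p M Y (hY.trans hW) (secApp (scalarsAct p M hW a) Y hY m) =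
      p.left Y (hY.trans (hW.trans hV)) (A.rho (hW.trans hV) hY a) •
        scalarsSec p M Y (hY.trans hW) m := rfl

lemma scalarsHom_ext {F : (Mod B).Obj V₁ h₁} {M : (Mod C).Obj V₂ h₂} {w₁ : W ≤ V₁} {w₂ : W ≤ V₂}
    {f g : ((Mod B).res h₁ w₁).obj F ⟶ ((Mod B).res h₂ w₂).obj (scalars p M)}
    (h : ∀ (Y : Opens X) (hY : Y ≤ W) (m : sec F Y (hY.trans w₁)),
      scalarsSec p M Y (hY.trans w₂) (secApp f Y hY m) =
        scalarsSec p M Y (hY.trans w₂) (secApp g Y hY m)) : f = g :=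
  secApp_ext fun Y hY m => (scalarsSec p M Y _).injective (h Y hY m)

/-- A module over a tensor product, as a module over the first factor in the modules over the
second one. -/
@[reducible]
noncomputable def scalarsMod : ModObj A (Mod B) V hV where
  obj := scalars p M
  act W hW :=
    { toFun := fun a => scalarsAct p M hW a
      map_one' := scalarsHom_ext p fun Y hY m => by
        rw [secApp_scalarsAct, map_one, map_one, one_smul]
        rfl
      map_mul' := fun a a' => scalarsHom_ext p fun Y hY m => by
        refine (secApp_scalarsAct p M hW (a * a') hY m).trans ?_
        rw [map_mul, map_mul, mul_smul]
        rfl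
      map_zero' := scalarsHom_ext p fun Y hY m => by
        rw [secApp_scalarsAct, map_zero, map_zero, zero_smul]
        rfl
      map_add' := fun a a' => scalarsHom_ext p fun Y hY m => by
        refine (secApp_scalarsAct p M hW (a + a') hY m).trans ?_
        rw [map_add, map_add, add_smul]
        rfl }
  act_algMap W hW r := scalarsHom_ext p fun Y hY m => by
    refine (secApp_scalarsAct p M hW _ hY m).trans ?_
    rw [A.rho_algMap, p.left_algMap, ← p.right_algMap, ← scalarsSec_smul]
    exact congrArg _ (secApp_smul (F := scalars p M) (G := scalars p M) (w₁ := hW) (w₂ := hW) r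
      (𝟙 _) hY m).symm
  act_res {W Y} hW hY a := scalarsHom_ext p fun Z hZ m => by
    refine (secApp_scalarsAct p M (hY.trans hW) _ hZ m).trans ?_
    rw [A.rho_rho]
    rfl

end restrictScalars

section

variable {S : Prestack.{w, v} 𝒪 U} {M₁ : ModObj A S V₁ h₁} {M₂ : ModObj A S V₂ h₂} {w₁ : W ≤ V₁}
  {w₂ : W ≤ V₂}

/-- A morphism over `W` whose restrictions commute with the actions of `A` is a morphism of
modules over `W`. -/
def modInHomOfResHom (f : (S.res h₁ w₁).obj M₁.obj ⟶ (S.res h₂ w₂).obj M₂.obj)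
    (hf : ∀ (Y : Opens X) (hY : Y ≤ W) (a : A.Sec Y (hY.trans (w₁.trans h₁))),
      M₁.act Y (hY.trans w₁) a ≫ S.resHom M₁.obj M₂.obj w₁ w₂ hY f =
        S.resHom M₁.obj M₂.obj w₁ w₂ hY f ≫ M₂.act Y (hY.trans w₂) a) :
    ((ModIn A S).res h₁ w₁).obj M₁ ⟶ ((ModIn A S).res h₂ w₂).obj M₂ :=
  ({ hom := f
     comm := fun Y hY a => by
        have h := hf Y hY a
        change ((S.resComp h₁ w₁ hY).hom.app M₁.obj ≫ M₁.act Y (hY.trans w₁) a ≫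
            (S.resComp h₁ w₁ hY).inv.app M₁.obj) ≫ (S.res _ hY).map f =
          (S.res _ hY).map f ≫ (S.resComp h₂ w₂ hY).hom.app M₂.obj ≫ M₂.act Y (hY.trans w₂) a ≫
            (S.resComp h₂ w₂ hY).inv.app M₂.obj
        rw [← cancel_mono ((S.resComp h₂ w₂ hY).hom.app M₂.obj),
          ← cancel_epi ((S.resComp h₁ w₁ hY).inv.app M₁.obj)]
        simpa [Prestack.resHom] using h } : M₁.restrict w₁ ⟶ M₂.restrict w₂)

end

section

variable {M₁ : ModObj A (Mod B) V₁ h₁} {M₂ : ModObj A (Mod B) V₂ h₂} {w₁ : W ≤ V₁} {w₂ : W ≤ V₂}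

/-- The action of a section of `A` on the sections of an `A`-module in `Mod B`. -/
noncomputable def secAct (M : ModObj A (Mod B) V hV) (W : Opens X) (hW : W ≤ V)
    (a : A.Sec W (hW.trans hV)) : sec M.obj W hW →ₗ[B.Sec W (hW.trans hV)] sec M.obj W hW :=
  secApp (M.act W hW a) W le_rfl

lemma secApp_act (M : ModObj A (Mod B) V hV) (hW : W ≤ V) (hY : Y ≤ W)
    (a : A.Sec W (hW.trans hV)) (m : sec M.obj Y (hY.trans hW)) :
    secApp (M.act W hW a) Y hY m = secAct M Y (hY.trans hW) (A.rho (hW.trans hV) hY a) m := by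
  rw [secAct, M.act_res hW hY a]
  exact (secApp_resHom (M.act W hW a) hY le_rfl m).symm

lemma secRes_secAct (M : ModObj A (Mod B) V hV) (hW : W ≤ V) (hY : Y ≤ W)
    (a : A.Sec W (hW.trans hV)) (m : sec M.obj W hW) :
    secRes M.obj hW hY (secAct M W hW a m) =
      secAct M Y (hY.trans hW) (A.rho (hW.trans hV) hY a) (secRes M.obj hW hY m) := by
  rw [← secApp_act]
  exact secRes_secApp (M.act W hW a) le_rfl hY m

/-- A morphism of sheaves of `B`-modules which commutes with the actions of `A` on sections is a
morphism of `A`-modules in `Mod B`. -/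
noncomputable def modInHom (f : ((Mod B).res h₁ w₁).obj M₁.obj ⟶ ((Mod B).res h₂ w₂).obj M₂.obj)
    (hf : ∀ (Y : Opens X) (hY : Y ≤ W) (a : A.Sec Y (hY.trans (w₁.trans h₁)))
      (m : sec M₁.obj Y (hY.trans w₁)),
      secApp f Y hY (secAct M₁ Y (hY.trans w₁) a m) =
        secAct M₂ Y (hY.trans w₂) a (secApp f Y hY m)) :
    ((ModIn A (Mod B)).res h₁ w₁).obj M₁ ⟶ ((ModIn A (Mod B)).res h₂ w₂).obj M₂ :=
  modInHomOfResHom f fun Y hY a => secApp_ext (F := M₁.obj) (G := M₂.obj) (w₁ := hY.trans w₁)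
    (w₂ := hY.trans w₂) fun Z hZ m => by
      change secApp f Z (hZ.trans hY) (secApp (M₁.act Y (hY.trans w₁) a) Z hZ m) =
        secApp (M₂.act Y (hY.trans w₂) a) Z hZ (secApp f Z (hZ.trans hY) m)
      rw [secApp_act, secApp_act]
      exact hf Z (hZ.trans hY) _ m

/-- The morphism of sheaves of modules underlying a morphism of modules. -/
noncomputable def modInHomHom (k : ((ModIn A (Mod B)).res h₁ w₁).obj M₁ ⟶ ((ModIn A (Mod B)).res h₂ w₂).obj M₂) :
    ((Mod B).res h₁ w₁).obj M₁.obj ⟶ ((Mod B).res h₂ w₂).obj M₂.obj :=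
  (k : M₁.restrict w₁ ⟶ M₂.restrict w₂).hom

lemma secApp_secAct
    (k : ((ModIn A (Mod B)).res h₁ w₁).obj M₁ ⟶ ((ModIn A (Mod B)).res h₂ w₂).obj M₂)
    (hY : Y ≤ W) (a : A.Sec Y (hY.trans (w₁.trans h₁))) (m : sec M₁.obj Y (hY.trans w₁)) :
    secApp (modInHomHom k) Y hY (secAct M₁ Y (hY.trans w₁) a m) =
      secAct M₂ Y (hY.trans w₂) a (secApp (modInHomHom k) Y hY m) :=
  congrArg (fun g => secApp (F := M₁.obj) (G := M₂.obj) (w₁ := hY.trans w₁) (w₂ := hY.trans w₂)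
    g Y le_rfl m) ((k : M₁.restrict w₁ ⟶ M₂.restrict w₂).comm Y hY a)

lemma modIn_hom_ext
    {k l : ((ModIn A (Mod B)).res h₁ w₁).obj M₁ ⟶ ((ModIn A (Mod B)).res h₂ w₂).obj M₂}
    (h : ∀ (Y : Opens X) (hY : Y ≤ W) (m : sec M₁.obj Y (hY.trans w₁)),
      secApp (modInHomHom k) Y hY m = secApp (modInHomHom l) Y hY m) : k = l :=
  ModObj.hom_ext (M := M₁.restrict w₁) (N := M₂.restrict w₂) (secApp_ext h)

end

section

variable (p : A.TensorPresentation B C) {M : (Mod C).Obj V₁ h₁} {N : (Mod C).Obj V₂ h₂}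
  {w₁ : W ≤ V₁} {w₂ : W ≤ V₂}

lemma scalarsSec_secAct (M : (Mod C).Obj V hV) (hW : W ≤ V) (a : A.Sec W (hW.trans hV))
    (m : sec (scalars p M) W hW) :
    scalarsSec p M W hW (secAct (scalarsMod p M) W hW a m) =
      p.left W (hW.trans hV) a • scalarsSec p M W hW m := by
  refine (secApp_scalarsAct p M hW a le_rfl m).trans ?_
  rw [A.rho_self]

/-- Restriction of scalars of a morphism. -/
noncomputable def scalarsHom (f : ((Mod C).res h₁ w₁).obj M ⟶ ((Mod C).res h₂ w₂).obj N) :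
    ((Mod B).res h₁ w₁).obj (scalars p M) ⟶ ((Mod B).res h₂ w₂).obj (scalars p N) :=
  secHom (scalars p M) (scalars p N) w₁ w₂ (fun Y hY =>
    { toFun := fun m => (scalarsSec p N Y (hY.trans w₂)).symm
        (secApp f Y hY (scalarsSec p M Y (hY.trans w₁) m))
      map_add' := fun m m' => by rw [map_add, map_add, map_add]
      map_smul' := fun b m => by
        rw [scalarsSec_smul, map_smul]
        rfl })
    (fun Y Z hY hZ m => secRes_secApp f hY hZ (scalarsSec p M Y (hY.trans w₁) m))

lemma secApp_scalarsHom (f : ((Mod C).res h₁ w₁).obj M ⟶ ((Mod C).res h₂ w₂).obj N)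
    (hY : Y ≤ W) (m : sec (scalars p M) Y (hY.trans w₁)) :
    scalarsSec p N Y (hY.trans w₂) (secApp (scalarsHom p f) Y hY m) =
      secApp f Y hY (scalarsSec p M Y (hY.trans w₁) m) := rfl

variable (M N w₁ w₂) in
/-- Restriction of scalars of a morphism, as a morphism of modules over the first factor. -/
noncomputable def scalarsModHom (f : ((Mod C).res h₁ w₁).obj M ⟶ ((Mod C).res h₂ w₂).obj N) :
    ((ModIn A (Mod B)).res h₁ w₁).obj (scalarsMod p M) ⟶
      ((ModIn A (Mod B)).res h₂ w₂).obj (scalarsMod p N) :=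
  modInHom (M₁ := scalarsMod p M) (M₂ := scalarsMod p N) (scalarsHom p f) fun Y hY a m => by
    apply (scalarsSec p N Y (hY.trans w₂)).injective
    rw [scalarsSec_secAct, secApp_scalarsHom]
    refine (congrArg (secApp f Y hY) (scalarsSec_secAct p M _ a m)).trans ?_
    rw [map_smul, secApp_scalarsHom]

/-- Morphisms compatible with both factors of a tensor product are linear over the tensor product,
which is locally generated by the factors. -/
lemma scalarsModHom_bijective : Function.Bijective (scalarsModHom p M N w₁ w₂) := by
  constructor
  · intro f g h
    exact secApp_ext fun Y hY m => congrArg (fun k => scalarsSec p N Y (hY.trans w₂)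
      (secApp (modInHomHom k) Y hY ((scalarsSec p M Y (hY.trans w₁)).symm m))) h
  · intro k
    let g (Y : Opens X) (hY : Y ≤ W) : sec M Y (hY.trans w₁) →+ sec N Y (hY.trans w₂) :=
      (scalarsSec p N Y (hY.trans w₂)).toAddMonoidHom.comp
        ((secApp (modInHomHom k) Y hY).toAddMonoidHom.comp
          (scalarsSec p M Y (hY.trans w₁)).symm.toAddMonoidHom)
    have hg (Y : Opens X) (hY : Y ≤ W) (m : sec M Y (hY.trans w₁)) : g Y hY m =
      scalarsSec p N Y (hY.trans w₂) (secApp (modInHomHom k) Y hY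
        ((scalarsSec p M Y (hY.trans w₁)).symm m)) := rfl
    have g_res (Y Z : Opens X) (hY : Y ≤ W) (hZ : Z ≤ Y) (m : sec M Y (hY.trans w₁)) :
        secRes N (hY.trans w₂) hZ (g Y hY m) =
          g Z (hZ.trans hY) (secRes M (hY.trans w₁) hZ m) :=
      secRes_secApp (modInHomHom k) hY hZ ((scalarsSec p M Y (hY.trans w₁)).symm m)
    have g_left (Y : Opens X) (hY : Y ≤ W) (a : A.Sec Y (hY.trans (w₁.trans h₁)))
        (m : sec M Y (hY.trans w₁)) : g Y hY (p.left Y _ a • m) = p.left Y _ a • g Y hY m := by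
      have h := secApp_secAct k hY a ((scalarsSec p M Y (hY.trans w₁)).symm m)
      have h' := congrArg (scalarsSec p N Y (hY.trans w₂)) h
      refine Eq.trans ?_ (h'.trans (scalarsSec_secAct p N (hY.trans w₂) a _))
      refine congrArg (fun t => scalarsSec p N Y (hY.trans w₂)
        (secApp (modInHomHom k) Y hY t)) ((scalarsSec p M Y (hY.trans w₁)).injective ?_)
      exact (scalarsSec_secAct p M (hY.trans w₁) a _).symm
    have g_right (Y : Opens X) (hY : Y ≤ W) (b : B.Sec Y (hY.trans (w₁.trans h₁)))
        (m : sec M Y (hY.trans w₁)) : g Y hY (p.right Y _ b • m) = p.right Y _ b • g Y hY m := by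
      rw [hg, scalarsSec_symm_smul]
      exact congrArg (scalarsSec p N Y (hY.trans w₂)) (map_smul (secApp (modInHomHom k) Y hY) b _)
    have g_mul (Y : Opens X) (hY : Y ≤ W) (t : A.TensorSec B Y (hY.trans (w₁.trans h₁)))
        (m : sec M Y (hY.trans w₁)) : g Y hY (p.mul Y _ t • m) = p.mul Y _ t • g Y hY m := by
      induction t using TensorProduct.induction_on with
      | zero => rw [map_zero, zero_smul, zero_smul, map_zero]
      | add t t' h h' => rw [map_add, add_smul, add_smul, map_add, h, h']
      | tmul a b => rw [p.mul_tmul, mul_smul, mul_smul, g_left, g_right]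
    have g_smul (Y : Opens X) (hY : Y ≤ W) (c : C.Sec Y (hY.trans (w₁.trans h₁)))
        (m : sec M Y (hY.trans w₁)) : g Y hY (c • m) = c • g Y hY m := by
      obtain ⟨ι, d, hd, h, h'⟩ := exists_cover (p.locally_surjective Y _ c)
      refine sec_ext N _ d hd h fun i => ?_
      obtain ⟨t, ht⟩ := h' i
      rw [secRes_smul, g_res, g_res, secRes_smul, ← ht]
      exact g_mul _ _ t _
    exact ⟨secHom M N w₁ w₂ (fun Y hY =>
      { toFun := g Y hY
        map_add' := map_add (g Y hY)
        map_smul' := g_smul Y hY }) g_res, rfl⟩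

/-- Restriction of scalars as a functor of prestacks. -/
noncomputable def scalarsCore : PFunctor.Core (Mod C) (ModIn A (Mod B)) where
  obj _ _ M := scalarsMod p M
  mapOn M N w₁ w₂ f := scalarsModHom p M N w₁ w₂ f
  mapOn_id _ _ := rfl
  mapOn_comp _ _ _ _ _ _ _ _ := rfl
  resHom_mapOn M N _ _ _ _ := modIn_hom_ext (M₁ := scalarsMod p M) (M₂ := scalarsMod p N)
    fun _ _ _ => rfl

lemma isLinear_scalarsCore : (scalarsCore p).toPFunctor.IsLinear :=
  PFunctor.Core.isLinear _ (fun _ _ _ _ _ _ => rfl) fun _ _ M N r f =>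
    modIn_hom_ext (M₁ := scalarsMod p M) (M₂ := scalarsMod p N) fun Y hY m => by
      refine (secApp_smul (F := M) (G := N) (w₁ := le_rfl) (w₂ := le_rfl) r f hY m).trans ?_
      refine Eq.trans ?_ (secApp_smul (F := scalars p M) (G := scalars p N) (w₁ := le_rfl)
        (w₂ := le_rfl) r (scalarsHom p f) hY m).symm
      rw [← p.right_algMap]
      rfl

end

section extendAction

variable (p : A.TensorPresentation B C) (N : ModObj A (Mod B) V hV)

/-- The ring homomorphism giving the action of `A` on sections. -/
noncomputable def leftEnd (W : Opens X) (hW : W ≤ V) :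
    A.Sec W (hW.trans hV) →+* AddMonoid.End (sec N.obj W hW) where
  toFun a := (secAct N W hW a).toAddMonoidHom
  map_one' := AddMonoidHom.ext fun m => by
    change secApp (N.act W hW 1) W le_rfl m = m
    rw [map_one]
    rfl
  map_mul' a a' := AddMonoidHom.ext fun m => by
    change secApp (N.act W hW (a * a')) W le_rfl m = _
    rw [map_mul]
    rfl
  map_zero' := AddMonoidHom.ext fun m => by
    change secApp (N.act W hW 0) W le_rfl m = 0
    rw [map_zero]
    rfl
  map_add' a a' := AddMonoidHom.ext fun m => by
    change secApp (N.act W hW (a + a')) W le_rfl m = _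
    rw [map_add]
    rfl

/-- The action of the presheaf tensor product of `A` and `B` on the sections of an `A`-module in
`Mod B`. -/
noncomputable def tensorEnd (W : Opens X) (hW : W ≤ V) :
    A.TensorSec B W (hW.trans hV) →+* AddMonoid.End (sec N.obj W hW) :=
  tensorLift (leftEnd N W hW) (Module.toAddMonoidEnd (B.Sec W (hW.trans hV)) (sec N.obj W hW))
    (fun r => AddMonoidHom.ext fun m => by
      change secApp (N.act W hW (A.algMap W (hW.trans hV) r)) W le_rfl m =
        B.algMap W (hW.trans hV) r • m
      rw [N.act_algMap]
      refine (secApp_smul (F := N.obj) (G := N.obj) (w₁ := hW) (w₂ := hW) r (𝟙 _) le_rfl m).trans ?_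
      rw [← B.rho_algMap, B.rho_self]
      rfl)
    (fun a b => AddMonoidHom.ext fun m => map_smul (secAct N W hW a) b m)

lemma tensorEnd_tmul (hW : W ≤ V) (a : A.Sec W (hW.trans hV)) (b : B.Sec W (hW.trans hV))
    (m : sec N.obj W hW) : tensorEnd N W hW (a ⊗ₜ b) m = secAct N W hW a (b • m) := rfl

lemma secRes_tensorEnd (hW : W ≤ V) (hY : Y ≤ W) (t : A.TensorSec B W (hW.trans hV))
    (m : sec N.obj W hW) : secRes N.obj hW hY (tensorEnd N W hW t m) =
      tensorEnd N Y (hY.trans hW) (A.tensorRho B _ hY t) (secRes N.obj hW hY m) := by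
  induction t using TensorProduct.induction_on with
  | zero =>
    rw [map_zero, map_zero, map_zero]
    exact map_zero _
  | add t t' h h' =>
    rw [map_add, map_add, map_add]
    exact (map_add (secRes N.obj hW hY) _ _).trans (congrArg₂ (· + ·) h h')
  | tmul a b =>
    rw [Alg.tensorRho_tmul, tensorEnd_tmul, tensorEnd_tmul, secRes_secAct, secRes_smul]

/-- The action of the presheaf tensor product factors through its image in the tensor product. -/
lemma tensorEnd_congr (hW : W ≤ V) {t t' : A.TensorSec B W (hW.trans hV)}
    (h : p.mul W _ t = p.mul W _ t') (m : sec N.obj W hW) :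
    tensorEnd N W hW t m = tensorEnd N W hW t' m := by
  have h₀ : p.mul W _ (t - t') = 0 := by rw [map_sub, h, sub_self]
  obtain ⟨ι, c, hc, hW', h'⟩ := exists_cover (p.locally_injective W _ _ h₀)
  refine sec_ext N.obj hW c hc hW' fun i => ?_
  rw [secRes_tensorEnd, secRes_tensorEnd]
  have := h' i
  rw [map_sub, sub_eq_zero] at this
  rw [this]

lemma exists_sec_eq_tensorEnd (hW : W ≤ V) (c : C.Sec W (hW.trans hV)) (m : sec N.obj W hW) :
    ∃ n : sec N.obj W hW, ∀ (Y : Opens X) (hY : Y ≤ W)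
      (t : A.TensorSec B Y (hY.trans (hW.trans hV))), p.mul Y _ t = C.rho _ hY c →
        secRes N.obj hW hY n = tensorEnd N Y (hY.trans hW) t (secRes N.obj hW hY m) := by
  obtain ⟨ι, d, hd, h, h'⟩ := exists_cover (p.locally_surjective W _ c)
  choose t ht using h'
  have key : ∀ (i : ι) (Z : Opens X) (hZ : Z ≤ W) (hi : Z ≤ d i)
      (t' : A.TensorSec B Z (hZ.trans (hW.trans hV))), p.mul Z _ t' = C.rho _ hZ c →
      secRes N.obj ((hd i).trans hW) hi
        (tensorEnd N (d i) ((hd i).trans hW) (t i) (secRes N.obj hW (hd i) m)) =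
        tensorEnd N Z (hZ.trans hW) t' (secRes N.obj hW hZ m) := by
    intro i Z hZ hi t' ht'
    rw [secRes_tensorEnd, secRes_secRes]
    refine tensorEnd_congr p N _ ?_ _
    rw [ht', ← p.rho_mul, ← C.rho_rho _ (hd i) hi]
    exact congrArg (C.rho _ hi) (ht i)
  obtain ⟨n, hn, -⟩ := existsUnique_sec N.obj hW d hd h
    (fun i => tensorEnd N (d i) ((hd i).trans hW) (t i) (secRes N.obj hW (hd i) m)) (fun i j => by
      have hij : p.mul (d i ⊓ d j) _ (A.tensorRho B _ inf_le_left (t i)) =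
          C.rho _ (inf_le_left.trans (hd i)) c := by
        rw [← p.rho_mul, ← C.rho_rho _ (hd i) inf_le_left]
        exact congrArg (C.rho _ inf_le_left) (ht i)
      rw [key i (d i ⊓ d j) (inf_le_left.trans (hd i)) inf_le_left _ hij,
        key j (d i ⊓ d j) (inf_le_left.trans (hd i)) inf_le_right _ hij])
  refine ⟨n, fun Z hZ t' ht' => sec_ext N.obj _ (fun i => Z ⊓ d i) (fun i => inf_le_left)
    (iSup_inf_of_iSup_eq h hZ) fun i => ?_⟩
  rw [secRes_secRes, ← secRes_secRes N.obj hW (hd i) inf_le_right, hn i,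
    key i (Z ⊓ d i) (inf_le_left.trans hZ) inf_le_right (A.tensorRho B _ inf_le_left t')
      (by rw [← p.rho_mul, ht', C.rho_rho]), secRes_tensorEnd, secRes_secRes]

/-- The action of a section of the tensor product: the one which is locally given by the action of
the presheaf tensor product. -/
noncomputable def tensorSmul (hW : W ≤ V) (c : C.Sec W (hW.trans hV)) (m : sec N.obj W hW) :
    sec N.obj W hW :=
  (exists_sec_eq_tensorEnd p N hW c m).choose

lemma secRes_tensorSmul (hW : W ≤ V) (c : C.Sec W (hW.trans hV)) (m : sec N.obj W hW)
    (hY : Y ≤ W) (t : A.TensorSec B Y (hY.trans (hW.trans hV)))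
    (ht : p.mul Y _ t = C.rho _ hY c) : secRes N.obj hW hY (tensorSmul p N hW c m) =
      tensorEnd N Y (hY.trans hW) t (secRes N.obj hW hY m) :=
  (exists_sec_eq_tensorEnd p N hW c m).choose_spec Y hY t ht

lemma tensorSmul_mul (hW : W ≤ V) (t : A.TensorSec B W (hW.trans hV)) (m : sec N.obj W hW) :
    tensorSmul p N hW (p.mul W _ t) m = tensorEnd N W hW t m := by
  have h := secRes_tensorSmul p N hW (p.mul W _ t) m le_rfl t (C.rho_self _ _).symm
  rwa [secRes_self, secRes_self] at h

lemma secRes_tensorSmul' (hW : W ≤ V) (c : C.Sec W (hW.trans hV)) (m : sec N.obj W hW)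
    (hY : Y ≤ W) : secRes N.obj hW hY (tensorSmul p N hW c m) =
      tensorSmul p N (hY.trans hW) (C.rho _ hY c) (secRes N.obj hW hY m) := by
  obtain ⟨ι, d, hd, h, h'⟩ := exists_cover (p.locally_surjective Y _ (C.rho _ hY c))
  refine sec_ext N.obj _ d hd h fun i => ?_
  obtain ⟨t, ht⟩ := h' i
  rw [secRes_secRes, secRes_tensorSmul p N hW c m ((hd i).trans hY) t
    (ht.trans (C.rho_rho _ _ _ _)), secRes_tensorSmul p N _ _ _ (hd i) t ht, secRes_secRes]

/-- Identities between actions of sections of the tensor product may be checked for sections of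
the presheaf tensor product. -/
lemma tensorSmul_local (hW : W ≤ V) (c c' : C.Sec W (hW.trans hV)) {n n' : sec N.obj W hW}
    (h : ∀ (Y : Opens X) (hY : Y ≤ W) (t t' : A.TensorSec B Y (hY.trans (hW.trans hV))),
      p.mul Y _ t = C.rho _ hY c → p.mul Y _ t' = C.rho _ hY c' →
        secRes N.obj hW hY n = secRes N.obj hW hY n') : n = n' := by
  obtain ⟨ι, d, hd, hd', h₁⟩ := exists_cover (p.locally_surjective W _ c)
  refine sec_ext N.obj _ d hd hd' fun i => ?_
  obtain ⟨t, ht⟩ := h₁ i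
  obtain ⟨κ, e, he, he', h₂⟩ := exists_cover (p.locally_surjective (d i) _ (C.rho _ (hd i) c'))
  refine sec_ext N.obj _ e he he' fun j => ?_
  obtain ⟨t', ht'⟩ := h₂ j
  rw [secRes_secRes, secRes_secRes]
  refine h _ _ (A.tensorRho B _ (he j) t) t' ?_ (ht'.trans (C.rho_rho _ _ _ _))
  rw [← p.rho_mul, ← C.rho_rho _ (hd i) (he j)]
  exact congrArg (C.rho _ (he j)) ht

/-- The sections of an `A`-module in `Mod B`, as modules over the tensor product. -/
@[reducible]
noncomputable def tensorModule (W : Opens X) (hW : W ≤ V) :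
    Module (C.Sec W (hW.trans hV)) (sec N.obj W hW) where
  smul c m := tensorSmul p N hW c m
  one_smul m := by
    change tensorSmul p N hW 1 m = m
    rw [← map_one (p.mul W _), tensorSmul_mul, map_one]
    rfl
  mul_smul c c' m := by
    change tensorSmul p N hW (c * c') m = tensorSmul p N hW c (tensorSmul p N hW c' m)
    refine tensorSmul_local p N hW c c' fun Y hY t t' ht ht' => ?_
    rw [secRes_tensorSmul p N hW (c * c') m hY (t * t') (by rw [map_mul, map_mul, ht, ht']),
      secRes_tensorSmul p N hW c _ hY t ht, secRes_tensorSmul p N hW c' _ hY t' ht', map_mul]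
    rfl
  smul_zero c := by
    change tensorSmul p N hW c 0 = 0
    refine tensorSmul_local p N hW c c fun Y hY t _ ht _ => ?_
    rw [secRes_tensorSmul p N hW c _ hY t ht, map_zero, map_zero]
  smul_add c m m' := by
    change tensorSmul p N hW c (m + m') = tensorSmul p N hW c m + tensorSmul p N hW c m'
    refine tensorSmul_local p N hW c c fun Y hY t _ ht _ => ?_
    rw [map_add, secRes_tensorSmul p N hW c _ hY t ht, secRes_tensorSmul p N hW c _ hY t ht,
      secRes_tensorSmul p N hW c _ hY t ht, map_add, map_add]
  add_smul c c' m := by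
    change tensorSmul p N hW (c + c') m = tensorSmul p N hW c m + tensorSmul p N hW c' m
    refine tensorSmul_local p N hW c c' fun Y hY t t' ht ht' => ?_
    rw [map_add, secRes_tensorSmul p N hW (c + c') m hY (t + t')
      (by rw [map_add, map_add, ht, ht']), secRes_tensorSmul p N hW c _ hY t ht,
      secRes_tensorSmul p N hW c' _ hY t' ht', map_add]
    rfl
  zero_smul m := by
    change tensorSmul p N hW 0 m = 0
    rw [← map_zero (p.mul W _), tensorSmul_mul, map_zero]
    rfl

/-- An `A`-module in `Mod B`, as a presheaf of modules over the tensor product. -/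
@[reducible]
noncomputable def tensorActPreMod : PreMod C hV where
  carrier W hW := sec N.obj W hW
  module W hW := tensorModule p N W hW
  res hW hY := secRes N.obj hW hY
  res_smul hW hY c m := secRes_tensorSmul' p N hW c m hY
  res_self hW m := secRes_self N.obj hW m
  res_res hW hY hZ m := secRes_secRes N.obj hW hY hZ m

/-- An `A`-module in `Mod B`, as a sheaf of modules over the tensor product. -/
noncomputable def ofModIn : (Mod C).Obj V hV :=
  PreMod.toObj (P := tensorActPreMod p N) fun _ hW _ c hc h s hs =>
    existsUnique_sec N.obj hW c hc h s hs

/-- The sections of a module, with the action of the tensor product. -/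
noncomputable def ofModInSec (W : Opens X) (hW : W ≤ V) :
    sec (ofModIn p N) W hW ≃+ sec N.obj W hW :=
  AddEquiv.refl (sec N.obj W hW)

lemma ofModInSec_smul (hW : W ≤ V) (c : C.Sec W (hW.trans hV)) (m : sec (ofModIn p N) W hW) :
    ofModInSec p N W hW (c • m) = tensorSmul p N hW c (ofModInSec p N W hW m) := rfl

lemma left_smul_ofModIn (hW : W ≤ V) (a : A.Sec W (hW.trans hV)) (m : sec (ofModIn p N) W hW) :
    ofModInSec p N W hW (p.left W _ a • m) = secAct N W hW a (ofModInSec p N W hW m) := by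
  have h : p.left W _ a = p.mul W (hW.trans hV) (a ⊗ₜ 1) := by
    rw [p.mul_tmul, map_one, mul_one]
  rw [ofModInSec_smul, h, tensorSmul_mul, tensorEnd_tmul, one_smul]

lemma right_smul_ofModIn (hW : W ≤ V) (b : B.Sec W (hW.trans hV))
    (m : sec (ofModIn p N) W hW) :
    ofModInSec p N W hW (p.right W _ b • m) = b • ofModInSec p N W hW m := by
  have h : p.right W _ b = p.mul W (hW.trans hV) (1 ⊗ₜ b) := by
    rw [p.mul_tmul, map_one, one_mul]
  rw [ofModInSec_smul, h, tensorSmul_mul, tensorEnd_tmul]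
  change leftEnd N W hW 1 _ = _
  rw [map_one]
  rfl

/-- The restrictions of scalars of the module over the tensor product are the given actions. -/
lemma nonempty_scalarsMod_ofModIn_iso : Nonempty (scalarsMod p (ofModIn p N) ≅ N) := by
  let s (W : Opens X) (hW : W ≤ V) : sec (scalars p (ofModIn p N)) W hW ≃+ sec N.obj W hW :=
    (scalarsSec p (ofModIn p N) W hW).trans (ofModInSec p N W hW)
  have s_smul (W : Opens X) (hW : W ≤ V) (b : B.Sec W (hW.trans hV))
      (m : sec (scalars p (ofModIn p N)) W hW) : s W hW (b • m) = b • s W hW m :=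
    right_smul_ofModIn p N hW b (scalarsSec p (ofModIn p N) W hW m)
  have s_act (W : Opens X) (hW : W ≤ V) (a : A.Sec W (hW.trans hV))
      (m : sec (scalars p (ofModIn p N)) W hW) :
      s W hW (secAct (scalarsMod p (ofModIn p N)) W hW a m) = secAct N W hW a (s W hW m) :=
    (congrArg (ofModInSec p N W hW) (scalarsSec_secAct p (ofModIn p N) hW a m)).trans
      (left_smul_ofModIn p N hW a (scalarsSec p (ofModIn p N) W hW m))
  let f : ((Mod B).res hV le_rfl).obj (scalars p (ofModIn p N)) ⟶
      ((Mod B).res hV le_rfl).obj N.obj :=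
    secHom (scalars p (ofModIn p N)) N.obj le_rfl le_rfl (fun Y hY =>
      { toFun := s Y hY
        map_add' := map_add (s Y hY)
        map_smul' := s_smul Y hY }) fun _ _ _ _ _ => rfl
  let g : ((Mod B).res hV le_rfl).obj N.obj ⟶
      ((Mod B).res hV le_rfl).obj (scalars p (ofModIn p N)) :=
    secHom N.obj (scalars p (ofModIn p N)) le_rfl le_rfl (fun Y hY =>
      { toFun := (s Y hY).symm
        map_add' := map_add (s Y hY).symm
        map_smul' := fun b m => (s Y hY).injective ((AddEquiv.apply_symm_apply _ _).trans (by
          rw [s_smul, RingHom.id_apply, AddEquiv.apply_symm_apply])) }) fun _ _ _ _ _ => rfl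
  let f' := modInHom (M₁ := scalarsMod p (ofModIn p N)) (M₂ := N) f s_act
  let g' := modInHom (M₁ := N) (M₂ := scalarsMod p (ofModIn p N)) g fun Y hY a m =>
    (s Y hY).injective (by
      refine (AddEquiv.apply_symm_apply (s Y hY) _).trans ?_
      refine Eq.trans ?_ (s_act Y hY a _).symm
      exact congrArg (secAct N Y hY a) (AddEquiv.apply_symm_apply (s Y hY) m).symm)
  exact ⟨downIso (S := ModIn A (Mod B)) ⟨f', g', modIn_hom_ext (M₁ := scalarsMod p (ofModIn p N))
      (M₂ := scalarsMod p (ofModIn p N)) fun _ _ _ => rfl,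
    modIn_hom_ext (M₁ := N) (M₂ := N) fun _ _ _ => rfl⟩⟩

end extendAction

variable (p : A.TensorPresentation B C)

lemma isEquiv_scalarsCore : (scalarsCore p).toPFunctor.IsEquiv := by
  refine PFunctor.isEquiv_of_isEquivalence _ fun V hV => ?_
  have h (M N : (Mod C).Obj V hV) := scalarsModHom_bijective p (M := M) (N := N)
    (w₁ := le_rfl) (w₂ := le_rfl)
  have : ((scalarsCore p).toPFunctor.app V hV).Full := ⟨fun {M N} g => by
    obtain ⟨f, hf⟩ := (h M N).2 (((ModIn A (Mod B)).res hV le_rfl).map g)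
    refine ⟨down f, ?_⟩
    change down ((scalarsCore p).mapOn M N le_rfl le_rfl (((Mod C).res hV le_rfl).map (down f))) = g
    rw [map_down_self]
    exact (congrArg down hf).trans (down_map g)⟩
  have : ((scalarsCore p).toPFunctor.app V hV).Faithful := ⟨fun {M N} f g hfg => by
    have h' := congrArg (((ModIn A (Mod B)).res hV le_rfl).map) hfg
    refine map_injective ((h M N).1 ?_)
    exact (map_down_self _).symm.trans (h'.trans (map_down_self _))⟩
  have : ((scalarsCore p).toPFunctor.app V hV).EssSurj :=
    ⟨fun N => ⟨ofModIn p N, nonempty_scalarsMod_ofModIn_iso p N⟩⟩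
  exact { }

end Mod

variable {X : TopCat.{u}} {𝒪 : Sheaf (Opens.grothendieckTopology X) CommRingCat.{u}} {U : Opens X}
  {A B C : Alg 𝒪 U} in
/-- Modules over a tensor product are modules over the first factor in the modules over the second
one. -/
theorem Alg.TensorPresentation.equivalent (p : A.TensorPresentation B C) :
    Equivalent (Mod C) (ModIn A (Mod B)) :=
  ⟨_, Mod.isLinear_scalarsCore p, Mod.isEquiv_scalarsCore p⟩

/-! ### Modules over the opposite of the opposite algebra -/

section

variable {X : TopCat.{u}} {𝒪 : Sheaf (Opens.grothendieckTopology X) CommRingCat.{u}} {U : Opens X}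
  (A : Alg 𝒪 U) {S : Prestack.{w, v} 𝒪 U} {V W Y : Opens X} {hV : V ≤ U}

open Prestack

/-- The identification of the sections of an algebra with those of the opposite of its opposite. -/
def Alg.oppOppSec (W : Opens X) (hW : W ≤ U) : A.Sec W hW ≃+* A.opp.opp.Sec W hW :=
  RingEquiv.opOp (A.Sec W hW)

variable {A}

/-- A module over the opposite of the opposite algebra, as a module over the algebra. -/
@[reducible]
def ModObj.ofOppOpp (M : ModObj A.opp.opp S V hV) : ModObj A S V hV where
  obj := M.obj
  act W hW := (M.act W hW).comp (A.oppOppSec W (hW.trans hV)).toRingHom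
  act_algMap W hW r := M.act_algMap W hW r
  act_res hW hY a := M.act_res hW hY (A.oppOppSec _ (hW.trans hV) a)

/-- A module over an algebra, as a module over the opposite of the opposite algebra. -/
@[reducible]
def ModObj.toOppOpp (M : ModObj A S V hV) : ModObj A.opp.opp S V hV where
  obj := M.obj
  act W hW := (M.act W hW).comp (A.oppOppSec W (hW.trans hV)).symm.toRingHom
  act_algMap W hW r := M.act_algMap W hW r
  act_res hW hY a := M.act_res hW hY ((A.oppOppSec _ (hW.trans hV)).symm a)

lemma Prestack.comp_map_id (F : S.Obj V hV) {hW : W ≤ V}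
    (e : (S.res hV hW).obj F ⟶ (S.res hV hW).obj F) :
    e ≫ (S.res hV hW).map (𝟙 F) = (S.res hV hW).map (𝟙 F) ≫ e := by
  rw [CategoryTheory.Functor.map_id, Category.comp_id, Category.id_comp]

variable (A S)

/-- Modules over the opposite of the opposite algebra are modules over the algebra. -/
def oppOppFunctor : PFunctor (ModIn A.opp.opp S) (ModIn A S) where
  app V hV :=
    { obj := fun M => ModObj.ofOppOpp M
      map := fun {M N} f =>
        { hom := f.hom
          comm := fun W hW a => f.comm W hW (A.oppOppSec W (hW.trans hV) a) }
      map_id := fun _ => rfl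
      map_comp := fun _ _ => rfl }
  iso {V W} hV hW := NatIso.ofComponents
    (fun M => ModObj.isoMk (M := ModObj.ofOppOpp (M.restrict hW))
      (N := (ModObj.ofOppOpp M).restrict hW) (Iso.refl ((S.res hV hW).obj M.obj))
      fun _ _ _ => comp_map_id ((S.res hV hW).obj M.obj) _)
    (fun {M N} f => ModObj.hom_ext ((Category.comp_id _).trans (Category.id_comp _).symm))
  iso_comp {V W Y} hV hW hY M := ModObj.hom_ext (by
    change (S.resComp hV hW hY).hom.app M.obj ≫ 𝟙 _ =
      𝟙 _ ≫ (S.res _ hY).map (𝟙 ((S.res hV hW).obj M.obj)) ≫ (S.resComp hV hW hY).hom.app M.obj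
    rw [CategoryTheory.Functor.map_id, Category.comp_id, Category.id_comp, Category.id_comp])

lemma isEquiv_oppOppFunctor : (oppOppFunctor A S).IsEquiv := by
  refine PFunctor.isEquiv_of_isEquivalence _ fun V hV => ?_
  have : ((oppOppFunctor A S).app V hV).Full := ⟨fun {M N} f =>
    ⟨{ hom := f.hom, comm := fun W hW a => f.comm W hW ((A.oppOppSec W (hW.trans hV)).symm a) },
      rfl⟩⟩
  have : ((oppOppFunctor A S).app V hV).Faithful :=
    ⟨fun {M N} _ _ h => ModObj.hom_ext
      (congrArg (ModObj.Hom.hom (M := ModObj.ofOppOpp M) (N := ModObj.ofOppOpp N)) h)⟩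
  have : ((oppOppFunctor A S).app V hV).EssSurj :=
    ⟨fun M => ⟨ModObj.toOppOpp M, ⟨ModObj.isoMk (M := (ModObj.toOppOpp M).ofOppOpp) (N := M)
      (Iso.refl M.obj) fun _ _ _ => comp_map_id M.obj _⟩⟩⟩
  exact { }

theorem equivalent_modIn_opp_opp : Equivalent (ModIn A.opp.opp S) (ModIn A S) :=
  ⟨oppOppFunctor A S, ⟨fun _ _ _ _ _ => rfl, fun _ _ _ _ _ => rfl⟩, isEquiv_oppOppFunctor A S⟩

end

/-! ### Duals and products of stacks of modules -/

section

variable {X : TopCat.{u}} {𝒪 : Sheaf (Opens.grothendieckTopology X) CommRingCat.{u}} {U : Opens X}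
  (A A' : Alg 𝒪 U)

theorem equivalent_dual_mod : Equivalent (dual (Mod A)) (Mod A.opp) :=
  (equivalent_homR_mod A (Alg.base 𝒪 U)).trans
    (Alg.TensorPresentation.selfBase A.opp).equivalent.symm

theorem equivalent_mod_tensor : Equivalent (Mod (A.tensor A')) (ModIn A (Mod A')) :=
  (Alg.TensorPresentation.tensor A A').equivalent

theorem equivalent_product_mod : Equivalent (product (Mod A) (Mod A')) (Mod (A.tensor A')) :=
  (((equivalent_dual_mod A).symm.homR_left (Mod A')).trans (equivalent_homR_mod A.opp A')).trans
    ((equivalent_modIn_opp_opp A (Mod A')).trans (equivalent_mod_tensor A A').symm)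

theorem isStack_modIn_mod : (ModIn A (Mod A')).IsStack := by
  obtain ⟨φ, -, hφ⟩ := (equivalent_mod_tensor A A').symm
  exact (Mod.isStack _).of_isEquiv φ hφ

end

/-! ### Duals and products of stacks of twisted modules -/

section

variable {X : TopCat.{u}} {𝒪 : Sheaf (Opens.grothendieckTopology X) CommRingCat.{u}} {U : Opens X}
  {S : Prestack.{w₁, v₁} 𝒪 U} {S' : Prestack.{w₂, v₂} 𝒪 U}

lemma Prestack.IsStack.dual (hS : S.IsStack) : (dual S).IsStack :=
  HomR.isStack hS (Mod.isStack _)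

lemma Prestack.IsStack.product (hS : S.IsStack) (hS' : S'.IsStack) : (product S S').IsStack :=
  HomR.isStack hS.dual hS'

lemma Equivalent.dual (h : Equivalent S S') : Equivalent (dual S) (dual S') :=
  h.symm.homR_left _

lemma Equivalent.product {T : Prestack.{w, v} 𝒪 U} {T' : Prestack.{w₃, v₃} 𝒪 U}
    (h : Equivalent S S') (k : Equivalent T T') : Equivalent (product S T) (product S' T') :=
  (h.dual.symm.homR_left T).trans (k.homR_right _)

lemma homR_restrict {V : Opens X} (hV : V ≤ U) :
    (HomR S S').restrict hV = HomR (S.restrict hV) (S'.restrict hV) := rfl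

lemma mod_restrict (A : Alg 𝒪 U) {V : Opens X} (hV : V ≤ U) :
    (Mod A).restrict hV = Mod (A.restrict hV) := rfl

lemma base_restrict {V : Opens X} (hV : V ≤ U) :
    (Alg.base 𝒪 U).restrict hV = Alg.base 𝒪 V := rfl

lemma dual_restrict {V : Opens X} (hV : V ≤ U) :
    (TwistedStack.dual S).restrict hV = TwistedStack.dual (S.restrict hV) :=
  (homR_restrict hV).trans (congrArg (HomR (S.restrict hV))
    ((mod_restrict _ hV).trans (congrArg Mod (base_restrict hV))))

lemma product_restrict {V : Opens X} (hV : V ≤ U) : (TwistedStack.product S S').restrict hV =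
    TwistedStack.product (S.restrict hV) (S'.restrict hV) :=
  (homR_restrict hV).trans
    (congrArg (fun T : Prestack 𝒪 V => HomR T (S'.restrict hV)) (dual_restrict hV))

theorem IsTwisted.dual (hS : IsTwisted S) : IsTwisted (dual S) := by
  obtain ⟨st, ι, c, hc, h, hA⟩ := hS
  refine ⟨st.dual, ι, c, hc, h, fun i => ?_⟩
  obtain ⟨A, hA⟩ := hA i
  rw [dual_restrict]
  exact ⟨A.opp, hA.dual.trans (equivalent_dual_mod A)⟩

theorem IsTwisted.product (hS : IsTwisted S) (hS' : IsTwisted S') : IsTwisted (product S S') := by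
  obtain ⟨st, ι, c, hc, h, hA⟩ := hS
  obtain ⟨st', κ, d, hd, h', hB⟩ := hS'
  refine ⟨st.product st', ι × κ, fun i => c i.1 ⊓ d i.2, fun i => inf_le_left.trans (hc i.1), ?_,
    fun i => ?_⟩
  · rw [iSup_prod]
    simp_rw [← inf_iSup_eq, ← iSup_inf_eq]
    rw [h, h', inf_idem]
  · obtain ⟨A, hA⟩ := hA i.1
    obtain ⟨B, hB⟩ := hB i.2
    refine ⟨(A.restrict inf_le_left).tensor (B.restrict inf_le_right), ?_⟩
    have eA : Equivalent (S.restrict (inf_le_left.trans (hc i.1) : c i.1 ⊓ d i.2 ≤ U))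
        (Mod (A.restrict (inf_le_left : c i.1 ⊓ d i.2 ≤ c i.1))) := hA.restrict inf_le_left
    have eB : Equivalent (S'.restrict (inf_le_left.trans (hc i.1) : c i.1 ⊓ d i.2 ≤ U))
        (Mod (B.restrict (inf_le_right : c i.1 ⊓ d i.2 ≤ d i.2))) := hB.restrict inf_le_right
    rw [product_restrict]
    exact (eA.product eB).trans (equivalent_product_mod _ _)

end

end TwistedStack

theorem mainTheorem3 (X : TopCat.{u})
    (𝒪 : Sheaf (Opens.grothendieckTopology X) CommRingCat.{u}) :
    (∀ A : TwistedStack.Alg 𝒪 ⊤,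
      (TwistedStack.Mod A).IsStack ∧
      (TwistedStack.dual (TwistedStack.Mod A)).IsStack ∧
      TwistedStack.Equivalent (TwistedStack.dual (TwistedStack.Mod A))
        (TwistedStack.Mod A.opp)) ∧
    (∀ A A' : TwistedStack.Alg 𝒪 ⊤,
      (TwistedStack.product (TwistedStack.Mod A) (TwistedStack.Mod A')).IsStack ∧
      (TwistedStack.ModIn A (TwistedStack.Mod A')).IsStack ∧
      TwistedStack.Equivalent
        (TwistedStack.product (TwistedStack.Mod A) (TwistedStack.Mod A'))
        (TwistedStack.Mod (A.tensor A')) ∧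
      TwistedStack.Equivalent (TwistedStack.Mod (A.tensor A'))
        (TwistedStack.ModIn A (TwistedStack.Mod A'))) ∧
    (∀ M : TwistedStack.Prestack.{w₁, v₁} 𝒪 ⊤, TwistedStack.IsTwisted M →
      TwistedStack.IsTwisted (TwistedStack.dual M)) ∧
    (∀ (M : TwistedStack.Prestack.{w₁, v₁} 𝒪 ⊤) (M' : TwistedStack.Prestack.{w₂, v₂} 𝒪 ⊤),
      TwistedStack.IsTwisted M → TwistedStack.IsTwisted M' →
      TwistedStack.IsTwisted (TwistedStack.product M M')) := by
  open TwistedStack in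
  exact ⟨fun A => ⟨Mod.isStack A, (Mod.isStack A).dual, equivalent_dual_mod A⟩,
    fun A A' => ⟨(Mod.isStack A).product (Mod.isStack A'), isStack_modIn_mod A A',
      equivalent_product_mod A A', equivalent_mod_tensor A A'⟩,
    fun _ hM => hM.dual, fun _ _ hM hM' => hM.product hM'⟩
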